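/- **Setting.** Let $G$ be a connected graph on a finite set $X$ with energy $\mathbb H:X\to\mathbb R$; write $\eta\sim\xi$ for edges. Put $\mathcal F(A)=\operatorname{argmin}_A\mathbb H$, $\partial A=\{\eta\notin A:\eta\sim\xi\text{ for some }\xi\in A\}$, $\mathcal S=\mathcal F(X)$. Let $\Phi(A,B)$ be the minimum over paths from $A$ to $B$ of the maximal energy on the path, $\overline\Phi=\max_{s,s'\in\mathcal S}\Phi(s,s')$, and $\overline X=\{\eta:\Phi(\mathcal S,\eta)\le\overline\Phi\}$. A *stable plateau* is a nonempty connected set $P$ of constant energy $\mathbb H(P)$ with $\mathbb H>\mathbb H(P)$ on $\partial P$. For a collection $\mathscr P$ of disjoint sets $P$ of constant energy put $$\Gamma_P=\Phi\Big(P,\bigcup_{Q\in\mathscr P,\,Q\ne P}Q\Big)-\mathbb H(P),\qquad \Gamma^\star(\mathscr P)=\min_{P\in\mathscr P}\Gamma_P,\qquad \mathcal V_P=\{\eta:\Phi(P,\eta)-\mathbb H(P)<\Gamma_P\}.$$ **Hierarchy.** Level $1$: $\mathscr P^{\star,1}$ is the collection of all stable plateaux contained in $\overline X$, and $\mathscr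 C^1=\{\mathcal V_P:P\in\mathscr P^{\star,1}\}$. Given level $h$, put $\Gamma^{\star,h}=\Gamma^\star(\mathscr P^{\star,h})$, $\Gamma^{C}=\min_{\partial C}\mathbb H-\min_C\mathbb H$ for $C\in\mathscr C^h$, $\mathscr C^{\star,h}=\{C\in\mathscr C^h:\Gamma^C\ge\Gamma^{\star,h}\}$, $\mathscr C^{\sharp,h}=\mathscr C^h\setminus\mathscr C^{\star,h}$, and $\Delta^h=\overline X\setminus\bigcup_{C\in\mathscr C^h}C$. Contract each $C\in\mathscr C^h$ to a point and consider the continuous-time chain on $\Delta^h\cup\mathscr C^h$ with rates $R(\eta,\xi)=1$ if $\eta,\xi\in\Delta^h$, $\eta\sim\xi$, $\mathbb H(\xi)\le\mathbb H(\eta)$; $R(\eta,C)=|\{\zeta\in C:\zeta\sim\eta\}|$ if $\eta\in\Delta^h\cap\partial C$; $R(C,\eta)=|\mathcal F(C)|^{-1}|\{\zeta\in C:\zeta\sim\eta\}|$ if $\Gamma^C\le\Gamma^{\star,h}$ and $\eta\in\Delta^h\cap\mathcal F(\partial C)$; and $0$ otherwise. The trace chain on $\mathscr C^{\star,h}$ has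 rates $R^\star(C,C')=\sum_{\eta\in\Delta^h}R(C,\eta)\,\mathbf P_\eta[\text{the first visited element of }\mathscr C^{\star,h}\text{ is }C']$. Let $\nu_h$ be its number of irreducible (recurrent) components, and $\nu_0=|\mathscr P^{\star,1}|$. Then $\mathscr P^{\star,h+1}$ consists of the sets $\bigcup_{C\in D}\mathcal F(C)$, one for each irreducible component $D$, and $\mathscr C^{h+1}$ consists of the valleys $\mathcal V_P$, $P\in\mathscr P^{\star,h+1}$ (taken with respect to $\mathscr P^{\star,h+1}$), together with the transient elements of $\mathscr C^{\star,h}$ and the elements of $\mathscr C^{\sharp,h}$ that are disjoint from all these valleys. Level $\mathfrak m$ is the last level if $\nu_0,\dots,\nu_{\mathfrak m-1}\ge2$ and $\nu_{\mathfrak m}=1$. **Model.** Let $K\ge L$ and $n\ge 2$ be integers with $n<L/2$, and let $J>0$. Let $X$ be the set of $\eta\in\{-1,+1\}^{V}$, $V=(\mathbb Z/K)\times(\mathbb Z/L)$, with exactly $n^2$ sites of spin $+1$ (occupied sites), let $$\mathbb H(\eta)=-\frac J4\sum_{\{x,y\}\in E}\eta(x)\eta(y)$$ ($E$ = nearest-neighbour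 bonds of the torus, so that a bond between two particles has energy $-J$), and let $\eta\sim\xi$ iff $\xi\neq\eta$ arises from $\eta$ by exchanging the spins of two neighbouring sites (Kawasaki dynamics). Let $\eta^x$ be the configuration whose occupied sites are $x+(i,j)$, $0\le i,j\le n-1$. A particle is *attached* to a set $A$ of sites if it lies outside $A$ and has exactly one neighbour in $A$. A configuration is *framed* in an $a\times b$ rectangle if its particles lie in the rectangle, the interior of the rectangle (the rectangle without its four sides) is fully occupied, and on each of the four sides (corners belonging to two sides) the particles occupy at least two and only consecutive sites. Define * $\Omega^0=\{\eta^x:x\in V\}$; * $\Omega^1$: an $n\times n$ square without one of its corners, plus one particle outside the square attached to the rest; * $\Omega^2$: configurations framed in an $n\times(n+1)$ or $(n+1)\times n$ rectangle; * $\Omega^3$: a full $(n-1)\times(n+1)$ or $(n+1)\times(n-1)$ rectangle plus one attached particle; * $\Omega^4$: configurations framed in an $(n-1)\times(n+2)$ or $(n+2)\times(n-1)$ rectangle. **Theorem (Structure of the stable plateaux, Case 3).** 1. The configurations that belong to a stable plateau in $\mathscr P^{\star,1}$ are exactly those of $\Omega^0\cup\Omega^1\cup\Omega^2\cup\Omega^3\cup\Omega^4$,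 and $\Gamma^{\star,1}=J$. 2. $\mathscr P^{\star,2}=\{\{\eta^x\}:x\in V\}$ and $\Gamma^{\star,2}=2J$; level $2$ is the last level. 3. If $n\ge3$ and $\mathbb H_0=\mathbb H(\eta^x)$, then for $i=0,1,2,3$ the set $\Omega^{i+1}$ consists of exactly those configurations of energy $\mathbb H_0+J$ that can be reached from $\Omega^i$ by a path of positive length along which the energy is at most $\mathbb H_0+2J$ and which, after its starting point, visits none of the sets $\Omega^k$ with $k\neq i+1$. In particular, for $J=1$, $\Gamma^{\star,1}=1$ and $\Gamma^{\star,2}=2$. -/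

import Mathlib

open scoped ENNReal

noncomputable section

namespace MetaHierarchy

/-! ### Energy landscapes on a finite graph

`G` is the edge structure of the configuration space `X` and `H` is the Hamiltonian. -/

section Landscape

variable {X : Type*}

/-- The bottom `F(A)`: the minimizers of `H` on `A`. -/
def bottom (H : X → ℝ) (A : Set X) : Set X := {η | η ∈ A ∧ ∀ ξ ∈ A, H η ≤ H ξ}

/-- The outer boundary `∂A`. -/
def boundary (G : SimpleGraph X) (A : Set X) : Set X := {η | η ∉ A ∧ ∃ ξ ∈ A, G.Adj η ξ}

/-- The ground states `S = F(X)`. -/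
def groundStates (H : X → ℝ) : Set X := bottom H Set.univ

/-- The height of a path: the maximal energy along it. -/
def pathHeight {G : SimpleGraph X} (H : X → ℝ) {η ξ : X} (w : G.Walk η ξ) : ℝ :=
  sSup (H '' {ζ | ζ ∈ w.support})

/-- The communication height `Φ(A, B)`: the minimal height of a path from `A` to `B`. -/
def commHeight (G : SimpleGraph X) (H : X → ℝ) (A B : Set X) : ℝ :=
  sInf {h | ∃ η ∈ A, ∃ ξ ∈ B, ∃ w : G.Walk η ξ, h = pathHeight H w}

/-- The largest communication height between two ground states. -/
def maxBarrier (G : SimpleGraph X) (H : X → ℝ) : ℝ :=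
  sSup {h | ∃ s ∈ groundStates H, ∃ s' ∈ groundStates H, h = commHeight G H {s} {s'}}

/-- The essential part of the configuration space: everything that can be reached from the ground
states without exceeding the level `maxBarrier`. -/
def essential (G : SimpleGraph X) (H : X → ℝ) : Set X :=
  {η | commHeight G H (groundStates H) {η} ≤ maxBarrier G H}

/-- Stable plateau: a nonempty connected set of constant energy all of whose boundary points have
strictly larger energy. -/
def IsStablePlateau (G : SimpleGraph X) (H : X → ℝ) (P : Set X) : Prop :=
  (G.induce P).Connected ∧ (∀ η ∈ P, ∀ ξ ∈ P, H η = H ξ) ∧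
    ∀ η ∈ P, ∀ ζ ∈ boundary G P, H η < H ζ

/-- The minimal energy on `A`; for a set of constant energy this is the common value `H(A)`. -/
def minEnergy (H : X → ℝ) (A : Set X) : ℝ := sInf (H '' A)

/-- The depth of a cycle: `min_{∂C} H - min_C H`. -/
def cycleDepth (G : SimpleGraph X) (H : X → ℝ) (C : Set X) : ℝ :=
  minEnergy H (boundary G C) - minEnergy H C

/-- The depth `Γ_i = Φ(P_i, ⋃_{j ≠ i} P_j) - H(P_i)` of a member `P` of a collection `Ps`. -/
def plateauDepth (G : SimpleGraph X) (H : X → ℝ) (Ps : Set (Set X)) (P : Set X) : ℝ :=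
  commHeight G H P (⋃₀ {Q | Q ∈ Ps ∧ Q ≠ P}) - minEnergy H P

/-- `Γ^⋆ = min_i Γ_i` for the collection `Ps`. -/
def starDepth (G : SimpleGraph X) (H : X → ℝ) (Ps : Set (Set X)) : ℝ :=
  sInf (plateauDepth G H Ps '' Ps)

/-- The valley `V_i = {η : Φ(P_i, η) - H(P_i) < Γ_i}`. -/
def valley (G : SimpleGraph X) (H : X → ℝ) (Ps : Set (Set X)) (P : Set X) : Set X :=
  {η | commHeight G H P {η} - minEnergy H P < plateauDepth G H Ps P}

/-! ### Markovian jumps between the cycles of a collection `Cs`, on the level `Γ` -/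

/-- The cycles of depth at least `Γ`. -/
def starCycles (G : SimpleGraph X) (H : X → ℝ) (Cs : Set (Set X)) (Γ : ℝ) : Set (Set X) :=
  {C | C ∈ Cs ∧ Γ ≤ cycleDepth G H C}

/-- The cycles of depth less than `Γ`. -/
def sharpCycles (G : SimpleGraph X) (H : X → ℝ) (Cs : Set (Set X)) (Γ : ℝ) : Set (Set X) :=
  {C | C ∈ Cs ∧ cycleDepth G H C < Γ}

/-- The essential configurations outside all cycles. -/
def remainder (G : SimpleGraph X) (H : X → ℝ) (Cs : Set (Set X)) : Set X :=
  essential G H \ ⋃₀ Cs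

open Classical in
/-- The transition rates of the induced chain on the contracted graph. The state `Sum.inl η` is
the configuration `η` (in the remainder); the state `Sum.inr C` is the cycle `C` contracted to
one point (the point that is also called `F(C)`; distinct cycles are disjoint). -/
def contractedRate (G : SimpleGraph X) (H : X → ℝ) (Cs : Set (Set X)) (Γ : ℝ) :
    X ⊕ Set X → X ⊕ Set X → ℝ≥0∞
  | .inl η, .inl ξ =>
      if η ∈ remainder G H Cs ∧ ξ ∈ remainder G H Cs ∧ G.Adj η ξ ∧ H ξ ≤ H η then 1 else 0
  | .inl η, .inr C =>
      if η ∈ remainder G H Cs ∧ C ∈ Cs ∧ η ∈ boundary G C then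
        (({ζ | ζ ∈ C ∧ G.Adj η ζ}.ncard : ℕ) : ℝ≥0∞) else 0
  | .inr C, .inl η =>
      if C ∈ Cs ∧ η ∈ remainder G H Cs ∧ cycleDepth G H C ≤ Γ ∧ η ∈ bottom H (boundary G C) then
        (((bottom H C).ncard : ℕ) : ℝ≥0∞)⁻¹ * (({ζ | ζ ∈ C ∧ G.Adj η ζ}.ncard : ℕ) : ℝ≥0∞) else 0
  | .inr _, .inr _ => 0

end Landscape

/-! ### Hitting probabilities of a continuous-time chain given by its jump rates -/

section Hitting

variable {S : Type*}

/-- Jump probabilities of the embedded discrete chain (all zero at an absorbing state). -/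
def jumpProb (R : S → S → ℝ≥0∞) (s t : S) : ℝ≥0∞ := R s t / ∑' u, R s u

open Classical in
/-- For `t ∈ A`: the probability that the chain started at `s` enters `A` for the first time at
its `k`-th jump, and does so at `t`. -/
def firstEntry (R : S → S → ℝ≥0∞) (A : Set S) (t : S) : ℕ → S → ℝ≥0∞
  | 0, s => if s = t then 1 else 0
  | k + 1, s => if s ∈ A then 0 else ∑' u, jumpProb R s u * firstEntry R A t k u

/-- For `t ∈ A`: the probability that the chain started at `s` hits `A`, and does so at `t`. -/
def hitProb (R : S → S → ℝ≥0∞) (A : Set S) (s t : S) : ℝ≥0∞ := ∑' k, firstEntry R A t k s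

end Hitting

section Levels

variable {X : Type*}

/-- The transition rates of the trace of the contracted chain on the cycles of depth at
least `Γ`. -/
def traceRate (G : SimpleGraph X) (H : X → ℝ) (Cs : Set (Set X)) (Γ : ℝ) (C C' : Set X) : ℝ≥0∞ :=
  ∑' η : remainder G H Cs, contractedRate G H Cs Γ (.inr C) (.inl η) *
    hitProb (contractedRate G H Cs Γ) (Sum.inr '' starCycles G H Cs Γ) (.inl η) (.inr C')

/-- `C'` is accessible from `C` for the trace chain. -/
def Accessible (G : SimpleGraph X) (H : X → ℝ) (Cs : Set (Set X)) (Γ : ℝ) :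
    Set X → Set X → Prop :=
  Relation.ReflTransGen fun C C' =>
    C ∈ starCycles G H Cs Γ ∧ C' ∈ starCycles G H Cs Γ ∧ 0 < traceRate G H Cs Γ C C'

/-- The recurrent states of the trace chain. -/
def recurrentCycles (G : SimpleGraph X) (H : X → ℝ) (Cs : Set (Set X)) (Γ : ℝ) :
    Set (Set X) :=
  {C | C ∈ starCycles G H Cs Γ ∧
    ∀ C', Accessible G H Cs Γ C C' → Accessible G H Cs Γ C' C}

/-- The transient states of the trace chain. -/
def transientCycles (G : SimpleGraph X) (H : X → ℝ) (Cs : Set (Set X)) (Γ : ℝ) :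
    Set (Set X) :=
  starCycles G H Cs Γ \ recurrentCycles G H Cs Γ

/-- The irreducible components of the trace chain. -/
def irreducibleComponents (G : SimpleGraph X) (H : X → ℝ) (Cs : Set (Set X)) (Γ : ℝ) :
    Set (Set (Set X)) :=
  {D | ∃ C ∈ recurrentCycles G H Cs Γ, D = {C' | Accessible G H Cs Γ C C'}}

/-- The data of one level `h` of the hierarchy: the collection `{P_i^h}` of its stable plateaux and
the collection `C^h` of its cycles. -/
structure Level (X : Type*) where
  plateaux : Set (Set X)
  cycles : Set (Set X)

/-- Level one: all stable plateaux of the essential set, with their valleys. -/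
def firstLevel (G : SimpleGraph X) (H : X → ℝ) : Level X where
  plateaux := {P | IsStablePlateau G H P ∧ P ⊆ essential G H}
  cycles := valley G H {P | IsStablePlateau G H P ∧ P ⊆ essential G H} ''
    {P | IsStablePlateau G H P ∧ P ⊆ essential G H}

/-- `Γ^{⋆,h}`. -/
def Level.gamma (G : SimpleGraph X) (H : X → ℝ) (ℓ : Level X) : ℝ := starDepth G H ℓ.plateaux

/-- The irreducible components of the trace chain of a level. -/
def Level.components (G : SimpleGraph X) (H : X → ℝ) (ℓ : Level X) : Set (Set (Set X)) :=
  irreducibleComponents G H ℓ.cycles (ℓ.gamma G H)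

/-- The plateaux of the next level: each irreducible component contributes the union of the bottoms
of its cycles. -/
def Level.nextPlateaux (G : SimpleGraph X) (H : X → ℝ) (ℓ : Level X) : Set (Set X) :=
  (fun D : Set (Set X) => ⋃ C ∈ D, bottom H C) '' ℓ.components G H

/-- The next level. Its cycles are the valleys of its plateaux, and those transient or shallow
cycles of the given level that are disjoint from all these valleys. -/
def Level.next (G : SimpleGraph X) (H : X → ℝ) (ℓ : Level X) : Level X where
  plateaux := ℓ.nextPlateaux G H
  cycles := valley G H (ℓ.nextPlateaux G H) '' ℓ.nextPlateaux G H ∪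
    {C | (C ∈ transientCycles G H ℓ.cycles (ℓ.gamma G H) ∨
        C ∈ sharpCycles G H ℓ.cycles (ℓ.gamma G H)) ∧
      ∀ P ∈ ℓ.nextPlateaux G H, Disjoint C (valley G H (ℓ.nextPlateaux G H) P)}

/-- The hierarchy; levels are numbered from `1`. -/
def level (G : SimpleGraph X) (H : X → ℝ) : ℕ → Level X
  | 0 => ⟨∅, ∅⟩
  | 1 => firstLevel G H
  | h + 2 => (level G H (h + 1)).next G H

/-- `ν_0` is the number of stable plateaux of level one, and for `h ≥ 1`, `ν_h` is the number of
irreducible components of the trace chain at level `h`. -/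
def nu (G : SimpleGraph X) (H : X → ℝ) : ℕ → ℕ
  | 0 => (level G H 1).plateaux.ncard
  | h + 1 => ((level G H (h + 1)).components G H).ncard

/-- `m` is the last level: the construction runs up to level `m` and there is only one irreducible
component at level `m`. -/
def IsLastLevel (G : SimpleGraph X) (H : X → ℝ) (m : ℕ) : Prop :=
  (∀ k < m, 2 ≤ nu G H k) ∧ nu G H m = 1

end Levels

/-! ### The Ising lattice gas with Kawasaki dynamics on the torus -/

section Kawasaki

/-- The sites of the `K × L` torus. -/
abbrev Site (K L : ℕ) : Type := ZMod K × ZMod L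

/-- Nearest-neighbour bonds. -/
def lattice (K L : ℕ) : SimpleGraph (Site K L) :=
  SimpleGraph.fromRel fun x y => y = x + (1, 0) ∨ y = x + (0, 1)

/-- Spin configurations; `ℤˣ` is `{-1, +1}`. -/
abbrev Spins (K L : ℕ) : Type := Site K L → ℤˣ

/-- The set of occupied sites. -/
def occupied {K L : ℕ} (η : Spins K L) : Set (Site K L) := {x | η x = 1}

/-- The configurations with exactly `N` particles. -/
abbrev Gas (K L N : ℕ) : Type := {η : Spins K L // (occupied η).ncard = N}

open Classical in
/-- The Hamiltonian `-(J/4) ∑_{{x,y} ∈ E} η(x) η(y)`. -/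
def energy (K L N : ℕ) [NeZero K] [NeZero L] (J : ℝ) (η : Gas K L N) : ℝ :=
  -(J / 4) * ∑ e ∈ (lattice K L).edgeFinset,
    Sym2.lift ⟨fun x y => (((η.1 x : ℤˣ) : ℤ) : ℝ) * (((η.1 y : ℤˣ) : ℤ) : ℝ),
      fun _ _ => mul_comm _ _⟩ e

open Classical in
/-- The edges of the Kawasaki dynamics: exchange the spins of two neighbouring sites. -/
def kawasaki (K L N : ℕ) : SimpleGraph (Gas K L N) where
  Adj η ξ := η ≠ ξ ∧ ∃ x y, (lattice K L).Adj x y ∧ ξ.1 = η.1 ∘ Equiv.swap x y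
  symm := ⟨by
    rintro η ξ ⟨hne, x, y, hxy, h⟩
    refine ⟨hne.symm, x, y, hxy, ?_⟩
    rw [h]
    funext z
    simp⟩
  loopless := ⟨fun _ h => h.1 rfl⟩

/-- The site `x + (i, j)`. -/
def shift {K L : ℕ} (x : Site K L) (i j : ℕ) : Site K L := x + ((i : ZMod K), (j : ZMod L))

/-- The `a × b` rectangle with lower left site `x`. -/
def rect {K L : ℕ} (x : Site K L) (a b : ℕ) : Set (Site K L) :=
  {y | ∃ i < a, ∃ j < b, y = shift x i j}

open Classical in
/-- The square configuration `η^x` of side length `n`. -/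
def square (K L n : ℕ) (x : Site K L) : Spins K L := fun y => if y ∈ rect x n n then 1 else -1

/-- A site outside `A` with exactly one neighbour in `A`. -/
def IsAttached {K L : ℕ} (A : Set (Site K L)) (z : Site K L) : Prop :=
  z ∉ A ∧ ∃! y, y ∈ A ∧ (lattice K L).Adj z y

/-- The sites `f 0, …, f (m - 1)` of a side that belong to `A` are consecutive, and there are at
least two of them. -/
def IsBar {K L : ℕ} (A : Set (Site K L)) (f : ℕ → Site K L) (m : ℕ) : Prop :=
  ∃ s e, s < e ∧ e < m ∧ ∀ i < m, f i ∈ A ↔ s ≤ i ∧ i ≤ e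

/-- `A` lies in the `a × b` rectangle at `x`, contains its interior, and meets each of its four
sides in a bar of at least two consecutive sites (the corners belong to two sides). -/
def IsFramed {K L : ℕ} (x : Site K L) (a b : ℕ) (A : Set (Site K L)) : Prop :=
  A ⊆ rect x a b ∧
  (∀ i j, 1 ≤ i → i + 1 < a → 1 ≤ j → j + 1 < b → shift x i j ∈ A) ∧
  IsBar A (fun i => shift x i 0) a ∧ IsBar A (fun i => shift x i (b - 1)) a ∧
  IsBar A (fun j => shift x 0 j) b ∧ IsBar A (fun j => shift x (a - 1) j) b

/-- The collections `Ω^0, …, Ω^4` for `n²` particles.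
* `Ω^0`: the squares `η^x`;
* `Ω^1`: an `n × n` square from which one corner particle is removed and attached to an edge;
* `Ω^2`: framed configurations in an `n × (n+1)` or `(n+1) × n` rectangle;
* `Ω^3`: a full `(n-1) × (n+1)` or `(n+1) × (n-1)` rectangle with one particle attached to an edge;
* `Ω^4`: framed configurations in an `(n-1) × (n+2)` or `(n+2) × (n-1)` rectangle. -/
def layer (K L n : ℕ) : Fin 5 → Set (Gas K L (n ^ 2))
  | 0 => {η | ∃ x, η.1 = square K L n x}
  | 1 => {η | ∃ x, ∃ i ∈ ({0, n - 1} : Set ℕ), ∃ j ∈ ({0, n - 1} : Set ℕ), ∃ z,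
      z ∉ rect x n n ∧ IsAttached (rect x n n \ {shift x i j}) z ∧
      occupied η.1 = insert z (rect x n n \ {shift x i j})}
  | 2 => {η | ∃ x, IsFramed x n (n + 1) (occupied η.1) ∨ IsFramed x (n + 1) n (occupied η.1)}
  | 3 => {η | ∃ x z,
      (IsAttached (rect x (n - 1) (n + 1)) z ∧
        occupied η.1 = insert z (rect x (n - 1) (n + 1))) ∨
      (IsAttached (rect x (n + 1) (n - 1)) z ∧
        occupied η.1 = insert z (rect x (n + 1) (n - 1)))}
  | 4 => {η | ∃ x, IsFramed x (n - 1) (n + 2) (occupied η.1) ∨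
      IsFramed x (n + 2) (n - 1) (occupied η.1)}

end Kawasaki

end MetaHierarchy

end

/-!
The hierarchy is computed for an abstract landscape, and the lattice gas is then shown to be an
instance.

A `TwoStepLandscape` has energies `c + J * p` with an integer height `p` and ground states at
height `q`; any two ground states are linked by a path of height at most `q + 2`, and a step from
a ground state leads to height `q + 2` at least. The configurations linked to the ground states at
height `q + 2` form the essential set. Its connected pieces of constant height `q` or `q + 1`
(`flats`) are the stable plateaux, and they are at the same time their own valleys, since every
exit from them has height `q + 2`. A flat of height `q + 1` has depth `J`, and a ground state has
depth `2 * J`. With `Γ = J` only the flats of height `q + 1` can be left, so that the ground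
states are absorbing and the other flats are transient; with `Γ = 2 * J` the ground states
communicate with each other and form the only recurrent class. This gives `sUnion_plateaux_one`,
`gamma_one`, `level_two`, `gamma_two` and `isLastLevel_two`.

For the lattice gas, the height is the half perimeter `hper` of the set `A` of occupied sites: the
number of its sites with vacant right neighbour plus the number of those with vacant upper
neighbour (the ends of its rows and columns). A set that is too small to wind around the torus has
an end in each of its rows and columns, which gives the isoperimetric inequality
`two_mul_le_hper`; equality holds for `n ^ 2` sites only in the squares (`square_of_hper_eq`), and
for `n ^ 2 - 1` sites only in the squares without a corner and the `(n - 1) × (n + 1)` rectangles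
(`core_of_hper_eq`). These are the cores, to which one further particle can be added anywhere. It
remains to identify the configurations of half perimeter `2 * n + 1` that communicate with the
squares at height `2 * n + 2`.

* They are not more than those of the five collections, called layers here. For `3 ≤ n` the set
  `InBasin` of the squares, the cores with a free particle, the droplets that fill the interior of
  an `n × (n + 1)` or `(n - 1) × (n + 2)` rectangle, and the droplets with one hole next to the
  frame (a pit) is closed under moves of height at most `2 * n + 2` (`InBasin.move`); its members
  of half perimeter `2 * n + 1` are in the layers (`InBasin.isLayer`). For `n = 2` every
  configuration of that half perimeter is in a layer (`isLayer_of_two`).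
* Each layer is connected to the preceding one through configurations of its own or of half
  perimeter `2 * n + 2` (`IsLayer.exists_reach`). An attached particle walks around its core, to
  the missing corner of a square or to a long side of a rectangle, where it is joined to form a
  bar. In a framed configuration the occupied parts of the four sides are slid along the sides, so
  that their vacancies are collected in the top or the bottom row, until a single particle is left
  there (`Framed.sheds`). The squares are connected among each other by `reach_box`: the particles
  of one side are carried over to the opposite side one after another.

Since the layers are disjoint for `3 ≤ n` (`IsLayer.unique`), the same paths show that each layer
is reached from the preceding one without a visit to the others (`mem_layer_iff_exists_walk`).
-/


/-! ### Communication heights on a finite graph -/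

namespace MetaHierarchy

section CommHeight

variable {X : Type*} {G : SimpleGraph X} {H : X → ℝ}

theorem minEnergy_eq {A : Set X} {t : ℝ} (h1 : ∃ a ∈ A, H a = t) (h2 : ∀ a ∈ A, t ≤ H a) :
    minEnergy H A = t := by
  obtain ⟨a, ha, rfl⟩ := h1
  exact IsLeast.csInf_eq ⟨⟨a, ha, rfl⟩, by rintro _ ⟨b, hb, rfl⟩; exact h2 b hb⟩

variable [Finite X]

theorem pathHeight_le_iff {a b : X} (w : G.Walk a b) (t : ℝ) :
    pathHeight H w ≤ t ↔ ∀ ζ ∈ w.support, H ζ ≤ t := by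
  have hne : (H '' {ζ | ζ ∈ w.support}).Nonempty := ⟨H a, a, w.start_mem_support, rfl⟩
  unfold pathHeight
  rw [csSup_le_iff (Set.toFinite _).bddAbove hne]
  simp

theorem pathHeight_mem_range {a b : X} (w : G.Walk a b) : pathHeight H w ∈ Set.range H := by
  have h : pathHeight H w ∈ H '' {ζ | ζ ∈ w.support} :=
    Set.Nonempty.csSup_mem ⟨H a, a, w.start_mem_support, rfl⟩ (Set.toFinite _)
  exact Set.image_subset_range _ _ h

theorem commHeight_values_finite (A B : Set X) :
    {h | ∃ η ∈ A, ∃ ξ ∈ B, ∃ w : G.Walk η ξ, h = pathHeight H w}.Finite := by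
  refine (Set.finite_range H).subset ?_
  rintro h ⟨η, -, ξ, -, w, rfl⟩
  exact pathHeight_mem_range w

theorem commHeight_eq {A B : Set X} {t : ℝ}
    (h1 : ∃ a ∈ A, ∃ b ∈ B, ∃ w : G.Walk a b, ∀ ζ ∈ w.support, H ζ ≤ t)
    (h2 : ∀ a ∈ A, ∀ b ∈ B, ∀ w : G.Walk a b, ∃ ζ ∈ w.support, t ≤ H ζ) :
    commHeight G H A B = t := by
  have lower : ∀ h ∈ {h | ∃ η ∈ A, ∃ ξ ∈ B, ∃ w : G.Walk η ξ, h = pathHeight H w}, t ≤ h := by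
    rintro h ⟨a, ha, b, hb, w, rfl⟩
    obtain ⟨ζ, hζ, hle⟩ := h2 a ha b hb w
    exact hle.trans ((pathHeight_le_iff w _).1 le_rfl ζ hζ)
  obtain ⟨a, ha, b, hb, w, hw⟩ := h1
  apply le_antisymm
  · exact (csInf_le (commHeight_values_finite A B).bddBelow ⟨a, ha, b, hb, w, rfl⟩).trans
      ((pathHeight_le_iff w t).2 hw)
  · exact le_csInf ⟨_, a, ha, b, hb, w, rfl⟩ lower

/-- The hypothesis `t < 0` excludes the value `0` that `commHeight` takes when there is no path at
all. -/
theorem exists_walk_of_commHeight_le {A B : Set X} {t : ℝ} (ht : t < 0)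
    (h : commHeight G H A B ≤ t) :
    ∃ a ∈ A, ∃ b ∈ B, ∃ w : G.Walk a b, ∀ ζ ∈ w.support, H ζ ≤ t := by
  have hne : {h | ∃ η ∈ A, ∃ ξ ∈ B, ∃ w : G.Walk η ξ, h = pathHeight H w}.Nonempty := by
    by_contra hemp
    rw [Set.not_nonempty_iff_eq_empty] at hemp
    unfold commHeight at h
    rw [hemp, Real.sInf_empty] at h
    linarith
  obtain ⟨a, ha, b, hb, w, hw⟩ := hne.csInf_mem (commHeight_values_finite A B)
  refine ⟨a, ha, b, hb, w, (pathHeight_le_iff w t).1 ?_⟩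
  rw [← hw]
  exact h

theorem commHeight_le_of_walk {A B : Set X} {t : ℝ} {a b : X} (ha : a ∈ A) (hb : b ∈ B)
    (w : G.Walk a b) (hw : ∀ ζ ∈ w.support, H ζ ≤ t) : commHeight G H A B ≤ t :=
  (csInf_le (commHeight_values_finite A B).bddBelow ⟨a, ha, b, hb, w, rfl⟩).trans
    ((pathHeight_le_iff w t).2 hw)

end CommHeight

/-! ### Positivity of hitting probabilities -/

section Hit

variable {S : Type*} [Finite S]

/-- A state that is reached along positive rates, with no earlier visit to `A`, is hit with positive
probability. -/
theorem hitProb_pos {R : S → S → ℝ≥0∞} (hR : ∀ s t, R s t ≠ ⊤) {A : Set S} {s t : S}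
    (h : Relation.ReflTransGen (fun a b => a ∉ A ∧ R a b ≠ 0) s t) : hitProb R A s t ≠ 0 := by
  have key : ∃ k, firstEntry R A t k s ≠ 0 := by
    induction h using Relation.ReflTransGen.head_induction_on with
    | refl => exact ⟨0, by simp [firstEntry]⟩
    | @head a b hab _ ih =>
      obtain ⟨k, hk⟩ := ih
      refine ⟨k + 1, ?_⟩
      rw [firstEntry, if_neg hab.1]
      intro h0
      rw [ENNReal.tsum_eq_zero] at h0
      have h1 := h0 b
      rw [mul_eq_zero] at h1
      rcases h1 with h1 | h1
      · rw [jumpProb, ENNReal.div_eq_zero_iff] at h1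
        rcases h1 with h1 | h1
        · exact hab.2 h1
        · have := Fintype.ofFinite S
          rw [tsum_fintype] at h1
          exact (ENNReal.sum_ne_top.2 fun c _ => hR a c) h1
      · exact hk h1
  obtain ⟨k, hk⟩ := key
  intro h0
  rw [hitProb, ENNReal.tsum_eq_zero] at h0
  exact hk (h0 k)

end Hit

/-! ### The hierarchy of a landscape with two energy gaps -/

/-- An energy landscape whose energies are `c + J * p` for an integer height `p`, with ground
states at height `q`. Any two ground states communicate below `q + 2`, every neighbour of a ground
state has height at least `q + 2`, and some configuration of height `q + 1` communicates with the
ground states below `q + 2`. The energy at height `q + 2` is negative, so that a communication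
height of at most that energy is never the junk value `0` of an empty infimum. -/
structure TwoStepLandscape {X : Type*} (G : SimpleGraph X) (H : X → ℝ) (c J : ℝ) (p : X → ℤ)
    (q : ℤ) : Prop where
  J_pos : 0 < J
  energy_eq : ∀ η, H η = c + J * p η
  neg : c + J * (q + 2) < 0
  le_height : ∀ η, q ≤ p η
  two_ground : ∃ s s', p s = q ∧ p s' = q ∧ s ≠ s'
  ground_linked : ∀ s s', p s = q → p s' = q → ∃ w : G.Walk s s', ∀ ζ ∈ w.support, p ζ ≤ q + 2
  ground_adj : ∀ s η, p s = q → G.Adj s η → q + 2 ≤ p η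
  exists_middle : ∃ η, p η = q + 1 ∧ ∃ s, p s = q ∧ ∃ w : G.Walk s η, ∀ ζ ∈ w.support, p ζ ≤ q + 2

namespace TwoStepLandscape

variable {X : Type*} {G : SimpleGraph X} {H : X → ℝ} {c J : ℝ} {p : X → ℤ} {q : ℤ}

/-- The configurations that are linked to a ground state by a path of height at most `q + 2`. -/
def basin (G : SimpleGraph X) (p : X → ℤ) (q : ℤ) : Set X :=
  {η | ∃ s, p s = q ∧ ∃ w : G.Walk s η, ∀ ζ ∈ w.support, p ζ ≤ q + 2}

/-- The connected component of `η` in the set of configurations of its height. -/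
def flat (G : SimpleGraph X) (p : X → ℤ) (η : X) : Set X :=
  {ξ | ∃ w : G.Walk η ξ, ∀ ζ ∈ w.support, p ζ = p η}

/-- The components of the configurations of the basin of height at most `q + 1`; they turn out to
be the stable plateaux and at the same time the cycles. -/
def flats (G : SimpleGraph X) (p : X → ℤ) (q : ℤ) : Set (Set X) :=
  {P | ∃ η ∈ basin G p q, p η ≤ q + 1 ∧ P = flat G p η}

theorem energy_le_iff (h : TwoStepLandscape G H c J p q) {η : X} {m : ℤ} :
    H η ≤ c + J * m ↔ p η ≤ m := by
  rw [h.energy_eq]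
  constructor
  · intro h1
    have : J * (p η : ℝ) ≤ J * m := by linarith
    exact_mod_cast le_of_mul_le_mul_left this h.J_pos
  · intro h1
    have : (p η : ℝ) ≤ m := by exact_mod_cast h1
    have := mul_le_mul_of_nonneg_left this h.J_pos.le
    linarith

theorem le_energy_iff (h : TwoStepLandscape G H c J p q) {η : X} {m : ℤ} :
    c + J * m ≤ H η ↔ m ≤ p η := by
  rw [h.energy_eq]
  constructor
  · intro h1
    have : J * (m : ℝ) ≤ J * p η := by linarith
    exact_mod_cast le_of_mul_le_mul_left this h.J_pos
  · intro h1
    have : (m : ℝ) ≤ p η := by exact_mod_cast h1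
    have := mul_le_mul_of_nonneg_left this h.J_pos.le
    linarith

theorem energy_le_energy_iff (h : TwoStepLandscape G H c J p q) {η ξ : X} :
    H η ≤ H ξ ↔ p η ≤ p ξ := by
  rw [h.energy_eq ξ, h.energy_le_iff]

theorem energy_lt_energy_iff (h : TwoStepLandscape G H c J p q) {η ξ : X} :
    H η < H ξ ↔ p η < p ξ := by
  rw [← not_le, h.energy_le_energy_iff, not_le]

theorem mem_flat_self (η : X) : η ∈ flat G p η := ⟨.nil, by simp⟩

theorem height_of_mem_flat {η ξ : X} (hξ : ξ ∈ flat G p η) : p ξ = p η := by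
  obtain ⟨w, hw⟩ := hξ
  exact hw _ w.end_mem_support

theorem flat_eq_of_mem {η ξ : X} (hξ : ξ ∈ flat G p η) : flat G p ξ = flat G p η := by
  have hp := height_of_mem_flat hξ
  obtain ⟨w, hw⟩ := hξ
  ext ζ
  constructor
  · rintro ⟨w', hw'⟩
    refine ⟨w.append w', fun z hz => ?_⟩
    rw [SimpleGraph.Walk.mem_support_append_iff] at hz
    rcases hz with hz | hz
    · exact hw z hz
    · rw [hw' z hz, hp]
  · rintro ⟨w', hw'⟩
    refine ⟨w.reverse.append w', fun z hz => ?_⟩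
    rw [SimpleGraph.Walk.mem_support_append_iff] at hz
    rcases hz with hz | hz
    · rw [SimpleGraph.Walk.support_reverse, List.mem_reverse] at hz
      rw [hw z hz, hp]
    · rw [hw' z hz, hp]

theorem adj_mem_flat {η ξ : X} (hadj : G.Adj η ξ) (hp : p ξ = p η) : ξ ∈ flat G p η :=
  ⟨hadj.toWalk, by simp [hp]⟩

theorem ground_mem_basin {s : X} (hs : p s = q) : s ∈ basin G p q :=
  ⟨s, hs, .nil, by simp [hs]⟩

theorem height_le_of_mem_basin {η : X} (hη : η ∈ basin G p q) : p η ≤ q + 2 := by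
  obtain ⟨s, hs, w, hw⟩ := hη
  exact hw _ w.end_mem_support

theorem basin_of_adj {η ξ : X} (hη : η ∈ basin G p q) (hadj : G.Adj η ξ) (hξ : p ξ ≤ q + 2) :
    ξ ∈ basin G p q := by
  obtain ⟨s, hs, w, hw⟩ := hη
  refine ⟨s, hs, w.append hadj.toWalk, fun z hz => ?_⟩
  rw [SimpleGraph.Walk.mem_support_append_iff] at hz
  rcases hz with hz | hz
  · exact hw z hz
  · simp only [SimpleGraph.Walk.support_cons, SimpleGraph.Walk.support_nil, List.mem_cons,
      List.not_mem_nil, or_false] at hz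
    rcases hz with rfl | rfl
    · exact hw _ w.end_mem_support
    · exact hξ

theorem flat_subset_basin {η : X} (hη : η ∈ basin G p q) : flat G p η ⊆ basin G p q := by
  have hle := height_le_of_mem_basin hη
  obtain ⟨s, hs, w, hw⟩ := hη
  rintro ξ ⟨w', hw'⟩
  refine ⟨s, hs, w.append w', fun z hz => ?_⟩
  rw [SimpleGraph.Walk.mem_support_append_iff] at hz
  rcases hz with hz | hz
  · exact hw z hz
  · rw [hw' z hz]
    exact hle

theorem flat_ground (h : TwoStepLandscape G H c J p q) {s : X} (hs : p s = q) :
    flat G p s = {s} := by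
  ext ξ
  constructor
  · rintro ⟨w, hw⟩
    cases w with
    | nil => rfl
    | cons hadj w' =>
      have h1 := h.ground_adj s _ hs hadj
      have h2 := hw _ (List.mem_cons_of_mem _ w'.start_mem_support)
      omega
  · rintro rfl
    exact mem_flat_self _

theorem groundStates_eq (h : TwoStepLandscape G H c J p q) : groundStates H = {s | p s = q} := by
  ext s
  obtain ⟨s0, -, hs0, -⟩ := h.two_ground
  simp only [groundStates, bottom, Set.mem_univ, true_and, Set.mem_ofPred_eq, forall_const,
    h.energy_le_energy_iff]
  constructor
  · intro h1
    exact le_antisymm (hs0 ▸ h1 s0) (h.le_height s)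
  · intro h1 ξ
    rw [h1]
    exact h.le_height ξ

/-- A path that leaves a flat of height at most `q + 1` reaches height `q + 2`. -/
theorem height_of_boundary (h : TwoStepLandscape G H c J p q) {η ξ : X} (hη : p η ≤ q + 1)
    (hξ : ξ ∈ boundary G (flat G p η)) :
    q + 2 ≤ p ξ := by
  obtain ⟨hξ1, ζ, hζ, hadj⟩ := hξ
  have hpζ := height_of_mem_flat hζ
  have hne : p ξ ≠ p η := fun he => hξ1 (by
    rw [← flat_eq_of_mem hζ]
    exact adj_mem_flat hadj.symm (by rw [he, hpζ]))
  rcases eq_or_ne (p η) q with h1 | h1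
  · exact h.ground_adj ζ ξ (by rw [hpζ, h1]) hadj.symm
  · have h2 := h.le_height η
    have h3 := h.le_height ξ
    by_contra hlt
    have h4 : p ξ = q := by omega
    have := h.ground_adj ξ ζ h4 hadj
    omega

theorem exists_high_of_exit (h : TwoStepLandscape G H c J p q) {η a b : X} (hη : p η ≤ q + 1)
    (ha : a ∈ flat G p η)
    (hb : b ∉ flat G p η) (w : G.Walk a b) :
    ∃ ζ ∈ w.support, ζ ∈ boundary G (flat G p η) ∧ q + 2 ≤ p ζ := by
  obtain ⟨d, hd, h1, h2⟩ := w.exists_boundary_dart _ ha hb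
  have hbd : d.snd ∈ boundary G (flat G p η) := ⟨h2, d.fst, h1, d.adj.symm⟩
  exact ⟨d.snd, w.dart_snd_mem_support_of_mem_darts hd, hbd, h.height_of_boundary hη hbd⟩

theorem exists_other_ground (h : TwoStepLandscape G H c J p q) (s : X) :
    ∃ s', p s' = q ∧ s' ≠ s := by
  obtain ⟨s1, s2, h1, h2, hne⟩ := h.two_ground
  by_cases hs : s1 = s
  · exact ⟨s2, h2, fun he => hne (hs.trans he.symm)⟩
  · exact ⟨s1, h1, hs⟩

theorem walk_to_ground (h : TwoStepLandscape G H c J p q) {η s : X} (hη : η ∈ basin G p q)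
    (hs : p s = q) : ∃ w : G.Walk η s, ∀ ζ ∈ w.support, p ζ ≤ q + 2 := by
  obtain ⟨s0, hs0, w, hw⟩ := hη
  obtain ⟨w', hw'⟩ := h.ground_linked s0 s hs0 hs
  refine ⟨w.reverse.append w', fun z hz => ?_⟩
  rw [SimpleGraph.Walk.mem_support_append_iff] at hz
  rcases hz with hz | hz
  · rw [SimpleGraph.Walk.support_reverse, List.mem_reverse] at hz
    exact hw z hz
  · exact hw' z hz

/-- From a flat of height at most `q + 1` one can leave to a different ground state. -/
theorem exists_exit (h : TwoStepLandscape G H c J p q) {η : X} (hη : η ∈ basin G p q) :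
    ∃ s, p s = q ∧ s ∉ flat G p η ∧
      ∃ w : G.Walk η s, ∀ ζ ∈ w.support, p ζ ≤ q + 2 := by
  have key : ∃ s, p s = q ∧ s ∉ flat G p η := by
    rcases eq_or_ne (p η) q with h1 | h1
    · obtain ⟨s, hs, hne⟩ := h.exists_other_ground η
      refine ⟨s, hs, ?_⟩
      rw [h.flat_ground h1]
      exact hne
    · obtain ⟨s, -, hs, -⟩ := h.two_ground
      exact ⟨s, hs, fun hmem => h1 ((height_of_mem_flat hmem).symm.trans hs)⟩
  obtain ⟨s, hs, hs'⟩ := key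
  exact ⟨s, hs, hs', h.walk_to_ground hη hs⟩

theorem flat_mem_flats {η : X} (hη : η ∈ basin G p q) (hp : p η ≤ q + 1) :
    flat G p η ∈ flats G p q := ⟨η, hη, hp, rfl⟩

theorem flat_nonempty {η : X} : (flat G p η).Nonempty := ⟨η, mem_flat_self η⟩

theorem sUnion_flats : ⋃₀ flats G p q = {η | η ∈ basin G p q ∧ p η ≤ q + 1} := by
  ext ξ
  constructor
  · rintro ⟨_, ⟨η, hη, hp, rfl⟩, hξ⟩
    exact ⟨flat_subset_basin hη hξ, (height_of_mem_flat hξ).trans_le hp⟩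
  · rintro ⟨hξ, hp⟩
    exact ⟨_, flat_mem_flats hξ hp, mem_flat_self ξ⟩

/-- The ground states as singletons. -/
def groundSets (p : X → ℤ) (q : ℤ) : Set (Set X) := {P | ∃ s, p s = q ∧ P = {s}}

theorem minEnergy_flat (h : TwoStepLandscape G H c J p q) (η : X) :
    minEnergy H (flat G p η) = c + J * p η :=
  minEnergy_eq ⟨η, mem_flat_self η, h.energy_eq η⟩ fun ξ hξ => by
    rw [h.le_energy_iff, height_of_mem_flat hξ]

theorem minEnergy_boundary (h : TwoStepLandscape G H c J p q) {η : X} (hη : η ∈ basin G p q)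
    (hp : p η ≤ q + 1) : minEnergy H (boundary G (flat G p η)) = c + J * (q + 2 : ℤ) := by
  obtain ⟨s, hs, hs', w, hw⟩ := h.exists_exit hη
  obtain ⟨ζ, hζ, hbd, hle⟩ := h.exists_high_of_exit hp (mem_flat_self η) hs' w
  refine minEnergy_eq ⟨ζ, hbd, le_antisymm (h.energy_le_iff.2 (hw ζ hζ)) (h.le_energy_iff.2 hle)⟩ ?_
  intro a ha
  exact h.le_energy_iff.2 (h.height_of_boundary hp ha)

theorem cycleDepth_flat (h : TwoStepLandscape G H c J p q) {η : X} (hη : η ∈ basin G p q)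
    (hp : p η ≤ q + 1) : cycleDepth G H (flat G p η) = J * (q + 2 - p η) := by
  rw [cycleDepth, h.minEnergy_boundary hη hp, h.minEnergy_flat]
  push_cast
  ring

theorem bottom_flat (h : TwoStepLandscape G H c J p q) (η : X) :
    bottom H (flat G p η) = flat G p η := by
  ext ξ
  refine ⟨fun hξ => hξ.1, fun hξ => ⟨hξ, fun ζ hζ => ?_⟩⟩
  rw [h.energy_le_energy_iff, height_of_mem_flat hξ, height_of_mem_flat hζ]

theorem groundSets_subset_flats (h : TwoStepLandscape G H c J p q) :
    groundSets p q ⊆ flats G p q := by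
  rintro _ ⟨s, hs, rfl⟩
  exact ⟨s, ground_mem_basin hs, by omega, (h.flat_ground hs).symm⟩

variable [Finite X]

theorem maxBarrier_eq (h : TwoStepLandscape G H c J p q) :
    maxBarrier G H = c + J * (q + 2 : ℤ) := by
  obtain ⟨s, s', hs, hs', hne⟩ := h.two_ground
  have key : ∀ a b, p a = q → p b = q → a ≠ b → commHeight G H {a} {b} = c + J * (q + 2 : ℤ) := by
    intro a b ha hb hab
    obtain ⟨w, hw⟩ := h.ground_linked a b ha hb
    refine commHeight_eq ⟨a, rfl, b, rfl, w, fun z hz => h.energy_le_iff.2 (hw z hz)⟩ ?_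
    rintro _ rfl _ rfl w
    obtain ⟨ζ, hζ, -, hle⟩ := h.exists_high_of_exit (η := _) (by omega : p _ ≤ q + 1)
      (mem_flat_self _) (by rw [h.flat_ground ha]; exact hab.symm) w
    exact ⟨ζ, hζ, h.le_energy_iff.2 hle⟩
  rw [maxBarrier, h.groundStates_eq]
  refine IsGreatest.csSup_eq ⟨⟨s, hs, s', hs', (key s s' hs hs' hne).symm⟩, ?_⟩
  rintro _ ⟨a, ha, b, hb, rfl⟩
  rcases eq_or_ne a b with rfl | hab
  · refine commHeight_le_of_walk (Set.mem_singleton a) (Set.mem_singleton a) .nil ?_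
    intro ζ hζ
    rw [SimpleGraph.Walk.support_nil, List.mem_singleton] at hζ
    subst hζ
    rw [h.energy_le_iff, show p ζ = q from ha]
    omega
  · exact (key a b ha hb hab).le

theorem essential_eq (h : TwoStepLandscape G H c J p q) : essential G H = basin G p q := by
  ext η
  rw [essential, h.maxBarrier_eq, h.groundStates_eq]
  constructor
  · intro hη
    obtain ⟨s, hs, _, rfl, w, hw⟩ := exists_walk_of_commHeight_le
      (by have := h.neg; push_cast; exact this) hη
    exact ⟨s, hs, w, fun z hz => h.energy_le_iff.1 (hw z hz)⟩
  · rintro ⟨s, hs, w, hw⟩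
    exact commHeight_le_of_walk hs rfl w fun z hz => h.energy_le_iff.2 (hw z hz)

theorem plateaux_eq (h : TwoStepLandscape G H c J p q) :
    {P | IsStablePlateau G H P ∧ P ⊆ essential G H} = flats G p q := by
  rw [h.essential_eq]
  ext P
  constructor
  · rintro ⟨⟨hconn, hconst, hbd⟩, hsub⟩
    obtain ⟨⟨η, hη⟩⟩ := hconn.nonempty
    have hconst' : ∀ ξ ∈ P, p ξ = p η := fun ξ hξ => le_antisymm
      (h.energy_le_energy_iff.1 (hconst ξ hξ η hη).le)
      (h.energy_le_energy_iff.1 (hconst ξ hξ η hη).ge)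
    have hple : p η ≤ q + 1 := by
      by_contra hlt
      obtain ⟨s, hs, w, hw⟩ := hsub hη
      have hsP : s ∉ P := fun hmem => by
        have := hconst' s hmem
        omega
      obtain ⟨d, hd, h1, h2⟩ := w.reverse.exists_boundary_dart P hη hsP
      have h3 := h.energy_lt_energy_iff.1 (hbd η hη d.snd ⟨h2, d.fst, h1, d.adj.symm⟩)
      have h4 := w.reverse.dart_snd_mem_support_of_mem_darts hd
      rw [SimpleGraph.Walk.support_reverse, List.mem_reverse] at h4
      have := hw _ h4
      omega
    refine ⟨η, hsub hη, hple, Set.Subset.antisymm ?_ ?_⟩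
    · intro ξ hξ
      obtain ⟨w⟩ := hconn.preconnected ⟨η, hη⟩ ⟨ξ, hξ⟩
      refine ⟨w.map (SimpleGraph.Embedding.induce P).toHom, fun z hz => ?_⟩
      erw [SimpleGraph.Walk.support_map, List.mem_map] at hz
      obtain ⟨z', -, rfl⟩ := hz
      exact hconst' _ z'.2
    · rintro ξ ⟨w, hw⟩
      by_contra hξ
      obtain ⟨d, hd, h1, h2⟩ := w.exists_boundary_dart P hη hξ
      have h3 := h.energy_lt_energy_iff.1 (hbd η hη d.snd ⟨h2, d.fst, h1, d.adj.symm⟩)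
      have := hw _ (w.dart_snd_mem_support_of_mem_darts hd)
      omega
  · rintro ⟨η, hη, hp, rfl⟩
    refine ⟨⟨?_, ?_, ?_⟩, flat_subset_basin hη⟩
    · classical
      have hre : ∀ ξ : flat G p η, (G.induce (flat G p η)).Reachable ⟨η, mem_flat_self η⟩ ξ := by
        rintro ⟨ξ, w, hw⟩
        have hmem : ∀ z ∈ w.support, z ∈ flat G p η := fun z hz =>
          ⟨w.takeUntil z hz, fun y hy => hw y (w.support_takeUntil_subset_support hz hy)⟩
        exact (w.induce (flat G p η) hmem).reachable
      have : Nonempty (flat G p η) := ⟨⟨η, mem_flat_self η⟩⟩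
      exact ⟨fun a b => (hre a).symm.trans (hre b)⟩
    · intro a ha b hb
      rw [h.energy_eq, h.energy_eq, height_of_mem_flat ha, height_of_mem_flat hb]
    · intro a ha b hb
      have := h.height_of_boundary hp hb
      rw [h.energy_lt_energy_iff, height_of_mem_flat ha]
      omega

/-- Whichever flats are in the collection besides all ground states, a flat is left for another set
of the collection at height exactly `q + 2`. -/
theorem plateauDepth_eq (h : TwoStepLandscape G H c J p q) {Ps : Set (Set X)}
    (h1 : Ps ⊆ flats G p q) (h2 : groundSets p q ⊆ Ps) {η : X} (hη : η ∈ basin G p q)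
    (hp : p η ≤ q + 1) : plateauDepth G H Ps (flat G p η) = J * (q + 2 - p η) := by
  have key : commHeight G H (flat G p η) (⋃₀ {Q | Q ∈ Ps ∧ Q ≠ flat G p η})
      = c + J * (q + 2 : ℤ) := by
    apply commHeight_eq
    · obtain ⟨s, hs, hs', w, hw⟩ := h.exists_exit hη
      refine ⟨η, mem_flat_self η, s, ⟨{s}, ⟨h2 ⟨s, hs, rfl⟩, fun he => hs' ?_⟩, rfl⟩, w,
        fun z hz => h.energy_le_iff.2 (hw z hz)⟩
      rw [← he]
      rfl
    · rintro a ha b ⟨Q, ⟨hQ, hne⟩, hb⟩ w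
      have hb' : b ∉ flat G p η := by
        intro hb'
        obtain ⟨ξ, -, -, rfl⟩ := h1 hQ
        exact hne ((flat_eq_of_mem hb).symm.trans (flat_eq_of_mem hb'))
      obtain ⟨ζ, hζ, -, hle⟩ := h.exists_high_of_exit hp ha hb' w
      exact ⟨ζ, hζ, h.le_energy_iff.2 hle⟩
  rw [plateauDepth, key, h.minEnergy_flat]
  push_cast
  ring

theorem valley_eq (h : TwoStepLandscape G H c J p q) {Ps : Set (Set X)}
    (h1 : Ps ⊆ flats G p q) (h2 : groundSets p q ⊆ Ps) {η : X} (hη : η ∈ basin G p q)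
    (hp : p η ≤ q + 1) : valley G H Ps (flat G p η) = flat G p η := by
  have hJ := h.J_pos
  ext ξ
  rw [valley, Set.mem_ofPred_eq, h.plateauDepth_eq h1 h2 hη hp, h.minEnergy_flat, sub_lt_iff_lt_add]
  constructor
  · intro hlt
    have hneg := h.neg
    obtain ⟨a, ha, b, rfl, w, hw⟩ := exists_walk_of_commHeight_le (by linarith) le_rfl
    by_contra hb
    obtain ⟨ζ, hζ, -, hle⟩ := h.exists_high_of_exit hp ha hb w
    have h3 := h.le_energy_iff.2 hle
    have h4 := hw ζ hζ
    push_cast at h3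
    linarith
  · rintro ⟨w, hw⟩
    have : commHeight G H (flat G p η) {ξ} ≤ c + J * p η :=
      commHeight_le_of_walk (mem_flat_self η) rfl w fun z hz => h.energy_le_iff.2 (hw z hz).le
    have hp' : (p η : ℝ) ≤ q + 1 := by exact_mod_cast hp
    nlinarith

theorem starDepth_flats (h : TwoStepLandscape G H c J p q) : starDepth G H (flats G p q) = J := by
  have hJ := h.J_pos
  obtain ⟨η, hη, hb⟩ := h.exists_middle
  refine IsLeast.csInf_eq ⟨⟨_, flat_mem_flats hb hη.le, ?_⟩, ?_⟩
  · rw [h.plateauDepth_eq subset_rfl h.groundSets_subset_flats hb hη.le, hη]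
    push_cast
    ring
  · rintro _ ⟨_, ⟨ξ, hξ, hp, rfl⟩, rfl⟩
    rw [h.plateauDepth_eq subset_rfl h.groundSets_subset_flats hξ hp]
    have hp' : (p ξ : ℝ) ≤ q + 1 := by exact_mod_cast hp
    nlinarith

theorem plateauDepth_ground (h : TwoStepLandscape G H c J p q) {s : X} (hs : p s = q) :
    plateauDepth G H (groundSets p q) {s} = 2 * J := by
  have := h.plateauDepth_eq h.groundSets_subset_flats subset_rfl (ground_mem_basin hs)
    (by omega : p s ≤ q + 1)
  rw [h.flat_ground hs, hs] at this
  rw [this]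
  ring

theorem starDepth_groundSets (h : TwoStepLandscape G H c J p q) :
    starDepth G H (groundSets p q) = 2 * J := by
  obtain ⟨s, -, hs, -⟩ := h.two_ground
  refine IsLeast.csInf_eq ⟨⟨_, ⟨s, hs, rfl⟩, h.plateauDepth_ground hs⟩, ?_⟩
  rintro _ ⟨_, ⟨ξ, hξ, rfl⟩, rfl⟩
  exact (h.plateauDepth_ground hξ).ge

end TwoStepLandscape

end MetaHierarchy

namespace MetaHierarchy

namespace TwoStepLandscape

variable {X : Type*} {G : SimpleGraph X} {H : X → ℝ} {c J : ℝ} {p : X → ℤ} {q : ℤ}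

open Classical in
/-- The state of the contracted chain that contains `η`. -/
def node (G : SimpleGraph X) (p : X → ℤ) (q : ℤ) (η : X) : X ⊕ Set X :=
  if p η ≤ q + 1 then .inr (flat G p η) else .inl η

theorem starCycles_one (h : TwoStepLandscape G H c J p q) :
    starCycles G H (flats G p q) J = flats G p q := by
  have hJ := h.J_pos
  ext C
  refine ⟨fun hC => hC.1, fun hC => ⟨hC, ?_⟩⟩
  obtain ⟨η, hη, hp, rfl⟩ := hC
  rw [h.cycleDepth_flat hη hp]
  have hp' : (p η : ℝ) ≤ q + 1 := by exact_mod_cast hp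
  nlinarith

theorem starCycles_two (h : TwoStepLandscape G H c J p q) :
    starCycles G H (flats G p q) (2 * J) = groundSets p q := by
  have hJ := h.J_pos
  ext C
  constructor
  · rintro ⟨⟨η, hη, hp, rfl⟩, hd⟩
    rw [h.cycleDepth_flat hη hp] at hd
    have h1 : (p η : ℝ) ≤ q := by nlinarith
    have h2 : p η = q := le_antisymm (by exact_mod_cast h1) (h.le_height η)
    exact ⟨η, h2, h.flat_ground h2⟩
  · rintro ⟨s, hs, rfl⟩
    refine ⟨h.groundSets_subset_flats ⟨s, hs, rfl⟩, ?_⟩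
    have := h.cycleDepth_flat (ground_mem_basin hs) (by omega : p s ≤ q + 1)
    rw [h.flat_ground hs, hs] at this
    rw [this]
    linarith

theorem remainder_eq [Finite X] (h : TwoStepLandscape G H c J p q) :
    remainder G H (flats G p q) = {η | η ∈ basin G p q ∧ p η = q + 2} := by
  rw [remainder, h.essential_eq, sUnion_flats]
  ext η
  constructor
  · rintro ⟨h1, h2⟩
    refine ⟨h1, le_antisymm (height_le_of_mem_basin h1) ?_⟩
    by_contra hlt
    exact h2 ⟨h1, by omega⟩
  · rintro ⟨h1, h2⟩
    exact ⟨h1, fun h3 => by have := h3.2; omega⟩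

theorem contractedRate_ne_top [Finite X] (h : TwoStepLandscape G H c J p q) (Γ : ℝ)
    (s t : X ⊕ Set X) : contractedRate G H (flats G p q) Γ s t ≠ ⊤ := by
  rcases s with η | C <;> rcases t with ξ | D <;> simp only [contractedRate]
  · split_ifs <;> simp
  · split_ifs <;> simp
  · split_ifs with hc
    · refine ENNReal.mul_ne_top ?_ (by simp)
      obtain ⟨η, -, -, rfl⟩ := hc.1
      rw [h.bottom_flat, Ne, ENNReal.inv_eq_top, Nat.cast_eq_zero,
        Set.ncard_eq_zero (Set.toFinite _)]
      exact flat_nonempty.ne_empty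
    · simp
  · simp

theorem rate_node_ne_zero [Finite X] (h : TwoStepLandscape G H c J p q) (Γ : ℝ) {η ξ : X}
    (hη : η ∈ basin G p q) (hξ : ξ ∈ basin G p q) (hadj : G.Adj η ξ) (hp : p η = q + 2) :
    contractedRate G H (flats G p q) Γ (.inl η) (node G p q ξ) ≠ 0 := by
  have hrem : η ∈ remainder G H (flats G p q) := by
    rw [h.remainder_eq]
    exact ⟨hη, hp⟩
  unfold node
  split_ifs with hle
  · have hne : η ∉ flat G p ξ := fun hmem => by
      have := height_of_mem_flat hmem
      omega
    simp only [contractedRate]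
    rw [if_pos ⟨hrem, flat_mem_flats hξ hle, hne, ξ, mem_flat_self ξ, hadj⟩, Ne, Nat.cast_eq_zero,
      Set.ncard_eq_zero (Set.toFinite _)]
    exact Set.Nonempty.ne_empty ⟨ξ, mem_flat_self ξ, hadj⟩
  · have hξp := height_le_of_mem_basin hξ
    simp only [contractedRate]
    rw [if_pos]
    · exact one_ne_zero
    · rw [h.remainder_eq, h.energy_le_energy_iff]
      exact ⟨⟨hη, hp⟩, ⟨hξ, by omega⟩, hadj, by omega⟩

theorem rate_flat_ne_zero [Finite X] (h : TwoStepLandscape G H c J p q) {Γ : ℝ} {η ξ : X}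
    (hη : η ∈ basin G p q) (hξ : ξ ∈ basin G p q) (hadj : G.Adj η ξ) (hp : p η ≤ q + 1)
    (hpξ : p ξ = q + 2) (hΓ : J * (q + 2 - p η) ≤ Γ) :
    contractedRate G H (flats G p q) Γ (.inr (flat G p η)) (.inl ξ) ≠ 0 := by
  have hne : ξ ∉ flat G p η := fun hmem => by
    have := height_of_mem_flat hmem
    omega
  simp only [contractedRate]
  rw [if_pos, mul_ne_zero_iff]
  · refine ⟨by simp, ?_⟩
    rw [Ne, Nat.cast_eq_zero, Set.ncard_eq_zero (Set.toFinite _)]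
    exact Set.Nonempty.ne_empty ⟨η, mem_flat_self η, hadj.symm⟩
  · rw [h.cycleDepth_flat hη hp, h.remainder_eq]
    refine ⟨flat_mem_flats hη hp, ⟨hξ, hpξ⟩, hΓ, ⟨hne, η, mem_flat_self η, hadj.symm⟩, ?_⟩
    intro ζ hζ
    rw [h.energy_le_energy_iff, hpξ]
    exact h.height_of_boundary hp hζ

/-- The chain that is contracted along `Cs`, stopped on the cycles of depth at least `Γ`, can move
from the first to the second state. -/
def Runs (G : SimpleGraph X) (H : X → ℝ) (p : X → ℤ) (q : ℤ) (Γ : ℝ) :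
    X ⊕ Set X → X ⊕ Set X → Prop :=
  Relation.ReflTransGen fun a b =>
    a ∉ Sum.inr '' starCycles G H (flats G p q) Γ ∧ contractedRate G H (flats G p q) Γ a b ≠ 0

theorem traceRate_pos [Finite X] (h : TwoStepLandscape G H c J p q) {Γ : ℝ} {η ξ : X}
    {C : Set X} (hη : η ∈ basin G p q) (hξ : ξ ∈ basin G p q) (hadj : G.Adj η ξ)
    (hp : p η ≤ q + 1) (hpξ : p ξ = q + 2) (hΓ : J * (q + 2 - p η) ≤ Γ)
    (hC : Runs G H p q Γ (.inl ξ) (.inr C)) :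
    0 < traceRate G H (flats G p q) Γ (flat G p η) C := by
  have hrem : ξ ∈ remainder G H (flats G p q) := by
    rw [h.remainder_eq]
    exact ⟨hξ, hpξ⟩
  rw [pos_iff_ne_zero, traceRate, Ne, ENNReal.tsum_eq_zero]
  intro h0
  have h1 := h0 ⟨ξ, hrem⟩
  rw [mul_eq_zero] at h1
  rcases h1 with h1 | h1
  · exact h.rate_flat_ne_zero hη hξ hadj hp hpξ hΓ h1
  · exact hitProb_pos (h.contractedRate_ne_top Γ) hC h1

/-- Along a path to a ground state the contracted chain reaches a deep cycle from which a ground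
state is accessible: that very ground state if all ground states can be left, that is, if
`Γ = 2 * J`. -/
theorem exists_accessible [Finite X] (h : TwoStepLandscape G H c J p q) {Γ : ℝ}
    (hΓ : Γ = J ∨ Γ = 2 * J) {η s : X} (w : G.Walk η s) (hs : p s = q)
    (hw : ∀ ζ ∈ w.support, p ζ ≤ q + 2) :
    ∃ C ∈ starCycles G H (flats G p q) Γ, ∃ s', p s' = q ∧ (Γ = 2 * J → s' = s) ∧
      Runs G H p q Γ (node G p q η) (.inr C) ∧ Accessible G H (flats G p q) Γ C {s'} := by
  have hJ := h.J_pos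
  have groundStar : ∀ t, p t = q → ({t} : Set X) ∈ starCycles G H (flats G p q) Γ := by
    intro t ht
    rcases hΓ with rfl | rfl
    · rw [h.starCycles_one]
      exact h.groundSets_subset_flats ⟨t, ht, rfl⟩
    · rw [h.starCycles_two]
      exact ⟨t, ht, rfl⟩
  have groundNode : ∀ t, p t = q → node G p q t = .inr {t} := by
    intro t ht
    rw [node, if_pos (by omega), h.flat_ground ht]
  induction w with
  | nil => exact ⟨{_}, groundStar _ hs, _, hs, fun _ => rfl, by rw [groundNode _ hs]; exact .refl,
      .refl⟩
  | @cons η ξ s hadj w ih =>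
    have hw' : ∀ ζ ∈ w.support, p ζ ≤ q + 2 := fun ζ hζ => hw ζ (List.mem_cons_of_mem _ hζ)
    obtain ⟨C, hC, s', hs', heq, hrun, hacc⟩ := ih hs hw'
    have hξ : ξ ∈ basin G p q := ⟨s, hs, w.reverse, fun ζ hζ => hw' ζ (by
      rwa [SimpleGraph.Walk.support_reverse, List.mem_reverse] at hζ)⟩
    have hη : η ∈ basin G p q := basin_of_adj hξ hadj.symm (hw η (by simp))
    have hq := h.le_height η
    have hη2 := height_le_of_mem_basin hη
    have hξ2 := height_le_of_mem_basin hξ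
    have hcases : p η = q ∨ p η = q + 1 ∨ p η = q + 2 := by omega
    rcases hcases with h0 | h1 | h2
    · -- a ground state is left at height `q + 2`, hence only if `Γ = 2 * J`
      have hξp : p ξ = q + 2 := le_antisymm hξ2 (h.ground_adj η ξ h0 hadj)
      by_cases hG : Γ = 2 * J
      · refine ⟨{η}, groundStar η h0, s', hs', heq, by rw [groundNode η h0]; exact .refl,
          .head ⟨groundStar η h0, hC, ?_⟩ hacc⟩
        rw [← h.flat_ground h0]
        refine h.traceRate_pos hη hξ hadj (by omega) hξp (by rw [h0, hG]; linarith) ?_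
        rw [node, if_neg (by omega)] at hrun
        exact hrun
      · exact ⟨{η}, groundStar η h0, η, h0, fun h3 => absurd h3 hG,
          by rw [groundNode η h0]; exact .refl, .refl⟩
    · have hnode : node G p q η = .inr (flat G p η) := by rw [node, if_pos (by omega)]
      have hξ1 : p ξ = q + 1 ∨ p ξ = q + 2 := by
        have := h.le_height ξ
        have h3 : p ξ ≠ q := fun h3 => by
          have := h.ground_adj ξ η h3 hadj.symm
          omega
        omega
      rcases hξ1 with hξ1 | hξ1
      · -- a step inside a flat
        refine ⟨C, hC, s', hs', heq, ?_, hacc⟩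
        rw [hnode, ← flat_eq_of_mem (adj_mem_flat hadj (hξ1.trans h1.symm))]
        rwa [node, if_pos (by omega)] at hrun
      · -- a flat of height `q + 1` is itself the deep cycle that is reached, unless it is shallow
        rw [node, if_neg (by omega)] at hrun
        have hΓ1 : J * (q + 2 - p η) ≤ Γ := by
          rw [h1]
          push_cast
          rcases hΓ with rfl | rfl <;> linarith
        by_cases hst : flat G p η ∈ starCycles G H (flats G p q) Γ
        · refine ⟨_, hst, s', hs', heq, by rw [hnode]; exact .refl, .head ⟨hst, hC, ?_⟩ hacc⟩
          exact h.traceRate_pos hη hξ hadj (by omega) hξ1 hΓ1 hrun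
        · refine ⟨C, hC, s', hs', heq, ?_, hacc⟩
          rw [hnode]
          refine .head ⟨?_, h.rate_flat_ne_zero hη hξ hadj (by omega) hξ1 hΓ1⟩ hrun
          rintro ⟨D, hD, hDe⟩
          rw [Sum.inr.injEq] at hDe
          exact hst (hDe ▸ hD)
    · -- at height `q + 2` every step of the path is a jump of the contracted chain
      refine ⟨C, hC, s', hs', heq, ?_, hacc⟩
      rw [node, if_neg (by omega)]
      refine .head ⟨?_, h.rate_node_ne_zero Γ hη hξ hadj h2⟩ hrun
      rintro ⟨D, -, hDe⟩
      exact Sum.inr_ne_inl hDe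

theorem accessible_flat [Finite X] (h : TwoStepLandscape G H c J p q) {η : X}
    (hη : η ∈ basin G p q) (hp : p η ≤ q + 1) :
    ∃ s, p s = q ∧ Accessible G H (flats G p q) J (flat G p η) {s} := by
  obtain ⟨s, hs, w, hw⟩ := hη
  obtain ⟨C, hC, s', hs', -, hrun, hacc⟩ := h.exists_accessible (.inl rfl) w.reverse hs
    fun ζ hζ => hw ζ (by rwa [SimpleGraph.Walk.support_reverse, List.mem_reverse] at hζ)
  refine ⟨s', hs', ?_⟩
  rw [node, if_pos hp] at hrun
  have hst : flat G p η ∈ starCycles G H (flats G p q) J := by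
    rw [h.starCycles_one]
    exact flat_mem_flats ⟨s, hs, w, hw⟩ hp
  rcases hrun.cases_head with heq | ⟨d, hd, -⟩
  · rw [Sum.inr.injEq] at heq
    rwa [heq]
  · exact absurd ⟨_, hst, rfl⟩ hd.1

theorem accessible_ground [Finite X] (h : TwoStepLandscape G H c J p q) {s s' : X} (hs : p s = q)
    (hs' : p s' = q) : Accessible G H (flats G p q) (2 * J) {s} {s'} := by
  obtain ⟨w, hw⟩ := h.ground_linked s s' hs hs'
  obtain ⟨C, hC, s'', -, heq, hrun, hacc⟩ := h.exists_accessible (.inr rfl) w hs' hw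
  rw [heq rfl] at hacc
  rw [node, if_pos (by omega), h.flat_ground hs] at hrun
  have hst : ({s} : Set X) ∈ starCycles G H (flats G p q) (2 * J) := by
    rw [h.starCycles_two]
    exact ⟨s, hs, rfl⟩
  rcases hrun.cases_head with heq | ⟨d, hd, -⟩
  · rw [Sum.inr.injEq] at heq
    rwa [heq]
  · exact absurd ⟨_, hst, rfl⟩ hd.1

/-- On level one the ground states are absorbing. -/
theorem accessible_one_ground (h : TwoStepLandscape G H c J p q) {s : X} (hs : p s = q)
    {C : Set X} (hC : Accessible G H (flats G p q) J {s} C) : C = {s} := by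
  rcases hC.cases_head with heq | ⟨D, hD, -⟩
  · exact heq.symm
  · have hJ := h.J_pos
    exfalso
    refine hD.2.2.ne' ?_
    rw [traceRate, ENNReal.tsum_eq_zero]
    intro η
    rw [mul_eq_zero]
    left
    simp only [contractedRate]
    rw [if_neg]
    rintro ⟨-, -, hle, -⟩
    have := h.cycleDepth_flat (ground_mem_basin hs) (by omega : p s ≤ q + 1)
    rw [h.flat_ground hs, hs] at this
    rw [this] at hle
    linarith

theorem recurrent_one [Finite X] (h : TwoStepLandscape G H c J p q) :
    recurrentCycles G H (flats G p q) J = groundSets p q := by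
  ext C
  rw [recurrentCycles, h.starCycles_one]
  constructor
  · rintro ⟨⟨η, hη, hp, rfl⟩, hrec⟩
    obtain ⟨s, hs, hacc⟩ := h.accessible_flat hη hp
    exact ⟨s, hs, h.accessible_one_ground hs (hrec _ hacc)⟩
  · rintro ⟨s, hs, rfl⟩
    refine ⟨h.groundSets_subset_flats ⟨s, hs, rfl⟩, fun C hC => ?_⟩
    rw [h.accessible_one_ground hs hC]
    exact .refl

theorem components_one [Finite X] (h : TwoStepLandscape G H c J p q) :
    irreducibleComponents G H (flats G p q) J = (fun C => {C}) '' groundSets p q := by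
  rw [irreducibleComponents, h.recurrent_one]
  have key : ∀ C ∈ groundSets p q, {C' | Accessible G H (flats G p q) J C C'} = {C} := by
    rintro _ ⟨s, hs, rfl⟩
    ext C
    exact ⟨fun hC => h.accessible_one_ground hs hC, fun hC => by rw [hC]; exact .refl⟩
  ext D
  constructor
  · rintro ⟨C, hC, rfl⟩
    exact ⟨C, hC, (key C hC).symm⟩
  · rintro ⟨C, hC, rfl⟩
    exact ⟨C, hC, (key C hC).symm⟩

theorem components_two [Finite X] (h : TwoStepLandscape G H c J p q) :
    irreducibleComponents G H (flats G p q) (2 * J) = {groundSets p q} := by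
  have key : ∀ C ∈ groundSets p q,
      {C' | Accessible G H (flats G p q) (2 * J) C C'} = groundSets p q := by
    rintro _ ⟨s, hs, rfl⟩
    ext C
    constructor
    · intro hC
      rcases hC.cases_tail with heq | ⟨D, -, hD⟩
      · exact heq ▸ ⟨s, hs, rfl⟩
      · rw [← h.starCycles_two]
        exact hD.2.1
    · rintro ⟨s', hs', rfl⟩
      exact h.accessible_ground hs hs'
  have hrec : recurrentCycles G H (flats G p q) (2 * J) = groundSets p q := by
    ext C
    rw [recurrentCycles, h.starCycles_two]
    refine ⟨fun hC => hC.1, fun hC => ⟨hC, fun C' hC' => ?_⟩⟩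
    have h1 : C' ∈ groundSets p q := by
      rw [← key C hC]
      exact hC'
    obtain ⟨s, hs, rfl⟩ := hC
    obtain ⟨s', hs', rfl⟩ := h1
    exact h.accessible_ground hs' hs
  obtain ⟨s, -, hs, -⟩ := h.two_ground
  rw [irreducibleComponents, hrec]
  ext D
  constructor
  · rintro ⟨C, hC, rfl⟩
    exact key C hC
  · rintro rfl
    exact ⟨{s}, ⟨s, hs, rfl⟩, (key _ ⟨s, hs, rfl⟩).symm⟩

theorem level_one [Finite X] (h : TwoStepLandscape G H c J p q) :
    level G H 1 = ⟨flats G p q, flats G p q⟩ := by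
  simp only [level, firstLevel, h.plateaux_eq]
  congr 1
  have key : ∀ P ∈ flats G p q, valley G H (flats G p q) P = P := by
    rintro _ ⟨η, hη, hp, rfl⟩
    exact h.valley_eq subset_rfl h.groundSets_subset_flats hη hp
  rw [Set.image_congr key, Set.image_id']

theorem gamma_one [Finite X] (h : TwoStepLandscape G H c J p q) :
    Level.gamma G H (level G H 1) = J := by
  rw [h.level_one, Level.gamma, h.starDepth_flats]

theorem nextPlateaux_one [Finite X] (h : TwoStepLandscape G H c J p q) :
    Level.nextPlateaux G H (level G H 1) = groundSets p q := by
  have hγ := h.gamma_one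
  rw [Level.nextPlateaux, Level.components, hγ, h.level_one]
  simp only
  rw [h.components_one, Set.image_image]
  have key : ∀ C ∈ groundSets p q, (⋃ C' ∈ ({C} : Set (Set X)), bottom H C') = C := by
    rintro _ ⟨s, hs, rfl⟩
    rw [Set.biUnion_singleton, ← h.flat_ground hs, h.bottom_flat]
  rw [Set.image_congr key, Set.image_id']

/-- On level two the plateaux are the ground states, while the cycles stay the same: the ground
states are their own valleys, and the other flats are transient. -/
theorem level_two [Finite X] (h : TwoStepLandscape G H c J p q) :
    level G H 2 = ⟨groundSets p q, flats G p q⟩ := by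
  have hv : ∀ P ∈ groundSets p q, valley G H (groundSets p q) P = P := by
    rintro _ ⟨s, hs, rfl⟩
    have := h.valley_eq h.groundSets_subset_flats subset_rfl (ground_mem_basin hs)
      (by omega : p s ≤ q + 1)
    rwa [h.flat_ground hs] at this
  have hγ := h.gamma_one
  have hn := h.nextPlateaux_one
  have h2 : level G H 2 = (level G H 1).next G H := rfl
  rw [h2, Level.next, hn, hγ, h.level_one]
  simp only
  congr 1
  rw [Set.image_congr hv, Set.image_id', transientCycles, h.starCycles_one, h.recurrent_one]
  ext C
  constructor
  · rintro (hC | ⟨hC | hC, -⟩)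
    · exact h.groundSets_subset_flats hC
    · exact hC.1
    · exact hC.1
  · intro hC
    by_cases hg : C ∈ groundSets p q
    · exact .inl hg
    · refine .inr ⟨.inl ⟨hC, hg⟩, fun P hP => ?_⟩
      rw [hv P hP]
      obtain ⟨η, -, -, rfl⟩ := hC
      obtain ⟨s, hs, rfl⟩ := hP
      rw [Set.disjoint_singleton_right]
      intro hmem
      refine hg ⟨s, hs, ?_⟩
      rw [← flat_eq_of_mem hmem, h.flat_ground hs]

theorem gamma_two [Finite X] (h : TwoStepLandscape G H c J p q) :
    Level.gamma G H (level G H 2) = 2 * J := by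
  rw [h.level_two, Level.gamma, h.starDepth_groundSets]

theorem two_le_ncard [Finite X] (h : TwoStepLandscape G H c J p q) :
    2 ≤ (groundSets p q).ncard := by
  obtain ⟨s, s', hs, hs', hne⟩ := h.two_ground
  exact (Set.one_lt_ncard (Set.toFinite _)).2
    ⟨{s}, ⟨s, hs, rfl⟩, {s'}, ⟨s', hs', rfl⟩, fun he => hne (Set.singleton_injective he)⟩

theorem isLastLevel_two [Finite X] (h : TwoStepLandscape G H c J p q) : IsLastLevel G H 2 := by
  have h1 : nu G H 1 = (groundSets p q).ncard := by
    have hγ := h.gamma_one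
    rw [nu, zero_add, Level.components, hγ, h.level_one]
    simp only
    rw [h.components_one, Set.ncard_image_of_injective _ Set.singleton_injective]
  have h2 : nu G H 2 = 1 := by
    have hγ := h.gamma_two
    have : nu G H 2 = ((level G H 2).components G H).ncard := rfl
    rw [this, Level.components, hγ, h.level_two]
    simp only
    rw [h.components_two, Set.ncard_singleton]
  refine ⟨fun k hk => ?_, h2⟩
  interval_cases k
  · rw [nu, h.level_one]
    exact h.two_le_ncard.trans (Set.ncard_le_ncard h.groundSets_subset_flats (Set.toFinite _))
  · rw [h1]
    exact h.two_le_ncard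

theorem sUnion_plateaux_one [Finite X] (h : TwoStepLandscape G H c J p q) :
    ⋃₀ (level G H 1).plateaux = {η | η ∈ basin G p q ∧ p η ≤ q + 1} := by
  rw [h.level_one, sUnion_flats]

end TwoStepLandscape

end MetaHierarchy

/-! ### Sets of sites: half perimeter and degrees -/

namespace MetaHierarchy

/-- The torus has side lengths more than `2 * n`, where `n` is the side length of the droplet. -/
structure Dims (K L n : ℕ) : Prop where
  two_le : 2 ≤ n
  lt_left : 2 * n < K
  lt_right : 2 * n < L

variable {K L : ℕ}

/-- The indicator function of a finite set, with integer values. -/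
def ind (A : Finset (Site K L)) (x : Site K L) : ℤ := if x ∈ A then 1 else 0

theorem ind_of_mem {A : Finset (Site K L)} {x : Site K L} (h : x ∈ A) : ind A x = 1 := if_pos h

theorem ind_of_notMem {A : Finset (Site K L)} {x : Site K L} (h : x ∉ A) : ind A x = 0 := if_neg h

theorem ind_nonneg (A : Finset (Site K L)) (x : Site K L) : 0 ≤ ind A x := by
  unfold ind
  split_ifs <;> norm_num

theorem ind_le_one (A : Finset (Site K L)) (x : Site K L) : ind A x ≤ 1 := by
  unfold ind
  split_ifs <;> norm_num

theorem ind_insert_of_ne {A : Finset (Site K L)} {x y : Site K L} (h : x ≠ y) :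
    ind (insert y A) x = ind A x := by
  simp [ind, h]

theorem ind_erase_of_ne {A : Finset (Site K L)} {x y : Site K L} (h : x ≠ y) :
    ind (A.erase y) x = ind A x := by
  simp [ind, h]

theorem ind_mono {A B : Finset (Site K L)} (h : A ⊆ B) (x : Site K L) : ind A x ≤ ind B x := by
  unfold ind
  split_ifs with h1 h2 <;> norm_num
  exact h2 (h h1)

/-- The number of occupied neighbours of `x`. -/
def deg (A : Finset (Site K L)) (x : Site K L) : ℤ :=
  ind A (x + (1, 0)) + ind A (x - (1, 0)) + ind A (x + (0, 1)) + ind A (x - (0, 1))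

theorem deg_nonneg (A : Finset (Site K L)) (x : Site K L) : 0 ≤ deg A x := by
  have h1 := ind_nonneg A (x + (1, 0))
  have h2 := ind_nonneg A (x - (1, 0))
  have h3 := ind_nonneg A (x + (0, 1))
  have h4 := ind_nonneg A (x - (0, 1))
  unfold deg
  omega

theorem deg_mono {A B : Finset (Site K L)} (h : A ⊆ B) (x : Site K L) : deg A x ≤ deg B x := by
  have h1 := ind_mono h (x + (1, 0))
  have h2 := ind_mono h (x - (1, 0))
  have h3 := ind_mono h (x + (0, 1))
  have h4 := ind_mono h (x - (0, 1))
  unfold deg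
  omega

/-- The sites of `A` from which the step `d` leads out of `A`. -/
def ends (d : Site K L) (A : Finset (Site K L)) : Finset (Site K L) := {x ∈ A | x + d ∉ A}

theorem mem_ends {d x : Site K L} {A : Finset (Site K L)} :
    x ∈ ends d A ↔ x ∈ A ∧ x + d ∉ A := by simp [ends]

/-- Half the perimeter of `A`. The energy of a configuration with `A` as its set of occupied sites
is an affine function of this number. -/
def hper (A : Finset (Site K L)) : ℤ := (ends (1, 0) A).card + (ends (0, 1) A).card

theorem card_ends (d : Site K L) (A : Finset (Site K L)) :
    ((ends d A).card : ℤ) = A.card - ∑ x ∈ A, ind A (x + d) := by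
  have h1 : ∑ x ∈ A, ind A (x + d) = ((A.filter fun x => x + d ∈ A).card : ℤ) := by
    simp [ind, Finset.sum_boole]
  have h2 := Finset.card_filter_add_card_filter_not (s := A) (fun x => x + d ∈ A)
  rw [h1, ends]
  omega

theorem sum_ind_neg (d : Site K L) (A : Finset (Site K L)) :
    ∑ x ∈ A, ind A (x + -d) = ∑ x ∈ A, ind A (x + d) := by
  have h1 : ∀ e : Site K L, ∑ x ∈ A, ind A (x + e) = ((A.filter fun x => x + e ∈ A).card : ℤ) := by
    intro e
    simp [ind, Finset.sum_boole]
  rw [h1, h1]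
  congr 1
  refine Finset.card_nbij' (fun x => x + -d) (fun x => x + d) ?_ ?_ ?_ ?_
  · intro x hx
    simp only [Finset.coe_filter, Set.mem_ofPred_eq] at hx ⊢
    simpa using hx.symm
  · intro x hx
    simp only [Finset.coe_filter, Set.mem_ofPred_eq] at hx ⊢
    simpa using hx.symm
  · intro x _
    simp
  · intro x _
    simp

theorem card_ends_neg (d : Site K L) (A : Finset (Site K L)) :
    (ends (-d) A).card = (ends d A).card := by
  have h1 := card_ends d A
  have h2 := card_ends (-d) A
  rw [sum_ind_neg] at h2
  omega

theorem card_ends_insert {d y : Site K L} {W : Finset (Site K L)} (hd : d ≠ 0) (hy : y ∉ W) :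
    ((ends d (insert y W)).card : ℤ)
      = (ends d W).card + 1 - ind W (y + d) - ind W (y - d) := by
  have h1 : ∀ x, ind (insert y W) (x + d) = ind W (x + d) + if x = y - d then 1 else 0 := by
    intro x
    by_cases hx : x = y - d
    · subst hx
      simp [ind, hy]
    · rw [ind_insert_of_ne (fun h => hx (by rw [← h]; abel)), if_neg hx, add_zero]
  have h2 : ind (insert y W) (y + d) = ind W (y + d) :=
    ind_insert_of_ne (by simpa using hd)
  rw [card_ends, card_ends, Finset.sum_insert hy, Finset.card_insert_of_notMem hy, h2,
    Finset.sum_congr rfl fun x _ => h1 x, Finset.sum_add_distrib, Finset.sum_ite_eq']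
  have h3 : (if y - d ∈ W then (1 : ℤ) else 0) = ind W (y - d) := rfl
  rw [h3]
  push_cast
  ring

variable {n : ℕ}

theorem Dims.one_lt_left (D : Dims K L n) : 1 < K := by
  have := D.two_le
  have := D.lt_left
  omega

theorem Dims.one_lt_right (D : Dims K L n) : 1 < L := by
  have := D.two_le
  have := D.lt_right
  omega

theorem Dims.fst_ne_zero (D : Dims K L n) : ((1, 0) : Site K L) ≠ 0 := by
  have := Fact.mk D.one_lt_left
  simp [Prod.ext_iff]

theorem Dims.snd_ne_zero (D : Dims K L n) : ((0, 1) : Site K L) ≠ 0 := by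
  have := Fact.mk D.one_lt_right
  simp [Prod.ext_iff]

theorem hper_insert (D : Dims K L n) {W : Finset (Site K L)} {y : Site K L} (hy : y ∉ W) :
    hper (insert y W) = hper W + 2 - deg W y := by
  rw [hper, hper, card_ends_insert D.fst_ne_zero hy, card_ends_insert D.snd_ne_zero hy, deg]
  ring

theorem deg_erase_self (D : Dims K L n) (A : Finset (Site K L)) (x : Site K L) :
    deg (A.erase x) x = deg A x := by
  have h1 := D.fst_ne_zero
  have h2 := D.snd_ne_zero
  unfold deg
  rw [ind_erase_of_ne (by simpa using h1), ind_erase_of_ne (by simpa using h1),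
    ind_erase_of_ne (by simpa using h2), ind_erase_of_ne (by simpa using h2)]

theorem hper_erase (D : Dims K L n) {A : Finset (Site K L)} {x : Site K L} (hx : x ∈ A) :
    hper (A.erase x) = hper A - 2 + deg A x := by
  have h := hper_insert D (Finset.notMem_erase x A)
  rw [Finset.insert_erase hx, deg_erase_self D] at h
  omega

/-! ### Charts of the torus -/

/-- Coordinates on the torus: a base point and two axes `u`, `v`, which are the unit vectors up to
sign and order. -/
structure Chart (K L : ℕ) where
  origin : Site K L
  u : Site K L
  v : Site K L
  axes : ((u = (1, 0) ∨ u = -(1, 0)) ∧ (v = (0, 1) ∨ v = -(0, 1))) ∨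
    ((u = (0, 1) ∨ u = -(0, 1)) ∧ (v = (1, 0) ∨ v = -(1, 0)))

namespace Chart

/-- The site with coordinates `(i, j)`. -/
def pt (φ : Chart K L) (i j : ℤ) : Site K L := φ.origin + i • φ.u + j • φ.v

/-- The chart with the coordinate directions of the torus. -/
def std (x : Site K L) : Chart K L := ⟨x, (1, 0), (0, 1), .inl ⟨.inl rfl, .inl rfl⟩⟩

/-- Exchange of the two coordinates. -/
def swap (φ : Chart K L) : Chart K L :=
  ⟨φ.origin, φ.v, φ.u, φ.axes.symm.imp (fun h => h.symm) (fun h => h.symm)⟩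

/-- Reflection `i ↦ a - 1 - i` of the first coordinate. -/
def flip (φ : Chart K L) (a : ℤ) : Chart K L :=
  ⟨φ.origin + (a - 1) • φ.u, -φ.u, φ.v, by
    rcases φ.axes with ⟨h1, h2⟩ | ⟨h1, h2⟩
    · exact .inl ⟨by rcases h1 with h1 | h1 <;> rw [h1] <;> simp, h2⟩
    · exact .inr ⟨by rcases h1 with h1 | h1 <;> rw [h1] <;> simp, h2⟩⟩

/-- Translation of the base point. -/
def trans (φ : Chart K L) (k l : ℤ) : Chart K L := ⟨φ.pt k l, φ.u, φ.v, φ.axes⟩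

variable (φ : Chart K L)

@[simp] theorem swap_pt (i j : ℤ) : φ.swap.pt i j = φ.pt j i := by
  simp only [pt, swap]
  abel

@[simp] theorem flip_pt (a i j : ℤ) : (φ.flip a).pt i j = φ.pt (a - 1 - i) j := by
  simp only [pt, flip, sub_smul, smul_neg]
  abel

@[simp] theorem trans_pt (k l i j : ℤ) : (φ.trans k l).pt i j = φ.pt (i + k) (j + l) := by
  simp only [pt, trans, add_smul]
  abel

theorem pt_add_u (i j : ℤ) : φ.pt i j + φ.u = φ.pt (i + 1) j := by
  simp only [pt, add_smul, one_smul]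
  abel

theorem pt_add_v (i j : ℤ) : φ.pt i j + φ.v = φ.pt i (j + 1) := by
  simp only [pt, add_smul, one_smul]
  abel

theorem pt_sub_u (i j : ℤ) : φ.pt i j - φ.u = φ.pt (i - 1) j := by
  simp only [pt, sub_smul, one_smul]
  abel

theorem pt_sub_v (i j : ℤ) : φ.pt i j - φ.v = φ.pt i (j - 1) := by
  simp only [pt, sub_smul, one_smul]
  abel

theorem deg_eq (A : Finset (Site K L)) (x : Site K L) :
    deg A x = ind A (x + φ.u) + ind A (x - φ.u) + ind A (x + φ.v) + ind A (x - φ.v) := by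
  unfold deg
  rcases φ.axes with ⟨h1 | h1, h2 | h2⟩ | ⟨h1 | h1, h2 | h2⟩ <;> rw [h1, h2] <;>
    (try simp only [sub_neg_eq_add, ← sub_eq_add_neg]) <;> ring

theorem deg_pt (A : Finset (Site K L)) (i j : ℤ) :
    deg A (φ.pt i j) = ind A (φ.pt (i + 1) j) + ind A (φ.pt (i - 1) j) + ind A (φ.pt i (j + 1))
      + ind A (φ.pt i (j - 1)) := by
  rw [φ.deg_eq, pt_add_u, pt_sub_u, pt_add_v, pt_sub_v]

theorem hper_eq (A : Finset (Site K L)) :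
    hper A = (ends φ.u A).card + (ends φ.v A).card := by
  unfold hper
  rcases φ.axes with ⟨h1 | h1, h2 | h2⟩ | ⟨h1 | h1, h2 | h2⟩ <;> rw [h1, h2] <;>
    (try simp only [card_ends_neg]) <;> ring

theorem natCast_dvd_of_zsmul {M : ℕ} {k : ℤ} (h : (k : ZMod M) = 0) : (M : ℤ) ∣ k :=
  (ZMod.intCast_zmod_eq_zero_iff_dvd k M).1 h

theorem smul_add_smul_eq_zero {φ : Chart K L} (D : Dims K L n) {i j : ℤ}
    (h : i • φ.u + j • φ.v = 0) (hi : |i| ≤ 2 * n) (hj : |j| ≤ 2 * n) : i = 0 ∧ j = 0 := by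
  have hK : (2 * n : ℤ) < K := by exact_mod_cast D.lt_left
  have hL : (2 * n : ℤ) < L := by exact_mod_cast D.lt_right
  have key : ∀ {M : ℕ} {k : ℤ}, (2 * n : ℤ) < M → |k| ≤ 2 * n → (k : ZMod M) = 0 → k = 0 := by
    intro M k hM hk h0
    exact Int.eq_zero_of_abs_lt_dvd (natCast_dvd_of_zsmul h0) (by omega)
  rcases φ.axes with ⟨h1 | h1, h2 | h2⟩ | ⟨h1 | h1, h2 | h2⟩ <;> rw [h1, h2] at h <;>
    simp [Prod.ext_iff] at h
  all_goals
    first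
      | exact ⟨key hK hi h.1, key hL hj h.2⟩
      | exact ⟨key hL hi h.2, key hK hj h.1⟩

theorem pt_inj {φ : Chart K L} (D : Dims K L n) {i j i' j' : ℤ} (h : φ.pt i j = φ.pt i' j')
    (hi : |i - i'| ≤ 2 * n) (hj : |j - j'| ≤ 2 * n) : i = i' ∧ j = j' := by
  have h1 : (i - i') • φ.u + (j - j') • φ.v = 0 := by
    have : φ.pt i j - φ.pt i' j' = 0 := sub_eq_zero.2 h
    rw [← this]
    simp only [pt, sub_smul]
    abel
  have := smul_add_smul_eq_zero D h1 hi hj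
  omega

end Chart

/-- Nearest neighbours on the torus. -/
def Nbr (x y : Site K L) : Prop :=
  y = x + (1, 0) ∨ y = x - (1, 0) ∨ y = x + (0, 1) ∨ y = x - (0, 1)

theorem Nbr.symm {x y : Site K L} (h : Nbr x y) : Nbr y x := by
  rcases h with rfl | rfl | rfl | rfl <;> simp [Nbr]

theorem Chart.nbr_iff (φ : Chart K L) {x y : Site K L} :
    Nbr x y ↔ y = x + φ.u ∨ y = x - φ.u ∨ y = x + φ.v ∨ y = x - φ.v := by
  unfold Nbr
  rcases φ.axes with ⟨h1 | h1, h2 | h2⟩ | ⟨h1 | h1, h2 | h2⟩ <;> rw [h1, h2] <;>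
    (try simp only [sub_neg_eq_add, ← sub_eq_add_neg]) <;> tauto

theorem Chart.nbr_pt (φ : Chart K L) {i j : ℤ} {y : Site K L} :
    Nbr (φ.pt i j) y ↔ y = φ.pt (i + 1) j ∨ y = φ.pt (i - 1) j ∨ y = φ.pt i (j + 1) ∨
      y = φ.pt i (j - 1) := by
  rw [φ.nbr_iff, pt_add_u, pt_sub_u, pt_add_v, pt_sub_v]

theorem Nbr.ne (D : Dims K L n) {x y : Site K L} (h : Nbr x y) : x ≠ y := by
  have h1 := D.fst_ne_zero
  have h2 := D.snd_ne_zero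
  rintro rfl
  rcases h with h | h | h | h
  · exact h1 (by simpa using h.symm)
  · exact h1 (by simpa using h.symm)
  · exact h2 (by simpa using h.symm)
  · exact h2 (by simpa using h.symm)

theorem lattice_adj_iff (D : Dims K L n) {x y : Site K L} : (lattice K L).Adj x y ↔ Nbr x y := by
  rw [lattice, SimpleGraph.fromRel_adj]
  constructor
  · rintro ⟨-, (h | h) | (h | h)⟩
    · exact .inl h
    · exact .inr (.inr (.inl h))
    · exact .inr (.inl (by rw [h]; abel))
    · exact .inr (.inr (.inr (by rw [h]; abel)))
  · intro h
    refine ⟨h.ne D, ?_⟩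
    rcases h with rfl | rfl | rfl | rfl <;> simp

theorem deg_erase_of_not_nbr {A : Finset (Site K L)} {x y : Site K L} (h : ¬Nbr x y) :
    deg (A.erase y) x = deg A x := by
  unfold Nbr at h
  push Not at h
  obtain ⟨h1, h2, h3, h4⟩ := h
  unfold deg
  rw [ind_erase_of_ne h1.symm, ind_erase_of_ne h2.symm, ind_erase_of_ne h3.symm,
    ind_erase_of_ne h4.symm]

theorem deg_insert_of_not_nbr {A : Finset (Site K L)} {x y : Site K L} (h : ¬Nbr x y) :
    deg (insert y A) x = deg A x := by
  unfold Nbr at h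
  push Not at h
  obtain ⟨h1, h2, h3, h4⟩ := h
  unfold deg
  rw [ind_insert_of_ne h1.symm, ind_insert_of_ne h2.symm, ind_insert_of_ne h3.symm,
    ind_insert_of_ne h4.symm]

theorem deg_insert_of_nbr (D : Dims K L n) {A : Finset (Site K L)} {x y : Site K L} (h : Nbr x y)
    (hy : y ∉ A) : deg (insert y A) x = deg A x + 1 := by
  obtain ⟨φ, rfl, rfl⟩ : ∃ φ : Chart K L, φ.pt 0 0 = x ∧ φ.pt 1 0 = y := by
    rcases h with rfl | rfl | rfl | rfl
    · exact ⟨⟨x, (1, 0), (0, 1), by simp⟩, by simp [Chart.pt], by simp [Chart.pt]⟩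
    · exact ⟨⟨x, -(1, 0), (0, 1), by simp⟩, by simp [Chart.pt],
        by simp [Chart.pt, sub_eq_add_neg]⟩
    · exact ⟨⟨x, (0, 1), (1, 0), by simp⟩, by simp [Chart.pt], by simp [Chart.pt]⟩
    · exact ⟨⟨x, -(0, 1), (1, 0), by simp⟩, by simp [Chart.pt],
        by simp [Chart.pt, sub_eq_add_neg]⟩
  have hn : (2 : ℤ) ≤ n := by exact_mod_cast D.two_le
  have hne : ∀ i j : ℤ, |i| ≤ 1 → |j| ≤ 1 → (i ≠ 1 ∨ j ≠ 0) → φ.pt i j ≠ φ.pt 1 0 := by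
    intro i j hi hj hij heq
    rw [abs_le] at hi hj
    have := Chart.pt_inj D heq (by rw [abs_le]; omega) (by rw [abs_le]; omega)
    omega
  rw [φ.deg_pt, φ.deg_pt]
  rw [show (0 : ℤ) + 1 = 1 from rfl, show (0 : ℤ) - 1 = -1 from rfl,
    ind_of_mem (Finset.mem_insert_self _ _), ind_of_notMem hy,
    ind_insert_of_ne (hne (-1) 0 (by norm_num) (by norm_num) (by norm_num)),
    ind_insert_of_ne (hne 0 1 (by norm_num) (by norm_num) (by norm_num)),
    ind_insert_of_ne (hne 0 (-1) (by norm_num) (by norm_num) (by norm_num))]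
  ring

theorem deg_erase_of_nbr (D : Dims K L n) {A : Finset (Site K L)} {x y : Site K L} (h : Nbr x y)
    (hy : y ∈ A) : deg (A.erase y) x = deg A x - 1 := by
  have h1 := deg_insert_of_nbr D h (Finset.notMem_erase y A)
  rw [Finset.insert_erase hy] at h1
  omega

end MetaHierarchy

/-! ### Boxes -/

namespace MetaHierarchy

variable {K L n : ℕ}

namespace Chart

variable (φ : Chart K L)

/-- The `a × b` rectangle in the coordinates of a chart. -/
noncomputable def box (a b : ℤ) : Finset (Site K L) :=
  (Finset.Ico 0 a ×ˢ Finset.Ico 0 b).image fun s => φ.pt s.1 s.2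

variable {φ}

theorem mem_box {a b : ℤ} {x : Site K L} :
    x ∈ φ.box a b ↔ ∃ i j, 0 ≤ i ∧ i < a ∧ 0 ≤ j ∧ j < b ∧ φ.pt i j = x := by
  simp only [box, Finset.mem_image, Finset.mem_product, Finset.mem_Ico, Prod.exists]
  constructor
  · rintro ⟨i, j, ⟨⟨h1, h2⟩, h3, h4⟩, h⟩
    exact ⟨i, j, h1, h2, h3, h4, h⟩
  · rintro ⟨i, j, h1, h2, h3, h4, h⟩
    exact ⟨i, j, ⟨⟨h1, h2⟩, h3, h4⟩, h⟩

theorem pt_mem_box {a b i j : ℤ} (h1 : 0 ≤ i) (h2 : i < a) (h3 : 0 ≤ j) (h4 : j < b) :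
    φ.pt i j ∈ φ.box a b := mem_box.2 ⟨i, j, h1, h2, h3, h4, rfl⟩

/-- Membership in a box can be read off from the coordinates as long as these stay in a range on
which the chart is injective. -/
theorem pt_mem_box_iff (D : Dims K L n) {a b i j : ℤ} (hi : i ≤ 2 * n) (hi' : a - 1 - 2 * n ≤ i)
    (hj : j ≤ 2 * n) (hj' : b - 1 - 2 * n ≤ j) :
    φ.pt i j ∈ φ.box a b ↔ 0 ≤ i ∧ i < a ∧ 0 ≤ j ∧ j < b := by
  constructor
  · intro h
    obtain ⟨i', j', h1, h2, h3, h4, h5⟩ := mem_box.1 h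
    have := pt_inj D h5 (by rw [abs_le]; omega) (by rw [abs_le]; omega)
    omega
  · rintro ⟨h1, h2, h3, h4⟩
    exact pt_mem_box h1 h2 h3 h4

@[simp] theorem swap_box (a b : ℤ) : φ.swap.box b a = φ.box a b := by
  ext x
  simp only [mem_box, swap_pt]
  constructor
  · rintro ⟨i, j, h1, h2, h3, h4, h5⟩
    exact ⟨j, i, h3, h4, h1, h2, h5⟩
  · rintro ⟨i, j, h1, h2, h3, h4, h5⟩
    exact ⟨j, i, h3, h4, h1, h2, h5⟩

@[simp] theorem flip_box (a b : ℤ) : (φ.flip a).box a b = φ.box a b := by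
  ext x
  simp only [mem_box, flip_pt]
  constructor
  · rintro ⟨i, j, h1, h2, h3, h4, h5⟩
    exact ⟨a - 1 - i, j, by omega, by omega, h3, h4, h5⟩
  · rintro ⟨i, j, h1, h2, h3, h4, h5⟩
    exact ⟨a - 1 - i, j, by omega, by omega, h3, h4, by rw [← h5]; congr 1; omega⟩

/-- A predicate on boxes that is invariant under reflections and exchange of the coordinates needs
to be considered only in the coordinate directions of the torus. -/
theorem exists_std {P : Chart K L → ℤ → ℤ → Prop} (hflip : ∀ φ a b, P φ a b → P (φ.flip a) a b)
    (hswap : ∀ φ a b, P φ a b → P φ.swap b a) {a b : ℤ} (h : P φ a b) :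
    ∃ x, P (std x) a b ∨ P (std x) b a := by
  have step : ∀ (φ : Chart K L) (a b : ℤ), P φ a b → (φ.u = (1, 0) ∨ φ.u = -(1, 0)) →
      (φ.v = (0, 1) ∨ φ.v = -(0, 1)) → ∃ x, P (std x) a b := by
    have step1 : ∀ (φ : Chart K L) (a b : ℤ), P φ a b → φ.u = (1, 0) → φ.v = (0, 1) →
        ∃ x, P (std x) a b := by
      rintro ⟨x, u, v, h⟩ a b hP rfl rfl
      exact ⟨x, hP⟩
    have step2 : ∀ (φ : Chart K L) (a b : ℤ), P φ a b → (φ.u = (1, 0) ∨ φ.u = -(1, 0)) →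
        φ.v = (0, 1) → ∃ x, P (std x) a b := by
      rintro φ a b hP (hu | hu) hv
      · exact step1 φ a b hP hu hv
      · exact step1 (φ.flip a) a b (hflip _ _ _ hP) (by simp [flip, hu]) hv
    rintro φ a b hP hu (hv | hv)
    · exact step2 φ a b hP hu hv
    · exact step2 (φ.swap.flip b).swap a b (hswap _ _ _ (hflip _ _ _ (hswap _ _ _ hP)))
        (by simpa [flip, swap] using hu) (by simp [flip, swap, hv])
  rcases φ.axes with ⟨h1, h2⟩ | ⟨h1, h2⟩
  · obtain ⟨x, hx⟩ := step φ a b h h1 h2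
    exact ⟨x, .inl hx⟩
  · obtain ⟨x, hx⟩ := step φ.swap b a (hswap _ _ _ h) h2 h1
    exact ⟨x, .inr hx⟩

/-- The coordinates in `[0, a) × [0, b)` of the sites of `A`. -/
noncomputable def coords (φ : Chart K L) (a b : ℤ) (A : Finset (Site K L)) : Finset (ℤ × ℤ) :=
  (Finset.Ico 0 a ×ˢ Finset.Ico 0 b).filter fun s => φ.pt s.1 s.2 ∈ A

theorem mem_coords {a b i j : ℤ} {A : Finset (Site K L)} :
    (i, j) ∈ φ.coords a b A ↔ 0 ≤ i ∧ i < a ∧ 0 ≤ j ∧ j < b ∧ φ.pt i j ∈ A := by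
  simp only [coords, Finset.mem_filter, Finset.mem_product, Finset.mem_Ico]
  tauto

theorem injOn_pt (D : Dims K L n) {a b : ℤ} (ha : a ≤ 2 * n + 1) (hb : b ≤ 2 * n + 1) :
    Set.InjOn (fun s : ℤ × ℤ => φ.pt s.1 s.2) (Finset.Ico 0 a ×ˢ Finset.Ico 0 b : Finset _) := by
  rintro ⟨i, j⟩ h1 ⟨i', j'⟩ h2 heq
  simp only [Finset.coe_product, Set.mem_prod, Finset.coe_Ico, Set.mem_Ico] at h1 h2
  have := pt_inj D heq (by rw [abs_le]; omega) (by rw [abs_le]; omega)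
  rw [Prod.mk.injEq]
  exact this

theorem card_coords (D : Dims K L n) {a b : ℤ} (ha : a ≤ 2 * n + 1) (hb : b ≤ 2 * n + 1)
    {A : Finset (Site K L)} (hA : A ⊆ φ.box a b) : (φ.coords a b A).card = A.card := by
  rw [← Finset.card_image_of_injOn (f := fun s : ℤ × ℤ => φ.pt s.1 s.2)
    ((injOn_pt (φ := φ) D ha hb).mono (by
      intro s hs
      exact (Finset.mem_filter.1 hs).1))]
  congr 1
  ext x
  simp only [Finset.mem_image, Prod.exists]
  constructor
  · rintro ⟨i, j, h, rfl⟩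
    exact (mem_coords.1 h).2.2.2.2
  · intro hx
    obtain ⟨i, j, h1, h2, h3, h4, h5⟩ := mem_box.1 (hA hx)
    exact ⟨i, j, mem_coords.2 ⟨h1, h2, h3, h4, h5 ▸ hx⟩, h5⟩

theorem card_box (D : Dims K L n) {a b : ℤ} (ha0 : 0 ≤ a) (hb0 : 0 ≤ b) (ha : a ≤ 2 * n + 1)
    (hb : b ≤ 2 * n + 1) : ((φ.box a b).card : ℤ) = a * b := by
  rw [box, Finset.card_image_of_injOn (injOn_pt D ha hb), Finset.card_product]
  push_cast
  simp [ha0, hb0]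

/-- A set of coordinates in the box at which `A` is empty has at most as many elements as `A` has
vacancies in the box. -/
theorem card_vacant_le (D : Dims K L n) {a b : ℤ} (ha0 : 0 ≤ a) (hb0 : 0 ≤ b)
    (ha : a ≤ 2 * n + 1) (hb : b ≤ 2 * n + 1) {A : Finset (Site K L)} (hA : A ⊆ φ.box a b)
    {S : Finset (ℤ × ℤ)} (hS : ∀ s ∈ S, 0 ≤ s.1 ∧ s.1 < a ∧ 0 ≤ s.2 ∧ s.2 < b ∧ φ.pt s.1 s.2 ∉ A) :
    (S.card : ℤ) ≤ a * b - A.card := by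
  have h1 : Disjoint S (φ.coords a b A) := by
    rw [Finset.disjoint_left]
    intro s hs hs'
    exact (hS s hs).2.2.2.2 (mem_coords.1 hs').2.2.2.2
  have h2 : S ∪ φ.coords a b A ⊆ Finset.Ico 0 a ×ˢ Finset.Ico 0 b := by
    intro s hs
    rw [Finset.mem_product, Finset.mem_Ico, Finset.mem_Ico]
    rcases Finset.mem_union.1 hs with hs | hs
    · have := hS s hs
      tauto
    · have := mem_coords.1 (show (s.1, s.2) ∈ _ from hs)
      tauto
  have h3 := Finset.card_le_card h2
  rw [Finset.card_union_of_disjoint h1, card_coords D ha hb hA, Finset.card_product] at h3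
  have h4 : (((Finset.Ico (0 : ℤ) a).card * (Finset.Ico (0 : ℤ) b).card : ℕ) : ℤ) = a * b := by
    push_cast
    simp [ha0, hb0]
  omega

theorem ends_u_eq (D : Dims K L n) {a b : ℤ} (ha : a ≤ 2 * n + 1) (hb : b ≤ 2 * n + 1)
    {A : Finset (Site K L)} (hA : A ⊆ φ.box a b) :
    (ends φ.u A).card
      = ((φ.coords a b A).filter fun s => φ.pt (s.1 + 1) s.2 ∉ A).card := by
  have h1 : ends φ.u A ⊆ φ.box a b := fun x hx => hA (mem_ends.1 hx).1
  rw [← card_coords D ha hb h1]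
  congr 1
  ext ⟨i, j⟩
  simp only [mem_coords, Finset.mem_filter, mem_ends, pt_add_u]
  tauto

/-- Every nonempty row has an end, and so `A` has at least as many row ends as rows. -/
theorem le_card_ends_u (D : Dims K L n) {a b : ℤ} (ha : a ≤ 2 * n) (hb : b ≤ 2 * n + 1)
    {A : Finset (Site K L)} (hA : A ⊆ φ.box a b)
    (hrow : ∀ j, 0 ≤ j → j < b → ∃ i, 0 ≤ i ∧ i < a ∧ φ.pt i j ∈ A) :
    b ≤ (ends φ.u A).card ∧ ((∃ i i' j, 0 ≤ i ∧ i < i' ∧ i' < a ∧ 0 ≤ j ∧ j < b ∧ φ.pt i j ∈ A ∧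
      φ.pt (i + 1) j ∉ A ∧ φ.pt i' j ∈ A) → b + 1 ≤ (ends φ.u A).card) := by
  have last : ∀ i0 j, 0 ≤ i0 → i0 < a → 0 ≤ j → j < b → φ.pt i0 j ∈ A →
      ∃ i, i0 ≤ i ∧ i < a ∧ φ.pt i j ∈ A ∧ φ.pt (i + 1) j ∉ A := by
    intro i0 j h1 h2 h3 h4 h5
    by_contra hcon
    push Not at hcon
    have hall : ∀ k : ℕ, i0 + k ≤ a → φ.pt (i0 + k) j ∈ A := by
      intro k
      induction k with
      | zero => intro _; simpa using h5
      | succ k ih =>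
        intro hk
        push_cast at hk ⊢
        rw [← add_assoc]
        exact hcon _ (by omega) (by omega) (ih (by omega))
    have h6 := hall (a - i0).toNat (by omega)
    rw [show i0 + ((a - i0).toNat : ℤ) = a by omega] at h6
    obtain ⟨i', j', g1, g2, g3, g4, g5⟩ := mem_box.1 (hA h6)
    have := pt_inj D g5 (by rw [abs_le]; omega) (by rw [abs_le]; omega)
    omega
  rw [ends_u_eq D (by omega) hb hA]
  set T := (φ.coords a b A).filter fun s => φ.pt (s.1 + 1) s.2 ∉ A with hT
  have memT : ∀ i j, (i, j) ∈ T ↔ (0 ≤ i ∧ i < a ∧ 0 ≤ j ∧ j < b ∧ φ.pt i j ∈ A) ∧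
      φ.pt (i + 1) j ∉ A := by
    intro i j
    rw [hT, Finset.mem_filter, mem_coords]
  have hsub : Finset.Ico 0 b ⊆ T.image Prod.snd := by
    intro j hj
    rw [Finset.mem_Ico] at hj
    obtain ⟨i0, h1, h2, h3⟩ := hrow j hj.1 hj.2
    obtain ⟨i, g1, g2, g3, g4⟩ := last i0 j h1 h2 hj.1 hj.2 h3
    exact Finset.mem_image.2 ⟨(i, j), (memT i j).2 ⟨⟨by omega, g2, hj.1, hj.2, g3⟩, g4⟩, rfl⟩
  have hcard := Finset.card_le_card hsub
  rw [Int.card_Ico] at hcard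
  have hle := Finset.card_image_le (s := T) (f := Prod.snd)
  refine ⟨by omega, ?_⟩
  rintro ⟨i, i', j, h1, h2, h3, h4, h5, h6, h7, h8⟩
  obtain ⟨k, g1, g2, g3, g4⟩ := last i' j (by omega) h3 h4 h5 h8
  have hlt : (T.image Prod.snd).card < T.card := by
    refine lt_of_le_of_ne hle fun heq => ?_
    have hinj := Finset.card_image_iff.1 heq
    have := hinj ((memT i j).2 ⟨⟨h1, by omega, h4, h5, h6⟩, h7⟩ : (i, j) ∈ (T : Set (ℤ × ℤ)))
      ((memT k j).2 ⟨⟨by omega, g2, h4, h5, g3⟩, g4⟩ : (k, j) ∈ (T : Set (ℤ × ℤ))) rfl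
    rw [Prod.mk.injEq] at this
    omega
  omega

/-- If every row of the box has at most one end, then `A` has at most as many row ends as the box
has rows. -/
theorem card_ends_u_le (D : Dims K L n) {a b : ℤ} (hb0 : 0 ≤ b) (ha : a ≤ 2 * n + 1)
    (hb : b ≤ 2 * n + 1) {A : Finset (Site K L)} (hA : A ⊆ φ.box a b)
    (hrow : ∀ i i' j, 0 ≤ i → i < i' → i' < a → 0 ≤ j → j < b → φ.pt i j ∈ A →
      φ.pt i' j ∈ A → φ.pt (i + 1) j ∈ A) : (ends φ.u A).card ≤ b := by
  rw [ends_u_eq D ha hb hA]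
  set T := (φ.coords a b A).filter fun s => φ.pt (s.1 + 1) s.2 ∉ A with hT
  have memT : ∀ i j, (i, j) ∈ T ↔ (0 ≤ i ∧ i < a ∧ 0 ≤ j ∧ j < b ∧ φ.pt i j ∈ A) ∧
      φ.pt (i + 1) j ∉ A := by
    intro i j
    rw [hT, Finset.mem_filter, mem_coords]
  have hcard : T.card ≤ (Finset.Ico 0 b).card := by
    refine Finset.card_le_card_of_injOn Prod.snd ?_ ?_
    · rintro ⟨i, j⟩ hs
      have := (memT i j).1 hs
      simp only [Finset.coe_Ico, Set.mem_Ico]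
      omega
    · rintro ⟨i, j⟩ h1 ⟨i', j'⟩ h2 heq
      have g1 := (memT i j).1 h1
      have g2 := (memT i' j').1 h2
      simp only at heq
      subst heq
      rw [Prod.mk.injEq]
      refine ⟨?_, rfl⟩
      rcases lt_trichotomy i i' with hlt | heq | hlt
      · exact absurd (hrow i i' j g1.1.1 hlt g2.1.2.1 g1.1.2.2.1 g1.1.2.2.2.1 g1.1.2.2.2.2
          g2.1.2.2.2.2) g1.2
      · exact heq
      · exact absurd (hrow i' i j g2.1.1 hlt g1.1.2.1 g1.1.2.2.1 g1.1.2.2.2.1 g2.1.2.2.2.2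
          g1.1.2.2.2.2) g2.2
  rw [Int.card_Ico] at hcard
  omega

/-- Row and column convex sets that meet all lines of the box have one end in each of them. -/
theorem card_ends_of_convex (D : Dims K L n) {a b : ℤ} (ha0 : 0 ≤ a) (hb0 : 0 ≤ b) (ha : a ≤ 2 * n)
    (hb : b ≤ 2 * n) {A : Finset (Site K L)} (hA : A ⊆ φ.box a b)
    (hrow : ∀ i i' j, 0 ≤ i → i < i' → i' < a → 0 ≤ j → j < b → φ.pt i j ∈ A →
      φ.pt i' j ∈ A → φ.pt (i + 1) j ∈ A)
    (hcol : ∀ i j j', 0 ≤ j → j < j' → j' < b → 0 ≤ i → i < a → φ.pt i j ∈ A →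
      φ.pt i j' ∈ A → φ.pt i (j + 1) ∈ A)
    (hrow' : ∀ j, 0 ≤ j → j < b → ∃ i, 0 ≤ i ∧ i < a ∧ φ.pt i j ∈ A)
    (hcol' : ∀ i, 0 ≤ i → i < a → ∃ j, 0 ≤ j ∧ j < b ∧ φ.pt i j ∈ A) :
    (((ends (1, 0) A).card : ℤ) = b ∧ ((ends (0, 1) A).card : ℤ) = a) ∨
      (((ends (1, 0) A).card : ℤ) = a ∧ ((ends (0, 1) A).card : ℤ) = b) := by
  have hA' : A ⊆ φ.swap.box b a := by rwa [swap_box]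
  have h1 := card_ends_u_le D hb0 (by omega) (by omega) hA hrow
  have h2 := card_ends_u_le (φ := φ.swap) D ha0 (by omega) (by omega) hA' (by
    simp only [swap_pt]
    intro j j' i g1 g2 g3 g4 g5
    exact hcol i j j' g1 g2 g3 g4 g5)
  have h3 := (le_card_ends_u D ha (by omega) hA hrow').1
  have h4 := (le_card_ends_u (φ := φ.swap) D hb (by omega) hA' (by
    simpa only [swap_pt] using hcol')).1
  have h5 : φ.swap.u = φ.v := rfl
  rw [h5] at h2 h4
  rcases φ.axes with ⟨hu | hu, hv | hv⟩ | ⟨hu | hu, hv | hv⟩ <;> rw [hu] at h1 h3 <;>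
    rw [hv] at h2 h4 <;> (try simp only [card_ends_neg] at h1 h2 h3 h4) <;> omega

theorem hper_of_convex (D : Dims K L n) {a b : ℤ} (ha0 : 0 ≤ a) (hb0 : 0 ≤ b) (ha : a ≤ 2 * n)
    (hb : b ≤ 2 * n) {A : Finset (Site K L)} (hA : A ⊆ φ.box a b)
    (hrow : ∀ i i' j, 0 ≤ i → i < i' → i' < a → 0 ≤ j → j < b → φ.pt i j ∈ A →
      φ.pt i' j ∈ A → φ.pt (i + 1) j ∈ A)
    (hcol : ∀ i j j', 0 ≤ j → j < j' → j' < b → 0 ≤ i → i < a → φ.pt i j ∈ A →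
      φ.pt i j' ∈ A → φ.pt i (j + 1) ∈ A)
    (hrow' : ∀ j, 0 ≤ j → j < b → ∃ i, 0 ≤ i ∧ i < a ∧ φ.pt i j ∈ A)
    (hcol' : ∀ i, 0 ≤ i → i < a → ∃ j, 0 ≤ j ∧ j < b ∧ φ.pt i j ∈ A) : hper A = a + b := by
  have := card_ends_of_convex D ha0 hb0 ha hb hA hrow hcol hrow' hcol'
  unfold hper
  omega

theorem le_hper (D : Dims K L n) {a b : ℤ} (ha : a ≤ 2 * n) (hb : b ≤ 2 * n)
    {A : Finset (Site K L)} (hA : A ⊆ φ.box a b)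
    (hrow' : ∀ j, 0 ≤ j → j < b → ∃ i, 0 ≤ i ∧ i < a ∧ φ.pt i j ∈ A)
    (hcol' : ∀ i, 0 ≤ i → i < a → ∃ j, 0 ≤ j ∧ j < b ∧ φ.pt i j ∈ A) :
    a + b ≤ hper A ∧
    ((∃ i i' j, 0 ≤ i ∧ i < i' ∧ i' < a ∧ 0 ≤ j ∧ j < b ∧ φ.pt i j ∈ A ∧
      φ.pt (i + 1) j ∉ A ∧ φ.pt i' j ∈ A) → a + b + 1 ≤ hper A ∧
      ((∃ i j j', 0 ≤ j ∧ j < j' ∧ j' < b ∧ 0 ≤ i ∧ i < a ∧ φ.pt i j ∈ A ∧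
      φ.pt i (j + 1) ∉ A ∧ φ.pt i j' ∈ A) → a + b + 2 ≤ hper A)) := by
  have hA' : A ⊆ φ.swap.box b a := by rwa [swap_box]
  have h3 := le_card_ends_u D ha (by omega) hA hrow'
  have h4 := le_card_ends_u (φ := φ.swap) D hb (by omega) hA' (by
    simpa only [swap_pt] using hcol')
  have h5 : φ.swap.u = φ.v := rfl
  rw [h5] at h4
  rw [φ.hper_eq]
  refine ⟨by omega, fun g1 => ?_⟩
  have g2 := h3.2 g1
  refine ⟨by omega, ?_⟩
  rintro ⟨i, j, j', g⟩
  have g3 := h4.2 ⟨j, j', i, by simpa only [swap_pt] using g⟩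
  omega

theorem hper_box (D : Dims K L n) {a b : ℤ} (ha0 : 0 < a) (hb0 : 0 < b) (ha : a ≤ 2 * n)
    (hb : b ≤ 2 * n) : hper (φ.box a b) = a + b := by
  refine hper_of_convex D ha0.le hb0.le ha hb subset_rfl ?_ ?_ ?_ ?_
  · intro i i' j h1 h2 h3 h4 h5 _ _
    exact pt_mem_box (by omega) (by omega) h4 h5
  · intro i j j' h1 h2 h3 h4 h5 _ _
    exact pt_mem_box h4 h5 (by omega) (by omega)
  · intro j h1 h2
    exact ⟨0, le_rfl, ha0, pt_mem_box le_rfl ha0 h1 h2⟩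
  · intro i h1 h2
    exact ⟨0, le_rfl, hb0, pt_mem_box h1 h2 le_rfl hb0⟩

end Chart

end MetaHierarchy

/-! ### The isoperimetric inequality on the torus -/

namespace MetaHierarchy

variable {K L n : ℕ}

theorem zmod_univ_of_add_one_mem {M : ℕ} [NeZero M] {S : Set (ZMod M)} {x : ZMod M} (hx : x ∈ S)
    (h : ∀ y ∈ S, y + 1 ∈ S) (y : ZMod M) : y ∈ S := by
  have hall : ∀ k : ℕ, x + k ∈ S := by
    intro k
    induction k with
    | zero => simpa using hx
    | succ k ih =>
      push_cast
      rw [← add_assoc]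
      exact h _ ih
  have := hall (y - x).val
  rwa [ZMod.natCast_zmod_val, add_sub_cancel] at this

/-- The rows that `A` fills only in part have an end. -/
theorem card_rows_le (A : Finset (Site K L)) [NeZero K] :
    ∃ F : Finset (ZMod L), (∀ j ∈ F, ∀ x, (x, j) ∈ A) ∧
      (A.image Prod.snd).card ≤ (ends (1, 0) A).card + F.card := by
  classical
  refine ⟨(A.image Prod.snd).filter fun j => ∀ x, (x, j) ∈ A, fun j hj =>
    (Finset.mem_filter.1 hj).2, ?_⟩
  have h := Finset.card_filter_add_card_filter_not (s := A.image Prod.snd)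
    (fun j => ∀ x, (x, j) ∈ A)
  have h2 : ((A.image Prod.snd).filter fun j => ¬∀ x, (x, j) ∈ A).card
      ≤ (ends (1, 0) A).card := by
    refine (Finset.card_le_card ?_).trans (Finset.card_image_le (f := Prod.snd))
    intro j hj
    obtain ⟨h3, h4⟩ := Finset.mem_filter.1 hj
    obtain ⟨⟨x, j'⟩, hx, rfl⟩ := Finset.mem_image.1 h3
    by_contra hcon
    refine h4 fun y => ?_
    refine zmod_univ_of_add_one_mem (S := {y | (y, j') ∈ A}) hx (fun y hy => ?_) y
    by_contra hy'
    refine hcon (Finset.mem_image.2 ⟨(y, j'), mem_ends.2 ⟨hy, ?_⟩, rfl⟩)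
    simpa using hy'
  omega

theorem card_cols_le (A : Finset (Site K L)) [NeZero L] :
    ∃ F : Finset (ZMod K), (∀ x ∈ F, ∀ j, (x, j) ∈ A) ∧
      (A.image Prod.fst).card ≤ (ends (0, 1) A).card + F.card := by
  classical
  refine ⟨(A.image Prod.fst).filter fun x => ∀ j, (x, j) ∈ A, fun j hj =>
    (Finset.mem_filter.1 hj).2, ?_⟩
  have h := Finset.card_filter_add_card_filter_not (s := A.image Prod.fst)
    (fun x => ∀ j, (x, j) ∈ A)
  have h2 : ((A.image Prod.fst).filter fun x => ¬∀ j, (x, j) ∈ A).card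
      ≤ (ends (0, 1) A).card := by
    refine (Finset.card_le_card ?_).trans (Finset.card_image_le (f := Prod.fst))
    intro x hx
    obtain ⟨h3, h4⟩ := Finset.mem_filter.1 hx
    obtain ⟨⟨x', j⟩, hj, rfl⟩ := Finset.mem_image.1 h3
    by_contra hcon
    refine h4 fun y => ?_
    refine zmod_univ_of_add_one_mem (S := {y | (x', y) ∈ A}) hj (fun y hy => ?_) y
    by_contra hy'
    refine hcon (Finset.mem_image.2 ⟨(x', y), mem_ends.2 ⟨hy, ?_⟩, rfl⟩)
    simpa using hy'
  omega

/-- A set of at most `n ^ 2 + 2` sites with half perimeter at most `2 * n` does not wind around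
the torus: it has an end in each of its rows and columns. -/
theorem rows_cols_le (D : Dims K L n) {A : Finset (Site K L)} (hA : A.card ≤ n ^ 2 + 2)
    (hp : hper A ≤ 2 * n) : (A.image Prod.snd).card ≤ (ends (1, 0) A).card ∧
      (A.image Prod.fst).card ≤ (ends (0, 1) A).card := by
  have hn := D.two_le
  have hK := D.lt_left
  have hL := D.lt_right
  have : NeZero K := ⟨by omega⟩
  have : NeZero L := ⟨by omega⟩
  obtain ⟨F, hF, h1⟩ := card_rows_le A
  obtain ⟨F', hF', h2⟩ := card_cols_le A
  have hfull : ∀ j ∈ F, A.image Prod.fst = Finset.univ := by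
    intro j hj
    ext x
    simp only [Finset.mem_univ, iff_true]
    exact Finset.mem_image.2 ⟨(x, j), hF j hj x, rfl⟩
  have hfull' : ∀ x ∈ F', A.image Prod.snd = Finset.univ := by
    intro x hx
    ext j
    simp only [Finset.mem_univ, iff_true]
    exact Finset.mem_image.2 ⟨(x, j), hF' x hx j, rfl⟩
  have hFc : F.card * K ≤ A.card := by
    have h3 : (Finset.univ : Finset (ZMod K)) ×ˢ F ⊆ A := by
      rintro ⟨x, j⟩ hx
      exact hF j (Finset.mem_product.1 hx).2 x
    have h4 := Finset.card_le_card h3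
    rw [Finset.card_product, Finset.card_univ, ZMod.card] at h4
    linarith [mul_comm F.card K]
  have hFc' : F'.card * L ≤ A.card := by
    have h3 : F' ×ˢ (Finset.univ : Finset (ZMod L)) ⊆ A := by
      rintro ⟨x, j⟩ hx
      exact hF' x (Finset.mem_product.1 hx).1 j
    have h4 := Finset.card_le_card h3
    rwa [Finset.card_product, Finset.card_univ, ZMod.card] at h4
  have hsmall : ∀ f M : ℕ, 2 * n < M → f * M ≤ A.card → f < n := by
    intro f M hM hf
    by_contra hcon
    have h5 : n * (2 * n + 1) ≤ f * M := Nat.mul_le_mul (by omega) (by omega)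
    nlinarith
  have hlt := hsmall _ _ hK hFc
  have hlt' := hsmall _ _ hL hFc'
  unfold hper at hp
  rcases F.eq_empty_or_nonempty with hFe | ⟨j, hj⟩
  · rcases F'.eq_empty_or_nonempty with hFe' | ⟨x, hx⟩
    · subst hFe hFe'
      simpa using ⟨h1, h2⟩
    · rw [hfull' x hx, Finset.card_univ, ZMod.card] at h1
      subst hFe
      rw [Finset.card_empty] at h1
      omega
  · rw [hfull j hj, Finset.card_univ, ZMod.card] at h2
    rcases F'.eq_empty_or_nonempty with hFe' | ⟨x, hx⟩
    · subst hFe'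
      rw [Finset.card_empty] at h2
      omega
    · rw [hfull' x hx, Finset.card_univ, ZMod.card] at h1
      omega

theorem card_le_rows_mul_cols (A : Finset (Site K L)) :
    A.card ≤ (A.image Prod.fst).card * (A.image Prod.snd).card := by
  rw [← Finset.card_product]
  refine Finset.card_le_card fun x hx => ?_
  exact Finset.mem_product.2 ⟨Finset.mem_image_of_mem _ hx, Finset.mem_image_of_mem _ hx⟩

/-- The isoperimetric inequality for sets with more sites than an `(n - 1) × n` rectangle. -/
theorem two_mul_le_hper (D : Dims K L n) {A : Finset (Site K L)} (hA : A.card ≤ n ^ 2 + 2)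
    (hA' : (n : ℤ) * (n - 1) < A.card) : 2 * n ≤ hper A := by
  by_contra hlt
  obtain ⟨h1, h2⟩ := rows_cols_le D hA (by omega)
  have h3 := card_le_rows_mul_cols A
  unfold hper at hlt
  generalize (A.image Prod.snd).card = r at *
  generalize (A.image Prod.fst).card = c at *
  have h4 : (c : ℤ) + r ≤ 2 * n - 1 := by omega
  have h5 : (A.card : ℤ) ≤ c * r := by exact_mod_cast h3
  nlinarith [sq_nonneg ((c : ℤ) - r), sq_nonneg ((c : ℤ) - r + 1), sq_nonneg ((c : ℤ) + r)]

/-- The isoperimetric inequality for sets with more sites than an `n × n` square. -/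
theorem two_mul_add_one_le_hper (D : Dims K L n) {A : Finset (Site K L)}
    (hA : A.card ≤ n ^ 2 + 2) (hA' : n ^ 2 < A.card) : 2 * n + 1 ≤ hper A := by
  by_contra hlt
  obtain ⟨h1, h2⟩ := rows_cols_le D hA (by omega)
  have h3 := card_le_rows_mul_cols A
  unfold hper at hlt
  generalize (A.image Prod.snd).card = r at *
  generalize (A.image Prod.fst).card = c at *
  have h4 : (c : ℤ) + r ≤ 2 * n := by omega
  have h5 : (A.card : ℤ) ≤ c * r := by exact_mod_cast h3
  have h6 : ((n : ℤ)) ^ 2 < A.card := by exact_mod_cast hA'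
  nlinarith [sq_nonneg ((c : ℤ) - r), sq_nonneg ((c : ℤ) + r)]

/-! ### The sets of half perimeter `2 * n` -/

/-- A subset of a cycle with only one end is an interval. -/
theorem zmod_interval {M : ℕ} [NeZero M] {S : Finset (ZMod M)} (hne : S.Nonempty)
    (hnu : ∃ y, y ∉ S) (hend : ∀ x ∈ S, ∀ y ∈ S, x + 1 ∉ S → y + 1 ∉ S → x = y) :
    ∃ x0, ∀ y, y ∈ S ↔ ∃ i : ℕ, i < S.card ∧ y = x0 + i := by
  obtain ⟨z, hz⟩ := hnu
  obtain ⟨x0, hx0, hx0'⟩ : ∃ x0, x0 ∈ S ∧ x0 - 1 ∉ S := by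
    by_contra hcon
    push Not at hcon
    obtain ⟨x, hx⟩ := hne
    have := zmod_univ_of_add_one_mem (S := {y | -y ∈ S}) (x := -x) (by simpa using hx)
      (fun y hy => by
        have := hcon _ hy
        simpa [sub_eq_add_neg, add_comm] using this) (-z)
    exact hz (by simpa using this)
  have hex : ∃ m : ℕ, x0 + m ∉ S := ⟨(z - x0).val, by
    rwa [ZMod.natCast_zmod_val, add_sub_cancel]⟩
  classical
  set m := Nat.find hex with hm
  have hm1 : x0 + (m : ZMod M) ∉ S := Nat.find_spec hex
  have hm2 : ∀ i < m, x0 + (i : ZMod M) ∈ S := fun i hi => not_not.1 (Nat.find_min hex hi)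
  have hm0 : 0 < m := by
    by_contra h0
    have : m = 0 := by omega
    rw [this] at hm1
    exact hm1 (by simpa using hx0)
  have hmle : m ≤ (z - x0).val := Nat.find_min' hex (by
    rwa [ZMod.natCast_zmod_val, add_sub_cancel])
  have hmM : m < M := lt_of_le_of_lt hmle (ZMod.val_lt _)
  have hlast : x0 + ((m - 1 : ℕ) : ZMod M) + 1 ∉ S := by
    rw [add_assoc, ← Nat.cast_succ, Nat.succ_eq_add_one, Nat.sub_add_cancel hm0]
    exact hm1
  have hmem : ∀ y, y ∈ S ↔ ∃ i : ℕ, i < m ∧ y = x0 + i := by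
    intro y
    refine ⟨fun hy => ?_, fun ⟨i, hi, h⟩ => h ▸ hm2 i hi⟩
    by_contra hcon
    push Not at hcon
    -- moving on from `y` one never meets the interval, and so never leaves `S`
    have := zmod_univ_of_add_one_mem (S := {y | y ∈ S ∧ ∀ i : ℕ, i < m → y ≠ x0 + i}) ⟨hy, hcon⟩
      (fun y hy => by
        obtain ⟨h1, h2⟩ := hy
        have h3 : y + 1 ∈ S := by
          by_contra h3
          exact h2 (m - 1) (by omega) (hend _ h1 _ (hm2 _ (by omega)) h3 hlast)
        refine ⟨h3, fun i hi h4 => ?_⟩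
        rcases Nat.eq_zero_or_pos i with rfl | hi0
        · have : y = x0 - 1 := by
            rw [eq_sub_iff_add_eq, h4]
            simp
          exact hx0' (this ▸ h1)
        · refine h2 (i - 1) (by omega) ?_
          have : (i : ZMod M) = ((i - 1 : ℕ) : ZMod M) + 1 := by
            rw [← Nat.cast_succ, Nat.succ_eq_add_one, Nat.sub_add_cancel hi0]
          rw [this, ← add_assoc] at h4
          exact add_right_cancel h4) z
    exact hz this.1
  have hcard : S.card = m := by
    have : S = (Finset.range m).image fun i : ℕ => x0 + (i : ZMod M) := by
      ext y
      rw [hmem, Finset.mem_image]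
      constructor
      · rintro ⟨i, hi, rfl⟩
        exact ⟨i, Finset.mem_range.2 hi, rfl⟩
      · rintro ⟨i, hi, rfl⟩
        exact ⟨i, Finset.mem_range.1 hi, rfl⟩
    rw [this, Finset.card_image_of_injOn, Finset.card_range]
    intro i hi j hj hij
    simp only [Finset.coe_range, Set.mem_Iio] at hi hj
    have h5 : (i : ZMod M) = j := add_left_cancel hij
    rwa [ZMod.natCast_eq_natCast_iff', Nat.mod_eq_of_lt (by omega),
      Nat.mod_eq_of_lt (by omega)] at h5
  refine ⟨x0, fun y => ?_⟩
  rw [hcard]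
  exact hmem y

theorem mem_std_box {x y : Site K L} {r c : ℕ} : y ∈ (Chart.std x).box r c ↔
    (∃ i : ℕ, i < r ∧ y.1 = x.1 + i) ∧ ∃ j : ℕ, j < c ∧ y.2 = x.2 + j := by
  rw [Chart.mem_box]
  constructor
  · rintro ⟨i, j, h1, h2, h3, h4, rfl⟩
    lift i to ℕ using h1
    lift j to ℕ using h3
    exact ⟨⟨i, by omega, by simp [Chart.pt, Chart.std]⟩,
      ⟨j, by omega, by simp [Chart.pt, Chart.std]⟩⟩
  · rintro ⟨⟨i, hi, h1⟩, ⟨j, hj, h2⟩⟩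
    exact ⟨i, j, by omega, by omega, by omega, by omega, by
      ext
      · simp [Chart.pt, Chart.std, h1]
      · simp [Chart.pt, Chart.std, h2]⟩

/-- A set of half perimeter `2 * n` with one or no site less than an `n × n` square is such a
square without one or no site, or an `(n - 1) × (n + 1)` rectangle. -/
theorem box_of_hper_eq (D : Dims K L n) {A : Finset (Site K L)} (hp : hper A = 2 * n)
    (hA : A.card ≤ n ^ 2) (hA' : n ^ 2 ≤ A.card + 1) :
    ∃ φ : Chart K L, A ⊆ φ.box n n ∨ (A.card + 1 = n ^ 2 ∧ A = φ.box (n - 1) (n + 1)) := by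
  have hn := D.two_le
  have hK := D.lt_left
  have hL := D.lt_right
  have : NeZero K := ⟨by omega⟩
  have : NeZero L := ⟨by omega⟩
  obtain ⟨h1, h2⟩ := rows_cols_le D (by omega) hp.le
  have h3 := card_le_rows_mul_cols A
  set R := A.image Prod.snd with hR
  set C := A.image Prod.fst with hC
  have hp' : ((ends (1, 0) A).card : ℤ) + (ends (0, 1) A).card = 2 * n := hp
  have h5 : (A.card : ℤ) ≤ C.card * R.card := by exact_mod_cast h3
  have h6 : (n : ℤ) ^ 2 ≤ A.card + 1 := by exact_mod_cast hA'
  have hn' : (2 : ℤ) ≤ n := by exact_mod_cast hn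
  have h4 : C.card + R.card = 2 * n := by
    by_contra hne
    have h4 : (C.card : ℤ) + R.card ≤ 2 * n - 1 := by omega
    nlinarith [sq_nonneg ((C.card : ℤ) - R.card), sq_nonneg ((C.card : ℤ) - R.card + 1),
      sq_nonneg ((C.card : ℤ) + R.card)]
  have hsub : A ⊆ C ×ˢ R := fun x hx =>
    Finset.mem_product.2 ⟨Finset.mem_image_of_mem _ hx, Finset.mem_image_of_mem _ hx⟩
  -- the rows and columns have unique ends
  have hrow : ∀ x x' j, (x, j) ∈ A → (x', j) ∈ A → (x + 1, j) ∉ A → (x' + 1, j) ∉ A → x = x' := by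
    have hsurj : R ⊆ (ends (1, 0) A).image Prod.snd := by
      intro j hj
      by_contra hcon
      obtain ⟨⟨x, j'⟩, hx, rfl⟩ := Finset.mem_image.1 hj
      have hfull := zmod_univ_of_add_one_mem (S := {y | (y, j') ∈ A}) hx fun y hy => by
        by_contra hy'
        refine hcon (Finset.mem_image.2 ⟨(y, j'), mem_ends.2 ⟨hy, ?_⟩, rfl⟩)
        simpa using hy'
      have hCu : C = Finset.univ := by
        ext x
        simp only [Finset.mem_univ, iff_true]
        exact Finset.mem_image.2 ⟨(x, j'), hfull x, rfl⟩
      rw [hCu, Finset.card_univ, ZMod.card] at h4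
      omega
    have hcard : ((ends (1, 0) A).image Prod.snd).card = (ends (1, 0) A).card := by
      have g1 := Finset.card_le_card hsurj
      have g2 := Finset.card_image_le (s := ends (1, 0) A) (f := Prod.snd)
      omega
    intro x x' j g1 g2 g3 g4
    have := Finset.card_image_iff.1 hcard
      (mem_ends.2 ⟨g1, by simpa using g3⟩ : (x, j) ∈ ((ends (1, 0) A : Finset _) : Set (Site K L)))
      (mem_ends.2 ⟨g2, by simpa using g4⟩ : (x', j) ∈ ((ends (1, 0) A : Finset _) : Set (Site K L)))
      rfl
    exact (Prod.mk.inj this).1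
  have hcol : ∀ x j j', (x, j) ∈ A → (x, j') ∈ A → (x, j + 1) ∉ A → (x, j' + 1) ∉ A → j = j' := by
    have hsurj : C ⊆ (ends (0, 1) A).image Prod.fst := by
      intro j hj
      by_contra hcon
      obtain ⟨⟨x, j'⟩, hx, rfl⟩ := Finset.mem_image.1 hj
      have hfull := zmod_univ_of_add_one_mem (S := {y | (x, y) ∈ A}) hx fun y hy => by
        by_contra hy'
        refine hcon (Finset.mem_image.2 ⟨(x, y), mem_ends.2 ⟨hy, ?_⟩, rfl⟩)
        simpa using hy'
      have hRu : R = Finset.univ := by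
        ext y
        simp only [Finset.mem_univ, iff_true]
        exact Finset.mem_image.2 ⟨(x, y), hfull y, rfl⟩
      rw [hRu, Finset.card_univ, ZMod.card] at h4
      omega
    have hcard : ((ends (0, 1) A).image Prod.fst).card = (ends (0, 1) A).card := by
      have g1 := Finset.card_le_card hsurj
      have g2 := Finset.card_image_le (s := ends (0, 1) A) (f := Prod.fst)
      omega
    intro x j j' g1 g2 g3 g4
    have := Finset.card_image_iff.1 hcard
      (mem_ends.2 ⟨g1, by simpa using g3⟩ : (x, j) ∈ ((ends (0, 1) A : Finset _) : Set (Site K L)))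
      (mem_ends.2 ⟨g2, by simpa using g4⟩ : (x, j') ∈ ((ends (0, 1) A : Finset _) : Set (Site K L)))
      rfl
    exact (Prod.mk.inj this).2
  have hmiss : (C ×ˢ R \ A).card + A.card = C.card * R.card := by
    rw [Finset.card_sdiff_add_card_eq_card hsub, Finset.card_product]
  -- at most one site of the product of the columns and the rows is missing in `A`
  have hshape : (C.card = n ∧ R.card = n) ∨ (C.card * R.card + 1 = n ^ 2 ∧
      ((C.card = n - 1 ∧ R.card = n + 1) ∨ (C.card = n + 1 ∧ R.card = n - 1))) := by
    obtain ⟨d, hd⟩ : ∃ d : ℤ, (C.card : ℤ) = n + d := ⟨C.card - n, by ring⟩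
    have hd' : (R.card : ℤ) = n - d := by omega
    have hdd : d * d ≤ 1 := by
      rw [hd, hd'] at h5
      nlinarith
    have hd1 : d ≤ 1 := by nlinarith
    have hd2 : -1 ≤ d := by nlinarith
    have hd3 : d = 0 ∨ d = 1 ∨ d = -1 := by omega
    rcases hd3 with rfl | rfl | rfl
    · left; omega
    · right
      refine ⟨?_, .inr (by omega)⟩
      have : ((C.card * R.card + 1 : ℕ) : ℤ) = ((n ^ 2 : ℕ) : ℤ) := by
        push_cast
        rw [hd, hd']
        ring
      exact_mod_cast this
    · right
      refine ⟨?_, .inl (by omega)⟩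
      have : ((C.card * R.card + 1 : ℕ) : ℤ) = ((n ^ 2 : ℕ) : ℤ) := by
        push_cast
        rw [hd, hd']
        ring
      exact_mod_cast this
  have hmiss1 : (C ×ˢ R \ A).card ≤ 1 := by
    rcases hshape with ⟨g1, g2⟩ | ⟨g1, -⟩
    · rw [g1, g2, ← sq] at hmiss
      omega
    · omega
  have huniq : ∀ s t, s ∈ C ×ˢ R → s ∉ A → t ∈ C ×ˢ R → t ∉ A → s = t := fun s t g1 g2 g3 g4 =>
    Finset.card_le_one.1 hmiss1 s (Finset.mem_sdiff.2 ⟨g1, g2⟩) t (Finset.mem_sdiff.2 ⟨g3, g4⟩)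
  -- one row and one column of the product are full
  have hfull : ∃ j ∈ R, ∀ x ∈ C, (x, j) ∈ A := by
    by_contra hcon
    push Not at hcon
    have hRne : R.Nonempty := by
      rw [← Finset.card_pos]
      omega
    obtain ⟨j, hj⟩ := hRne
    obtain ⟨x, hx, hxj⟩ := hcon j hj
    have hone : R.card ≤ 1 := Finset.card_le_one.2 fun a ha b hb => by
      obtain ⟨x1, hx1, g1⟩ := hcon a ha
      obtain ⟨x2, hx2, g2⟩ := hcon b hb
      exact (Prod.mk.inj (huniq _ _ (Finset.mk_mem_product hx1 ha) g1
        (Finset.mk_mem_product hx2 hb) g2)).2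
    rcases hshape with ⟨g1, g2⟩ | ⟨g1, -⟩
    · omega
    · have g2 : (C ×ˢ R \ A).card = 0 := by omega
      rw [Finset.card_eq_zero] at g2
      exact Finset.notMem_empty _ (g2 ▸ Finset.mem_sdiff.2 ⟨Finset.mk_mem_product hx hj, hxj⟩)
  have hfull' : ∃ x ∈ C, ∀ j ∈ R, (x, j) ∈ A := by
    by_contra hcon
    push Not at hcon
    have hCne : C.Nonempty := by
      rw [← Finset.card_pos]
      omega
    obtain ⟨x, hx⟩ := hCne
    obtain ⟨j, hj, hxj⟩ := hcon x hx
    have hone : C.card ≤ 1 := Finset.card_le_one.2 fun a ha b hb => by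
      obtain ⟨x1, hx1, g1⟩ := hcon a ha
      obtain ⟨x2, hx2, g2⟩ := hcon b hb
      exact (Prod.mk.inj (huniq _ _ (Finset.mk_mem_product ha hx1) g1
        (Finset.mk_mem_product hb hx2) g2)).1
    rcases hshape with ⟨g1, g2⟩ | ⟨g1, -⟩
    · omega
    · have g2 : (C ×ˢ R \ A).card = 0 := by omega
      rw [Finset.card_eq_zero] at g2
      exact Finset.notMem_empty _ (g2 ▸ Finset.mem_sdiff.2 ⟨Finset.mk_mem_product hx hj, hxj⟩)
  have notUniv : ∀ {M : ℕ} [NeZero M] (S : Finset (ZMod M)), S.card < M → ∃ y, y ∉ S := by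
    intro M _ S hS
    by_contra hcon
    push Not at hcon
    rw [← Finset.eq_univ_iff_forall] at hcon
    rw [hcon, Finset.card_univ, ZMod.card] at hS
    exact lt_irrefl _ hS
  obtain ⟨x0, hx0⟩ : ∃ x0, ∀ y, y ∈ C ↔ ∃ i : ℕ, i < C.card ∧ y = x0 + i := by
    obtain ⟨j, hj, hall⟩ := hfull
    have hmem : ∀ x, x ∈ C ↔ (x, j) ∈ A := fun x =>
      ⟨hall x, fun h => Finset.mem_image.2 ⟨_, h, rfl⟩⟩
    refine zmod_interval (Finset.card_pos.1 (by omega)) (notUniv C (by omega)) ?_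
    intro x hx y hy g1 g2
    rw [hmem] at hx hy g1 g2
    exact hrow x y j hx hy g1 g2
  obtain ⟨y0, hy0⟩ : ∃ y0, ∀ y, y ∈ R ↔ ∃ i : ℕ, i < R.card ∧ y = y0 + i := by
    obtain ⟨x, hx, hall⟩ := hfull'
    have hmem : ∀ j, j ∈ R ↔ (x, j) ∈ A := fun j =>
      ⟨hall j, fun h => Finset.mem_image.2 ⟨_, h, rfl⟩⟩
    refine zmod_interval (Finset.card_pos.1 (by omega)) (notUniv R (by omega)) ?_
    intro a ha b hb g1 g2
    rw [hmem] at ha hb g1 g2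
    exact hcol x a b ha hb g1 g2
  have hbox : C ×ˢ R = (Chart.std (x0, y0)).box C.card R.card := by
    ext y
    rw [Finset.mem_product, mem_std_box, hx0, hy0]
  rcases hshape with ⟨g1, g2⟩ | ⟨g1, g2⟩
  · exact ⟨_, .inl (by rw [hbox, g1, g2] at hsub; exact hsub)⟩
  · have hAe : A = C ×ˢ R := Finset.eq_of_subset_of_card_le hsub (by
      rw [Finset.card_product]
      omega)
    rw [hbox] at hAe
    rcases g2 with ⟨g2, g3⟩ | ⟨g2, g3⟩
    · refine ⟨Chart.std (x0, y0), .inr ⟨by omega, ?_⟩⟩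
      rw [g2, g3] at hAe
      rw [hAe]
      congr 1 <;> omega
    · refine ⟨(Chart.std (x0, y0)).swap, .inr ⟨by omega, ?_⟩⟩
      rw [g2, g3] at hAe
      rw [hAe, Chart.swap_box]
      congr 1 <;> omega

/-- The sets of `n ^ 2` sites with minimal half perimeter are the squares. -/
theorem square_of_hper_eq (D : Dims K L n) {A : Finset (Site K L)} (hp : hper A = 2 * n)
    (hA : A.card = n ^ 2) : ∃ φ : Chart K L, A = φ.box n n := by
  obtain ⟨φ, h | h⟩ := box_of_hper_eq D hp hA.le (by omega)
  · refine ⟨φ, Finset.eq_of_subset_of_card_le h ?_⟩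
    have h1 := Chart.card_box (φ := φ) D (a := n) (b := n) (by omega) (by omega) (by omega)
      (by omega)
    have h2 : ((φ.box n n).card : ℤ) = ((n ^ 2 : ℕ) : ℤ) := by
      rw [h1]
      push_cast
      ring
    have h3 : (φ.box n n).card = n ^ 2 := by exact_mod_cast h2
    omega
  · omega

/-- A set of half perimeter `2 * n` that has one site less than a square around it is the square
without a corner. -/
theorem erase_corner_of_subset (D : Dims K L n) {W : Finset (Site K L)} (hp : hper W = 2 * n)
    (hW : W.card + 1 = n ^ 2) {φ : Chart K L} (h : W ⊆ φ.box n n) :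
    ∃ ψ : Chart K L, W = (ψ.box n n).erase (ψ.pt 0 0) := by
  have hn := D.two_le
  have h1 := Chart.card_box (φ := φ) D (a := n) (b := n) (by omega) (by omega) (by omega)
    (by omega)
  have h2 : ((φ.box n n).card : ℤ) = ((n ^ 2 : ℕ) : ℤ) := by
    rw [h1]
    push_cast
    ring
  have h3 : (φ.box n n).card = n ^ 2 := by exact_mod_cast h2
  obtain ⟨c, hc⟩ : ∃ c, φ.box n n \ W = {c} := by
    rw [← Finset.card_eq_one]
    have := Finset.card_sdiff_add_card_eq_card h
    omega
  have hcm : c ∈ φ.box n n ∧ c ∉ W := by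
    rw [← Finset.mem_sdiff, hc]
    exact Finset.mem_singleton_self c
  have hWe : W = (φ.box n n).erase c := by
    refine Finset.eq_of_subset_of_card_le ?_ ?_
    · intro x hx
      exact Finset.mem_erase.2 ⟨fun he => hcm.2 (he ▸ hx), h hx⟩
    · rw [Finset.card_erase_of_mem hcm.1]
      omega
  have hdeg : deg (φ.box n n) c = 2 := by
    have g1 := hper_erase D hcm.1
    rw [← hWe, hp, Chart.hper_box D (by omega) (by omega) (by omega) (by omega)] at g1
    omega
  obtain ⟨i, j, i1, i2, j1, j2, rfl⟩ := Chart.mem_box.1 hcm.1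
  have hcorner : (i = 0 ∨ i = n - 1) ∧ (j = 0 ∨ j = n - 1) := by
    rw [φ.deg_pt] at hdeg
    have key : ∀ k l : ℤ, 0 ≤ k → k < n → 0 ≤ l → l < n → ind (φ.box n n) (φ.pt k l) = 1 :=
      fun k l k1 k2 l1 l2 => ind_of_mem (Chart.pt_mem_box k1 k2 l1 l2)
    have b1 := ind_nonneg (φ.box n n) (φ.pt (i + 1) j)
    have b2 := ind_nonneg (φ.box n n) (φ.pt (i - 1) j)
    have b3 := ind_nonneg (φ.box n n) (φ.pt i (j + 1))
    have b4 := ind_nonneg (φ.box n n) (φ.pt i (j - 1))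
    constructor
    · by_contra hcon
      have c1 := key (i + 1) j (by omega) (by omega) j1 j2
      have c2 := key (i - 1) j (by omega) (by omega) j1 j2
      by_cases hj : j = 0
      · have c3 := key i (j + 1) i1 i2 (by omega) (by omega)
        omega
      · have c3 := key i (j - 1) i1 i2 (by omega) (by omega)
        omega
    · by_contra hcon
      have c1 := key i (j + 1) i1 i2 (by omega) (by omega)
      have c2 := key i (j - 1) i1 i2 (by omega) (by omega)
      by_cases hi : i = 0
      · have c3 := key (i + 1) j (by omega) (by omega) j1 j2
        omega
      · have c3 := key (i - 1) j (by omega) (by omega) j1 j2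
        omega
  -- a reflection moves the corner to the origin
  obtain ⟨ψ, hψ, hψ'⟩ : ∃ ψ : Chart K L, ψ.box n n = φ.box n n ∧ ψ.pt 0 j = φ.pt i j := by
    rcases hcorner.1 with rfl | rfl
    · exact ⟨φ, rfl, rfl⟩
    · exact ⟨φ.flip n, by simp, by simp⟩
  obtain ⟨χ, hχ, hχ'⟩ : ∃ χ : Chart K L, χ.box n n = ψ.box n n ∧ χ.pt 0 0 = ψ.pt 0 j := by
    rcases hcorner.2 with rfl | rfl
    · exact ⟨ψ, rfl, rfl⟩
    · exact ⟨(ψ.swap.flip n).swap, by simp, by simp⟩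
  exact ⟨χ, by rw [hWe, hχ', hψ', hχ, hψ]⟩

/-- With one site less, one gets the squares without a corner and the `(n - 1) × (n + 1)`
rectangles. -/
theorem core_of_hper_eq (D : Dims K L n) {W : Finset (Site K L)} (hp : hper W = 2 * n)
    (hW : W.card + 1 = n ^ 2) : ∃ φ : Chart K L,
      W = (φ.box n n).erase (φ.pt 0 0) ∨ W = φ.box (n - 1) (n + 1) := by
  have hn := D.two_le
  obtain ⟨φ, h | h⟩ := box_of_hper_eq D hp (by omega) (by omega)
  · obtain ⟨ψ, hψ⟩ := erase_corner_of_subset D hp hW h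
    exact ⟨ψ, .inl hψ⟩
  · exact ⟨φ, .inr h.2⟩

end MetaHierarchy

/-! ### Droplets inside a rectangle -/

namespace MetaHierarchy

variable {K L n : ℕ}

/-- The side lengths of the rectangles around the droplets. -/
def Shape (n : ℕ) (a b : ℤ) : Prop :=
  (a = n ∧ b = n + 1) ∨ (a = n + 1 ∧ b = n) ∨ (a = n - 1 ∧ b = n + 2) ∨ (a = n + 2 ∧ b = n - 1)

theorem Shape.swap {a b : ℤ} (h : Shape n a b) : Shape n b a := by
  unfold Shape at *
  omega

theorem Shape.vacancies_le {a b : ℤ} (h : Shape n a b) : a * b - n ^ 2 ≤ a ∧ a * b - n ^ 2 ≤ b := by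
  rcases h with ⟨rfl, rfl⟩ | ⟨rfl, rfl⟩ | ⟨rfl, rfl⟩ | ⟨rfl, rfl⟩ <;> constructor <;> ring_nf <;>
    omega

theorem Shape.add_eq {a b : ℤ} (h : Shape n a b) : a + b = 2 * n + 1 := by
  unfold Shape at h
  omega

/-- `A` lies in the `a × b` box and fills its interior. -/
def Inside (φ : Chart K L) (a b : ℤ) (A : Finset (Site K L)) : Prop :=
  A ⊆ φ.box a b ∧ ∀ i j, 1 ≤ i → i ≤ a - 2 → 1 ≤ j → j ≤ b - 2 → φ.pt i j ∈ A

theorem Inside.swap {φ : Chart K L} {a b : ℤ} {A : Finset (Site K L)} (h : Inside φ a b A) :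
    Inside φ.swap b a A := by
  refine ⟨by rw [Chart.swap_box]; exact h.1, fun i j h1 h2 h3 h4 => ?_⟩
  rw [Chart.swap_pt]
  exact h.2 j i h3 h4 h1 h2

theorem Inside.flip {φ : Chart K L} {a b : ℤ} {A : Finset (Site K L)} (h : Inside φ a b A) :
    Inside (φ.flip a) a b A := by
  refine ⟨by rw [Chart.flip_box]; exact h.1, fun i j h1 h2 h3 h4 => ?_⟩
  rw [Chart.flip_pt]
  exact h.2 _ j (by omega) (by omega) h3 h4

/-- Moving a site of the frame to a vacant site of the box. -/
theorem Inside.move {φ : Chart K L} {a b : ℤ} {A : Finset (Site K L)} (h : Inside φ a b A)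
    {x y : Site K L} (hy : y ∈ φ.box a b)
    (hx : ∀ i j, 1 ≤ i → i ≤ a - 2 → 1 ≤ j → j ≤ b - 2 → φ.pt i j ≠ x) :
    Inside φ a b (insert y (A.erase x)) := by
  constructor
  · intro s hs
    rcases Finset.mem_insert.1 hs with rfl | hs
    · exact hy
    · exact h.1 (Finset.mem_of_mem_erase hs)
  · intro i j h1 h2 h3 h4
    exact Finset.mem_insert_of_mem (Finset.mem_erase.2 ⟨hx i j h1 h2 h3 h4, h.2 i j h1 h2 h3 h4⟩)

namespace Chart

variable {φ : Chart K L}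

/-- A vacant segment of a column and further vacant sites are counted together. -/
theorem vacant_col_add (D : Dims K L n) {a b : ℤ} (ha : a ≤ 2 * n + 1)
    (hb : b ≤ 2 * n + 1) {A : Finset (Site K L)} (hA : A ⊆ φ.box a b) {k l r : ℤ} (hk : 0 ≤ k)
    (hka : k < a) (hl : 0 ≤ l) (hlr : l ≤ r) (hr : r ≤ b)
    (hseg : ∀ j, l ≤ j → j < r → φ.pt k j ∉ A) (T : Finset (ℤ × ℤ))
    (hT : ∀ s ∈ T, 0 ≤ s.1 ∧ s.1 < a ∧ 0 ≤ s.2 ∧ s.2 < b ∧ φ.pt s.1 s.2 ∉ A ∧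
      ¬(s.1 = k ∧ l ≤ s.2 ∧ s.2 < r)) : r - l + T.card ≤ a * b - A.card := by
  have h0 : ((Finset.Ico l r).image fun j => (k, j)).card = (r - l).toNat := by
    rw [Finset.card_image_of_injective _ (fun x y h => (Prod.mk.inj h).2), Int.card_Ico]
  have hd : Disjoint ((Finset.Ico l r).image fun j => (k, j)) T := by
    rw [Finset.disjoint_left]
    rintro s hs hs'
    obtain ⟨j, hj, rfl⟩ := Finset.mem_image.1 hs
    rw [Finset.mem_Ico] at hj
    exact (hT _ hs').2.2.2.2.2 ⟨rfl, hj.1, hj.2⟩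
  have h1 := card_vacant_le D (by omega) (by omega) ha hb hA
    (S := ((Finset.Ico l r).image fun j => (k, j)) ∪ T) (by
      intro s hs
      rcases Finset.mem_union.1 hs with hs | hs
      · obtain ⟨j, hj, rfl⟩ := Finset.mem_image.1 hs
        rw [Finset.mem_Ico] at hj
        exact ⟨hk, hka, by simp only; omega, by simp only; omega, hseg j hj.1 hj.2⟩
      · have := hT s hs
        tauto)
  rw [Finset.card_union_of_disjoint hd, h0] at h1
  push_cast at h1
  omega

theorem vacant_col (D : Dims K L n) {a b : ℤ} (ha : a ≤ 2 * n + 1)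
    (hb : b ≤ 2 * n + 1) {A : Finset (Site K L)} (hA : A ⊆ φ.box a b) {k l r : ℤ} (hk : 0 ≤ k)
    (hka : k < a) (hl : 0 ≤ l) (hlr : l ≤ r) (hr : r ≤ b)
    (hseg : ∀ j, l ≤ j → j < r → φ.pt k j ∉ A) : r - l ≤ a * b - A.card := by
  have := vacant_col_add D ha hb hA hk hka hl hlr hr hseg ∅ (by simp)
  simpa using this

theorem vacant_col_one (D : Dims K L n) {a b : ℤ} (ha : a ≤ 2 * n + 1)
    (hb : b ≤ 2 * n + 1) {A : Finset (Site K L)} (hA : A ⊆ φ.box a b) {k l r : ℤ} (hk : 0 ≤ k)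
    (hka : k < a) (hl : 0 ≤ l) (hlr : l ≤ r) (hr : r ≤ b)
    (hseg : ∀ j, l ≤ j → j < r → φ.pt k j ∉ A) {i j : ℤ}
    (hs : (0 ≤ i ∧ i < a ∧ 0 ≤ j ∧ j < b) ∧ ¬(i = k ∧ l ≤ j ∧ j < r)) (hs' : φ.pt i j ∉ A) :
    r - l + 1 ≤ a * b - A.card := by
  have := vacant_col_add D ha hb hA hk hka hl hlr hr hseg {(i, j)} (by
    intro s h
    rw [Finset.mem_singleton] at h
    subst h
    simp only
    tauto)
  simpa using this

theorem vacant_col_two (D : Dims K L n) {a b : ℤ} (ha : a ≤ 2 * n + 1)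
    (hb : b ≤ 2 * n + 1) {A : Finset (Site K L)} (hA : A ⊆ φ.box a b) {k l r : ℤ} (hk : 0 ≤ k)
    (hka : k < a) (hl : 0 ≤ l) (hlr : l ≤ r) (hr : r ≤ b)
    (hseg : ∀ j, l ≤ j → j < r → φ.pt k j ∉ A) {i j i' j' : ℤ}
    (hs : (0 ≤ i ∧ i < a ∧ 0 ≤ j ∧ j < b) ∧ ¬(i = k ∧ l ≤ j ∧ j < r)) (hs' : φ.pt i j ∉ A)
    (ht : (0 ≤ i' ∧ i' < a ∧ 0 ≤ j' ∧ j' < b) ∧ ¬(i' = k ∧ l ≤ j' ∧ j' < r))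
    (ht' : φ.pt i' j' ∉ A) (hne : ¬(i = i' ∧ j = j')) :
    r - l + 2 ≤ a * b - A.card := by
  have := vacant_col_add D ha hb hA hk hka hl hlr hr hseg {(i, j), (i', j')} (by
    intro s h
    rw [Finset.mem_insert, Finset.mem_singleton] at h
    rcases h with rfl | rfl <;> simp only <;> tauto)
  rwa [Finset.card_pair (by rw [Ne, Prod.mk.injEq]; exact hne)] at this

/-- A neighbour of a box lies next to one of its sides; a symmetry of the box brings it to the far
end of the first axis. -/
theorem exists_outer {a b : ℤ} {x y : Site K L} (hx : x ∈ φ.box a b) (hy : y ∉ φ.box a b)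
    (h : Nbr x y) : ∃ (ψ : Chart K L) (a' b' : ℤ), ((a' = a ∧ b' = b) ∨ (a' = b ∧ b' = a)) ∧
      ψ.box a' b' = φ.box a b ∧ ∃ j, 0 ≤ j ∧ j < b' ∧ x = ψ.pt (a' - 1) j ∧ y = ψ.pt a' j := by
  obtain ⟨i, j, h1, h2, h3, h4, rfl⟩ := mem_box.1 hx
  rcases φ.nbr_pt.1 h with rfl | rfl | rfl | rfl
  · have : i = a - 1 := by
      by_contra hne
      exact hy (pt_mem_box (by omega) (by omega) h3 h4)
    subst this
    exact ⟨φ, a, b, .inl ⟨rfl, rfl⟩, rfl, j, h3, h4, rfl, by congr 1; omega⟩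
  · have : i = 0 := by
      by_contra hne
      exact hy (pt_mem_box (by omega) (by omega) h3 h4)
    subst this
    refine ⟨φ.flip a, a, b, .inl ⟨rfl, rfl⟩, by simp, j, h3, h4, ?_, ?_⟩ <;> rw [flip_pt] <;>
      congr 1 <;> omega
  · have : j = b - 1 := by
      by_contra hne
      exact hy (pt_mem_box h1 h2 (by omega) (by omega))
    subst this
    refine ⟨φ.swap, b, a, .inr ⟨rfl, rfl⟩, by simp, i, h1, h2, by simp, ?_⟩
    rw [swap_pt]
    congr 1
    omega
  · have : j = 0 := by
      by_contra hne
      exact hy (pt_mem_box h1 h2 (by omega) (by omega))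
    subst this
    refine ⟨φ.swap.flip b, b, a, .inr ⟨rfl, rfl⟩, by simp, i, h1, h2, ?_, ?_⟩ <;>
      rw [flip_pt, swap_pt] <;> congr 1 <;> omega

theorem exists_nbr_of_deg_pos {A : Finset (Site K L)} {y : Site K L} (h : 0 < deg A y) :
    ∃ x ∈ A, Nbr x y := by
  by_contra hcon
  push Not at hcon
  have key : ∀ x, Nbr y x → ind A x = 0 := fun x hx => ind_of_notMem fun hm => hcon x hm hx.symm
  unfold deg at h
  rw [key _ (.inl rfl), key _ (.inr (.inl rfl)), key _ (.inr (.inr (.inl rfl))),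
    key _ (.inr (.inr (.inr rfl)))] at h
  simp at h

/-- A site outside a box has at most one neighbour in it. -/
theorem deg_box_le_one (D : Dims K L n) {a b : ℤ} (ha : a ≤ 2 * n - 1) (hb : b ≤ 2 * n - 1)
    {y : Site K L} (hy : y ∉ φ.box a b) : deg (φ.box a b) y ≤ 1 := by
  by_contra hcon
  obtain ⟨x, hx, hxy⟩ := exists_nbr_of_deg_pos (by omega : 0 < deg (φ.box a b) y)
  obtain ⟨ψ, a', b', hab, hbox, j, h1, h2, rfl, rfl⟩ := exists_outer hx hy hxy
  rw [← hbox] at hcon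
  rw [ψ.deg_pt] at hcon
  have key : ∀ k l : ℤ, k = a' ∨ k = a' + 1 → -1 ≤ l → l ≤ b' →
      ind (ψ.box a' b') (ψ.pt k l) = 0 := by
    intro k l hk h3 h4
    refine ind_of_notMem fun hm => ?_
    rw [pt_mem_box_iff D (by omega) (by omega) (by omega) (by omega)] at hm
    omega
  rw [key (a' + 1) j (by omega) (by omega) (by omega), key a' (j + 1) (by omega) (by omega)
    (by omega), key a' (j - 1) (by omega) (by omega) (by omega)] at hcon
  have := ind_le_one (ψ.box a' b') (ψ.pt (a' - 1) j)
  omega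

end Chart

/-- Adding a site cannot close a hole: a set of `n ^ 2 + 1` sites with half perimeter `2 * n + 1`
has no vacant site with three occupied neighbours. -/
theorem deg_le_two_of_notMem (D : Dims K L n) {U : Finset (Site K L)} (hU : U.card = n ^ 2 + 1)
    (hp : hper U ≤ 2 * n + 1) {y : Site K L} (hy : y ∉ U) : deg U y ≤ 2 := by
  have h1 := hper_insert D hy
  have h2 := two_mul_add_one_le_hper D (A := insert y U)
    (by rw [Finset.card_insert_of_notMem hy]; omega) (by
      rw [Finset.card_insert_of_notMem hy]; omega)
  omega

/-- In a droplet inside a rectangle that is not a square, no row of the rectangle is empty. -/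
theorem Inside.row_nonempty (D : Dims K L n) (hn : 3 ≤ n) {φ : Chart K L} {a b : ℤ}
    (hs : Shape n a b) {A : Finset (Site K L)} (h : Inside φ a b A) (hA : n ^ 2 ≤ A.card)
    (hp : 2 * n + 1 ≤ hper A) {j : ℤ} (h1 : 0 ≤ j) (h2 : j < b) :
    ∃ i, 0 ≤ i ∧ i < a ∧ φ.pt i j ∈ A := by
  by_contra hcon
  push Not at hcon
  have hv := hs.vacancies_le
  have hA' : (n : ℤ) ^ 2 ≤ A.card := by exact_mod_cast hA
  have hle : a ≤ a * b - A.card := by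
    have := Chart.vacant_col (φ := φ.swap) D (a := b) (b := a) (A := A) (k := j) (l := 0) (r := a)
      (by unfold Shape at hs; omega) (by unfold Shape at hs; omega)
      (by rw [Chart.swap_box]; exact h.1) h1 h2 le_rfl (by unfold Shape at hs; omega) le_rfl
      (by intro i h3 h4; rw [Chart.swap_pt]; exact hcon i h3 h4)
    rw [mul_comm b a] at this
    omega
  have hab : a = n ∧ b = n + 1 := by
    rcases hs with ⟨rfl, rfl⟩ | ⟨rfl, rfl⟩ | ⟨rfl, rfl⟩ | ⟨rfl, rfl⟩
    · exact ⟨rfl, rfl⟩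
    · exfalso
      ring_nf at hle hA'
      omega
    · exfalso
      ring_nf at hle hA'
      omega
    · exfalso
      ring_nf at hle hA'
      omega
  obtain ⟨rfl, rfl⟩ := hab
  have hj : j = 0 ∨ j = n := by
    by_contra hne
    exact hcon 1 (by omega) (by omega) (h.2 1 j (by omega) (by omega) (by omega) (by omega))
  -- then `A` is contained in a square, and hence equal to it
  obtain ⟨ψ, hψ⟩ : ∃ ψ : Chart K L, A ⊆ ψ.box n n := by
    rcases hj with rfl | rfl
    · refine ⟨φ.trans 0 1, fun x hx => ?_⟩
      obtain ⟨i, l, g1, g2, g3, g4, rfl⟩ := Chart.mem_box.1 (h.1 hx)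
      have : l ≠ 0 := fun h0 => hcon i g1 g2 (h0 ▸ hx)
      refine Chart.mem_box.2 ⟨i, l - 1, g1, g2, by omega, by omega, ?_⟩
      rw [Chart.trans_pt]
      congr 1 <;> omega
    · refine ⟨φ, fun x hx => ?_⟩
      obtain ⟨i, l, g1, g2, g3, g4, rfl⟩ := Chart.mem_box.1 (h.1 hx)
      have : l ≠ n := fun h0 => hcon i g1 g2 (h0 ▸ hx)
      exact Chart.pt_mem_box g1 g2 g3 (by omega)
  have hc := Chart.card_box (φ := ψ) D (a := n) (b := n) (by omega) (by omega) (by omega) (by omega)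
  have hAe : A = ψ.box n n := Finset.eq_of_subset_of_card_le hψ (by
    have : ((ψ.box n n).card : ℤ) ≤ A.card := by
      rw [hc]
      linarith
    exact_mod_cast this)
  rw [hAe, Chart.hper_box D (by omega) (by omega) (by omega) (by omega)] at hp
  omega

theorem Inside.col_nonempty (D : Dims K L n) (hn : 3 ≤ n) {φ : Chart K L} {a b : ℤ}
    (hs : Shape n a b) {A : Finset (Site K L)} (h : Inside φ a b A) (hA : n ^ 2 ≤ A.card)
    (hp : 2 * n + 1 ≤ hper A) {i : ℤ} (h1 : 0 ≤ i) (h2 : i < a) :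
    ∃ j, 0 ≤ j ∧ j < b ∧ φ.pt i j ∈ A := by
  simpa only [Chart.swap_pt] using h.swap.row_nonempty D hn hs.swap hA hp h1 h2

/-- Rows and columns with several ends increase the half perimeter. -/
theorem Inside.le_hper (D : Dims K L n) (hn : 3 ≤ n) {φ : Chart K L} {a b : ℤ}
    (hs : Shape n a b) {A : Finset (Site K L)} (h : Inside φ a b A) (hA : n ^ 2 ≤ A.card)
    (hp : 2 * n + 1 ≤ hper A) {i i' j : ℤ} (hi : 0 ≤ i ∧ i + 1 < i' ∧ i' < a ∧ 0 ≤ j ∧ j < b)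
    (h1 : φ.pt i j ∈ A) (h2 : φ.pt (i + 1) j ∉ A) (h3 : φ.pt i' j ∈ A) :
    2 * n + 2 ≤ hper A ∧ ∀ k l l', (0 ≤ l ∧ l + 1 < l' ∧ l' < b ∧ 0 ≤ k ∧ k < a) →
      φ.pt k l ∈ A → φ.pt k (l + 1) ∉ A → φ.pt k l' ∈ A → 2 * n + 3 ≤ hper A := by
  have h4 := (Chart.le_hper D (a := a) (b := b) (by unfold Shape at hs; omega)
    (by unfold Shape at hs; omega) h.1 (fun j g1 g2 => h.row_nonempty D hn hs hA hp g1 g2)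
    (fun j g1 g2 => h.col_nonempty D hn hs hA hp g1 g2)).2
    ⟨i, i', j, by omega, by omega, by omega, by omega, by omega, h1, h2, h3⟩
  have h5 := hs.add_eq
  refine ⟨by omega, fun k l l' g1 g2 g3 g4 => ?_⟩
  have := h4.2 ⟨k, l, l', by omega, by omega, by omega, by omega, by omega, g2, g3, g4⟩
  omega

end MetaHierarchy

/-! ### The basin of the squares -/

namespace MetaHierarchy

variable {K L n : ℕ}

/-- A set of half perimeter `2 * n` with one site less than the square: to it a further particle
can be added anywhere. -/
def IsCore (n : ℕ) (W : Finset (Site K L)) : Prop := hper W = 2 * n ∧ W.card + 1 = n ^ 2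

/-- A core with a free particle that is not even adjacent to a missing corner of the core. -/
def IsFree (n : ℕ) (A : Finset (Site K L)) : Prop :=
  ∃ W z, IsCore n W ∧ z ∉ W ∧ A = insert z W ∧ deg W z = 0 ∧
    ∀ y, y ∉ W → deg W y = 2 → ¬Nbr z y

/-- A droplet, other than a square, that fills the interior of its rectangle. -/
def IsDent (n : ℕ) (A : Finset (Site K L)) : Prop :=
  2 * n + 1 ≤ hper A ∧ ∃ φ a b, Shape n a b ∧ Inside φ a b A

/-- A droplet with a hole at the site `(1, i)` of the interior: behind the hole the side of the
rectangle is vacant from the corner on, but the neighbour `(1, 0)` of the corner is occupied.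
Filling the hole gives `U`. -/
def IsPit (n : ℕ) (A : Finset (Site K L)) : Prop :=
  ∃ (φ : Chart K L) (a b : ℤ) (U : Finset (Site K L)) (i : ℤ), Shape n a b ∧ Inside φ a b U ∧
    U.card = n ^ 2 + 1 ∧ hper U = 2 * n + 1 ∧ 1 ≤ i ∧ i ≤ b - 2 ∧ 3 ≤ a ∧
    (∀ j, 0 ≤ j → j ≤ i → φ.pt 0 j ∉ U) ∧ φ.pt 1 0 ∈ U ∧ A = U.erase (φ.pt 1 i)

/-- A set of configurations that contains the squares and that no move of height at most
`2 * n + 2` leaves, if `3 ≤ n`. -/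
def InBasin (n : ℕ) (A : Finset (Site K L)) : Prop :=
  hper A = 2 * n ∨ IsFree n A ∨ IsDent n A ∨ IsPit n A

theorem Inside.inBasin (D : Dims K L n) {A : Finset (Site K L)} (hA : A.card = n ^ 2)
    {φ : Chart K L} {a b : ℤ} (hs : Shape n a b) (h : Inside φ a b A) : InBasin n A := by
  have hn := D.two_le
  have hp := two_mul_le_hper D (A := A) (by omega) (by rw [hA]; push_cast; nlinarith)
  rcases eq_or_lt_of_le hp with h1 | h1
  · exact .inl h1.symm
  · exact .inr (.inr (.inl ⟨by omega, φ, a, b, hs, h⟩))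

theorem IsCore.deg_le_two (D : Dims K L n) {W : Finset (Site K L)} (hW : IsCore n W)
    {z : Site K L} (hz : z ∉ W) : deg W z ≤ 2 := by
  have hn := D.two_le
  have h1 := hper_insert D hz
  have hc : (insert z W).card = n ^ 2 := by
    rw [Finset.card_insert_of_notMem hz]
    exact hW.2
  have h2 := two_mul_le_hper D (A := insert z W) (by omega) (by rw [hc]; push_cast; nlinarith)
  rw [hW.1] at h1
  omega

theorem Shape.grow {a b : ℤ} (h : (a = n ∧ b = n) ∨ (a = n - 1 ∧ b = n + 1) ∨
    (a = n + 1 ∧ b = n - 1)) : Shape n (a + 1) b := by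
  unfold Shape
  omega

/-- A core and a further particle form a configuration of the basin. -/
theorem IsCore.insert_inBasin (D : Dims K L n) (hn : 3 ≤ n) {W : Finset (Site K L)}
    (hW : IsCore n W) {z : Site K L} (hz : z ∉ W) : InBasin n (insert z W) := by
  have hcard : (insert z W).card = n ^ 2 := by
    rw [Finset.card_insert_of_notMem hz]
    exact hW.2
  have hdeg := hW.deg_le_two D hz
  have hins := hper_insert D hz
  rw [hW.1] at hins
  by_cases h2 : deg W z = 2
  · exact .inl (by omega)
  by_cases hfree : deg W z = 0 ∧ ∀ y, y ∉ W → deg W y = 2 → ¬Nbr z y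
  · exact .inr (.inl ⟨W, z, hW, hz, rfl, hfree.1, hfree.2⟩)
  obtain ⟨φ, hφ⟩ := core_of_hper_eq D hW.1 hW.2
  -- the particle is a neighbour of the box around the core
  obtain ⟨a, b, hab, hsub, hcorner, hzB, x, hx, hxz⟩ : ∃ a b : ℤ,
      ((a = n ∧ b = n) ∨ (a = n - 1 ∧ b = n + 1)) ∧ W ⊆ φ.box a b ∧
      (∀ y ∈ φ.box a b, y ∉ W → deg (φ.box a b) y ≤ 2) ∧ z ∉ φ.box a b ∧
      ∃ x ∈ φ.box a b, Nbr x z := by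
    have hnbr : ∀ B, W ⊆ B → (∀ y, y ∉ B → deg B y ≤ 1) → ∃ x ∈ B, Nbr x z := by
      intro B hB hout
      by_cases h0 : deg W z = 0
      · have : ∃ y, y ∉ W ∧ deg W y = 2 ∧ Nbr z y := by
          by_contra hcon
          push Not at hcon
          exact hfree ⟨h0, hcon⟩
        obtain ⟨y, hy, hy2, hzy⟩ := this
        refine ⟨y, ?_, hzy.symm⟩
        by_contra hyB
        have g1 := hout y hyB
        have g2 := deg_mono hB y
        omega
      · have hpos := deg_nonneg W z
        obtain ⟨x, hx, hxz⟩ := Chart.exists_nbr_of_deg_pos (by omega : 0 < deg W z)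
        exact ⟨x, hB hx, hxz⟩
    rcases hφ with rfl | rfl
    · have hc0 : φ.pt 0 0 ∈ φ.box n n := Chart.pt_mem_box le_rfl (by omega) le_rfl (by omega)
      have hdc : deg (φ.box n n) (φ.pt 0 0) = 2 := by
        have g1 := hper_erase D hc0
        rw [hW.1, Chart.hper_box D (by omega) (by omega) (by omega) (by omega)] at g1
        omega
      refine ⟨n, n, .inl ⟨rfl, rfl⟩, Finset.erase_subset _ _, ?_, ?_,
        hnbr _ (Finset.erase_subset _ _) fun y hy =>
          Chart.deg_box_le_one D (by omega) (by omega) hy⟩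
      · intro y hy hy'
        rw [Finset.mem_erase, not_and_or, not_not] at hy'
        rcases hy' with rfl | hy'
        · exact hdc.le
        · exact absurd hy hy'
      · intro hzB
        rw [Finset.mem_erase, not_and_or, not_not] at hz
        rcases hz with rfl | hz
        · exact h2 (by rw [deg_erase_self D]; exact hdc)
        · exact hz hzB
    · exact ⟨n - 1, n + 1, .inr ⟨rfl, rfl⟩, subset_rfl, fun y h1 h2 => absurd h1 h2, hz,
        hnbr _ subset_rfl fun y hy => Chart.deg_box_le_one D (by omega) (by omega) hy⟩
  obtain ⟨ψ, a', b', hab', hbox, j, hj1, hj2, -, rfl⟩ := Chart.exists_outer hx hzB hxz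
  rw [← hbox] at hsub hcorner
  refine Inside.inBasin D hcard (φ := ψ) (a := a' + 1) (b := b') (Shape.grow (by omega)) ⟨?_, ?_⟩
  · intro s hs
    rcases Finset.mem_insert.1 hs with rfl | hs
    · exact Chart.pt_mem_box (by omega) (by omega) hj1 hj2
    · obtain ⟨k, l, g1, g2, g3, g4, rfl⟩ := Chart.mem_box.1 (hsub hs)
      exact Chart.pt_mem_box g1 (by omega) g3 g4
  · intro k l g1 g2 g3 g4
    refine Finset.mem_insert_of_mem ?_
    by_contra hkl
    have g5 := hcorner _ (Chart.pt_mem_box (by omega) (by omega) (by omega) (by omega)) hkl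
    have key : ∀ k l : ℤ, 0 ≤ k → k < a' → 0 ≤ l → l < b' → ind (ψ.box a' b') (ψ.pt k l) = 1 :=
      fun k l k1 k2 l1 l2 => ind_of_mem (Chart.pt_mem_box k1 k2 l1 l2)
    rw [ψ.deg_pt, key (k - 1) l (by omega) (by omega) (by omega) (by omega),
      key k (l + 1) (by omega) (by omega) (by omega) (by omega),
      key k (l - 1) (by omega) (by omega) (by omega) (by omega)] at g5
    have := ind_nonneg (ψ.box a' b') (ψ.pt (k + 1) l)
    omega

/-- The case of a move in a dented droplet in which the site `(i, 1)` next to the side of the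
rectangle moves into a vacancy of the side: the droplet turns into one with a pit. -/
theorem Inside.isPit_of_move (D : Dims K L n) (hn : 3 ≤ n) {A : Finset (Site K L)}
    (hA : A.card = n ^ 2) {φ : Chart K L} {a b : ℤ} (hs : Shape n a b) (h : Inside φ a b A)
    (hp1 : 2 * n + 1 ≤ hper A) (hp2 : hper A ≤ 2 * n + 2) {i : ℤ} (hi1 : 1 ≤ i) (hi2 : i ≤ a - 2)
    (hb : 3 ≤ b) (hy : φ.pt i 0 ∉ A) (hW : 2 * n + 1 ≤ hper (A.erase (φ.pt i 1)))
    (hA' : hper (insert (φ.pt i 0) (A.erase (φ.pt i 1))) ≤ 2 * n + 2) :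
    IsPit n (insert (φ.pt i 0) (A.erase (φ.pt i 1))) := by
  have hs' := hs
  unfold Shape at hs'
  have hv := hs.vacancies_le
  have hAc : (A.card : ℤ) = n ^ 2 := by exact_mod_cast hA
  have ha2 : a ≤ 2 * n - 1 := by omega
  have hb2 : b ≤ 2 * n - 1 := by omega
  have hA2 : n ^ 2 ≤ A.card := hA.ge
  have hnot : ∀ k l, -1 ≤ k → k ≤ a → -1 ≤ l → l ≤ b → ¬(0 ≤ k ∧ k < a ∧ 0 ≤ l ∧ l < b) →
      φ.pt k l ∉ A := by
    intro k l k1 k2 l1 l2 hout hm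
    exact hout ((Chart.pt_mem_box_iff D (by omega) (by omega) (by omega) (by omega)).1 (h.1 hm))
  have hne : ∀ {k l k' l' : ℤ}, -1 ≤ k → k ≤ a → -1 ≤ l → l ≤ b → -1 ≤ k' → k' ≤ a → -1 ≤ l' →
      l' ≤ b → ¬(k = k' ∧ l = l') → φ.pt k l ≠ φ.pt k' l' := by
    intro k l k' l' k1 k2 l1 l2 k3 k4 l3 l4 hkl heq
    exact hkl (Chart.pt_inj D heq (by rw [abs_le]; omega) (by rw [abs_le]; omega))
  have hx : φ.pt i 1 ∈ A := h.2 i 1 hi1 hi2 le_rfl (by omega)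
  have hxy : Nbr (φ.pt i 0) (φ.pt i 1) := φ.nbr_pt.2 (.inr (.inr (.inl rfl)))
  have hyW : φ.pt i 0 ∉ A.erase (φ.pt i 1) := fun hm => hy (Finset.mem_of_mem_erase hm)
  have hpW := hper_erase D hx
  have hpA' := hper_insert D hyW
  have hdy := deg_erase_of_nbr D hxy hx
  have hpU := hper_insert D hy
  have hUc : (insert (φ.pt i 0) A).card = n ^ 2 + 1 := by
    rw [Finset.card_insert_of_notMem hy, hA]
  have hpU1 := two_mul_add_one_le_hper D (A := insert (φ.pt i 0) A) (by omega) (by omega)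
  have hUin : Inside φ a b (insert (φ.pt i 0) A) := by
    refine ⟨?_, fun k l h1 h2 h3 h4 => Finset.mem_insert_of_mem (h.2 k l h1 h2 h3 h4)⟩
    intro s hs
    rcases Finset.mem_insert.1 hs with rfl | hs
    · exact Chart.pt_mem_box (by omega) (by omega) le_rfl (by omega)
    · exact h.1 hs
  have hAe : insert (φ.pt i 0) (A.erase (φ.pt i 1)) = (insert (φ.pt i 0) A).erase (φ.pt i 1) := by
    rw [Finset.erase_insert_of_ne]
    exact hne (by omega) (by omega) (by omega) (by omega) (by omega) (by omega) (by omega)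
      (by omega) (by omega)
  -- the degrees of the two sites in the coordinates
  have hdx := φ.deg_pt A i 1
  have hdyc := φ.deg_pt A i 0
  rw [show (1 : ℤ) + 1 = 2 from rfl, show (1 : ℤ) - 1 = 0 from rfl, ind_of_notMem hy] at hdx
  rw [show (0 : ℤ) + 1 = 1 from rfl, show (0 : ℤ) - 1 = -1 from rfl, ind_of_mem hx,
    ind_of_notMem (hnot i (-1) (by omega) (by omega) (by omega) (by omega) (by omega))] at hdyc
  have l1 := ind_le_one A (φ.pt (i + 1) 0)
  have l2 := ind_le_one A (φ.pt (i - 1) 0)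
  have l3 := ind_le_one A (φ.pt (i + 1) 1)
  have l4 := ind_le_one A (φ.pt (i - 1) 1)
  have l5 := ind_le_one A (φ.pt i 2)
  have m1 := ind_nonneg A (φ.pt (i + 1) 0)
  have m2 := ind_nonneg A (φ.pt (i - 1) 0)
  have m3 := ind_nonneg A (φ.pt (i + 1) 1)
  have m4 := ind_nonneg A (φ.pt (i - 1) 1)
  have m5 := ind_nonneg A (φ.pt i 2)
  have hdx2 : deg A (φ.pt i 1) ≤ 2 := by omega
  -- a second neighbour of `(i, 1)` is vacant: at a corner of the interior
  have corner : ∀ ψ : Chart K L, Inside ψ a b A → ψ.box a b = φ.box a b →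
      ψ.pt 1 0 = φ.pt i 0 → ψ.pt 1 1 = φ.pt i 1 → ψ.pt 0 1 ∉ A →
      IsPit n (insert (φ.pt i 0) (A.erase (φ.pt i 1))) := by
    intro ψ hψ hbox e0 e1 h01
    rw [← e0] at hy hyW hxy hpA' hA' hdy hpU hUc hpU1 hAe hUin ⊢
    rw [← e1] at hx hxy hyW hpA' hA' hdy hpW hW hAe hdx2 ⊢
    have hnot : ∀ k l, -1 ≤ k → k ≤ a → -1 ≤ l → l ≤ b → ¬(0 ≤ k ∧ k < a ∧ 0 ≤ l ∧ l < b) →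
        ψ.pt k l ∉ A := by
      intro k l k1 k2 l1 l2 hout hm
      exact hout ((Chart.pt_mem_box_iff D (by omega) (by omega) (by omega) (by omega)).1
        (hψ.1 hm))
    have hne : ∀ {k l k' l' : ℤ}, -1 ≤ k → k ≤ a → -1 ≤ l → l ≤ b → -1 ≤ k' → k' ≤ a → -1 ≤ l' →
        l' ≤ b → ¬(k = k' ∧ l = l') → ψ.pt k l ≠ ψ.pt k' l' := by
      intro k l k' l' k1 k2 l1 l2 k3 k4 l3 l4 hkl heq
      exact hkl (Chart.pt_inj D heq (by rw [abs_le]; omega) (by rw [abs_le]; omega))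
    have hUin : Inside ψ a b (insert (ψ.pt 1 0) A) :=
      ⟨hbox ▸ hUin.1, fun k l h1 h2 h3 h4 => Finset.mem_insert_of_mem (hψ.2 k l h1 h2 h3 h4)⟩
    have hdx := ψ.deg_pt A 1 1
    have hdyc := ψ.deg_pt A 1 0
    rw [show (1 : ℤ) + 1 = 2 from rfl, show (1 : ℤ) - 1 = 0 from rfl, ind_of_notMem hy,
      ind_of_notMem h01] at hdx
    rw [show (0 : ℤ) + 1 = 1 from rfl, show (0 : ℤ) - 1 = -1 from rfl,
      show (1 : ℤ) + 1 = 2 from rfl, show (1 : ℤ) - 1 = 0 from rfl, ind_of_mem hx,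
      ind_of_notMem (hnot 1 (-1) (by omega) (by omega) (by omega) (by omega) (by omega))] at hdyc
    have l1 := ind_le_one A (ψ.pt 2 0)
    have l2 := ind_le_one A (ψ.pt 0 0)
    have m1 := ind_nonneg A (ψ.pt 2 0)
    have m2 := ind_nonneg A (ψ.pt 0 0)
    by_cases h00 : ψ.pt 0 0 ∈ A
    · by_cases hcol : ∀ l, 2 ≤ l → l < b → ψ.pt 0 l ∉ A
      · -- the column of the corner is empty otherwise, and there are no further vacancies
        have hseg : ∀ l, 1 ≤ l → l < b → ψ.pt 0 l ∉ A := by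
          intro l g1 g2
          rcases eq_or_lt_of_le g1 with rfl | g3
          · exact h01
          · exact hcol l (by omega) g2
        have hocc : ∀ k l, 1 ≤ k → k < a → 0 ≤ l → l < b → ¬(k = 1 ∧ l = 0) → ψ.pt k l ∈ A := by
          intro k l k1 k2 l1 l2 hkl
          by_contra hm
          have := Chart.vacant_col_two D (by omega) (by omega) hψ.1 le_rfl (by omega)
            (by omega : (0 : ℤ) ≤ 1) (by omega) le_rfl hseg (i := 1) (j := 0) (by omega) hy
            (i' := k) (j' := l) (by omega) hm (by omega)
          omega
        have h20 := hocc 2 0 (by omega) (by omega) (by omega) (by omega) (by omega)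
        rw [ind_of_mem h20, ind_of_mem h00] at hdyc
        let χ : Chart K L := (ψ.swap.flip b).swap
        have hχ : ∀ k l, χ.pt k l = ψ.pt k (b - 1 - l) := fun k l => by
          simp [χ]
        refine ⟨χ, a, b, insert (ψ.pt 1 0) A, b - 2, hs, hUin.swap.flip.swap, hUc, by omega,
          by omega, le_rfl, by omega, ?_, ?_, ?_⟩
        · intro j g1 g2
          rw [hχ, Finset.mem_insert, not_or]
          exact ⟨hne (by omega) (by omega) (by omega) (by omega) (by omega) (by omega)
            (by omega) (by omega) (by omega), hseg _ (by omega) (by omega)⟩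
        · rw [hχ]
          exact Finset.mem_insert_of_mem (hocc 1 _ (by omega) (by omega) (by omega) (by omega)
            (by omega))
        · rw [hAe, hχ]
          congr 2
          omega
      · exfalso
        push Not at hcol
        obtain ⟨l, g1, g2, g3⟩ := hcol
        have hrow : ∀ k, 2 ≤ k → k < a → ψ.pt k 0 ∉ A := by
          intro k k1 k2 hk
          have := (hψ.le_hper D hn hs hA2 hp1 (i := 0) (i' := k) (j := 0) (by omega) h00
            (by simpa using hy) hk).2 0 0 l (by omega) h00 (by simpa using h01) g3
          omega
        have hseg : ∀ k, 1 ≤ k → k < a → ψ.swap.pt 0 k ∉ A := by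
          intro k k1 k2
          rw [Chart.swap_pt]
          rcases eq_or_lt_of_le k1 with rfl | k3
          · exact hy
          · exact hrow k (by omega) k2
        have hocc : ∀ k l, 0 ≤ k → k < a → 1 ≤ l → l < b → ¬(k = 0 ∧ l = 1) → ψ.pt k l ∈ A := by
          intro k l k1 k2 l1 l2 hkl
          by_contra hm
          have := Chart.vacant_col_two (φ := ψ.swap) D (by omega) (by omega) hψ.swap.1 le_rfl
            (by omega) (by omega : (0 : ℤ) ≤ 1) (by omega) le_rfl hseg (i := 1) (j := 0) (by omega)
            (by rw [Chart.swap_pt]; exact h01) (i' := l) (j' := k) (by omega)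
            (by rw [Chart.swap_pt]; exact hm) (by omega)
          rw [mul_comm b a] at this
          omega
        have h4 := (hψ.swap.le_hper D hn hs.swap hA2 hp1 (i := 0) (i' := 2) (j := 0) (by omega)
          (by simpa using h00) (by simpa using h01) (by
            simpa using hocc 0 2 (by omega) (by omega) (by omega) (by omega) (by omega))).1
        rw [ind_of_mem (hocc 2 1 (by omega) (by omega) (by omega) (by omega) (by omega)),
          ind_of_mem (hocc 1 2 (by omega) (by omega) (by omega) (by omega) (by omega))] at hdx
        rw [ind_of_notMem (hrow 2 le_rfl (by omega))] at hdyc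
        omega
    · -- a pit at the corner of the interior
      rw [ind_of_notMem h00] at hdyc
      refine ⟨ψ, a, b, insert (ψ.pt 1 0) A, 1, hs, hUin, hUc, ?_, le_rfl, by omega, by omega, ?_,
        Finset.mem_insert_self _ _, hAe⟩
      · have hseg : ∀ l, 0 ≤ l → l < 2 → ψ.pt 0 l ∉ A := by
          intro l g1 g2
          have : l = 0 ∨ l = 1 := by omega
          rcases this with rfl | rfl
          · exact h00
          · exact h01
        have h21 : ψ.pt 2 1 ∈ A := by
          by_contra hm
          have g0 : a = 3 := by
            by_contra hne3
            exact hm (hψ.2 2 1 (by omega) (by omega) (by omega) (by omega))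
          have := Chart.vacant_col_two D (by omega) (by omega) hψ.1 le_rfl (by omega)
            le_rfl (by omega) (by omega) hseg (i := 1) (j := 0) (by omega) hy
            (i' := 2) (j' := 1) (by omega) hm (by omega)
          omega
        have h12 : ψ.pt 1 2 ∈ A := by
          by_contra hm
          have g0 : b = 3 := by
            by_contra hne3
            exact hm (hψ.2 1 2 (by omega) (by omega) (by omega) (by omega))
          have := Chart.vacant_col_two D (by omega) (by omega) hψ.1 le_rfl (by omega)
            le_rfl (by omega) (by omega) hseg (i := 1) (j := 0) (by omega) hy
            (i' := 1) (j' := 2) (by omega) hm (by omega)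
          omega
        rw [ind_of_mem h21, ind_of_mem h12] at hdx
        omega
      · intro j g1 g2
        rw [Finset.mem_insert, not_or]
        refine ⟨hne (by omega) (by omega) (by omega) (by omega) (by omega) (by omega)
            (by omega) (by omega) (by omega), ?_⟩
        have : j = 0 ∨ j = 1 := by omega
        rcases this with rfl | rfl
        · exact h00
        · exact h01
  by_cases h4 : φ.pt (i - 1) 1 ∈ A
  · by_cases h3 : φ.pt (i + 1) 1 ∈ A
    · -- a rectangle whose interior has width one
      rw [ind_of_mem h3, ind_of_mem h4] at hdx
      have h2 : φ.pt i 2 ∉ A := fun hm => by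
        rw [ind_of_mem hm] at hdx
        omega
      have hb3 : b = 3 := by
        by_contra hne3
        exact h2 (h.2 i 2 hi1 hi2 (by omega) (by omega))
      rw [ind_of_notMem h2] at hdx
      -- vacancies in the top row and one at `(i, 0)`
      have hcount : ∀ l r, 0 ≤ l → l ≤ r → r ≤ a → (∀ k, l ≤ k → k < r → φ.pt k 2 ∉ A) →
          ∀ k, 0 ≤ k → k < a → ¬(l ≤ k ∧ k < r) → φ.pt k 2 ∉ A → r - l + 2 ≤ 3 := by
        intro l r g1 g2 g3 hseg k k1 k2 hk hk'
        have := Chart.vacant_col_two (φ := φ.swap) D (by omega) (by omega) h.swap.1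
          (k := 2) (l := l) (r := r) (by omega)
          (by omega) g1 g2 g3 (by intro j; rw [Chart.swap_pt]; exact hseg j)
          (i := 0) (j := i) (by omega) (by rw [Chart.swap_pt]; exact hy)
          (i' := 2) (j' := k) (by omega) (by rw [Chart.swap_pt]; exact hk') (by omega)
        rw [mul_comm b a] at this
        omega
      have hcount0 : ∀ l r, 0 ≤ l → l ≤ r → r ≤ a → (∀ k, l ≤ k → k < r → φ.pt k 0 ∉ A) →
          ∀ k, 0 ≤ k → k < a → k ≠ i → φ.pt k 2 ∉ A → r - l + 2 ≤ 3 := by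
        intro l r g1 g2 g3 hseg k k1 k2 hk hk'
        have := Chart.vacant_col_two (φ := φ.swap) D (by omega) (by omega) h.swap.1
          (k := 0) (l := l) (r := r) (by omega)
          (by omega) g1 g2 g3 (by intro j; rw [Chart.swap_pt]; exact hseg j)
          (i := 2) (j := i) (by omega) (by rw [Chart.swap_pt]; exact h2)
          (i' := 2) (j' := k) (by omega) (by rw [Chart.swap_pt]; exact hk') (by omega)
        rw [mul_comm b a] at this
        omega
      by_cases hboth : deg A (φ.pt i 0) = 3
      · -- the vacancy in the bottom row closes a gap
        have hpU2 : hper (insert (φ.pt i 0) A) = 2 * n + 1 := by omega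
        have hdU := deg_le_two_of_notMem D hUc hpU2.le (y := φ.pt i 2) (by
          rw [Finset.mem_insert, not_or]
          exact ⟨hne (by omega) (by omega) (by omega) (by omega) (by omega) (by omega)
            (by omega) (by omega) (by omega), h2⟩)
        rw [φ.deg_pt, show (2 : ℤ) - 1 = 1 from rfl,
          ind_of_mem (Finset.mem_insert_of_mem hx)] at hdU
        have hcase : ∀ ψ : Chart K L, Inside ψ a b A → ψ.box a b = φ.box a b →
            (∃ s, 1 ≤ s ∧ s ≤ a - 2 ∧ ψ.pt s 0 = φ.pt i 0 ∧ ψ.pt s 1 = φ.pt i 1 ∧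
              ψ.pt s 2 ∉ A ∧ ψ.pt (s - 1) 2 ∉ A ∧ ψ.pt (s - 1) 1 ∈ A) →
            (∀ l r, 0 ≤ l → l ≤ r → r ≤ a → (∀ k, l ≤ k → k < r → ψ.pt k 2 ∉ A) →
              ∀ k, 0 ≤ k → k < a → ¬(l ≤ k ∧ k < r) → ψ.pt k 2 ∉ A → r - l + 2 ≤ 3) →
            IsPit n (insert (φ.pt i 0) (A.erase (φ.pt i 1))) := by
          rintro ψ hψ hbox ⟨s, s1, s2, e0, e1, h2, h2', h3⟩ hcnt
          have hUψ : Inside ψ a b (insert (φ.pt i 0) A) := ⟨hbox ▸ hUin.1, fun k l h1 h2 h3 h4 =>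
            Finset.mem_insert_of_mem (hψ.2 k l h1 h2 h3 h4)⟩
          have hneψ : ∀ {k l k' l' : ℤ}, -1 ≤ k → k ≤ a → -1 ≤ l → l ≤ b → -1 ≤ k' → k' ≤ a →
              -1 ≤ l' → l' ≤ b → ¬(k = k' ∧ l = l') → ψ.pt k l ≠ ψ.pt k' l' := by
            intro k l k' l' k1 k2 l1 l2 k3 k4 l3 l4 hkl heq
            exact hkl (Chart.pt_inj D heq (by rw [abs_le]; omega) (by rw [abs_le]; omega))
          have hseg : ∀ k, s - 1 ≤ k → k < s + 1 → ψ.pt k 2 ∉ A := by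
            intro k k1 k2
            have : k = s - 1 ∨ k = s := by omega
            rcases this with rfl | rfl
            · exact h2'
            · exact h2
          have hother : ∀ k, 0 ≤ k → k < a → ¬(s - 1 ≤ k ∧ k < s + 1) → ψ.pt k 2 ∈ A := by
            intro k k1 k2 hk
            by_contra hm
            have := hcnt (s - 1) (s + 1) (by omega) (by omega) (by omega) hseg k k1 k2 hk hm
            omega
          have hs1 : s = 1 := by
            by_contra hne1
            have := (hUψ.le_hper D hn hs (by omega) (by omega) (i := s - 2) (i' := s + 1) (j := 2)
              (by omega)
              (Finset.mem_insert_of_mem (hother _ (by omega) (by omega) (by omega))) (by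
                rw [Finset.mem_insert, not_or]
                refine ⟨?_, by rw [show s - 2 + 1 = s - 1 by ring]; exact h2'⟩
                rw [← e0]
                exact hneψ (by omega) (by omega) (by omega) (by omega) (by omega) (by omega)
                  (by omega) (by omega) (by omega))
              (Finset.mem_insert_of_mem (hother _ (by omega) (by omega) (by omega)))).1
            omega
          subst hs1
          let χ : Chart K L := ψ.swap.flip 3
          have hχ : ∀ k l, χ.pt k l = ψ.pt l (2 - k) := fun k l => by
            simp only [χ, Chart.flip_pt, Chart.swap_pt]
            congr 1
          refine ⟨χ, b, a, insert (φ.pt i 0) A, 1, hs.swap, by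
            have := hUψ.swap.flip
            rw [hb3] at this ⊢
            exact this, hUc, hpU2, le_rfl, by omega, by omega, ?_, ?_, ?_⟩
          · intro j g1 g2
            rw [hχ, Finset.mem_insert, not_or, ← e0]
            exact ⟨hneψ (by omega) (by omega) (by omega) (by omega) (by omega) (by omega)
              (by omega) (by omega) (by omega), hseg j (by omega) (by omega)⟩
          · rw [hχ]
            exact Finset.mem_insert_of_mem h3
          · rw [hAe, hχ, ← e1]
            congr 1
        have hUA : ∀ k, 0 ≤ k → k < a → ind (insert (φ.pt i 0) A) (φ.pt k 2) = ind A (φ.pt k 2) :=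
          fun k k1 k2 => ind_insert_of_ne (hne (by omega) (by omega) (by omega) (by omega)
            (by omega) (by omega) (by omega) (by omega) (by omega))
        rw [hUA _ (by omega) (by omega), hUA _ (by omega) (by omega)] at hdU
        have m6 := ind_nonneg (insert (φ.pt i 0) A) (φ.pt i (2 + 1))
        by_cases h5 : φ.pt (i - 1) 2 ∈ A
        · rw [ind_of_mem h5] at hdU
          have h6 : φ.pt (i + 1) 2 ∉ A := fun hm => by
            rw [ind_of_mem hm] at hdU
            omega
          refine hcase (φ.flip a) h.flip (by simp) ⟨a - 1 - i, by omega, by omega, ?_, ?_, ?_, ?_,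
            ?_⟩ ?_
          · rw [Chart.flip_pt]; congr 1; omega
          · rw [Chart.flip_pt]; congr 1; omega
          · rw [Chart.flip_pt, show a - 1 - (a - 1 - i) = i by ring]; exact h2
          · rw [Chart.flip_pt, show a - 1 - (a - 1 - i - 1) = i + 1 by ring]; exact h6
          · rw [Chart.flip_pt, show a - 1 - (a - 1 - i - 1) = i + 1 by ring]; exact h3
          · intro l r g1 g2 g3 hseg k k1 k2 hk hk'
            have := hcount (a - r) (a - l) (by omega) (by omega) (by omega) (by
              intro t t1 t2
              have := hseg (a - 1 - t) (by omega) (by omega)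
              rwa [Chart.flip_pt, show a - 1 - (a - 1 - t) = t by ring] at this) (a - 1 - k)
              (by omega) (by omega) (by omega) (by rwa [Chart.flip_pt] at hk')
            omega
        · exact hcase φ h rfl ⟨i, hi1, hi2, rfl, rfl, h2, h5, h4⟩ hcount
      · -- otherwise the top row has two ends
        exfalso
        have hpA : hper A = 2 * n + 1 := by omega
        have hrow2 : ∀ k, 0 ≤ k → k < a → k ≠ i → φ.pt k 2 ∈ A := by
          intro k k1 k2 hk
          by_contra hm
          have hd : φ.pt (i - 1) 0 ∉ A ∨ φ.pt (i + 1) 0 ∉ A := by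
            by_contra hcon
            push Not at hcon
            rw [ind_of_mem hcon.1, ind_of_mem hcon.2] at hdyc
            omega
          rcases hd with hd | hd
          · have := hcount0 (i - 1) (i + 1) (by omega) (by omega) (by omega) (by
              intro t t1 t2
              have : t = i - 1 ∨ t = i := by omega
              rcases this with rfl | rfl
              · exact hd
              · exact hy) k k1 k2 hk hm
            omega
          · have := hcount0 i (i + 2) (by omega) (by omega) (by omega) (by
              intro t t1 t2
              have : t = i ∨ t = i + 1 := by omega
              rcases this with rfl | rfl
              · exact hy
              · exact hd) k k1 k2 hk hm
            omega
        have := (h.le_hper D hn hs hA2 hp1 (i := i - 1) (i' := i + 1) (j := 2) (by omega)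
          (hrow2 _ (by omega) (by omega) (by omega)) (by rw [sub_add_cancel]; exact h2)
          (hrow2 _ (by omega) (by omega) (by omega))).1
        omega
    · have hi : i = a - 2 := by
        by_contra hne2
        exact h3 (h.2 _ 1 (by omega) (by omega) le_rfl (by omega))
      refine corner (φ.flip a) h.flip (by simp) ?_ ?_ ?_
      · rw [Chart.flip_pt]; congr 1; omega
      · rw [Chart.flip_pt]; congr 1; omega
      · rwa [Chart.flip_pt, show a - 1 - 0 = i + 1 by omega]
  · have hi : i = 1 := by
      by_contra hne2
      exact h4 (h.2 _ 1 (by omega) (by omega) le_rfl (by omega))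
    subst hi
    exact corner φ h rfl rfl rfl h4

end MetaHierarchy

/-! ### No move of low energy leaves the basin -/

namespace MetaHierarchy

variable {K L n : ℕ}

/-- Around a pit, the two columns next to the vacant part of the side are occupied. -/
theorem pit_occupied (D : Dims K L n) (hn : 3 ≤ n) {φ : Chart K L} {a b : ℤ}
    {U : Finset (Site K L)} {i : ℤ} (hs : Shape n a b) (h : Inside φ a b U)
    (hU : U.card = n ^ 2 + 1) (hp : hper U = 2 * n + 1) (h1 : 1 ≤ i) (h2 : i ≤ b - 2) (ha : 3 ≤ a)
    (hcol : ∀ j, 0 ≤ j → j ≤ i → φ.pt 0 j ∉ U) (h10 : φ.pt 1 0 ∈ U) {j : ℤ} (hj : 0 ≤ j)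
    (hji : j ≤ i + 1) : φ.pt 1 j ∈ U ∧ φ.pt 2 j ∈ U := by
  have hs' := hs
  unfold Shape at hs'
  have hv := hs.vacancies_le
  have hUc : (U.card : ℤ) = n ^ 2 + 1 := by exact_mod_cast hU
  have hcount : ∀ k l, 1 ≤ k → k < a → 0 ≤ l → l < b → φ.pt k l ∉ U →
      i + 2 ≤ a * b - U.card := by
    intro k l k1 k2 l1 l2 hkl
    have := Chart.vacant_col_one (r := i + 1) D (by omega) (by omega) h.1 le_rfl (by omega) le_rfl
      (by omega) (by omega) (by intro t t1 t2; exact hcol t t1 (by omega)) (i := k) (j := l)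
      (by omega) hkl
    omega
  constructor
  · by_contra hm
    have := hcount 1 j le_rfl (by omega) hj (by omega) hm
    have hj0 : j ≠ 0 := by
      rintro rfl
      exact hm h10
    exact hm (h.2 1 j le_rfl (by omega) (by omega) (by omega))
  · by_contra hm
    have hcj := hcount 2 j (by omega) (by omega) hj (by omega) hm
    by_cases hj0 : j = 0
    · subst hj0
      have hseg : ∀ k, 2 ≤ k → k < a → φ.swap.pt 0 k ∉ U := by
        intro k k1 k2 hk
        rw [Chart.swap_pt] at hk
        rcases eq_or_lt_of_le k1 with rfl | k3
        · exact hm hk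
        have := (h.le_hper D hn hs (by omega) (by omega) (i := 1) (i' := k) (j := 0) (by omega) h10
          (by simpa using hm) hk).1
        omega
      have := Chart.vacant_col_two (φ := φ.swap) D (by omega) (by omega) h.swap.1 le_rfl
        (by omega) (by omega : (0 : ℤ) ≤ 2) (by omega) le_rfl hseg (i := 0) (j := 0) (by omega)
        (by rw [Chart.swap_pt]; exact hcol 0 le_rfl (by omega)) (i' := 1) (j' := 0) (by omega)
        (by rw [Chart.swap_pt]; exact hcol 1 (by omega) h1) (by omega)
      rw [mul_comm b a] at this
      omega
    · exact hm (h.2 2 j (by omega) (by omega) (by omega) (by omega))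

/-- A neighbour `x` of the pit `(1, i)` moves into it, so that the hole is now at `x`. If `x` lies
on one of the four sides, the interior is full again; if the hole is still next to the vacant part of
the side, there is a new pit. Otherwise, as `x` has at most three neighbours, one of them on another
side of the rectangle is vacant. It is the only vacancy of that side, whose occupied sites are thus
not consecutive, and this is excluded by `hper U = 2 * n + 1`. -/
theorem pit_fill (D : Dims K L n) (hn : 3 ≤ n) {φ : Chart K L} {a b : ℤ}
    {U : Finset (Site K L)} {i : ℤ} (hs : Shape n a b) (h : Inside φ a b U)
    (hU : U.card = n ^ 2 + 1) (hp : hper U = 2 * n + 1) (h1 : 1 ≤ i) (h2 : i ≤ b - 2) (ha : 3 ≤ a)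
    (hcol : ∀ j, 0 ≤ j → j ≤ i → φ.pt 0 j ∉ U) (h10 : φ.pt 1 0 ∈ U) {x : Site K L} (hx : x ∈ U)
    (hxz : Nbr (φ.pt 1 i) x) (hdeg : deg U x ≤ 3) : InBasin n (U.erase x) := by
  have hs' := hs
  unfold Shape at hs'
  have hv := hs.vacancies_le
  have hUc : (U.card : ℤ) = n ^ 2 + 1 := by exact_mod_cast hU
  have hocc : ∀ {j}, 0 ≤ j → j ≤ i + 1 → φ.pt 1 j ∈ U ∧ φ.pt 2 j ∈ U := fun hj hji =>
    pit_occupied D hn hs h hU hp h1 h2 ha hcol h10 hj hji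
  have hcount := fun (k l k' l' : ℤ) (hkl) (hm : φ.pt k l ∉ U) (hkl') (hm' : φ.pt k' l' ∉ U)
    (hne : ¬(k = k' ∧ l = l')) => Chart.vacant_col_two (r := i + 1) D (by omega) (by omega) h.1
      le_rfl (by omega) le_rfl
      (by omega) (by omega) (by intro t t1 t2; exact hcol t t1 (by omega)) (i := k) (j := l)
      hkl hm hkl' hm' hne
  have hne : ∀ {k l k' l' : ℤ}, -1 ≤ k → k ≤ a → -1 ≤ l → l ≤ b → -1 ≤ k' → k' ≤ a → -1 ≤ l' →
      l' ≤ b → ¬(k = k' ∧ l = l') → φ.pt k l ≠ φ.pt k' l' := by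
    intro k l k' l' k1 k2 l1 l2 k3 k4 l3 l4 hkl heq
    exact hkl (Chart.pt_inj D heq (by rw [abs_le]; omega) (by rw [abs_le]; omega))
  have hfr : (∀ k l, 1 ≤ k → k ≤ a - 2 → 1 ≤ l → l ≤ b - 2 → φ.pt k l ≠ x) →
      InBasin n (U.erase x) := fun hfr => by
    refine Inside.inBasin D (by rw [Finset.card_erase_of_mem hx, hU]; rfl) hs
      ⟨(Finset.erase_subset _ _).trans h.1, fun k l k1 k2 l1 l2 => Finset.mem_erase.2
        ⟨hfr k l k1 k2 l1 l2, h.2 k l k1 k2 l1 l2⟩⟩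
  have hz := (hocc (by omega : 0 ≤ i) (by omega)).1
  rcases φ.nbr_pt.1 hxz with rfl | rfl | rfl | rfl
  · -- `x = (2, i)`
    rw [show (1 : ℤ) + 1 = 2 from rfl] at *
    by_cases ha3 : a = 3
    · exact hfr fun k l k1 k2 l1 l2 => hne (by omega) (by omega) (by omega) (by omega) (by omega)
        (by omega) (by omega) (by omega) (by omega)
    exfalso
    rw [φ.deg_pt, show (2 : ℤ) - 1 = 1 from rfl, show (2 : ℤ) + 1 = 3 from rfl, ind_of_mem hz,
      ind_of_mem (hocc (by omega : 0 ≤ i + 1) (by omega)).2,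
      ind_of_mem (hocc (by omega : 0 ≤ i - 1) (by omega)).2] at hdeg
    have h3i : φ.pt 3 i ∉ U := fun hm => by
      rw [ind_of_mem hm] at hdeg
      omega
    have ha4 : a = 4 := by
      by_contra hne4
      exact h3i (h.2 3 i (by omega) (by omega) h1 h2)
    have h3 : ∀ l, 0 ≤ l → l < b → l ≠ i → φ.pt 3 l ∈ U := by
      intro l l1 l2 hl
      by_contra hm
      have := hcount 3 i 3 l (by omega) h3i (by omega) hm (by omega)
      omega
    have := (h.swap.le_hper D hn hs.swap (by omega) (by omega) (i := i - 1) (i' := i + 1) (j := 3)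
      (by omega) (by
        rw [Chart.swap_pt]
        exact h3 _ (by omega) (by omega) (by omega)) (by
        rw [Chart.swap_pt, sub_add_cancel]
        exact h3i) (by
        rw [Chart.swap_pt]
        exact h3 _ (by omega) (by omega) (by omega))).1
    omega
  · -- `x = (0, i)` is vacant
    exact absurd hx (by simpa using hcol i (by omega) le_rfl)
  · -- `x = (1, i + 1)`
    by_cases hib : i + 1 = b - 1
    · exact hfr fun k l k1 k2 l1 l2 => hne (by omega) (by omega) (by omega) (by omega) (by omega)
        (by omega) (by omega) (by omega) (by omega)
    refine .inr (.inr (.inr ⟨φ, a, b, U, i + 1, hs, h, hU, hp, by omega, by omega, ha, ?_, h10,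
      rfl⟩))
    intro j j1 j2
    by_cases hji : j ≤ i
    · exact hcol j j1 hji
    obtain rfl : j = i + 1 := by omega
    intro hm
    rw [φ.deg_pt, show (1 : ℤ) - 1 = 0 from rfl, show (1 : ℤ) + 1 = 2 from rfl, ind_of_mem hm,
      add_sub_cancel_right, ind_of_mem hz,
      ind_of_mem (hocc (by omega : 0 ≤ i + 1) (by omega)).2] at hdeg
    have h1i : φ.pt 1 (i + 1 + 1) ∉ U := fun hm => by
      rw [ind_of_mem hm] at hdeg
      omega
    have hb : i + 1 + 1 = b - 1 := by
      by_contra hne4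
      exact h1i (h.2 1 _ (by omega) (by omega) (by omega) (by omega))
    have h3 : ∀ k, 0 ≤ k → k < a → k ≠ 1 → φ.pt k (i + 1 + 1) ∈ U := by
      intro k k1 k2 hl
      by_contra hm
      have := hcount 1 (i + 1 + 1) k (i + 1 + 1) (by omega) h1i (by omega) hm (by omega)
      omega
    have := (h.le_hper D hn hs (by omega) (by omega) (i := 0) (i' := 2) (j := i + 1 + 1)
      (by omega) (h3 _ (by omega) (by omega) (by omega)) (by simpa using h1i)
      (h3 _ (by omega) (by omega) (by omega))).1
    omega
  · -- `x = (1, i - 1)`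
    by_cases hi1 : i = 1
    · exact hfr fun k l k1 k2 l1 l2 => hne (by omega) (by omega) (by omega) (by omega) (by omega)
        (by omega) (by omega) (by omega) (by omega)
    exact .inr (.inr (.inr ⟨φ, a, b, U, i - 1, hs, h, hU, hp, by omega, by omega, ha,
      fun j j1 j2 => hcol j j1 (by omega), h10, rfl⟩))

/-- From a droplet with a pit, either the pit is filled, or a particle with at most one neighbour
moves somewhere else in the rectangle and leaves the pit as it is. -/
theorem IsPit.move_inBasin (D : Dims K L n) (hn : 3 ≤ n) {A : Finset (Site K L)}
    (hpit : IsPit n A) {x y : Site K L} (hx : x ∈ A) (hy : y ∉ A) (hxy : Nbr x y)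
    (hp' : hper (insert y (A.erase x)) ≤ 2 * n + 2) : InBasin n (insert y (A.erase x)) := by
  obtain ⟨φ, a, b, U, i, hs, h, hU, hp, h1, h2, ha, hcol, h10, rfl⟩ := hpit
  have hs' := hs
  unfold Shape at hs'
  have hv := hs.vacancies_le
  have hUc : (U.card : ℤ) = n ^ 2 + 1 := by exact_mod_cast hU
  have hocc : ∀ {j}, 0 ≤ j → j ≤ i + 1 → φ.pt 1 j ∈ U ∧ φ.pt 2 j ∈ U := fun hj hji =>
    pit_occupied D hn hs h hU hp h1 h2 ha hcol h10 hj hji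
  have hz := (hocc (by omega : 0 ≤ i) (by omega)).1
  have hdz : deg U (φ.pt 1 i) = 3 := by
    rw [φ.deg_pt, show (1 : ℤ) - 1 = 0 from rfl, show (1 : ℤ) + 1 = 2 from rfl,
      ind_of_mem (hocc (by omega : 0 ≤ i) (by omega)).2,
      ind_of_mem (hocc (by omega : 0 ≤ i + 1) (by omega)).1,
      ind_of_mem (hocc (by omega : 0 ≤ i - 1) (by omega)).1,
      ind_of_notMem (hcol i (by omega) le_rfl)]
    norm_num
  have hpA := hper_erase D hz
  have hyW : y ∉ (U.erase (φ.pt 1 i)).erase x := fun hm => hy (Finset.mem_of_mem_erase hm)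
  have hpW := hper_erase D hx
  have hpA' := hper_insert D hyW
  have hxU := Finset.mem_of_mem_erase hx
  have hxz : x ≠ φ.pt 1 i := Finset.ne_of_mem_erase hx
  have hdy := deg_erase_of_nbr D hxy.symm hx
  have hcount := fun (k l : ℤ) (hkl) (hm : φ.pt k l ∉ U) => Chart.vacant_col_one (r := i + 1)
    D (by omega) (by omega) h.1 le_rfl (by omega) le_rfl (by omega) (by omega)
    (by intro t t1 t2; exact hcol t t1 (by omega)) (i := k) (j := l) hkl hm
  by_cases hyz : y = φ.pt 1 i
  · subst hyz
    rw [Finset.erase_right_comm, Finset.insert_erase (Finset.mem_erase.2 ⟨hxz.symm, hz⟩)] at hp' ⊢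
    have := hper_erase D hxU
    exact pit_fill D hn hs h hU hp h1 h2 ha hcol h10 hxU hxy.symm (by omega)
  have hyU : y ∉ U := fun hm => hy (Finset.mem_erase.2 ⟨hyz, hm⟩)
  have hdyU := deg_le_two_of_notMem D hU hp.le hyU
  have hdyA := deg_mono (Finset.erase_subset (φ.pt 1 i) U) y
  have hbox : ∀ {s}, s ∉ φ.box a b → deg U s ≤ 1 := fun hsb =>
    (deg_mono h.1 _).trans (Chart.deg_box_le_one D (by omega) (by omega) hsb)
  have hne : ∀ {k l k' l' : ℤ}, -1 ≤ k → k ≤ a → -1 ≤ l → l ≤ b → -1 ≤ k' → k' ≤ a → -1 ≤ l' →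
      l' ≤ b → ¬(k = k' ∧ l = l') → φ.pt k l ≠ φ.pt k' l' := by
    intro k l k' l' k1 k2 l1 l2 k3 k4 l3 l4 hkl heq
    exact hkl (Chart.pt_inj D heq (by rw [abs_le]; omega) (by rw [abs_le]; omega))
  have hnot : ∀ k l, -1 ≤ k → k ≤ a → -1 ≤ l → l ≤ b → ¬(0 ≤ k ∧ k < a ∧ 0 ≤ l ∧ l < b) →
      φ.pt k l ∉ U := by
    intro k l k1 k2 l1 l2 hout hm
    exact hout ((Chart.pt_mem_box_iff D (by omega) (by omega) (by omega) (by omega)).1 (h.1 hm))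
  -- vacant sites on the side next to the pit have few occupied neighbours
  have hside : ∀ j, 0 ≤ j → j < i → deg U (φ.pt 0 j) ≤ 1 := by
    intro j j1 j2
    rw [φ.deg_pt, ind_of_notMem (hcol (j + 1) (by omega) (by omega)),
      ind_of_notMem (x := φ.pt 0 (j - 1)) (by
        by_cases hj0 : j = 0
        · exact hnot _ _ (by omega) (by omega) (by omega) (by omega) (by omega)
        · exact hcol (j - 1) (by omega) (by omega)),
      ind_of_notMem (hnot (0 - 1) j (by omega) (by omega) (by omega) (by omega) (by omega))]
    have := ind_le_one U (φ.pt (0 + 1) j)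
    omega
  have h10d : 2 ≤ deg U (φ.pt 1 0) := by
    rw [φ.deg_pt, show (1 : ℤ) - 1 = 0 from rfl, show (1 : ℤ) + 1 = 2 from rfl,
      ind_of_mem (hocc le_rfl (by omega)).2,
      ind_of_mem (hocc (by omega : (0 : ℤ) ≤ 0 + 1) (by omega)).1]
    have g1 := ind_nonneg U (φ.pt 0 0)
    have g2 := ind_nonneg U (φ.pt 1 (0 - 1))
    omega
  by_cases hnb : Nbr (φ.pt 1 i) x
  · -- a neighbour of the pit cannot move anywhere but into the pit
    exfalso
    have hdx := deg_erase_of_nbr D hnb.symm hz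
    rcases φ.nbr_pt.1 hnb with rfl | rfl | rfl | rfl
    · have hd : deg U (φ.pt (1 + 1) i) ≤ 2 := by omega
      rw [φ.deg_pt, show (1 : ℤ) + 1 = 2 from rfl, show (2 : ℤ) - 1 = 1 from rfl, ind_of_mem hz,
        ind_of_mem (hocc (by omega : 0 ≤ i + 1) (by omega)).2,
        ind_of_mem (hocc (by omega : 0 ≤ i - 1) (by omega)).2] at hd
      have := ind_nonneg U (φ.pt (2 + 1) i)
      omega
    · exact absurd hxU (by simpa using hcol i (by omega) le_rfl)
    · have e1 : φ.pt 1 (i + 1) ∈ U := hxU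
      have hd : deg U (φ.pt 1 (i + 1)) ≤ 2 := by omega
      rw [φ.deg_pt, show (1 : ℤ) - 1 = 0 from rfl, show (1 : ℤ) + 1 = 2 from rfl,
        add_sub_cancel_right, ind_of_mem hz,
        ind_of_mem (hocc (by omega : 0 ≤ i + 1) (by omega)).2] at hd
      have g1 := ind_nonneg U (φ.pt 0 (i + 1))
      have g2 := ind_nonneg U (φ.pt 1 (i + 1 + 1))
      have hm1 : φ.pt 0 (i + 1) ∉ U := fun hm => by
        rw [ind_of_mem hm] at hd
        omega
      have hm2 : φ.pt 1 (i + 1 + 1) ∉ U := fun hm => by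
        rw [ind_of_mem hm] at hd
        omega
      have hseg : ∀ j, 0 ≤ j → j < i + 2 → φ.pt 0 j ∉ U := by
        intro j j1 j2
        by_cases hji : j ≤ i
        · exact hcol j j1 hji
        · obtain rfl : j = i + 1 := by omega
          exact hm1
      by_cases hib : i + 1 = b - 1
      · have := Chart.vacant_col D (by omega) (by omega) h.1 le_rfl (by omega) le_rfl
          (by omega) (by omega) hseg
        omega
      · have : i + 1 + 1 = b - 1 := by
          by_contra hcon
          exact hm2 (h.2 1 _ le_rfl (by omega) (by omega) (by omega))
        have := Chart.vacant_col_one D (by omega) (by omega) h.1 le_rfl (by omega) le_rfl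
          (by omega) (by omega) hseg (i := 1) (j := i + 1 + 1) (by omega) hm2
        omega
    · by_cases hi1 : i = 1
      · subst hi1
        rw [sub_self] at *
        rcases φ.nbr_pt.1 hxy with rfl | rfl | rfl | rfl
        · exact hyU (hocc le_rfl (by omega)).2
        · have := hside 0 le_rfl (by omega)
          rw [show (1 : ℤ) - 1 = 0 from rfl] at *
          omega
        · exact hyU hz
        · have := hbox (s := φ.pt 1 (0 - 1)) fun hm => by
            rw [Chart.pt_mem_box_iff D (by omega) (by omega) (by omega) (by omega)] at hm
            omega
          omega
      · have hd : deg U (φ.pt 1 (i - 1)) ≤ 2 := by omega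
        rw [φ.deg_pt, show (1 : ℤ) - 1 = 0 from rfl, show (1 : ℤ) + 1 = 2 from rfl,
          sub_add_cancel, ind_of_mem hz,
          ind_of_mem (hocc (by omega : 0 ≤ i - 1) (by omega)).2,
          ind_of_mem (hocc (by omega : 0 ≤ i - 1 - 1) (by omega)).1] at hd
        have g1 := ind_nonneg U (φ.pt 0 (i - 1))
        omega
  -- the move takes place in `U`, far from the pit
  have hdx : deg (U.erase (φ.pt 1 i)) x = deg U x :=
    deg_erase_of_not_nbr fun hcon => hnb hcon.symm
  have hpUx := hper_erase D hxU
  have hUxc : (U.erase x).card = n ^ 2 := by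
    rw [Finset.card_erase_of_mem hxU, hU]
    rfl
  have h2n := two_mul_le_hper D (A := U.erase x) (by omega) (by rw [hUxc]; push_cast; nlinarith)
  have hynb : ¬Nbr (φ.pt 1 i) y := fun hcon => by
    have := deg_erase_of_nbr D hcon.symm hz
    omega
  have hdyUx := deg_erase_of_nbr D hxy.symm hxU
  have hyUx : y ∉ U.erase x := fun hm => hyU (Finset.mem_of_mem_erase hm)
  have hpU' := hper_insert D hyUx
  have hdx2 : deg U x ≤ 1 := by omega
  have hyb : y ∈ φ.box a b := by
    by_contra hyb
    have := hbox hyb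
    omega
  refine .inr (.inr (.inr ⟨φ, a, b, insert y (U.erase x), i, hs, h.move hyb ?_, ?_, by omega, h1,
    h2, ha, ?_, ?_, ?_⟩))
  · rintro k l k1 k2 l1 l2 rfl
    have hhor : φ.pt (k + 1) l ∈ U ∨ φ.pt (k - 1) l ∈ U := by
      by_cases ha3 : k = a - 2
      · by_cases hk1 : k = 1
        · left
          by_contra hm
          have := hcount _ _ (by omega) hm
          omega
        · exact .inr (h.2 _ _ (by omega) (by omega) (by omega) (by omega))
      · exact .inl (h.2 _ _ (by omega) (by omega) (by omega) (by omega))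
    have hver : φ.pt k (l + 1) ∈ U ∨ φ.pt k (l - 1) ∈ U := by
      by_cases ha3 : l = b - 2
      · by_cases hk1 : l = 1
        · left
          by_contra hm
          have := hcount _ _ (by omega) hm
          omega
        · exact .inr (h.2 _ _ (by omega) (by omega) (by omega) (by omega))
      · exact .inl (h.2 _ _ (by omega) (by omega) (by omega) (by omega))
    rw [φ.deg_pt] at hdx2
    have g1 := ind_nonneg U (φ.pt (k + 1) l)
    have g2 := ind_nonneg U (φ.pt (k - 1) l)
    have g3 := ind_nonneg U (φ.pt k (l + 1))
    have g4 := ind_nonneg U (φ.pt k (l - 1))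
    rcases hhor with hm | hm <;> rcases hver with hm' | hm' <;>
      rw [ind_of_mem hm, ind_of_mem hm'] at hdx2 <;> omega
  · rw [Finset.card_insert_of_notMem hyUx, hUxc]
  · intro j j1 j2
    rw [Finset.mem_insert, not_or]
    refine ⟨?_, fun hm => hcol j j1 j2 (Finset.mem_of_mem_erase hm)⟩
    rintro rfl
    rcases eq_or_lt_of_le j2 with rfl | j3
    · exact hynb (φ.nbr_pt.2 (.inr (.inl rfl)))
    · have := hside j j1 j3
      omega
  · refine Finset.mem_insert_of_mem (Finset.mem_erase.2 ⟨?_, h10⟩)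
    rintro rfl
    omega
  · rw [Finset.erase_insert_of_ne hyz, Finset.erase_right_comm]

end MetaHierarchy

namespace MetaHierarchy

variable {K L n : ℕ}

/-- The moves of a dented droplet that do not leave a core behind: the particle stays in the
rectangle, and if it comes from the interior, the droplet turns into one with a pit. -/
theorem IsDent.move_inBasin (D : Dims K L n) (hn : 3 ≤ n) {A : Finset (Site K L)}
    (hA : A.card = n ^ 2) (hpA : hper A ≤ 2 * n + 2) (hd : IsDent n A) {x y : Site K L}
    (hx : x ∈ A) (hy : y ∉ A) (hxy : Nbr x y) (hW : 2 * n + 1 ≤ hper (A.erase x))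
    (hp' : hper (insert y (A.erase x)) ≤ 2 * n + 2) : InBasin n (insert y (A.erase x)) := by
  obtain ⟨hp1, φ, a, b, hs, h⟩ := hd
  have hs' := hs
  unfold Shape at hs'
  have hyW : y ∉ A.erase x := fun hm => hy (Finset.mem_of_mem_erase hm)
  have hpA' := hper_insert D hyW
  have hdy := deg_erase_of_nbr D hxy.symm hx
  have hcard : (insert y (A.erase x)).card = n ^ 2 := by
    rw [Finset.card_insert_of_notMem hyW, Finset.card_erase_of_mem hx, hA]
    have : 0 < n ^ 2 := by positivity
    omega
  have hyb : y ∈ φ.box a b := by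
    by_contra hyb
    have h1 := deg_mono h.1 y
    have h2 := Chart.deg_box_le_one D (by omega) (by omega) hyb
    omega
  by_cases hfr : ∀ k l, 1 ≤ k → k ≤ a - 2 → 1 ≤ l → l ≤ b - 2 → φ.pt k l ≠ x
  · exact Inside.inBasin D hcard hs (h.move hyb hfr)
  push Not at hfr
  obtain ⟨k, l, k1, k2, l1, l2, rfl⟩ := hfr
  refine .inr (.inr (.inr ?_))
  -- the vacancy lies on one of the four sides, which the symmetries of the box reduce to one
  rcases φ.nbr_pt.1 hxy with rfl | rfl | rfl | rfl
  · have hk : k = a - 2 := by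
      by_contra hne
      exact hy (h.2 _ _ (by omega) (by omega) l1 l2)
    have e0 : (φ.flip a).swap.pt l 0 = φ.pt (k + 1) l := by
      rw [Chart.swap_pt, Chart.flip_pt]
      congr 1
      omega
    have e1 : (φ.flip a).swap.pt l 1 = φ.pt k l := by
      rw [Chart.swap_pt, Chart.flip_pt]
      congr 1
      omega
    rw [← e0] at hy hp' ⊢
    rw [← e1] at hW hp' ⊢
    exact h.flip.swap.isPit_of_move D hn hA hs.swap hp1 hpA l1 (by omega) (by omega) hy hW hp'
  · have hk : k = 1 := by
      by_contra hne
      exact hy (h.2 _ _ (by omega) (by omega) l1 l2)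
    have e0 : φ.swap.pt l 0 = φ.pt (k - 1) l := by
      rw [Chart.swap_pt]
      congr 1
      omega
    have e1 : φ.swap.pt l 1 = φ.pt k l := by
      rw [Chart.swap_pt]
      congr 1
      omega
    rw [← e0] at hy hp' ⊢
    rw [← e1] at hW hp' ⊢
    exact h.swap.isPit_of_move D hn hA hs.swap hp1 hpA l1 (by omega) (by omega) hy hW hp'
  · have hk : l = b - 2 := by
      by_contra hne
      exact hy (h.2 _ _ (by omega) (by omega) (by omega) (by omega))
    have e0 : (φ.swap.flip b).swap.pt k 0 = φ.pt k (l + 1) := by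
      rw [Chart.swap_pt, Chart.flip_pt, Chart.swap_pt]
      congr 1
      omega
    have e1 : (φ.swap.flip b).swap.pt k 1 = φ.pt k l := by
      rw [Chart.swap_pt, Chart.flip_pt, Chart.swap_pt]
      congr 1
      omega
    rw [← e0] at hy hp' ⊢
    rw [← e1] at hW hp' ⊢
    exact h.swap.flip.swap.isPit_of_move D hn hA hs hp1 hpA k1 (by omega) (by omega) hy hW hp'
  · have hk : l = 1 := by
      by_contra hne
      exact hy (h.2 _ _ (by omega) (by omega) (by omega) (by omega))
    subst hk
    rw [show (1 : ℤ) - 1 = 0 from rfl] at *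
    exact h.isPit_of_move D hn hA hs hp1 hpA k1 (by omega) (by omega) hy hW hp'

/-- The basin is closed under the moves of height at most `2 * n + 2`. -/
theorem InBasin.move (D : Dims K L n) (hn : 3 ≤ n) {A : Finset (Site K L)}
    (hA : A.card = n ^ 2) (hpA : hper A ≤ 2 * n + 2) (h : InBasin n A) {x y : Site K L}
    (hx : x ∈ A) (hy : y ∉ A) (hxy : Nbr x y)
    (hp' : hper (insert y (A.erase x)) ≤ 2 * n + 2) : InBasin n (insert y (A.erase x)) := by
  have hyW : y ∉ A.erase x := fun hm => hy (Finset.mem_of_mem_erase hm)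
  have hpA' := hper_insert D hyW
  have hdy := deg_erase_of_nbr D hxy.symm hx
  have hpos : 0 < n ^ 2 := by positivity
  have hWc : (A.erase x).card + 1 = n ^ 2 := by
    rw [Finset.card_erase_of_mem hx, hA]
    omega
  have hWc' : ((A.erase x).card : ℤ) + 1 = n ^ 2 := by exact_mod_cast hWc
  have h2n := two_mul_le_hper D (A := A.erase x) (by omega) (by nlinarith)
  -- a particle outside a core may go anywhere
  rcases eq_or_lt_of_le h2n with hW | hW
  · exact IsCore.insert_inBasin D hn ⟨hW.symm, hWc⟩ hyW
  rcases h with h | h | h | h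
  · -- a corner of the square would leave a core behind, and no other particle can move
    obtain ⟨φ, rfl⟩ := square_of_hper_eq D h hA
    have := Chart.deg_box_le_one D (by omega) (by omega) hy
    omega
  · obtain ⟨W, z, hWcore, hz, rfl, hdz, hfree⟩ := h
    have hpz := hper_insert D hz
    rw [hWcore.1, hdz] at hpz
    rcases Finset.mem_insert.1 hx with rfl | hxW
    · rw [Finset.erase_insert hz] at hW
      have := hWcore.1
      omega
    -- the free particle is not next to a missing corner, so no particle of the core can move
    exfalso
    have hzx : ¬Nbr x z := fun hcon => by
      have g1 := deg_erase_of_nbr D hcon.symm hxW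
      have g2 := deg_nonneg (W.erase x) z
      omega
    have hdx : deg (insert z W) x = deg W x := deg_insert_of_not_nbr hzx
    have hpx := hper_erase D hx
    have hpWx := hper_erase D hxW
    have hc1 : (W.erase x).card + 2 = n ^ 2 := by
      have := Finset.card_erase_add_one hxW
      have := hWcore.2
      omega
    have hc2 : ((W.erase x).card : ℤ) + 2 = n ^ 2 := by exact_mod_cast hc1
    have h2 := two_mul_le_hper D (A := W.erase x) (by omega) (by
      have : (3 : ℤ) ≤ n := by exact_mod_cast hn
      nlinarith)
    have hyW' : y ∉ W := fun hm => hy (Finset.mem_insert_of_mem hm)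
    have hyd := hWcore.deg_le_two D hyW'
    have hyd' := hfree y hyW'
    have := hWcore.1
    by_cases hzy : Nbr z y
    · have := deg_insert_of_nbr D hzy.symm hz
      exact hyd' (by omega) hzy
    · have : deg (insert z W) y = deg W y := deg_insert_of_not_nbr fun hcon => hzy hcon.symm
      omega
  · exact h.move_inBasin D hn hA hpA hx hy hxy (by omega) hp'
  · exact h.move_inBasin D hn hx hy hxy hp'

/-! ### The configurations of half perimeter `2 * n + 1` in the basin -/

/-- The sites `f 0, …, f (m - 1)` that belong to `A` are consecutive, and there are at least two of
them. -/
def HasBar (A : Finset (Site K L)) (f : ℤ → Site K L) (m : ℤ) : Prop :=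
  ∃ s e : ℤ, 0 ≤ s ∧ s < e ∧ e < m ∧ ∀ i, 0 ≤ i → i < m → (f i ∈ A ↔ s ≤ i ∧ i ≤ e)

/-- `A` is framed in the `a × b` box of the chart. -/
def Framed (φ : Chart K L) (a b : ℤ) (A : Finset (Site K L)) : Prop :=
  Inside φ a b A ∧ HasBar A (fun i => φ.pt i 0) a ∧ HasBar A (fun i => φ.pt i (b - 1)) a ∧
    HasBar A (fun j => φ.pt 0 j) b ∧ HasBar A (fun j => φ.pt (a - 1) j) b

theorem Framed.swap {φ : Chart K L} {a b : ℤ} {A : Finset (Site K L)} (h : Framed φ a b A) :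
    Framed φ.swap b a A := by
  obtain ⟨h0, h1, h2, h3, h4⟩ := h
  refine ⟨h0.swap, ?_, ?_, ?_, ?_⟩ <;> simpa only [Chart.swap_pt]

theorem HasBar.reverse {A : Finset (Site K L)} {f g : ℤ → Site K L} {m : ℤ} (h : HasBar A f m)
    (hg : ∀ i, g i = f (m - 1 - i)) : HasBar A g m := by
  obtain ⟨s, e, h1, h2, h3, h4⟩ := h
  refine ⟨m - 1 - e, m - 1 - s, by omega, by omega, by omega, fun i i1 i2 => ?_⟩
  rw [hg, h4 _ (by omega) (by omega)]
  omega

theorem Framed.flip {φ : Chart K L} {a b : ℤ} {A : Finset (Site K L)} (h : Framed φ a b A) :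
    Framed (φ.flip a) a b A := by
  obtain ⟨h0, h1, h2, h3, h4⟩ := h
  refine ⟨h0.flip, h1.reverse fun i => by rw [Chart.flip_pt], h2.reverse fun i => by
    rw [Chart.flip_pt], ?_, ?_⟩
  · simpa only [Chart.flip_pt, sub_zero] using h4
  · simpa only [Chart.flip_pt, sub_self] using h3

theorem HasBar.convex {A : Finset (Site K L)} {f : ℤ → Site K L} {m : ℤ} (h : HasBar A f m)
    {i j k : ℤ} (hi : 0 ≤ i) (hij : i ≤ j) (hjk : j ≤ k) (hk : k < m) (h1 : f i ∈ A)
    (h2 : f k ∈ A) : f j ∈ A := by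
  obtain ⟨s, e, g1, g2, g3, h4⟩ := h
  rw [h4 _ (by omega) (by omega)] at h1 h2 ⊢
  omega

theorem Framed.row_nonempty {φ : Chart K L} {a b : ℤ} {A : Finset (Site K L)}
    (h : Framed φ a b A) {j : ℤ} (j1 : 0 ≤ j) (j2 : j < b) :
    ∃ i, 0 ≤ i ∧ i < a ∧ φ.pt i j ∈ A := by
  obtain ⟨h0, ⟨s, e, h1, h2, h3, h4⟩, ⟨s', e', h1', h2', h3', h4'⟩, h5, -⟩ := h
  by_cases hj0 : j = 0
  · subst hj0
    exact ⟨s, h1, by omega, (h4 s h1 (by omega)).2 (by omega)⟩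
  by_cases hjb : j = b - 1
  · subst hjb
    exact ⟨s', h1', by omega, (h4' s' h1' (by omega)).2 (by omega)⟩
  by_cases ha : 3 ≤ a
  · exact ⟨1, by omega, by omega, h0.2 _ _ le_rfl (by omega) (by omega) (by omega)⟩
  · -- a box of width two is full
    exact ⟨0, le_rfl, by omega, h5.convex le_rfl j1 (by omega : j ≤ b - 1) (by omega)
      ((h4 0 le_rfl (by omega)).2 (by omega)) ((h4' 0 le_rfl (by omega)).2 (by omega))⟩

/-- The collections `Ω^0, …, Ω^4` in the coordinates of charts. -/
def IsLayer (n : ℕ) (A : Finset (Site K L)) : Fin 5 → Prop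
  | 0 => ∃ φ : Chart K L, A = φ.box n n
  | 1 => ∃ (φ : Chart K L) (z : Site K L), z ∉ (φ.box n n).erase (φ.pt 0 0) ∧
      deg ((φ.box n n).erase (φ.pt 0 0)) z = 1 ∧ A = insert z ((φ.box n n).erase (φ.pt 0 0))
  | 2 => ∃ φ : Chart K L, Framed φ n (n + 1) A
  | 3 => ∃ (φ : Chart K L) (z : Site K L), z ∉ φ.box (n - 1) (n + 1) ∧
      deg (φ.box (n - 1) (n + 1)) z = 1 ∧ A = insert z (φ.box (n - 1) (n + 1))
  | 4 => ∃ φ : Chart K L, Framed φ (n - 1) (n + 2) A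

theorem IsCore.isLayer (D : Dims K L n) {W : Finset (Site K L)} (hW : IsCore n W) {z : Site K L}
    (hz : z ∉ W) (hdeg : deg W z = 1) : IsLayer n (insert z W) 1 ∨ IsLayer n (insert z W) 3 := by
  obtain ⟨φ, rfl | rfl⟩ := core_of_hper_eq D hW.1 hW.2
  · exact .inl ⟨φ, z, hz, hdeg, rfl⟩
  · exact .inr ⟨φ, z, hz, hdeg, rfl⟩

/-- A particle with one neighbour can be taken from a configuration of half perimeter
`2 * n + 1`, and leaves a core. -/
theorem isLayer_of_deg_le_one (D : Dims K L n) {A : Finset (Site K L)} (hA : A.card = n ^ 2)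
    (hp : hper A = 2 * n + 1) {z : Site K L} (hz : z ∈ A) (hd : deg A z ≤ 1) :
    IsLayer n A 1 ∨ IsLayer n A 3 := by
  have hn := D.two_le
  have h1 := hper_erase D hz
  have hc : (A.erase z).card + 1 = n ^ 2 := by
    rw [Finset.card_erase_add_one hz, hA]
  have hc' : ((A.erase z).card : ℤ) + 1 = n ^ 2 := by exact_mod_cast hc
  have h2 := two_mul_le_hper D (A := A.erase z) (by omega) (by nlinarith)
  have h3 : deg (A.erase z) z = 1 := by
    rw [deg_erase_self D]
    omega
  have := IsCore.isLayer D ⟨by omega, hc⟩ (Finset.notMem_erase z A) h3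
  rwa [Finset.insert_erase hz] at this

/-- The side of the rectangle carries a bar or a single attached particle. -/
theorem Inside.hasBar (D : Dims K L n) (hn : 3 ≤ n) {A : Finset (Site K L)}
    (hA : A.card = n ^ 2) (hp : hper A = 2 * n + 1) {φ : Chart K L} {a b : ℤ} (hs : Shape n a b)
    (h : Inside φ a b A) :
    HasBar A (fun i => φ.pt i 0) a ∨ IsLayer n A 1 ∨ IsLayer n A 3 := by
  have hs' := hs
  unfold Shape at hs'
  obtain ⟨i, i1, i2, hi⟩ := h.row_nonempty D hn hs hA.ge hp.ge le_rfl (by omega : 0 < b)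
  have hmem : ∀ t, t ∈ (Finset.Ico 0 a).filter (fun t => φ.pt t 0 ∈ A) ↔
      (0 ≤ t ∧ t < a) ∧ φ.pt t 0 ∈ A := fun t => by rw [Finset.mem_filter, Finset.mem_Ico]
  have hne : ((Finset.Ico 0 a).filter (fun t => φ.pt t 0 ∈ A)).Nonempty :=
    ⟨i, (hmem i).2 ⟨⟨i1, i2⟩, hi⟩⟩
  obtain ⟨s, hs1, hs2⟩ := Finset.exists_minimal hne
  obtain ⟨e, he1, he2⟩ := Finset.exists_maximal hne
  rw [hmem] at hs1 he1
  have hs3 : ∀ t, 0 ≤ t → t < a → φ.pt t 0 ∈ A → s ≤ t := fun t t1 t2 ht => by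
    by_contra hcon
    exact hcon (hs2 ((hmem t).2 ⟨⟨t1, t2⟩, ht⟩) (by omega))
  have he3 : ∀ t, 0 ≤ t → t < a → φ.pt t 0 ∈ A → t ≤ e := fun t t1 t2 ht => by
    by_contra hcon
    exact hcon (he2 ((hmem t).2 ⟨⟨t1, t2⟩, ht⟩) (by omega))
  rcases eq_or_lt_of_le (hs3 e he1.1.1 he1.1.2 he1.2) with rfl | hlt
  · refine .inr (isLayer_of_deg_le_one D hA hp hs1.2 ?_)
    rw [φ.deg_pt, ind_of_notMem (x := φ.pt (s + 1) 0), ind_of_notMem (x := φ.pt (s - 1) 0),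
      ind_of_notMem (x := φ.pt s (0 - 1))]
    · have := ind_le_one A (φ.pt s (0 + 1))
      omega
    · intro hm
      have := (Chart.pt_mem_box_iff D (by omega) (by omega) (by omega) (by omega)).1 (h.1 hm)
      omega
    · intro hm
      have h1 := (Chart.pt_mem_box_iff D (by omega) (by omega) (by omega) (by omega)).1 (h.1 hm)
      have := hs3 _ h1.1 h1.2.1 hm
      omega
    · intro hm
      have h1 := (Chart.pt_mem_box_iff D (by omega) (by omega) (by omega) (by omega)).1 (h.1 hm)
      have := he3 _ h1.1 h1.2.1 hm
      omega
  · refine .inl ⟨s, e, hs1.1.1, hlt, he1.1.2, fun t t1 t2 => ⟨fun ht => ⟨hs3 t t1 t2 ht,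
      he3 t t1 t2 ht⟩, ?_⟩⟩
    rintro ⟨h1, h2⟩
    simp only
    induction t, h1 using Int.leInduction with
    | base => exact hs1.2
    | succ t h1 ih =>
      by_contra hm
      have hte : t + 1 ≠ e := by
        rintro rfl
        exact hm he1.2
      have := (h.le_hper D hn hs hA.ge hp.ge (i := t) (i' := e) (j := 0) (by omega)
        (ih (by omega) (by omega) (by omega)) hm he1.2).1
      omega

/-- The configurations of half perimeter `2 * n + 1` in the basin. -/
theorem InBasin.isLayer (D : Dims K L n) (hn : 3 ≤ n) {A : Finset (Site K L)}
    (hA : A.card = n ^ 2) (hp : hper A = 2 * n + 1) (h : InBasin n A) :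
    ∃ i : Fin 5, i ≠ 0 ∧ IsLayer n A i := by
  rcases h with h | h | h | h
  · omega
  · obtain ⟨W, z, hW, hz, rfl, hdz, -⟩ := h
    have h1 := hper_insert D hz
    have := hW.1
    omega
  · obtain ⟨-, φ, a, b, hs, h⟩ := h
    have hfr : Framed φ a b A ∨ IsLayer n A 1 ∨ IsLayer n A 3 := by
      rcases h.hasBar D hn hA hp hs with h1 | h1
      swap
      · exact .inr h1
      rcases h.swap.flip.swap.hasBar D hn hA hp hs with h2 | h2
      swap
      · exact .inr h2
      rcases h.swap.hasBar D hn hA hp hs.swap with h3 | h3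
      swap
      · exact .inr h3
      rcases h.flip.swap.hasBar D hn hA hp hs.swap with h4 | h4
      swap
      · exact .inr h4
      simp only [Chart.swap_pt, Chart.flip_pt, sub_zero] at h2 h3 h4
      exact .inl ⟨h, h1, h2, h3, h4⟩
    rcases hfr with hfr | hfr | hfr
    · rcases hs with ⟨rfl, rfl⟩ | ⟨rfl, rfl⟩ | ⟨rfl, rfl⟩ | ⟨rfl, rfl⟩
      · exact ⟨2, by decide, φ, hfr⟩
      · exact ⟨2, by decide, φ.swap, hfr.swap⟩
      · exact ⟨4, by decide, φ, hfr⟩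
      · exact ⟨4, by decide, φ.swap, hfr.swap⟩
    · exact ⟨1, by decide, hfr⟩
    · exact ⟨3, by decide, hfr⟩
  · obtain ⟨φ, a, b, U, i, hs, h, hU, hpU, h1, h2, ha, hcol, h10, rfl⟩ := h
    have hocc : ∀ {j}, 0 ≤ j → j ≤ i + 1 → φ.pt 1 j ∈ U ∧ φ.pt 2 j ∈ U := fun hj hji =>
      pit_occupied D hn hs h hU hpU h1 h2 ha hcol h10 hj hji
    have hz := (hocc (by omega : 0 ≤ i) (by omega)).1
    have h3 := hper_erase D hz
    rw [φ.deg_pt, show (1 : ℤ) - 1 = 0 from rfl, show (1 : ℤ) + 1 = 2 from rfl,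
      ind_of_mem (hocc (by omega : 0 ≤ i) (by omega)).2,
      ind_of_mem (hocc (by omega : 0 ≤ i + 1) (by omega)).1,
      ind_of_mem (hocc (by omega : 0 ≤ i - 1) (by omega)).1,
      ind_of_notMem (hcol i (by omega) le_rfl)] at h3
    omega

/-- The sum of the degrees counts every bond twice. -/
theorem sum_deg (A : Finset (Site K L)) : ∑ x ∈ A, deg A x = 4 * A.card - 2 * hper A := by
  have h1 := card_ends (1, 0) A
  have h2 := card_ends (0, 1) A
  have h3 := sum_ind_neg (1, 0) A
  have h4 := sum_ind_neg (0, 1) A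
  unfold deg hper
  simp only [Finset.sum_add_distrib, sub_eq_add_neg]
  linarith

/-- For four particles there is no need to know how the configuration was reached. -/
theorem isLayer_of_two (D : Dims K L 2) {A : Finset (Site K L)} (hA : A.card = 2 ^ 2)
    (hp : hper A = 2 * 2 + 1) : ∃ i : Fin 5, i ≠ 0 ∧ IsLayer 2 A i := by
  obtain ⟨z, hz, hd⟩ : ∃ z ∈ A, deg A z < 2 := by
    apply Finset.exists_lt_of_sum_lt
    rw [sum_deg, Finset.sum_const, hA, hp]
    norm_num
  rcases isLayer_of_deg_le_one D hA (by exact_mod_cast hp) hz (by omega) with h | h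
  · exact ⟨1, by decide, h⟩
  · exact ⟨3, by decide, h⟩

theorem Framed.card_ends (D : Dims K L n) {φ : Chart K L} {a b : ℤ} (ha0 : 0 ≤ a) (hb0 : 0 ≤ b)
    (ha : a ≤ 2 * n) (hb : b ≤ 2 * n) {A : Finset (Site K L)} (h : Framed φ a b A) :
    (((ends (1, 0) A).card : ℤ) = b ∧ ((ends (0, 1) A).card : ℤ) = a) ∨
      (((ends (1, 0) A).card : ℤ) = a ∧ ((ends (0, 1) A).card : ℤ) = b) := by
  have key : ∀ {ψ : Chart K L} {a b : ℤ}, Framed ψ a b A → ∀ i i' j, 0 ≤ i → i < i' → i' < a →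
      0 ≤ j → j < b → ψ.pt i j ∈ A → ψ.pt i' j ∈ A → ψ.pt (i + 1) j ∈ A := by
    intro ψ a b h i i' j i1 i2 i3 j1 j2 hi hi'
    by_cases hj0 : j = 0
    · subst hj0
      exact h.2.1.convex i1 (by omega : i ≤ i + 1) (by omega : i + 1 ≤ i') i3 hi hi'
    by_cases hjb : j = b - 1
    · subst hjb
      exact h.2.2.1.convex i1 (by omega : i ≤ i + 1) (by omega : i + 1 ≤ i') i3 hi hi'
    by_cases hia : i + 1 = i'
    · rwa [hia]
    exact h.1.2 _ _ (by omega) (by omega) (by omega) (by omega)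
  refine Chart.card_ends_of_convex D ha0 hb0 ha hb h.1.1 (key h) ?_ (fun j => h.row_nonempty) ?_
  · intro i j j' i1 i2 i3 j1 j2 hi hi'
    simpa only [Chart.swap_pt] using key h.swap j j' i i1 i2 i3 j1 j2
      (by simpa only [Chart.swap_pt]) (by simpa only [Chart.swap_pt])
  · intro i i1 i2
    simpa only [Chart.swap_pt] using h.swap.row_nonempty i1 i2

theorem Framed.hper_eq (D : Dims K L n) {φ : Chart K L} {a b : ℤ} (ha0 : 0 ≤ a) (hb0 : 0 ≤ b)
    (ha : a ≤ 2 * n) (hb : b ≤ 2 * n) {A : Finset (Site K L)} (h : Framed φ a b A) :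
    hper A = a + b := by
  have := h.card_ends D ha0 hb0 ha hb
  unfold hper
  omega

theorem Chart.deg_corner (D : Dims K L n) {φ : Chart K L} :
    deg (φ.box n n) (φ.pt 0 0) = 2 := by
  have hn := D.two_le
  have h1 : φ.pt (0 + 1) 0 ∈ φ.box n n :=
    Chart.pt_mem_box (by omega) (by omega) (by omega) (by omega)
  have h2 : φ.pt 0 (0 + 1) ∈ φ.box n n :=
    Chart.pt_mem_box (by omega) (by omega) (by omega) (by omega)
  rw [φ.deg_pt, ind_of_mem h1, ind_of_mem h2, ind_of_notMem, ind_of_notMem]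
  · rfl
  · rw [Chart.pt_mem_box_iff D (by omega) (by omega) (by omega) (by omega)]
    omega
  · rw [Chart.pt_mem_box_iff D (by omega) (by omega) (by omega) (by omega)]
    omega

/-- The squares are the ground states, and the other layers have the next value of the half
perimeter. -/
theorem IsLayer.hper_eq (D : Dims K L n) {A : Finset (Site K L)} {i : Fin 5} (h : IsLayer n A i) :
    hper A = if i = 0 then 2 * (n : ℤ) else 2 * n + 1 := by
  have hn := D.two_le
  fin_cases i
  · obtain ⟨φ, rfl⟩ := h
    rw [Chart.hper_box D (by omega) (by omega) (by omega) (by omega)]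
    change (n : ℤ) + n = 2 * n
    ring
  · obtain ⟨φ, z, hz, hd, rfl⟩ := h
    have hc : φ.pt 0 0 ∈ φ.box n n := Chart.pt_mem_box le_rfl (by omega) le_rfl (by omega)
    have hc2 : deg (φ.box n n) (φ.pt 0 0) = 2 := Chart.deg_corner D
    have h1 := hper_insert D hz
    have h2 := hper_erase D hc
    have h3 := Chart.hper_box (φ := φ) D (a := n) (b := n) (by omega) (by omega) (by omega)
      (by omega)
    rw [if_neg (by decide)]
    omega
  · obtain ⟨φ, h⟩ := h
    rw [h.hper_eq D (by omega) (by omega) (by omega) (by omega), if_neg (by decide)]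
    ring
  · obtain ⟨φ, z, hz, hd, rfl⟩ := h
    have h1 := hper_insert D hz
    have h3 := Chart.hper_box (φ := φ) D (a := n - 1) (b := n + 1) (by omega) (by omega) (by omega)
      (by omega)
    rw [if_neg (by decide)]
    omega
  · obtain ⟨φ, h⟩ := h
    rw [h.hper_eq D (by omega) (by omega) (by omega) (by omega), if_neg (by decide)]
    ring

end MetaHierarchy

/-! ### Paths -/

namespace MetaHierarchy

variable {K L n : ℕ}

/-- A particle moves to a vacant neighbouring site. -/
def Step (A B : Finset (Site K L)) : Prop :=
  ∃ x y, x ∈ A ∧ y ∉ A ∧ Nbr x y ∧ B = insert y (A.erase x)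

/-- There is a path from `A` to `B` all of whose configurations except possibly the last one are
in `S`. -/
def Reach (S : Finset (Site K L) → Prop) : Finset (Site K L) → Finset (Site K L) → Prop :=
  Relation.ReflTransGen fun A B => S A ∧ Step A B

variable {S : Finset (Site K L) → Prop}

theorem Step.symm (D : Dims K L n) {A B : Finset (Site K L)} (h : Step A B) : Step B A := by
  obtain ⟨x, y, hx, hy, hxy, rfl⟩ := h
  have hne := hxy.ne D
  refine ⟨y, x, Finset.mem_insert_self _ _, ?_, hxy.symm, ?_⟩
  · rw [Finset.mem_insert, not_or]
    exact ⟨hne, Finset.notMem_erase _ _⟩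
  · rw [Finset.erase_insert (fun h => hy (Finset.mem_of_mem_erase h)), Finset.insert_erase hx]

theorem Reach.refl (A : Finset (Site K L)) : Reach S A A := Relation.ReflTransGen.refl

theorem Reach.trans {A B C : Finset (Site K L)} (h : Reach S A B) (h' : Reach S B C) :
    Reach S A C := Relation.ReflTransGen.trans h h'

theorem Reach.mono {T : Finset (Site K L) → Prop} (hST : ∀ A, S A → T A)
    {A B : Finset (Site K L)} (h : Reach S A B) : Reach T A B :=
  Relation.ReflTransGen.mono (fun _ _ h => ⟨hST _ h.1, h.2⟩) _ _ h

theorem Reach.step (D : Dims K L n) {W : Finset (Site K L)} {x y : Site K L} (hx : x ∉ W)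
    (hy : y ∉ W) (hxy : Nbr x y) (hS : S (insert x W)) : Reach S (insert x W) (insert y W) := by
  refine Relation.ReflTransGen.single ⟨hS, x, y, Finset.mem_insert_self _ _, ?_, hxy, ?_⟩
  · rw [Finset.mem_insert, not_or]
    exact ⟨(hxy.ne D).symm, hy⟩
  · rw [Finset.erase_insert hx]

theorem Step.card_eq {A B : Finset (Site K L)} (h : Step A B) : B.card = A.card := by
  obtain ⟨x, y, hx, hy, -, rfl⟩ := h
  rw [Finset.card_insert_of_notMem (fun h => hy (Finset.mem_of_mem_erase h)),
    Finset.card_erase_add_one hx]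

theorem Reach.card_eq {A B : Finset (Site K L)} (h : Reach S A B) : B.card = A.card := by
  induction h with
  | refl => rfl
  | tail _ h ih => rw [h.2.card_eq, ih]

/-- A particle moves along a line of vacant sites, downwards in the parametrization. -/
theorem reach_insert_desc (D : Dims K L n) {W : Finset (Site K L)} (f : ℤ → Site K L) {s e : ℤ}
    (hse : s ≤ e) (hW : ∀ t, s ≤ t → t ≤ e → f t ∉ W)
    (hf : ∀ t, s ≤ t → t < e → Nbr (f t) (f (t + 1)))
    (hS : ∀ t, s < t → t ≤ e → S (insert (f t) W)) :
    Reach S (insert (f e) W) (insert (f s) W) := by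
  induction e, hse using Int.leInduction with
  | base => exact .refl _
  | succ e hse ih =>
    exact (Reach.step D (hW _ (by omega) le_rfl) (hW e hse (by omega))
      (hf e hse (by omega)).symm (hS _ (by omega) le_rfl)).trans
      (ih (fun t t1 t2 => hW t t1 (by omega)) (fun t t1 t2 => hf t t1 (by omega))
        fun t t1 t2 => hS t t1 (by omega))

/-- A particle moves along a line of vacant sites, upwards in the parametrization. -/
theorem reach_insert_asc (D : Dims K L n) {W : Finset (Site K L)} (f : ℤ → Site K L) {s e : ℤ}
    (hse : s ≤ e) (hW : ∀ t, s ≤ t → t ≤ e → f t ∉ W)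
    (hf : ∀ t, s ≤ t → t < e → Nbr (f t) (f (t + 1)))
    (hS : ∀ t, s ≤ t → t < e → S (insert (f t) W)) :
    Reach S (insert (f s) W) (insert (f e) W) := by
  have := reach_insert_desc D (W := W) (S := S) (fun t => f (-t)) (s := -e) (e := -s) (by omega)
    (fun t t1 t2 => hW _ (by omega) (by omega)) (fun t t1 t2 => by
      have := (hf (-(t + 1)) (by omega) (by omega)).symm
      rwa [show -(t + 1) + 1 = -t by ring] at this) fun t t1 t2 => hS _ (by omega) (by omega)
  simpa only [neg_neg] using this

/-- A hole moves along a line of occupied sites, downwards in the parametrization. -/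
theorem reach_erase_desc (D : Dims K L n) {U : Finset (Site K L)} (f : ℤ → Site K L) {s e : ℤ}
    (hse : s ≤ e) (hU : ∀ t, s ≤ t → t ≤ e → f t ∈ U)
    (hf : ∀ t, s ≤ t → t < e → Nbr (f t) (f (t + 1)))
    (hS : ∀ t, s < t → t ≤ e → S (U.erase (f t))) :
    Reach S (U.erase (f e)) (U.erase (f s)) := by
  induction e, hse using Int.leInduction with
  | base => exact .refl _
  | succ e hse ih =>
    refine Reach.trans (B := U.erase (f e)) ?_
      (ih (fun t t1 t2 => hU t t1 (by omega)) (fun t t1 t2 => hf t t1 (by omega))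
        fun t t1 t2 => hS t t1 (by omega))
    have hnb := hf e hse (by omega)
    have hne := hnb.ne D
    refine Relation.ReflTransGen.single ⟨hS _ (by omega) le_rfl, f e, f (e + 1),
      Finset.mem_erase.2 ⟨hne, hU e hse (by omega)⟩, Finset.notMem_erase _ _, hnb, ?_⟩
    rw [Finset.erase_right_comm, Finset.insert_erase]
    exact Finset.mem_erase.2 ⟨hne.symm, hU _ (by omega) le_rfl⟩

/-- A hole moves along a line of occupied sites, upwards in the parametrization. -/
theorem reach_erase_asc (D : Dims K L n) {U : Finset (Site K L)} (f : ℤ → Site K L) {s e : ℤ}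
    (hse : s ≤ e) (hU : ∀ t, s ≤ t → t ≤ e → f t ∈ U)
    (hf : ∀ t, s ≤ t → t < e → Nbr (f t) (f (t + 1)))
    (hS : ∀ t, s ≤ t → t < e → S (U.erase (f t))) :
    Reach S (U.erase (f s)) (U.erase (f e)) := by
  have := reach_erase_desc D (U := U) (S := S) (fun t => f (-t)) (s := -e) (e := -s) (by omega)
    (fun t t1 t2 => hU _ (by omega) (by omega)) (fun t t1 t2 => by
      have := (hf (-(t + 1)) (by omega) (by omega)).symm
      rwa [show -(t + 1) + 1 = -t by ring] at this) fun t t1 t2 => hS _ (by omega) (by omega)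
  simpa only [neg_neg] using this

namespace Chart

variable (φ : Chart K L)

theorem nbr_col (i j : ℤ) : Nbr (φ.pt i j) (φ.pt i (j + 1)) := φ.nbr_pt.2 (.inr (.inr (.inl rfl)))

theorem nbr_row (i j : ℤ) : Nbr (φ.pt i j) (φ.pt (i + 1) j) := φ.nbr_pt.2 (.inl rfl)

end Chart

/-- The configurations that may be visited between two layers: those of height `2 * n + 2`, and
those of the layer `j`. -/
def Passable (n : ℕ) (j : Fin 5) (A : Finset (Site K L)) : Prop :=
  hper A = 2 * n + 2 ∨ IsLayer n A j

/-- Outside a box around a core, a particle moves freely. -/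
theorem IsCore.passable (D : Dims K L n) {φ : Chart K L} {a b : ℤ} (ha : a ≤ 2 * n - 1)
    (hb : b ≤ 2 * n - 1) {W : Finset (Site K L)} (hW : hper W = 2 * n) (hWb : W ⊆ φ.box a b)
    {j : Fin 5} (hj : ∀ z, z ∉ φ.box a b → deg W z = 1 → IsLayer n (insert z W) j)
    {z : Site K L} (hz : z ∉ φ.box a b) : Passable n j (insert z W) := by
  have h1 := hper_insert D (fun h => hz (hWb h) : z ∉ W)
  have h2 := deg_mono hWb z
  have h3 := Chart.deg_box_le_one D ha hb hz
  have h4 := deg_nonneg W z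
  rcases (by omega : deg W z = 0 ∨ deg W z = 1) with h | h
  · exact .inl (by omega)
  · exact .inr (hj z hz h)

/-- From `Ω^1` the attached particle moves around the square to the missing corner. -/
theorem reach_square (D : Dims K L n) {A : Finset (Site K L)} (hA : IsLayer n A 1) :
    ∃ B, IsLayer n B 0 ∧ Reach (Passable n 1) A B := by
  have hn := D.two_le
  obtain ⟨φ, z, hz, hd, rfl⟩ := hA
  have hc : φ.pt 0 0 ∈ φ.box n n := Chart.pt_mem_box le_rfl (by omega) le_rfl (by omega)
  set W := (φ.box n n).erase (φ.pt 0 0) with hWdef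
  have hWp : hper W = 2 * n := by
    have h1 := hper_erase D hc
    rw [← hWdef, Chart.deg_corner D,
      Chart.hper_box D (by omega) (by omega) (by omega) (by omega)] at h1
    omega
  have hcW : φ.pt 0 0 ∉ W := Finset.notMem_erase _ _
  have hdc : deg W (φ.pt 0 0) = 2 := by rw [deg_erase_self D, Chart.deg_corner D]
  have hzb : z ∉ φ.box n n := fun h => by
    rw [Finset.mem_erase, not_and_or, not_not] at hz
    rcases hz with rfl | hz
    · omega
    · exact hz h
  obtain ⟨x, hx, hxz⟩ := Chart.exists_nbr_of_deg_pos (by omega : 0 < deg W z)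
  obtain ⟨ψ, a, b, hab, hbox, j, j1, j2, -, rfl⟩ :=
    Chart.exists_outer (Finset.mem_of_mem_erase hx) hzb hxz
  obtain ⟨rfl, rfl⟩ : a = n ∧ b = n := by omega
  -- a reflection brings the missing corner to the side `0` of the second axis
  obtain ⟨χ, hχ, l, l1, l2, hl, k, hk, hkc⟩ : ∃ χ : Chart K L, χ.box n n = φ.box n n ∧ ∃ l : ℤ,
      0 ≤ l ∧ l < n ∧ χ.pt n l = ψ.pt n j ∧ ∃ k : ℤ, (0 ≤ k ∧ k < n) ∧ χ.pt k 0 = φ.pt 0 0 := by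
    have hcψ := hc
    rw [← hbox] at hcψ
    obtain ⟨k, k', k1, k2, k3, k4, hkc⟩ := Chart.mem_box.1 hcψ
    have hdeg : deg (ψ.box n n) (ψ.pt k k') = 2 := by rw [hbox, hkc, Chart.deg_corner D]
    have hk' : k' = 0 ∨ k' = n - 1 := by
      by_contra hcon
      have key : ∀ k l : ℤ, 0 ≤ k → k < n → 0 ≤ l → l < n → ind (ψ.box n n) (ψ.pt k l) = 1 :=
        fun k l k1 k2 l1 l2 => ind_of_mem (Chart.pt_mem_box k1 k2 l1 l2)
      rw [ψ.deg_pt, key k (k' + 1) k1 k2 (by omega) (by omega),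
        key k (k' - 1) k1 k2 (by omega) (by omega)] at hdeg
      have b1 := ind_nonneg (ψ.box n n) (ψ.pt (k + 1) k')
      have b2 := ind_nonneg (ψ.box n n) (ψ.pt (k - 1) k')
      by_cases hk0 : k = 0
      · have := key (k + 1) k' (by omega) (by omega) k3 k4
        omega
      · have := key (k - 1) k' (by omega) (by omega) k3 k4
        omega
    rcases hk' with rfl | rfl
    · exact ⟨ψ, hbox, j, j1, j2, rfl, k, ⟨k1, k2⟩, hkc⟩
    · refine ⟨(ψ.swap.flip n).swap, by simpa using hbox, n - 1 - j, by omega, by omega, ?_, k,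
        ⟨k1, k2⟩, ?_⟩
      · simp
      · simpa using hkc
  have hout : ∀ {s t : ℤ}, -1 ≤ s → s ≤ n → -1 ≤ t → t ≤ n → (s = n ∨ t = -1) →
      χ.pt s t ∉ φ.box n n := by
    intro s t s1 s2 t1 t2 hst hm
    rw [← hχ, Chart.pt_mem_box_iff D (by omega) (by omega) (by omega) (by omega)] at hm
    omega
  have hWsub : W ⊆ φ.box n n := Finset.erase_subset _ _
  have hS : ∀ {s t : ℤ}, -1 ≤ s → s ≤ n → -1 ≤ t → t ≤ n → (s = n ∨ t = -1) →
      Passable n 1 (insert (χ.pt s t) W) := fun s1 s2 t1 t2 hst =>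
    IsCore.passable D (j := 1) (by omega) (by omega) hWp hWsub
      (fun z hz hd => ⟨φ, z, fun h => hz (hWsub h), hd, rfl⟩) (hout s1 s2 t1 t2 hst)
  refine ⟨φ.box n n, ⟨φ, rfl⟩, ?_⟩
  have hW' : ∀ {s t : ℤ}, -1 ≤ s → s ≤ n → -1 ≤ t → t ≤ n → (s = n ∨ t = -1) →
      χ.pt s t ∉ W := fun s1 s2 t1 t2 hst h => hout s1 s2 t1 t2 hst (hWsub h)
  have r1 : Reach (Passable n 1) (insert (χ.pt n l) W) (insert (χ.pt n (-1)) W) :=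
    reach_insert_desc D (fun t => χ.pt n t) (by omega) (fun t t1 t2 => hW' (by omega) le_rfl t1
      (by omega) (.inl rfl)) (fun t t1 t2 => χ.nbr_col _ _) fun t t1 t2 => hS (by omega) le_rfl
        (by omega) (by omega) (.inl rfl)
  have r2 : Reach (Passable n 1) (insert (χ.pt n (-1)) W) (insert (χ.pt k (-1)) W) :=
    reach_insert_desc D (fun t => χ.pt t (-1)) (by omega) (fun t t1 t2 => hW' (by omega) (by omega)
      le_rfl (by omega) (.inr rfl)) (fun t t1 t2 => χ.nbr_row _ _) fun t t1 t2 => hS (by omega)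
        (by omega) le_rfl (by omega) (.inr rfl)
  have r3 : Reach (Passable n 1) (insert (χ.pt k (-1)) W) (insert (χ.pt k 0) W) :=
    Reach.step D (hW' (by omega) (by omega) le_rfl (by omega) (.inr rfl)) (by rwa [hkc])
      (χ.nbr_col _ _) (hS (by omega) (by omega) le_rfl (by omega) (.inr rfl))
  have := (r1.trans r2).trans r3
  rwa [hkc, hl, hWdef, Finset.insert_erase hc] at this

end MetaHierarchy

namespace MetaHierarchy

variable {K L n : ℕ}

/-- If the square that contains the rest of the configuration is known, then so is the layer. -/
theorem isLayer_one_of_subset (D : Dims K L n) {A : Finset (Site K L)} (hA : A.card = n ^ 2)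
    (hp : hper A = 2 * n + 1) {z : Site K L} (hz : z ∈ A) (hd : deg A z ≤ 1) {φ : Chart K L}
    (h : A.erase z ⊆ φ.box n n) : IsLayer n A 1 := by
  have hn := D.two_le
  have h1 := hper_erase D hz
  have hc : (A.erase z).card + 1 = n ^ 2 := by
    rw [Finset.card_erase_add_one hz, hA]
  have hc' : ((A.erase z).card : ℤ) + 1 = n ^ 2 := by exact_mod_cast hc
  have h2 := two_mul_le_hper D (A := A.erase z) (by omega) (by nlinarith)
  have h3 : deg (A.erase z) z = 1 := by
    rw [deg_erase_self D]
    omega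
  obtain ⟨ψ, hψ⟩ := erase_corner_of_subset D (by omega) hc h
  refine ⟨ψ, z, ?_, ?_, ?_⟩
  · rw [← hψ]
    exact Finset.notMem_erase _ _
  · rwa [← hψ]
  · rw [← hψ, Finset.insert_erase hz]

/-- A particle attached to a long side of a rectangle is joined by a second one, which together with
it forms a bar. The particle first slides to the second site `(n - 1, 1)` of the side. Then the row
of the short side shifts by one site: its last particle moves to `(n - 1, 0)`, and the hole that it
leaves walks along the row to the far corner `(0, 0)`. -/
theorem reach_bar (D : Dims K L n) {χ : Chart K L} {j : ℤ} (hj : 0 ≤ j) (hj' : j < n + 1) :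
    ∃ B, Reach (Passable n 3) (insert (χ.pt (n - 1) j) (χ.box (n - 1) (n + 1))) B ∧
      (3 ≤ n → IsLayer n B 2) ∧ (n = 2 → IsLayer n B 1) := by
  have hn := D.two_le
  set W := χ.box (n - 1) (n + 1) with hW
  have hWp : hper W = 2 * n := by
    rw [hW, Chart.hper_box D (by omega) (by omega) (by omega) (by omega)]
    ring
  have hWm : ∀ s t : ℤ, -1 ≤ s → s ≤ n → -1 ≤ t → t ≤ n + 1 →
      (χ.pt s t ∈ W ↔ 0 ≤ s ∧ s < n - 1 ∧ 0 ≤ t ∧ t < n + 1) := fun s t s1 s2 t1 t2 =>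
    Chart.pt_mem_box_iff D (by omega) (by omega) (by omega) (by omega)
  have hS : ∀ t : ℤ, 0 ≤ t → t ≤ n → Passable n 3 (insert (χ.pt (n - 1) t) W) := fun t t1 t2 =>
    IsCore.passable D (j := 3) (by omega) (by omega) hWp (φ := χ) (a := n - 1) (b := n + 1)
      subset_rfl (fun z hz hd => ⟨χ, z, hz, hd, rfl⟩) (by
        rw [hWm _ _ (by omega) (by omega) (by omega) (by omega)]
        omega)
  -- the attached particle slides along the side
  have r1 : Reach (Passable n 3) (insert (χ.pt (n - 1) j) W) (insert (χ.pt (n - 1) 1) W) := by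
    rcases le_total j 1 with hj1 | hj1
    · exact reach_insert_asc D (fun t => χ.pt (n - 1) t) hj1 (fun t t1 t2 => by
        rw [hWm _ _ (by omega) (by omega) (by omega) (by omega)]
        omega) (fun t _ _ => χ.nbr_col _ _) fun t t1 t2 => hS t (by omega) (by omega)
    · exact reach_insert_desc D (fun t => χ.pt (n - 1) t) hj1 (fun t t1 t2 => by
        rw [hWm _ _ (by omega) (by omega) (by omega) (by omega)]
        omega) (fun t _ _ => χ.nbr_col _ _) fun t t1 t2 => hS t (by omega) (by omega)
  have hne : ∀ {k l k' l' : ℤ}, -1 ≤ k → k ≤ n → -1 ≤ l → l ≤ n + 1 → -1 ≤ k' → k' ≤ n →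
      -1 ≤ l' → l' ≤ n + 1 → (χ.pt k l = χ.pt k' l' ↔ k = k' ∧ l = l') := by
    intro k l k' l' k1 k2 l1 l2 k3 k4 l3 l4
    refine ⟨fun heq => Chart.pt_inj D heq (by rw [abs_le]; omega) (by rw [abs_le]; omega), ?_⟩
    rintro ⟨rfl, rfl⟩
    rfl
  set U := insert (χ.pt (n - 1) 0) (insert (χ.pt (n - 1) 1) W) with hU
  have hUm : ∀ s t : ℤ, -1 ≤ s → s ≤ n → -1 ≤ t → t ≤ n + 1 →
      (χ.pt s t ∈ U ↔ (0 ≤ s ∧ s < n - 1 ∧ 0 ≤ t ∧ t < n + 1) ∨ (s = n - 1 ∧ 0 ≤ t ∧ t ≤ 1)) := by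
    intro s t s1 s2 t1 t2
    rw [hU, Finset.mem_insert, Finset.mem_insert, hWm s t s1 s2 t1 t2,
      hne s1 s2 t1 t2 (by omega) (by omega) (by omega) (by omega),
      hne s1 s2 t1 t2 (by omega) (by omega) (by omega) (by omega)]
    omega
  have hUb : U ⊆ χ.box n (n + 1) := by
    intro x hx
    rw [hU, Finset.mem_insert, Finset.mem_insert] at hx
    rcases hx with rfl | rfl | hx
    · exact Chart.pt_mem_box (by omega) (by omega) (by omega) (by omega)
    · exact Chart.pt_mem_box (by omega) (by omega) (by omega) (by omega)
    · obtain ⟨s, t, s1, s2, t1, t2, rfl⟩ := Chart.mem_box.1 hx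
      exact Chart.pt_mem_box (by omega) (by omega) (by omega) (by omega)
  have hUp : hper U = 2 * n + 1 := by
    rw [Chart.hper_of_convex (φ := χ) D (a := n) (b := n + 1) (by omega) (by omega) (by omega)
      (by omega) hUb]
    · ring
    · intro i i' j i1 i2 i3 j1 j2
      rw [hUm _ _ (by omega) (by omega) (by omega) (by omega),
        hUm _ _ (by omega) (by omega) (by omega) (by omega),
        hUm _ _ (by omega) (by omega) (by omega) (by omega)]
      omega
    · intro i j j' i1 i2 i3 j1 j2
      rw [hUm _ _ (by omega) (by omega) (by omega) (by omega),
        hUm _ _ (by omega) (by omega) (by omega) (by omega),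
        hUm _ _ (by omega) (by omega) (by omega) (by omega)]
      omega
    · intro j j1 j2
      exact ⟨0, by omega, by omega, (hUm _ _ (by omega) (by omega) (by omega) (by omega)).2
        (by omega)⟩
    · intro j j1 j2
      exact ⟨0, by omega, by omega, (hUm _ _ (by omega) (by omega) (by omega) (by omega)).2
        (by omega)⟩
  have hUe : U.erase (χ.pt (n - 1) 0) = insert (χ.pt (n - 1) 1) W := by
    rw [hU, Finset.erase_insert]
    rw [Finset.mem_insert, hWm _ _ (by omega) (by omega) (by omega) (by omega),
      hne (by omega) (by omega) (by omega) (by omega) (by omega) (by omega) (by omega) (by omega)]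
    omega
  have hm0 : ∀ t : ℤ, 0 ≤ t → t ≤ n - 1 → χ.pt t 0 ∈ U := fun t t1 t2 =>
    (hUm _ _ (by omega) (by omega) (by omega) (by omega)).2 (by omega)
  have hout : ∀ t : ℤ, 0 ≤ t → t ≤ n - 1 → χ.pt t (0 - 1) ∉ U := fun t t1 t2 => by
    rw [hUm _ _ (by omega) (by omega) (by omega) (by omega)]
    omega
  have hm1 : ∀ t : ℤ, 0 ≤ t → t ≤ n - 1 → χ.pt t (0 + 1) ∈ U := fun t t1 t2 =>
    (hUm _ _ (by omega) (by omega) (by omega) (by omega)).2 (by omega)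
  -- the hole walks along the row of the short side
  have r2 : Reach (Passable n 3) (U.erase (χ.pt (n - 1) 0)) (U.erase (χ.pt 0 0)) := by
    refine reach_erase_desc D (fun t => χ.pt t 0) (by omega) (fun t t1 t2 => hm0 t t1 t2)
      (fun t _ _ => χ.nbr_row _ _) fun t t1 t2 => ?_
    rcases eq_or_lt_of_le t2 with rfl | t3
    · rw [hUe]
      exact hS 1 (by omega) (by omega)
    · left
      have h1 := hper_erase D (hm0 t (by omega) t2)
      rw [χ.deg_pt, ind_of_mem (hm0 _ (by omega) (by omega)),
        ind_of_mem (hm0 _ (by omega) (by omega)), ind_of_mem (hm1 _ (by omega) (by omega)),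
        ind_of_notMem (hout _ (by omega) (by omega))] at h1
      omega
  have hU0 : χ.pt (0 - 1) 0 ∉ U := by
    rw [hUm _ _ (by omega) (by omega) (by omega) (by omega)]
    omega
  have hBp := hper_erase D (hm0 0 (by omega) (by omega))
  rw [χ.deg_pt, ind_of_mem (hm0 _ (by omega) (by omega)), ind_of_notMem hU0,
    ind_of_mem (hm1 _ (by omega) (by omega)), ind_of_notMem (hout _ (by omega) (by omega))] at hBp
  rw [hUe] at r2
  have hBm : ∀ s t : ℤ, -1 ≤ s → s ≤ n → -1 ≤ t → t ≤ n + 1 →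
      (χ.pt s t ∈ U.erase (χ.pt 0 0) ↔ ((0 ≤ s ∧ s < n - 1 ∧ 0 ≤ t ∧ t < n + 1) ∨
        (s = n - 1 ∧ 0 ≤ t ∧ t ≤ 1)) ∧ ¬(s = 0 ∧ t = 0)) := by
    intro s t s1 s2 t1 t2
    rw [Finset.mem_erase, hUm s t s1 s2 t1 t2, Ne,
      hne s1 s2 t1 t2 (by omega) (by omega) (by omega) (by omega), and_comm]
  refine ⟨U.erase (χ.pt 0 0), r1.trans r2, fun hn3 => ⟨χ, ⟨(Finset.erase_subset _ _).trans hUb, ?_⟩,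
    ⟨1, n - 1, by omega, by omega, by omega, ?_⟩, ⟨0, n - 2, by omega, by omega, by omega, ?_⟩,
    ⟨1, n, by omega, by omega, by omega, ?_⟩, ⟨0, 1, by omega, by omega, by omega, ?_⟩⟩, ?_⟩
  · intro i j i1 i2 j1 j2
    rw [hBm _ _ (by omega) (by omega) (by omega) (by omega)]
    omega
  · intro i i1 i2
    rw [hBm _ _ (by omega) (by omega) (by omega) (by omega)]
    omega
  · intro i i1 i2
    rw [hBm _ _ (by omega) (by omega) (by omega) (by omega)]
    omega
  · intro i i1 i2
    rw [hBm _ _ (by omega) (by omega) (by omega) (by omega)]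
    omega
  · intro i i1 i2
    rw [hBm _ _ (by omega) (by omega) (by omega) (by omega)]
    omega
  · intro hn2
    have hn2' : (n : ℤ) = 2 := by exact_mod_cast hn2
    have hcard : (U.erase (χ.pt 0 0)).card = n ^ 2 := by
      have h1 := Chart.card_box (φ := χ) D (a := n - 1) (b := n + 1) (by omega) (by omega)
        (by omega) (by omega)
      have h2 : W.card + 1 = n ^ 2 := by
        have : (W.card : ℤ) + 1 = n ^ 2 := by
          rw [h1]
          ring
        exact_mod_cast this
      rw [(r1.trans r2).card_eq, Finset.card_insert_of_notMem, h2]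
      rw [hWm _ _ (by omega) (by omega) (by omega) (by omega)]
      omega
    have hz : χ.pt 1 0 ∈ U.erase (χ.pt 0 0) := by
      rw [hBm _ _ (by omega) (by omega) (by omega) (by omega)]
      omega
    refine isLayer_one_of_subset D hcard (by omega) hz ?_ (φ := χ.trans 0 1) ?_
    · rw [χ.deg_pt, ind_of_notMem (x := χ.pt (1 + 1) 0), ind_of_notMem (x := χ.pt (1 - 1) 0),
        ind_of_notMem (x := χ.pt 1 (0 - 1))]
      · have := ind_le_one (U.erase (χ.pt 0 0)) (χ.pt 1 (0 + 1))
        omega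
      all_goals
        rw [hBm _ _ (by omega) (by omega) (by omega) (by omega)]
        omega
    · intro x hx
      rw [Finset.mem_erase] at hx
      obtain ⟨s, t, s1, s2, t1, t2, rfl⟩ := Chart.mem_box.1 (hUb (Finset.mem_of_mem_erase hx.2))
      rw [hBm _ _ (by omega) (by omega) (by omega) (by omega)] at hx
      have hst : ¬(s = 1 ∧ t = 0) := by
        rintro ⟨rfl, rfl⟩
        exact hx.1 rfl
      refine Chart.mem_box.2 ⟨s, t - 1, by omega, by omega, by omega, by omega, ?_⟩
      rw [Chart.trans_pt]
      congr 1 <;> omega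

/-- From `Ω^3` to the preceding layer; for four particles this is `Ω^1`. -/
theorem reach_of_isLayer_three (D : Dims K L n) {A : Finset (Site K L)} (hA : IsLayer n A 3) :
    ∃ B, Reach (Passable n 3) A B ∧ (3 ≤ n → IsLayer n B 2) ∧ (n = 2 → IsLayer n B 1) := by
  have hn := D.two_le
  obtain ⟨φ, z, hz, hd, rfl⟩ := hA
  obtain ⟨x, hx, hxz⟩ := Chart.exists_nbr_of_deg_pos (hd ▸ one_pos)
  obtain ⟨ψ, a, b, hab, hbox, j, j1, j2, -, rfl⟩ := Chart.exists_outer hx hz hxz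
  rcases hab with ⟨rfl, rfl⟩ | ⟨rfl, rfl⟩
  · rw [← hbox]
    exact reach_bar D j1 j2
  · -- from a short side, the particle goes around a corner to a long side
    have hWp : hper (ψ.box (n + 1) (n - 1)) = 2 * n := by
      rw [Chart.hper_box D (by omega) (by omega) (by omega) (by omega)]
      ring
    have hm : ∀ s t : ℤ, -1 ≤ s → s ≤ n + 1 → -1 ≤ t → t ≤ n → (n + 1 ≤ s ∨ n - 1 ≤ t) →
        ψ.pt s t ∉ ψ.box (n + 1) (n - 1) := fun s t s1 s2 t1 t2 hst => by
      rw [Chart.pt_mem_box_iff D (by omega) (by omega) (by omega) (by omega)]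
      omega
    have hS : ∀ s t : ℤ, -1 ≤ s → s ≤ n + 1 → -1 ≤ t → t ≤ n → (n + 1 ≤ s ∨ n - 1 ≤ t) →
        Passable n 3 (insert (ψ.pt s t) (ψ.box (n + 1) (n - 1))) := fun s t s1 s2 t1 t2 hst =>
      IsCore.passable D (j := 3) (by omega) (by omega) hWp subset_rfl
        (fun z hz hd => ⟨ψ.swap, z, by rwa [Chart.swap_box], by rwa [Chart.swap_box], by
          rw [Chart.swap_box]⟩) (hm s t s1 s2 t1 t2 hst)
    have r1 : Reach (Passable n 3) (insert (ψ.pt (n + 1) j) (ψ.box (n + 1) (n - 1)))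
        (insert (ψ.pt (n + 1) (n - 1)) (ψ.box (n + 1) (n - 1))) :=
      reach_insert_asc D (fun t => ψ.pt (n + 1) t) (by omega)
        (fun t t1 t2 => hm _ _ (by omega) (by omega) (by omega) (by omega) (by omega))
        (fun t _ _ => ψ.nbr_col _ _)
        fun t t1 t2 => hS _ _ (by omega) (by omega) (by omega) (by omega) (by omega)
    have r2 : Reach (Passable n 3) (insert (ψ.pt (n + 1) (n - 1)) (ψ.box (n + 1) (n - 1)))
        (insert (ψ.pt n (n - 1)) (ψ.box (n + 1) (n - 1))) :=
      Reach.step D (hm _ _ (by omega) (by omega) (by omega) (by omega) (by omega))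
        (hm _ _ (by omega) (by omega) (by omega) (by omega) (by omega)) (ψ.nbr_row _ _).symm
        (hS _ _ (by omega) (by omega) (by omega) (by omega) (by omega))
    obtain ⟨B, hB, h⟩ := reach_bar D (χ := (ψ.flip (n + 1)).swap) (j := 0) le_rfl (by omega)
    rw [Chart.swap_box, Chart.flip_box, Chart.swap_pt, Chart.flip_pt, add_sub_cancel_right,
      sub_zero] at hB
    rw [← hbox]
    exact ⟨B, (r1.trans r2).trans hB, h⟩

end MetaHierarchy

/-! ### Sliding the bars of a framed configuration -/

namespace MetaHierarchy

variable {K L n : ℕ}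

@[simp] theorem Chart.flip_flip (φ : Chart K L) (a : ℤ) : (φ.flip a).flip a = φ := by
  obtain ⟨x, u, v, hax⟩ := φ
  simp only [Chart.flip, neg_neg]
  congr 1
  simp

@[simp] theorem Chart.swap_swap (φ : Chart K L) : φ.swap.swap = φ := rfl

/-- A configuration that fills the `a × b` box up to four hooks at the corners. The occupied sites
of the bottom, the top, the left and the right side of the box are those with coordinate between
`s` and `e`, with index `0`, `1`, `2` and `3` in this order. -/
structure Hooked (n : ℕ) (φ : Chart K L) (a b : ℤ) (A : Finset (Site K L))
    (s0 e0 s1 e1 s2 e2 s3 e3 : ℤ) : Prop where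
  inside : Inside φ a b A
  card_eq : A.card = n ^ 2
  hper_eq : hper A = 2 * n + 1
  range0 : 0 ≤ s0 ∧ s0 ≤ e0 ∧ e0 < a
  range1 : 0 ≤ s1 ∧ s1 ≤ e1 ∧ e1 < a
  range2 : 0 ≤ s2 ∧ s2 ≤ e2 ∧ e2 < b
  range3 : 0 ≤ s3 ∧ s3 ≤ e3 ∧ e3 < b
  bottom : ∀ i, 0 ≤ i → i < a → (φ.pt i 0 ∈ A ↔ s0 ≤ i ∧ i ≤ e0)
  top : ∀ i, 0 ≤ i → i < a → (φ.pt i (b - 1) ∈ A ↔ s1 ≤ i ∧ i ≤ e1)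
  left : ∀ j, 0 ≤ j → j < b → (φ.pt 0 j ∈ A ↔ s2 ≤ j ∧ j ≤ e2)
  right : ∀ j, 0 ≤ j → j < b → (φ.pt (a - 1) j ∈ A ↔ s3 ≤ j ∧ j ≤ e3)

namespace Hooked

variable {φ : Chart K L} {a b : ℤ} {A : Finset (Site K L)} {s0 e0 s1 e1 s2 e2 s3 e3 : ℤ}

theorem swap (h : Hooked n φ a b A s0 e0 s1 e1 s2 e2 s3 e3) :
    Hooked n φ.swap b a A s2 e2 s3 e3 s0 e0 s1 e1 where
  inside := h.inside.swap
  card_eq := h.card_eq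
  hper_eq := h.hper_eq
  range0 := h.range2
  range1 := h.range3
  range2 := h.range0
  range3 := h.range1
  bottom := by simpa only [Chart.swap_pt] using h.left
  top := by simpa only [Chart.swap_pt] using h.right
  left := by simpa only [Chart.swap_pt] using h.bottom
  right := by simpa only [Chart.swap_pt] using h.top

theorem flip (h : Hooked n φ a b A s0 e0 s1 e1 s2 e2 s3 e3) :
    Hooked n (φ.flip a) a b A (a - 1 - e0) (a - 1 - s0) (a - 1 - e1) (a - 1 - s1) s3 e3 s2 e2 where
  inside := h.inside.flip
  card_eq := h.card_eq
  hper_eq := h.hper_eq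
  range0 := by have := h.range0; omega
  range1 := by have := h.range1; omega
  range2 := h.range3
  range3 := h.range2
  bottom := fun i h1 h2 => by
    rw [Chart.flip_pt, h.bottom _ (by omega) (by omega)]
    omega
  top := fun i h1 h2 => by
    rw [Chart.flip_pt, h.top _ (by omega) (by omega)]
    omega
  left := by simpa only [Chart.flip_pt, sub_zero] using h.right
  right := by simpa only [Chart.flip_pt, sub_self] using h.left

theorem corners (h : Hooked n φ a b A s0 e0 s1 e1 s2 e2 s3 e3) :
    (s0 = 0 ↔ s2 = 0) ∧ (e0 = a - 1 ↔ s3 = 0) ∧ (s1 = 0 ↔ e2 = b - 1) ∧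
      (e1 = a - 1 ↔ e3 = b - 1) := by
  have r0 := h.range0
  have r1 := h.range1
  have r2 := h.range2
  have r3 := h.range3
  have h1 := h.bottom 0 le_rfl (by omega)
  have h2 := h.left 0 le_rfl (by omega)
  have h3 := h.bottom (a - 1) (by omega) (by omega)
  have h4 := h.right 0 (by omega) (by omega)
  have h5 := h.top 0 (by omega) (by omega)
  have h6 := h.left (b - 1) (by omega) (by omega)
  have h7 := h.top (a - 1) (by omega) (by omega)
  have h8 := h.right (b - 1) (by omega) (by omega)
  rw [h1] at h2
  rw [h3] at h4
  rw [h5] at h6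
  rw [h7] at h8
  omega

theorem framed (h : Hooked n φ a b A s0 e0 s1 e1 s2 e2 s3 e3) (h0 : s0 < e0) (h1 : s1 < e1)
    (h2 : s2 < e2) (h3 : s3 < e3) : Framed φ a b A :=
  ⟨h.inside, ⟨s0, e0, h.range0.1, h0, h.range0.2.2, h.bottom⟩,
    ⟨s1, e1, h.range1.1, h1, h.range1.2.2, h.top⟩, ⟨s2, e2, h.range2.1, h2, h.range2.2.2, h.left⟩,
    ⟨s3, e3, h.range3.1, h3, h.range3.2.2, h.right⟩⟩

/-- The left bar moves up by one site: a hole walks along the bar from its upper to its lower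
end. -/
theorem slide_up (D : Dims K L n) {k : Fin 5} (h : Hooked n φ a b A s0 e0 s1 e1 s2 e2 s3 e3)
    (hS : Passable n k A) (ha : 3 ≤ a) (hb : 3 ≤ b) (ha' : a ≤ 2 * n - 1) (hb' : b ≤ 2 * n - 1)
    (h0 : s0 < e0) (h1 : s1 < e1) (h2 : s2 < e2) (hup : e2 ≤ b - 2)
    (hcl : e2 = b - 2 → s1 = 1) : ∃ A' s0' s1', Reach (Passable n k) A A' ∧
      Hooked n φ a b A' s0' e0 s1' e1 (s2 + 1) (e2 + 1) s3 e3 ∧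
      (s2 = 0 → s0' = 1) ∧ (s2 ≠ 0 → s0' = s0) ∧ (e2 = b - 2 → s1' = 0) ∧
      (e2 ≠ b - 2 → s1' = s1) := by
  have r0 := h.range0
  have r1 := h.range1
  have r2 := h.range2
  have r3 := h.range3
  have hc := h.corners
  have hne : ∀ {k l k' l' : ℤ}, -1 ≤ k → k ≤ a → -1 ≤ l → l ≤ b → -1 ≤ k' → k' ≤ a → -1 ≤ l' →
      l' ≤ b → (φ.pt k l = φ.pt k' l' ↔ k = k' ∧ l = l') := by
    intro k l k' l' k1 k2 l1 l2 k3 k4 l3 l4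
    refine ⟨fun heq => Chart.pt_inj D heq (by rw [abs_le]; omega) (by rw [abs_le]; omega), ?_⟩
    rintro ⟨rfl, rfl⟩
    rfl
  have hnot : ∀ k l, -1 ≤ k → k ≤ a → -1 ≤ l → l ≤ b → ¬(0 ≤ k ∧ k < a ∧ 0 ≤ l ∧ l < b) →
      φ.pt k l ∉ A := by
    intro k l k1 k2 l1 l2 hout hm
    exact hout ((Chart.pt_mem_box_iff D (by omega) (by omega) (by omega) (by omega)).1
      (h.inside.1 hm))
  have hy : φ.pt 0 (e2 + 1) ∉ A := by
    rw [h.left _ (by omega) (by omega)]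
    omega
  have h1m : ∀ j, 1 ≤ j → j ≤ e2 + 1 → φ.pt 1 j ∈ A := by
    intro j j1 j2
    by_cases hj : j = b - 1
    · subst hj
      rw [h.top _ (by omega) (by omega)]
      omega
    · exact h.inside.2 _ _ le_rfl (by omega) j1 (by omega)
  have hout : ∀ j, -1 ≤ j → j ≤ b → φ.pt (0 - 1) j ∉ A := fun j j1 j2 =>
    hnot _ _ (by omega) (by omega) j1 j2 (by omega)
  have hdy : deg A (φ.pt 0 (e2 + 1)) = 2 := by
    rw [φ.deg_pt, zero_add, ind_of_mem (h1m _ (by omega) le_rfl),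
      ind_of_notMem (hout _ (by omega) (by omega)), add_sub_cancel_right,
      ind_of_mem ((h.left e2 (by omega) (by omega)).2 (by omega)), ind_of_notMem]
    · norm_num
    · by_cases hj : e2 + 1 + 1 = b
      · exact hnot _ _ (by omega) (by omega) (by omega) (by omega) (by omega)
      · rw [h.left _ (by omega) (by omega)]
        omega
  have hpU := hper_insert D hy
  rw [hdy, h.hper_eq] at hpU
  have hUm : ∀ k l, -1 ≤ k → k ≤ a → -1 ≤ l → l ≤ b → (φ.pt k l ∈ insert (φ.pt 0 (e2 + 1)) A ↔
      (k = 0 ∧ l = e2 + 1) ∨ φ.pt k l ∈ A) := by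
    intro k l k1 k2 l1 l2
    rw [Finset.mem_insert, hne k1 k2 l1 l2 (by omega) (by omega) (by omega) (by omega)]
  have hcol : ∀ j, s2 ≤ j → j ≤ e2 + 1 → φ.pt 0 j ∈ insert (φ.pt 0 (e2 + 1)) A := by
    intro j j1 j2
    rw [hUm _ _ (by omega) (by omega) (by omega) (by omega), h.left _ (by omega) (by omega)]
    omega
  have hcol1 : ∀ j, 1 ≤ j → j ≤ e2 → φ.pt (0 + 1) j ∈ insert (φ.pt 0 (e2 + 1)) A := by
    intro j j1 j2
    rw [hUm _ _ (by omega) (by omega) (by omega) (by omega)]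
    exact .inr (h1m j j1 (by omega))
  have hcol2 : ∀ j, 0 ≤ j → j ≤ e2 → φ.pt (0 - 1) j ∉ insert (φ.pt 0 (e2 + 1)) A := by
    intro j j1 j2
    rw [hUm _ _ (by omega) (by omega) (by omega) (by omega), not_or]
    exact ⟨by omega, hout j (by omega) (by omega)⟩
  have hUe : (insert (φ.pt 0 (e2 + 1)) A).erase (φ.pt 0 (e2 + 1)) = A := Finset.erase_insert hy
  have hreach : Reach (Passable n k) ((insert (φ.pt 0 (e2 + 1)) A).erase (φ.pt 0 (e2 + 1)))
      ((insert (φ.pt 0 (e2 + 1)) A).erase (φ.pt 0 s2)) := by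
    refine reach_erase_desc D (fun t => φ.pt 0 t) (by omega) hcol (fun t _ _ => φ.nbr_col _ _)
      fun t t1 t2 => ?_
    rcases eq_or_lt_of_le t2 with rfl | t3
    · rwa [hUe]
    · left
      have g1 := hper_erase D (hcol t t1.le t2)
      rw [φ.deg_pt, ind_of_mem (hcol1 t (by omega) (by omega)),
        ind_of_mem (hcol (t + 1) (by omega) (by omega)),
        ind_of_mem (hcol (t - 1) (by omega) (by omega)),
        ind_of_notMem (hcol2 t (by omega) (by omega)), hpU] at g1
      omega
  have hcard := hreach.card_eq
  rw [hUe] at hreach hcard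
  have hper' := hper_erase D (hcol s2 le_rfl (by omega))
  have h1s : φ.pt (0 + 1) s2 ∈ insert (φ.pt 0 (e2 + 1)) A := by
    by_cases hs : s2 = 0
    · rw [hUm _ _ (by omega) (by omega) (by omega) (by omega), hs, h.bottom _ (by omega) (by omega)]
      omega
    · exact hcol1 _ (by omega) (by omega)
  have h0s : φ.pt 0 (s2 - 1) ∉ insert (φ.pt 0 (e2 + 1)) A := by
    rw [hUm _ _ (by omega) (by omega) (by omega) (by omega), not_or]
    refine ⟨by omega, ?_⟩
    by_cases hs : s2 = 0
    · exact hnot _ _ (by omega) (by omega) (by omega) (by omega) (by omega)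
    · rw [h.left _ (by omega) (by omega)]
      omega
  rw [φ.deg_pt, ind_of_mem h1s, ind_of_mem (hcol (s2 + 1) (by omega) (by omega)),
    ind_of_notMem h0s, ind_of_notMem (hcol2 s2 (by omega) (by omega)), hpU] at hper'
  have hm : ∀ k l, 0 ≤ k → k < a → 0 ≤ l → l < b →
      (φ.pt k l ∈ (insert (φ.pt 0 (e2 + 1)) A).erase (φ.pt 0 s2) ↔
      ¬(k = 0 ∧ l = s2) ∧ ((k = 0 ∧ l = e2 + 1) ∨ φ.pt k l ∈ A)) := by
    intro k l k1 k2 l1 l2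
    rw [Finset.mem_erase, Ne, hne (by omega) (by omega) (by omega) (by omega) (by omega) (by omega)
      (by omega) (by omega), hUm _ _ (by omega) (by omega) (by omega) (by omega)]
  refine ⟨_, if s2 = 0 then 1 else s0, if e2 = b - 2 then 0 else s1, hreach,
    ⟨⟨?_, ?_⟩, by rw [hcard, h.card_eq], by omega, ?_, ?_, ?_, r3, ?_, ?_, ?_, ?_⟩, ?_, ?_, ?_, ?_⟩
  · refine (Finset.erase_subset _ _).trans (Finset.insert_subset ?_ h.inside.1)
    exact Chart.pt_mem_box le_rfl (by omega) (by omega) (by omega)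
  · intro i j i1 i2 j1 j2
    rw [hm _ _ (by omega) (by omega) (by omega) (by omega)]
    exact ⟨by omega, .inr (h.inside.2 i j i1 i2 j1 j2)⟩
  · split_ifs <;> omega
  · split_ifs <;> omega
  · omega
  · intro i i1 i2
    rw [hm _ _ (by omega) (by omega) (by omega) (by omega), h.bottom i i1 i2]
    split_ifs <;> omega
  · intro i i1 i2
    rw [hm _ _ (by omega) (by omega) (by omega) (by omega), h.top i i1 i2]
    split_ifs <;> omega
  · intro i i1 i2
    rw [hm _ _ (by omega) (by omega) (by omega) (by omega), h.left i i1 i2]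
    omega
  · intro i i1 i2
    rw [hm _ _ (by omega) (by omega) (by omega) (by omega), h.right i i1 i2]
    omega
  all_goals
    intro hs
    simp [hs]

/-- The left bar moves down by one site. -/
theorem slide_down (D : Dims K L n) {k : Fin 5} (h : Hooked n φ a b A s0 e0 s1 e1 s2 e2 s3 e3)
    (hS : Passable n k A) (ha : 3 ≤ a) (hb : 3 ≤ b) (ha' : a ≤ 2 * n - 1) (hb' : b ≤ 2 * n - 1)
    (h0 : s0 < e0) (h1 : s1 < e1) (h2 : s2 < e2) (hdn : 1 ≤ s2)
    (hcl : s2 = 1 → s0 = 1) : ∃ A' s0' s1', Reach (Passable n k) A A' ∧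
      Hooked n φ a b A' s0' e0 s1' e1 (s2 - 1) (e2 - 1) s3 e3 ∧
      (e2 = b - 1 → s1' = 1) ∧ (e2 ≠ b - 1 → s1' = s1) ∧ (s2 = 1 → s0' = 0) ∧
      (s2 ≠ 1 → s0' = s0) := by
  obtain ⟨A', s1', s0', hr, hA', g1, g2, g3, g4⟩ :=
    slide_up D h.swap.flip.swap hS ha hb ha' hb' h1 h0
    (by omega) (by omega) (by omega)
  have := hA'.swap.flip.swap
  simp only [Chart.swap_swap, Chart.flip_flip] at this
  refine ⟨A', s0', s1', hr, ?_, by omega, by omega, by omega, by omega⟩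
  convert this using 1 <;> omega

/-- The bottom bar moves to the left by one site. -/
theorem slide_bottom (D : Dims K L n) {k : Fin 5} (h : Hooked n φ a b A s0 e0 s1 e1 s2 e2 s3 e3)
    (hS : Passable n k A) (ha : 3 ≤ a) (hb : 3 ≤ b) (ha' : a ≤ 2 * n - 1) (hb' : b ≤ 2 * n - 1)
    (h0 : s0 < e0) (h2 : s2 < e2) (h3 : s3 < e3) (hdn : 1 ≤ s0)
    (hcl : s0 = 1 → s2 = 1) : ∃ A' s2' s3', Reach (Passable n k) A A' ∧
      Hooked n φ a b A' (s0 - 1) (e0 - 1) s1 e1 s2' e2 s3' e3 ∧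
      (e0 = a - 1 → s3' = 1) ∧ (e0 ≠ a - 1 → s3' = s3) ∧ (s0 = 1 → s2' = 0) ∧
      (s0 ≠ 1 → s2' = s2) := by
  obtain ⟨A', s2', s3', hr, hA', g⟩ := slide_down D h.swap hS hb ha hb' ha' h2 h3 h0 hdn hcl
  exact ⟨A', s2', s3', hr, hA'.swap, g⟩

/-- The top bar moves to the left by one site. -/
theorem slide_top (D : Dims K L n) {k : Fin 5} (h : Hooked n φ a b A s0 e0 s1 e1 s2 e2 s3 e3)
    (hS : Passable n k A) (ha : 3 ≤ a) (hb : 3 ≤ b) (ha' : a ≤ 2 * n - 1) (hb' : b ≤ 2 * n - 1)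
    (h1 : s1 < e1) (h2 : s2 < e2) (h3 : s3 < e3) (hdn : 1 ≤ s1)
    (hcl : s1 = 1 → e2 = b - 2) : ∃ A' e2' e3', Reach (Passable n k) A A' ∧
      Hooked n φ a b A' s0 e0 (s1 - 1) (e1 - 1) s2 e2' s3 e3' ∧
      (e1 = a - 1 → e3' = b - 2) ∧ (e1 ≠ a - 1 → e3' = e3) ∧ (s1 = 1 → e2' = b - 1) ∧
      (s1 ≠ 1 → e2' = e2) := by
  obtain ⟨A', s2', s3', hr, hA', g1, g2, g3, g4⟩ := slide_down D h.swap.flip hS hb ha hb' ha'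
    (by omega) (by omega) h1 hdn (by omega)
  have := hA'.flip.swap
  simp only [Chart.swap_swap, Chart.flip_flip] at this
  refine ⟨A', b - 1 - s2', b - 1 - s3', hr, ?_, by omega, by omega, by omega, by omega⟩
  convert this using 1 <;> omega

end Hooked

end MetaHierarchy

/-! ### Framed configurations reach the preceding layer -/

namespace MetaHierarchy

variable {K L n : ℕ}

namespace Hooked

variable {φ : Chart K L} {a b : ℤ} {A : Finset (Site K L)} {s0 e0 s1 e1 s2 e2 s3 e3 : ℤ}

/-- The rectangles in which the bars are slid, with the layer `k` of the configurations framed in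
them and the layer `k'` of those in which one bar of a short side, the bottom or the top, has been
reduced to one site. -/
def Frame (n : ℕ) (a b : ℤ) (k k' : Fin 5) : Prop :=
  (a = n ∧ b = n + 1 ∧ k = 2 ∧ k' = 1) ∨ (a = n - 1 ∧ b = n + 2 ∧ k = 4 ∧ k' = 3)

/-- The configuration is connected to the layer `k'`. -/
def Sheds (n : ℕ) (k k' : Fin 5) (A : Finset (Site K L)) : Prop :=
  ∃ B, Reach (Passable n k) A B ∧ IsLayer n B k'

theorem Sheds.of_reach {k k' : Fin 5} {A B : Finset (Site K L)} (h : Reach (Passable n k) A B)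
    (hB : Sheds n k k' B) : Sheds n k k' A := by
  obtain ⟨C, hC, hk⟩ := hB
  exact ⟨C, h.trans hC, hk⟩

variable {k k' : Fin 5}

/-- A top bar of one site is an attached particle. -/
theorem sheds_of_top (D : Dims K L n) (hn : 3 ≤ n) (hab : Frame n a b k k')
    (h : Hooked n φ a b A s0 e0 s1 e1 s2 e2 s3 e3) (h1 : s1 = e1) : Sheds n k k' A := by
  subst h1
  have hab' := hab
  unfold Frame at hab'
  have r1 := h.range1
  have hz : φ.pt s1 (b - 1) ∈ A := (h.top s1 (by omega) (by omega)).2 ⟨le_rfl, le_rfl⟩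
  have hnot : ∀ k l, -1 ≤ k → k ≤ a → -1 ≤ l → l ≤ b → ¬(0 ≤ k ∧ k < a ∧ 0 ≤ l ∧ l < b) →
      φ.pt k l ∉ A := by
    intro k l k1 k2 l1 l2 hout hm
    exact hout ((Chart.pt_mem_box_iff D (by omega) (by omega) (by omega) (by omega)).1
      (h.inside.1 hm))
  have htop : ∀ i, -1 ≤ i → i ≤ a → i ≠ s1 → φ.pt i (b - 1) ∉ A := by
    intro i i1 i2 hi
    by_cases hi' : 0 ≤ i ∧ i < a
    · rw [h.top i hi'.1 hi'.2]
      omega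
    · exact hnot _ _ (by omega) (by omega) (by omega) (by omega) (by omega)
  have hd : deg A (φ.pt s1 (b - 1)) ≤ 1 := by
    rw [φ.deg_pt, ind_of_notMem (htop (s1 + 1) (by omega) (by omega) (by omega)),
      ind_of_notMem (htop (s1 - 1) (by omega) (by omega) (by omega)),
      ind_of_notMem (hnot s1 (b - 1 + 1) (by omega) (by omega) (by omega) (by omega) (by omega))]
    have := ind_le_one A (φ.pt s1 (b - 1 - 1))
    omega
  have hsub : A.erase (φ.pt s1 (b - 1)) ⊆ φ.box a (b - 1) := by
    intro x hx
    rw [Finset.mem_erase] at hx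
    obtain ⟨i, j, i1, i2, j1, j2, rfl⟩ := Chart.mem_box.1 (h.inside.1 hx.2)
    refine Chart.pt_mem_box i1 i2 j1 ?_
    by_contra hj
    obtain rfl : j = b - 1 := by omega
    have := (h.top i i1 i2).1 hx.2
    exact hx.1 (by rw [show i = s1 by omega])
  refine ⟨A, .refl _, ?_⟩
  rcases hab with ⟨rfl, rfl, rfl, rfl⟩ | ⟨rfl, rfl, rfl, rfl⟩
  · rw [add_sub_cancel_right] at hsub hz hd
    exact isLayer_one_of_subset D h.card_eq h.hper_eq hz hd hsub
  · rw [show (n : ℤ) + 2 - 1 = n + 1 by ring] at hsub hz hd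
    have hc := Chart.card_box (φ := φ) D (a := n - 1) (b := n + 1) (by omega) (by omega)
      (by omega) (by omega)
    have he : A.erase (φ.pt s1 (n + 1)) = φ.box (n - 1) (n + 1) := by
      refine Finset.eq_of_subset_of_card_le hsub ?_
      have h2 : ((φ.box (n - 1) (n + 1)).card : ℤ) + 1 = (n ^ 2 : ℕ) := by
        rw [hc]
        push_cast
        ring
      have h3 := Finset.card_erase_add_one hz
      rw [h.card_eq] at h3
      omega
    have hpe := hper_erase D hz
    rw [he, Chart.hper_box D (by omega) (by omega) (by omega) (by omega), h.hper_eq] at hpe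
    refine ⟨φ, φ.pt s1 (n + 1), ?_, ?_, ?_⟩
    · rw [← he]
      exact Finset.notMem_erase _ _
    · rw [← he, deg_erase_self D]
      omega
    · rw [← he, Finset.insert_erase hz]

theorem sheds_of_bottom (D : Dims K L n) (hn : 3 ≤ n) (hab : Frame n a b k k')
    (h : Hooked n φ a b A s0 e0 s1 e1 s2 e2 s3 e3) (h0 : s0 = e0) : Sheds n k k' A :=
  sheds_of_top D hn hab h.swap.flip.swap h0

theorem passable (hab : Frame n a b k k') (h : Hooked n φ a b A s0 e0 s1 e1 s2 e2 s3 e3)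
    (h0 : s0 < e0) (h1 : s1 < e1) (h2 : s2 < e2) (h3 : s3 < e3) : Passable n k A := by
  have := h.framed h0 h1 h2 h3
  rcases hab with ⟨rfl, rfl, rfl, rfl⟩ | ⟨rfl, rfl, rfl, rfl⟩
  · exact .inr ⟨φ, this⟩
  · exact .inr ⟨φ, this⟩

/-- If all vacancies are in the top row, then they number at most `a - 1 - (e1 - s1)`. -/
theorem vacancies_le (D : Dims K L n) (hab : Frame n a b k k')
    (h : Hooked n φ a b A s0 e0 s1 e1 s2 e2 s3 e3) (h2 : s2 = 0) (h3 : s3 = 0) (h4 : b - 2 ≤ e2)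
    (h5 : b - 2 ≤ e3) : a * b - n ^ 2 ≤ a - 1 - (e1 - s1) := by
  have hab' := hab
  unfold Frame at hab'
  have hn := D.two_le
  have hc := h.corners
  have r0 := h.range0
  have r1 := h.range1
  have r2 := h.range2
  have r3 := h.range3
  have hsub : φ.box a b ⊆
      A ∪ ((Finset.Ico 0 a \ Finset.Icc s1 e1).image fun i => φ.pt i (b - 1)) := by
    intro x hx
    obtain ⟨i, j, i1, i2, j1, j2, rfl⟩ := Chart.mem_box.1 hx
    rw [Finset.mem_union]
    by_cases hj : j = b - 1
    · subst hj
      by_cases hi : s1 ≤ i ∧ i ≤ e1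
      · exact .inl ((h.top i i1 i2).2 hi)
      · refine .inr (Finset.mem_image_of_mem (fun i => φ.pt i (b - 1)) ?_)
        rw [Finset.mem_sdiff, Finset.mem_Ico, Finset.mem_Icc]
        exact ⟨⟨i1, i2⟩, hi⟩
    left
    by_cases hj0 : j = 0
    · subst hj0
      rw [h.bottom i i1 i2]
      omega
    by_cases hi0 : i = 0
    · subst hi0
      rw [h.left j j1 j2]
      omega
    by_cases hia : i = a - 1
    · subst hia
      rw [h.right j j1 j2]
      omega
    exact h.inside.2 i j (by omega) (by omega) (by omega) (by omega)
  have h1 := (Finset.card_le_card hsub).trans (Finset.card_union_le _ _)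
  have h2 : ((Finset.Ico 0 a \ Finset.Icc s1 e1).image fun i => φ.pt i (b - 1)).card ≤
      (a - (e1 + 1 - s1)).toNat := by
    refine Finset.card_image_le.trans ?_
    rw [Finset.card_sdiff_of_subset, Int.card_Ico, Int.card_Icc]
    · omega
    · intro i
      rw [Finset.mem_Ico, Finset.mem_Icc]
      omega
  have h3 := Chart.card_box (φ := φ) D (a := a) (b := b) (by omega) (by omega) (by omega)
    (by omega)
  have h4 : (A.card : ℤ) = n ^ 2 := by exact_mod_cast h.card_eq
  omega

/-- The left bar ends next to the top and has a vacancy below it, which can be exchanged for one of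
the top row: the top bar is slid to the left until it ends in the corner, and then the left bar,
which contains that corner, moves down. This shortens the top bar by one site. If the left bar moves
down into the bottom left corner, then the bottom bar has to end next to that corner; this is the
condition on `s0`. -/
theorem sheds_of_left (D : Dims K L n) (hn : 3 ≤ n) (hab : Frame n a b k k') {N : ℤ}
    (ih : ∀ (φ : Chart K L) (A : Finset (Site K L)) (s0 e0 s1 e1 s2 e2 s3 e3 : ℤ),
      Hooked n φ a b A s0 e0 s1 e1 s2 e2 s3 e3 → s2 < e2 → s3 < e3 → e1 - s1 < N → Sheds n k k' A)
    (h : Hooked n φ a b A s0 e0 s1 e1 s2 e2 s3 e3) (h2 : s2 < e2) (h3 : s3 < e3)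
    (hN : e1 - s1 = N) (h4 : b - 2 ≤ e2) (h5 : 1 ≤ s2) (h6 : s2 = 1 → s0 = 1) :
    Sheds n k k' A := by
  have hab' := hab
  unfold Frame at hab'
  obtain ⟨t, ht⟩ : ∃ t : ℕ, (t : ℤ) = s1 := ⟨s1.toNat, Int.toNat_of_nonneg h.range1.1⟩
  induction t generalizing A s1 e1 e2 e3 with
  | zero =>
    have hc := h.corners
    have r0 := h.range0
    have r1 := h.range1
    have r2 := h.range2
    by_cases h0 : s0 = e0
    · exact sheds_of_bottom D hn hab h h0
    by_cases h1 : s1 = e1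
    · exact sheds_of_top D hn hab h h1
    obtain ⟨A', s0', s1', hr, hA', g1, g2, g3, g4⟩ := h.slide_down D
      (h.passable hab (by omega) (by omega) h2 h3) (by omega) (by omega) (by omega) (by omega)
      (by omega) (by omega) h2 h5 h6
    exact .of_reach hr (ih _ _ _ _ _ _ _ _ _ _ hA' (by omega) h3 (by omega))
  | succ t iht =>
    have hc := h.corners
    have r0 := h.range0
    have r1 := h.range1
    have r2 := h.range2
    have r3 := h.range3
    by_cases h0 : s0 = e0
    · exact sheds_of_bottom D hn hab h h0
    by_cases h1 : s1 = e1
    · exact sheds_of_top D hn hab h h1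
    -- there are not enough vacancies to leave only two particles on the right side
    have hs3 : s3 < b - 2 := by
      by_contra hcon
      have g1 := Chart.vacant_col_two D (a := a) (b := b) (by omega) (by omega) h.inside.1
        (k := a - 1) (l := 0) (r := s3) (by omega) (by omega) le_rfl (by omega) (by omega)
        (fun j j1 j2 => by
          rw [h.right j j1 (by omega)]
          omega) (i := 0) (j := 0) (by omega) (by
          rw [h.left 0 le_rfl (by omega)]
          omega) (i' := 0) (j' := b - 1) (by omega) (by
          rw [h.left _ (by omega) (by omega)]
          omega) (by omega)
      have g2 : (A.card : ℤ) = n ^ 2 := by exact_mod_cast h.card_eq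
      have g3 : Shape n a b := by
        unfold Shape
        omega
      have := g3.vacancies_le
      omega
    obtain ⟨A', e2', e3', hr, hA', g1, g2, g3, g4⟩ := h.slide_top D
      (h.passable hab (by omega) (by omega) h2 h3) (by omega) (by omega) (by omega) (by omega)
      (by omega) h2 h3 (by omega) (by omega)
    refine .of_reach hr (iht hA' ?_ ?_ (by omega) ?_ (by push_cast at ht; omega))
    all_goals
      by_cases s1 = 1 <;> by_cases e1 = a - 1 <;> omega

/-- If only the corner is vacant below the left bar, the bottom bar is first slid to the left until
it ends next to the corner. -/
theorem sheds_of_bottom_left (D : Dims K L n) (hn : 3 ≤ n) (hab : Frame n a b k k') {N : ℤ}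
    (ih : ∀ (φ : Chart K L) (A : Finset (Site K L)) (s0 e0 s1 e1 s2 e2 s3 e3 : ℤ),
      Hooked n φ a b A s0 e0 s1 e1 s2 e2 s3 e3 → s2 < e2 → s3 < e3 → e1 - s1 < N → Sheds n k k' A)
    (h : Hooked n φ a b A s0 e0 s1 e1 s2 e2 s3 e3) (h2 : s2 < e2) (h3 : s3 < e3)
    (hN : e1 - s1 = N) (h4 : b - 2 ≤ e2) (h4' : b - 2 ≤ e3) (h5 : 1 ≤ s2) : Sheds n k k' A := by
  have hab' := hab
  unfold Frame at hab'
  by_cases h6 : 2 ≤ s2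
  · exact sheds_of_left D hn hab ih h h2 h3 hN h4 h5 (by omega)
  obtain ⟨t, ht⟩ : ∃ t : ℕ, (t : ℤ) = s0 := ⟨s0.toNat, Int.toNat_of_nonneg h.range0.1⟩
  induction t generalizing A s0 e0 s2 s3 with
  | zero =>
    have hc := h.corners
    omega
  | succ t iht =>
    by_cases ht0 : t = 0
    · subst ht0
      exact sheds_of_left D hn hab ih h h2 h3 hN h4 h5 (by omega)
    have hc := h.corners
    have r0 := h.range0
    have r1 := h.range1
    have r2 := h.range2
    have r3 := h.range3
    by_cases h0 : s0 = e0
    · exact sheds_of_bottom D hn hab h h0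
    by_cases h1 : s1 = e1
    · exact sheds_of_top D hn hab h h1
    obtain ⟨A', s2', s3', hr, hA', g1, g2, g3, g4⟩ := h.slide_bottom D
      (h.passable hab (by omega) (by omega) h2 h3) (by omega) (by omega) (by omega) (by omega)
      (by omega) h2 h3 (by omega) (by omega)
    push_cast at ht
    refine .of_reach hr (iht hA' ?_ ?_ ?_ ?_ (by omega))
    all_goals
      by_cases e0 = a - 1 <;> omega

/-- Both side bars end next to the top: if a vacancy is left below one of them, the top bar can be
shortened, and otherwise it is a single site. -/
theorem sheds_of_long (D : Dims K L n) (hn : 3 ≤ n) (hab : Frame n a b k k') {N : ℤ}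
    (ih : ∀ (φ : Chart K L) (A : Finset (Site K L)) (s0 e0 s1 e1 s2 e2 s3 e3 : ℤ),
      Hooked n φ a b A s0 e0 s1 e1 s2 e2 s3 e3 → s2 < e2 → s3 < e3 → e1 - s1 < N → Sheds n k k' A)
    (h : Hooked n φ a b A s0 e0 s1 e1 s2 e2 s3 e3) (h2 : s2 < e2) (h3 : s3 < e3)
    (hN : e1 - s1 = N) (h4 : b - 2 ≤ e2) (h4' : b - 2 ≤ e3) : Sheds n k k' A := by
  have r1 := h.range1
  have r2 := h.range2
  have r3 := h.range3
  by_cases h5 : 1 ≤ s2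
  · exact sheds_of_bottom_left D hn hab ih h h2 h3 hN h4 h4' h5
  by_cases h6 : 1 ≤ s3
  · exact sheds_of_bottom_left D hn hab ih h.flip h3 h2 (by omega) h4' h4 h6
  -- otherwise all vacancies are in the top row, so that its bar is a single site
  have hv := h.vacancies_le D hab (by omega) (by omega) h4 h4'
  refine sheds_of_top D hn hab h ?_
  unfold Frame at hab
  rcases hab with ⟨rfl, rfl, rfl, rfl⟩ | ⟨rfl, rfl, rfl, rfl⟩ <;> ring_nf at hv <;> omega

/-- The left bar is moved up until it ends next to the top. The right bar, of which `P` is known,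
and the top bar stay the same. -/
theorem sheds_of_right_long (D : Dims K L n) (hn : 3 ≤ n) (hab : Frame n a b k k')
    {P : ℤ → Prop} {N : ℤ}
    (hlong : ∀ (φ : Chart K L) (A : Finset (Site K L)) (s0 e0 s1 e1 s2 e2 s3 e3 : ℤ),
      Hooked n φ a b A s0 e0 s1 e1 s2 e2 s3 e3 → s2 < e2 → s3 < e3 → e1 - s1 = N → b - 2 ≤ e2 →
      P e3 → Sheds n k k' A)
    (h : Hooked n φ a b A s0 e0 s1 e1 s2 e2 s3 e3) (h2 : s2 < e2) (h3 : s3 < e3)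
    (hN : e1 - s1 = N) (h4 : P e3) : Sheds n k k' A := by
  have hab' := hab
  unfold Frame at hab'
  obtain ⟨t, ht⟩ : ∃ t : ℕ, (t : ℤ) = b - 1 - e2 :=
    ⟨(b - 1 - e2).toNat, Int.toNat_of_nonneg (by have := h.range2; omega)⟩
  induction t generalizing A s0 s1 s2 e2 with
  | zero => exact hlong _ _ _ _ _ _ _ _ _ _ h h2 h3 hN (by omega) h4
  | succ t iht =>
    by_cases h5 : b - 2 ≤ e2
    · exact hlong _ _ _ _ _ _ _ _ _ _ h h2 h3 hN h5 h4
    have hc := h.corners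
    have r0 := h.range0
    have r1 := h.range1
    have r2 := h.range2
    by_cases h0 : s0 = e0
    · exact sheds_of_bottom D hn hab h h0
    by_cases h1 : s1 = e1
    · exact sheds_of_top D hn hab h h1
    obtain ⟨A', s0', s1', hr, hA', g1, g2, g3, g4⟩ := h.slide_up D
      (h.passable hab (by omega) (by omega) h2 h3) (by omega) (by omega) (by omega) (by omega)
      (by omega) (by omega) h2 (by omega) (by omega)
    exact .of_reach hr (iht hA' (by omega) (by omega) (by push_cast at ht; omega))

/-- By induction on the length of the top bar: both side bars are moved up, and then the top bar is
shortened. -/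
theorem sheds (D : Dims K L n) (hn : 3 ≤ n) (hab : Frame n a b k k')
    (h : Hooked n φ a b A s0 e0 s1 e1 s2 e2 s3 e3) (h2 : s2 < e2) (h3 : s3 < e3) :
    Sheds n k k' A := by
  obtain ⟨N, hN⟩ : ∃ N : ℕ, (N : ℤ) = e1 - s1 :=
    ⟨(e1 - s1).toNat, Int.toNat_of_nonneg (by have := h.range1; omega)⟩
  induction N using Nat.strong_induction_on generalizing φ A s0 e0 s1 e1 s2 e2 s3 e3 with
  | _ N ih =>
    refine sheds_of_right_long D hn hab (P := fun _ => True) (N := N) ?_ h h2 h3 hN.symm trivial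
    intro φ A s0 e0 s1 e1 s2 e2 s3 e3 h h2 h3 hN h4 _
    refine sheds_of_right_long D hn hab (P := fun e => b - 2 ≤ e) (N := N) ?_ h.flip h3 h2
      (by omega) h4
    intro φ A s0 e0 s1 e1 s2 e2 s3 e3 h h2 h3 hN h4 h4'
    refine sheds_of_long D hn hab (N := N) ?_ h h2 h3 hN h4 h4'
    intro φ A s0 e0 s1 e1 s2 e2 s3 e3 h h2 h3 hN'
    have := h.range1
    exact ih (e1 - s1).toNat (by omega) h h2 h3 (by omega)

end Hooked

/-- Framed configurations reach the preceding layer. -/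
theorem Framed.sheds (D : Dims K L n) (hn : 3 ≤ n) {a b : ℤ} {k k' : Fin 5}
    (hab : Hooked.Frame n a b k k') {φ : Chart K L} {A : Finset (Site K L)} (hA : A.card = n ^ 2)
    (h : Framed φ a b A) : Hooked.Sheds n k k' A := by
  have hp : hper A = 2 * n + 1 := by
    unfold Hooked.Frame at hab
    rw [h.hper_eq D (by omega) (by omega) (by omega) (by omega)]
    omega
  obtain ⟨h0, ⟨s0, e0, g1, g2, g3, g4⟩, ⟨s1, e1, g5, g6, g7, g8⟩, ⟨s2, e2, g9, g10, g11, g12⟩,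
    ⟨s3, e3, g13, g14, g15, g16⟩⟩ := h
  exact Hooked.sheds D hn hab ⟨h0, hA, hp, ⟨g1, g2.le, g3⟩, ⟨g5, g6.le, g7⟩, ⟨g9, g10.le, g11⟩,
    ⟨g13, g14.le, g15⟩, g4, g8, g12, g16⟩ g10 g14

end MetaHierarchy

/-! ### The squares are connected -/

namespace MetaHierarchy

variable {K L n : ℕ}

/-- The square `[0, n) × [0, n)` and the row of its right neighbours up to the height `k`, without
the sites of the first column above the height `n - k`. This is a stage in the transport of the
first column of the square to the other side. -/
noncomputable def shear (φ : Chart K L) (n : ℕ) (k : ℤ) : Finset (Site K L) :=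
  φ.box (n + 1) n \ (((Finset.Ico (n - k) n).image fun j => φ.pt 0 j) ∪
    (Finset.Ico (k + 1) n).image fun j => φ.pt n j)

theorem mem_shear (D : Dims K L n) {φ : Chart K L} {k : ℤ} {s t : ℤ} (s1 : -1 ≤ s)
    (s2 : s ≤ n + 1) (t1 : -1 ≤ t) (t2 : t ≤ n) (hk : 0 ≤ k) (hk' : k < n) :
    φ.pt s t ∈ shear φ n k ↔ 0 ≤ s ∧ s ≤ n ∧ 0 ≤ t ∧ t < n ∧ (s = 0 → t < n - k) ∧
      (s = n → t ≤ k) := by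
  have hn := D.two_le
  rw [shear, Finset.mem_sdiff, Chart.pt_mem_box_iff D (by omega) (by omega) (by omega) (by omega),
    Finset.mem_union, Finset.mem_image, Finset.mem_image]
  have h1 : (∃ j ∈ Finset.Ico ((n : ℤ) - k) n, φ.pt 0 j = φ.pt s t) ↔
      s = 0 ∧ n - k ≤ t ∧ t < n := by
    constructor
    · rintro ⟨j, hj, h⟩
      rw [Finset.mem_Ico] at hj
      have := Chart.pt_inj D h (by rw [abs_le]; omega) (by rw [abs_le]; omega)
      omega
    · rintro ⟨rfl, h⟩
      exact ⟨t, Finset.mem_Ico.2 h, rfl⟩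
  have h2 : (∃ j ∈ Finset.Ico (k + 1) (n : ℤ), φ.pt n j = φ.pt s t) ↔
      s = n ∧ k + 1 ≤ t ∧ t < n := by
    constructor
    · rintro ⟨j, hj, h⟩
      rw [Finset.mem_Ico] at hj
      have := Chart.pt_inj D h (by rw [abs_le]; omega) (by rw [abs_le]; omega)
      omega
    · rintro ⟨rfl, h⟩
      exact ⟨t, Finset.mem_Ico.2 h, rfl⟩
  rw [h1, h2]
  omega

theorem shear_subset {φ : Chart K L} {k : ℤ} : shear φ n k ⊆ φ.box (n + 1) n :=
  Finset.sdiff_subset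

theorem hper_shear (D : Dims K L n) {φ : Chart K L} {k : ℤ} (hk : 0 ≤ k) (hk' : k < n) :
    hper (shear φ n k) = 2 * n + 1 := by
  have hn := D.two_le
  rw [Chart.hper_of_convex (φ := φ) D (a := n + 1) (b := n) (by omega) (by omega) (by omega)
    (by omega) shear_subset]
  · ring
  · intro i i' j i1 i2 i3 j1 j2
    rw [mem_shear D (by omega) (by omega) (by omega) (by omega) hk hk',
      mem_shear D (by omega) (by omega) (by omega) (by omega) hk hk',
      mem_shear D (by omega) (by omega) (by omega) (by omega) hk hk']
    omega
  · intro i j j' i1 i2 i3 j1 j2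
    rw [mem_shear D (by omega) (by omega) (by omega) (by omega) hk hk',
      mem_shear D (by omega) (by omega) (by omega) (by omega) hk hk',
      mem_shear D (by omega) (by omega) (by omega) (by omega) hk hk']
    omega
  · intro j j1 j2
    refine ⟨1, by omega, by omega, ?_⟩
    rw [mem_shear D (by omega) (by omega) (by omega) (by omega) hk hk']
    omega
  · intro j j1 j2
    refine ⟨0, by omega, by omega, ?_⟩
    rw [mem_shear D (by omega) (by omega) (by omega) (by omega) hk hk']
    omega

/-- Configurations of height at most `2 * n + 2`. -/
def IsLow (n : ℕ) (A : Finset (Site K L)) : Prop := hper A ≤ 2 * n + 2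

theorem isLow_shear_erase (D : Dims K L n) {φ : Chart K L} {k : ℤ} (hk : 0 ≤ k) (hk' : k < n)
    {s t : ℤ} (h : φ.pt s t ∈ shear φ n k) (hs : 0 ≤ s) (hs' : s ≤ n) (ht : 0 ≤ t) (ht' : t < n)
    (hst : s = 0 ∨ s = n ∨ t = 0) : IsLow n ((shear φ n k).erase (φ.pt s t)) := by
  have h1 := hper_erase D h
  rw [hper_shear D hk hk', φ.deg_pt] at h1
  have b1 := ind_le_one (shear φ n k) (φ.pt (s + 1) t)
  have b2 := ind_le_one (shear φ n k) (φ.pt (s - 1) t)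
  have b3 := ind_le_one (shear φ n k) (φ.pt s (t + 1))
  have b4 := ind_le_one (shear φ n k) (φ.pt s (t - 1))
  unfold IsLow
  rcases hst with rfl | rfl | rfl
  · rw [ind_of_notMem (x := φ.pt (0 - 1) t)] at h1
    · omega
    · rw [mem_shear D (by omega) (by omega) (by omega) (by omega) hk hk']
      omega
  · rw [ind_of_notMem (x := φ.pt (n + 1) t)] at h1
    · omega
    · rw [mem_shear D (by omega) (by omega) (by omega) (by omega) hk hk']
      omega
  · rw [ind_of_notMem (x := φ.pt s (0 - 1))] at h1
    · omega
    · rw [mem_shear D (by omega) (by omega) (by omega) (by omega) hk hk']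
      omega

/-- A hole walks from the top of the new column along three sides to the top of the old column. -/
theorem reach_shear (D : Dims K L n) (φ : Chart K L) {k : ℤ} (hk : 0 ≤ k) (hk' : k < n) :
    Reach (IsLow n) ((shear φ n k).erase (φ.pt n k))
      ((shear φ n k).erase (φ.pt 0 (n - k - 1))) := by
  have hn := D.two_le
  have h1 : ∀ t, 0 ≤ t → t ≤ k → φ.pt n t ∈ shear φ n k := fun t t1 t2 => by
    rw [mem_shear D (by omega) (by omega) (by omega) (by omega) hk hk']
    omega
  have h2 : ∀ s : ℤ, 0 ≤ s → s ≤ n → φ.pt s 0 ∈ shear φ n k := fun t t1 t2 => by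
    rw [mem_shear D (by omega) (by omega) (by omega) (by omega) hk hk']
    omega
  have h3 : ∀ t, 0 ≤ t → t ≤ n - k - 1 → φ.pt 0 t ∈ shear φ n k := fun t t1 t2 => by
    rw [mem_shear D (by omega) (by omega) (by omega) (by omega) hk hk']
    omega
  have r1 := reach_erase_desc (S := IsLow n) D (fun t => φ.pt n t) hk h1
    (fun t _ _ => φ.nbr_col _ _) fun t t1 t2 => isLow_shear_erase D hk hk' (h1 t (by omega) t2)
      (by omega) (by omega) (by omega) (by omega) (by omega)
  have r2 := reach_erase_desc (S := IsLow n) D (fun t => φ.pt t 0) (by omega : (0 : ℤ) ≤ n) h2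
    (fun t _ _ => φ.nbr_row _ _) fun t t1 t2 => isLow_shear_erase D hk hk' (h2 t (by omega) t2)
      (by omega) (by omega) (by omega) (by omega) (by omega)
  have r3 := reach_erase_asc (S := IsLow n) D (fun t => φ.pt 0 t) (by omega : (0 : ℤ) ≤ n - k - 1)
    h3 (fun t _ _ => φ.nbr_col _ _) fun t t1 t2 => isLow_shear_erase D hk hk' (h3 t t1 (by omega))
      (by omega) (by omega) (by omega) (by omega) (by omega)
  exact (r1.trans r2).trans r3

/-- A square can be moved by one site. -/
theorem reach_trans (D : Dims K L n) (φ : Chart K L) :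
    Reach (IsLow n) (φ.box n n) ((φ.trans 1 0).box n n) := by
  have hn := D.two_le
  have hne : ∀ {k l k' l' : ℤ}, -1 ≤ k → k ≤ n → -1 ≤ l → l ≤ n → -1 ≤ k' → k' ≤ n → -1 ≤ l' →
      l' ≤ n → (φ.pt k l = φ.pt k' l' ↔ k = k' ∧ l = l') := by
    intro k l k' l' k1 k2 l1 l2 k3 k4 l3 l4
    refine ⟨fun heq => Chart.pt_inj D heq (by rw [abs_le]; omega) (by rw [abs_le]; omega), ?_⟩
    rintro ⟨rfl, rfl⟩
    rfl
  have hext : ∀ {A B : Finset (Site K L)}, A ⊆ φ.box (n + 1) n → B ⊆ φ.box (n + 1) n →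
      (∀ s t : ℤ, 0 ≤ s → s ≤ n → 0 ≤ t → t < n → (φ.pt s t ∈ A ↔ φ.pt s t ∈ B)) → A = B := by
    intro A B hA hB h
    ext x
    constructor
    · intro hx
      obtain ⟨s, t, s1, s2, t1, t2, rfl⟩ := Chart.mem_box.1 (hA hx)
      exact (h s t s1 (by omega) t1 t2).1 hx
    · intro hx
      obtain ⟨s, t, s1, s2, t1, t2, rfl⟩ := Chart.mem_box.1 (hB hx)
      exact (h s t s1 (by omega) t1 t2).2 hx
  have key : ∀ k : ℕ, (k : ℤ) < n →
      Reach (IsLow n) (φ.box n n) ((shear φ n k).erase (φ.pt n k)) := by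
    intro k
    induction k with
    | zero =>
      intro h0
      have : φ.box n n = (shear φ n (0 : ℕ)).erase (φ.pt n (0 : ℕ)) := by
        refine hext ?_ ((Finset.erase_subset _ _).trans shear_subset) ?_
        · intro x hx
          obtain ⟨s, t, s1, s2, t1, t2, rfl⟩ := Chart.mem_box.1 hx
          exact Chart.pt_mem_box s1 (by omega) t1 t2
        · intro s t s1 s2 t1 t2
          rw [Finset.mem_erase, Ne, hne (by omega) (by omega) (by omega) (by omega) (by omega)
            (by omega) (by omega) (by omega), mem_shear D (by omega) (by omega) (by omega)
            (by omega) (by omega) (by omega), Chart.pt_mem_box_iff D (by omega) (by omega)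
            (by omega) (by omega)]
          omega
      rw [this]
      exact .refl _
    | succ k ih =>
      intro hk
      push_cast at hk ⊢
      have h1 := (ih (by omega)).trans (reach_shear D φ (by omega) (by omega : (k : ℤ) < n))
      have : (shear φ n k).erase (φ.pt 0 (n - k - 1)) =
          (shear φ n (k + 1)).erase (φ.pt n (k + 1)) := by
        refine hext ((Finset.erase_subset _ _).trans shear_subset)
          ((Finset.erase_subset _ _).trans shear_subset) ?_
        intro s t s1 s2 t1 t2
        rw [Finset.mem_erase, Ne, hne (by omega) (by omega) (by omega) (by omega) (by omega)
          (by omega) (by omega) (by omega), mem_shear D (by omega) (by omega) (by omega)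
          (by omega) (by omega) (by omega), Finset.mem_erase, Ne, hne (by omega) (by omega)
          (by omega) (by omega) (by omega) (by omega) (by omega) (by omega), mem_shear D (by omega)
          (by omega) (by omega) (by omega) (by omega) (by omega)]
        omega
      rwa [this] at h1
  have h1 := (key (n - 1) (by omega)).trans
    (reach_shear D φ (k := (n - 1 : ℕ)) (by omega) (by omega))
  have : (shear φ n (n - 1 : ℕ)).erase (φ.pt 0 (n - (n - 1 : ℕ) - 1)) = (φ.trans 1 0).box n n := by
    refine hext ((Finset.erase_subset _ _).trans shear_subset) ?_ ?_
    · intro x hx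
      obtain ⟨s, t, s1, s2, t1, t2, rfl⟩ := Chart.mem_box.1 hx
      rw [Chart.trans_pt]
      exact Chart.pt_mem_box (by omega) (by omega) (by omega) (by omega)
    · intro s t s1 s2 t1 t2
      have h2 : φ.pt s t = (φ.trans 1 0).pt (s - 1) t := by
        rw [Chart.trans_pt]
        congr 1 <;> omega
      rw [Finset.mem_erase, Ne, hne (by omega) (by omega) (by omega) (by omega) (by omega)
        (by omega) (by omega) (by omega), mem_shear D (by omega) (by omega) (by omega)
        (by omega) (by omega) (by omega), h2, Chart.pt_mem_box_iff D (by omega) (by omega)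
        (by omega) (by omega)]
      omega
  rwa [this] at h1

theorem exists_std_box (φ : Chart K L) : ∃ x, φ.box n n = (Chart.std x).box n n := by
  obtain ⟨x, h | h⟩ := Chart.exists_std (P := fun (ψ : Chart K L) a b => φ.box n n = ψ.box a b)
    (fun ψ a b h => by rw [h, Chart.flip_box]) (fun ψ a b h => by rw [h, Chart.swap_box])
    (rfl : φ.box n n = φ.box n n)
  · exact ⟨x, h⟩
  · exact ⟨x, h⟩

/-- Any two squares are connected by a path of height at most `2 * n + 2`. -/
theorem reach_box (D : Dims K L n) (φ ψ : Chart K L) :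
    Reach (IsLow n) (φ.box n n) (ψ.box n n) := by
  obtain ⟨x, hx⟩ := exists_std_box (n := n) φ
  obtain ⟨y, hy⟩ := exists_std_box (n := n) ψ
  rw [hx, hy]
  have : NeZero K := ⟨by have := D.one_lt_left; omega⟩
  have : NeZero L := ⟨by have := D.one_lt_right; omega⟩
  have h1 : ∀ i : ℕ, Reach (IsLow n) ((Chart.std x).box n n)
      ((Chart.std (x + ((i : ZMod K), 0))).box n n) := by
    intro i
    induction i with
    | zero =>
      rw [show x + (((0 : ℕ) : ZMod K), (0 : ZMod L)) = x by simp]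
      exact .refl _
    | succ i ih =>
      have h := reach_trans D (Chart.std (x + ((i : ZMod K), 0)))
      have e : (Chart.std (x + ((i : ZMod K), (0 : ZMod L)))).trans 1 0 =
          Chart.std (x + (((i + 1 : ℕ) : ZMod K), 0)) := by
        simp only [Chart.trans, Chart.std, Chart.pt]
        congr 1
        ext <;> simp [add_assoc]
      rw [e] at h
      exact ih.trans h
  have h2 : ∀ z : Site K L, ∀ j : ℕ, Reach (IsLow n) ((Chart.std z).box n n)
      ((Chart.std (z + (0, (j : ZMod L)))).box n n) := by
    intro z j
    induction j with
    | zero =>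
      rw [show z + ((0 : ZMod K), ((0 : ℕ) : ZMod L)) = z by simp]
      exact .refl _
    | succ j ih =>
      have h := reach_trans D (Chart.std (z + (0, (j : ZMod L)))).swap
      have e : (Chart.std (z + ((0 : ZMod K), (j : ZMod L)))).swap.trans 1 0 =
          (Chart.std (z + (0, ((j + 1 : ℕ) : ZMod L)))).swap := by
        simp only [Chart.trans, Chart.std, Chart.pt, Chart.swap]
        congr 1
        ext <;> simp [add_assoc]
      rw [e, Chart.swap_box, Chart.swap_box] at h
      exact ih.trans h
  have h3 := (h1 (y - x).1.val).trans (h2 _ (y - x).2.val)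
  have e : x + (((y - x).1.val : ZMod K), (0 : ZMod L)) + (0, ((y - x).2.val : ZMod L)) = y := by
    ext <;> simp
  rwa [e] at h3

end MetaHierarchy

/-! ### The layers are disjoint -/

namespace MetaHierarchy

variable {K L n : ℕ}

/-- A framed configuration in a box of width two fills the box. -/
theorem Framed.two_mul_le_card (D : Dims K L n) {φ : Chart K L} {a b : ℤ}
    {A : Finset (Site K L)} (h : Framed φ a b A) (ha : a = 2) (hb : b ≤ 2 * n + 1) :
    2 * b ≤ A.card := by
  have hn := D.two_le
  obtain ⟨h0, ⟨s, e, h1, h2, h3, h4⟩, ⟨s', e', h1', h2', h3', h4'⟩, h5, h6⟩ := h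
  have hb0 : 0 < b := by
    obtain ⟨t, r, t1, t2, t3, -⟩ := h5
    omega
  have hsub : φ.box a b ⊆ A := by
    intro x hx
    obtain ⟨i, j, i1, i2, j1, j2, rfl⟩ := Chart.mem_box.1 hx
    rcases (by omega : i = 0 ∨ i = a - 1) with rfl | rfl
    · exact h5.convex le_rfl j1 (by omega : j ≤ b - 1) (by omega)
        ((h4 _ le_rfl (by omega)).2 (by omega)) ((h4' _ le_rfl (by omega)).2 (by omega))
    · exact h6.convex le_rfl j1 (by omega : j ≤ b - 1) (by omega)
        ((h4 _ (by omega) (by omega)).2 (by omega)) ((h4' _ (by omega) (by omega)).2 (by omega))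
  have h7 := Finset.card_le_card hsub
  have h8 := Chart.card_box (φ := φ) D (a := a) (b := b) (by omega) (by omega) (by omega) hb
  subst ha
  omega

/-- In a framed configuration every particle has at least two neighbours. -/
theorem Framed.two_le_deg {φ : Chart K L} {a b : ℤ}
    {A : Finset (Site K L)} (h : Framed φ a b A) (ha : 3 ≤ a) (hb : 3 ≤ b) {x : Site K L}
    (hx : x ∈ A) : 2 ≤ deg A x := by
  obtain ⟨h0, h1, h2, h3, h4⟩ := h
  have hbar : ∀ {f : ℤ → Site K L} {m : ℤ}, HasBar A f m → ∀ t, 0 ≤ t → t < m → f t ∈ A →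
      1 ≤ ind A (f (t + 1)) + ind A (f (t - 1)) := by
    rintro f m ⟨s, e, g1, g2, g3, g4⟩ t t1 t2 ht
    rw [g4 t t1 t2] at ht
    have b1 := ind_nonneg A (f (t + 1))
    have b2 := ind_nonneg A (f (t - 1))
    by_cases hte : t = e
    · have := ind_of_mem ((g4 (t - 1) (by omega) (by omega)).2 (by omega))
      omega
    · have := ind_of_mem ((g4 (t + 1) (by omega) (by omega)).2 (by omega))
      omega
  have hmid : ∀ {f : ℤ → Site K L} {m : ℤ}, HasBar A f m → m = 3 → f 1 ∈ A := by
    rintro f m ⟨s, e, g1, g2, g3, g4⟩ rfl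
    exact (g4 1 (by omega) (by omega)).2 (by omega)
  obtain ⟨i, j, i1, i2, j1, j2, rfl⟩ := Chart.mem_box.1 (h0.1 hx)
  rw [φ.deg_pt]
  have b1 := ind_nonneg A (φ.pt (i + 1) j)
  have b2 := ind_nonneg A (φ.pt (i - 1) j)
  have b3 := ind_nonneg A (φ.pt i (j + 1))
  have b4 := ind_nonneg A (φ.pt i (j - 1))
  -- an interior of width one or height one is flanked by the middles of two bars
  by_cases hc : a = 3 ∧ i = 1 ∧ 1 ≤ j ∧ j ≤ b - 2
  · obtain ⟨hc1, rfl, hc3, hc4⟩ := hc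
    have g1 : φ.pt 1 (j + 1) ∈ A := by
      rcases eq_or_ne (j + 1) (b - 1) with hj | hj
      · rw [hj]
        exact hmid h2 hc1
      · exact h0.2 1 (j + 1) (by omega) (by omega) (by omega) (by omega)
    have g2 : φ.pt 1 (j - 1) ∈ A := by
      rcases eq_or_ne (j - 1) 0 with hj | hj
      · rw [hj]
        exact hmid h1 hc1
      · exact h0.2 1 (j - 1) (by omega) (by omega) (by omega) (by omega)
    rw [ind_of_mem g1, ind_of_mem g2]
    omega
  by_cases hd : b = 3 ∧ j = 1 ∧ 1 ≤ i ∧ i ≤ a - 2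
  · obtain ⟨hd1, rfl, hd3, hd4⟩ := hd
    have g1 : φ.pt (i + 1) 1 ∈ A := by
      rcases eq_or_ne (i + 1) (a - 1) with hi | hi
      · rw [hi]
        exact hmid h4 hd1
      · exact h0.2 (i + 1) 1 (by omega) (by omega) (by omega) (by omega)
    have g2 : φ.pt (i - 1) 1 ∈ A := by
      rcases eq_or_ne (i - 1) 0 with hi | hi
      · rw [hi]
        exact hmid h3 hd1
      · exact h0.2 (i - 1) 1 (by omega) (by omega) (by omega) (by omega)
    rw [ind_of_mem g1, ind_of_mem g2]
    omega
  have hhor : 1 ≤ ind A (φ.pt (i + 1) j) + ind A (φ.pt (i - 1) j) := by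
    by_cases hj : j = 0
    · subst hj
      exact hbar h1 i i1 i2 hx
    by_cases hj' : j = b - 1
    · subst hj'
      exact hbar h2 i i1 i2 hx
    by_cases hi : i < a - 2
    · have := ind_of_mem (h0.2 (i + 1) j (by omega) (by omega) (by omega) (by omega))
      omega
    · have := ind_of_mem (h0.2 (i - 1) j (by omega) (by omega) (by omega) (by omega))
      omega
  have hver : 1 ≤ ind A (φ.pt i (j + 1)) + ind A (φ.pt i (j - 1)) := by
    by_cases hi : i = 0
    · subst hi
      exact hbar h3 j j1 j2 hx
    by_cases hi' : i = a - 1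
    · subst hi'
      exact hbar h4 j j1 j2 hx
    by_cases hj : j < b - 2
    · have := ind_of_mem (h0.2 i (j + 1) (by omega) (by omega) (by omega) (by omega))
      omega
    · have := ind_of_mem (h0.2 i (j - 1) (by omega) (by omega) (by omega) (by omega))
      omega
  omega

theorem Chart.two_le_deg_box {φ : Chart K L} {a b : ℤ} (ha : 2 ≤ a) (hb : 2 ≤ b) {x : Site K L}
    (hx : x ∈ φ.box a b) : 2 ≤ deg (φ.box a b) x := by
  obtain ⟨i, j, i1, i2, j1, j2, rfl⟩ := Chart.mem_box.1 hx
  have key : ∀ k l : ℤ, 0 ≤ k → k < a → 0 ≤ l → l < b → ind (φ.box a b) (φ.pt k l) = 1 :=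
    fun k l k1 k2 l1 l2 => ind_of_mem (Chart.pt_mem_box k1 k2 l1 l2)
  have b1 := ind_nonneg (φ.box a b) (φ.pt (i + 1) j)
  have b2 := ind_nonneg (φ.box a b) (φ.pt (i - 1) j)
  have b3 := ind_nonneg (φ.box a b) (φ.pt i (j + 1))
  have b4 := ind_nonneg (φ.box a b) (φ.pt i (j - 1))
  rw [φ.deg_pt]
  have hhor : 1 ≤ ind (φ.box a b) (φ.pt (i + 1) j) + ind (φ.box a b) (φ.pt (i - 1) j) := by
    by_cases hi : i = 0
    · have := key (i + 1) j (by omega) (by omega) j1 j2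
      omega
    · have := key (i - 1) j (by omega) (by omega) j1 j2
      omega
  by_cases hj : j = 0
  · have := key i (j + 1) i1 i2 (by omega) (by omega)
    omega
  · have := key i (j - 1) i1 i2 (by omega) (by omega)
    omega

/-- A square without a corner is not a rectangle. -/
theorem erase_corner_ne_box (D : Dims K L n) (hn : 3 ≤ n) (φ ψ : Chart K L) :
    (φ.box n n).erase (φ.pt 0 0) ≠ ψ.box (n - 1) (n + 1) := by
  intro h
  have hm : ∀ s t : ℤ, -1 ≤ s → s ≤ n → -1 ≤ t → t ≤ n → (φ.pt s t ∈ (φ.box n n).erase (φ.pt 0 0) ↔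
      ¬(s = 0 ∧ t = 0) ∧ 0 ≤ s ∧ s < n ∧ 0 ≤ t ∧ t < n) := by
    intro s t s1 s2 t1 t2
    rw [Finset.mem_erase, Chart.pt_mem_box_iff D (by omega) (by omega) (by omega) (by omega)]
    have : φ.pt s t ≠ φ.pt 0 0 ↔ ¬(s = 0 ∧ t = 0) := by
      refine not_congr ⟨fun heq => Chart.pt_inj D heq (by rw [abs_le]; omega)
        (by rw [abs_le]; omega), ?_⟩
      rintro ⟨rfl, rfl⟩
      rfl
    rw [this]
  have h1 := Chart.card_ends_of_convex (φ := φ) D (a := n) (b := n) (by omega) (by omega) (by omega)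
    (by omega) (Finset.erase_subset (φ.pt 0 0) _) (by
      intro i i' j i1 i2 i3 j1 j2
      rw [hm _ _ (by omega) (by omega) (by omega) (by omega),
        hm _ _ (by omega) (by omega) (by omega) (by omega),
        hm _ _ (by omega) (by omega) (by omega) (by omega)]
      omega) (by
      intro i i' j i1 i2 i3 j1 j2
      rw [hm _ _ (by omega) (by omega) (by omega) (by omega),
        hm _ _ (by omega) (by omega) (by omega) (by omega),
        hm _ _ (by omega) (by omega) (by omega) (by omega)]
      omega) (by
      intro j j1 j2
      refine ⟨1, by omega, by omega, ?_⟩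
      rw [hm _ _ (by omega) (by omega) (by omega) (by omega)]
      omega) (by
      intro j j1 j2
      refine ⟨1, by omega, by omega, ?_⟩
      rw [hm _ _ (by omega) (by omega) (by omega) (by omega)]
      omega)
  have h2 := Chart.card_ends_of_convex (φ := ψ) D (a := n - 1) (b := n + 1) (by omega) (by omega)
    (by omega) (by omega) subset_rfl
    (fun i i' j i1 i2 i3 j1 j2 _ _ => Chart.pt_mem_box (by omega) (by omega) j1 j2)
    (fun i j j' i1 i2 i3 j1 j2 _ _ => Chart.pt_mem_box j1 j2 (by omega) (by omega))
    (fun j j1 j2 => ⟨0, le_rfl, by omega, Chart.pt_mem_box le_rfl (by omega) j1 j2⟩)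
    (fun j j1 j2 => ⟨0, le_rfl, by omega, Chart.pt_mem_box j1 j2 le_rfl (by omega)⟩)
  rw [h] at h1
  omega

/-- For `3 ≤ n` the layers are pairwise disjoint. -/
theorem IsLayer.unique (D : Dims K L n) (hn : 3 ≤ n) {A : Finset (Site K L)} (hA : A.card = n ^ 2)
    {i j : Fin 5} (hi : IsLayer n A i) (hj : IsLayer n A j) : i = j := by
  have hA' : (A.card : ℤ) = n ^ 2 := by exact_mod_cast hA
  have hatt : ∀ {k : Fin 5}, (k = 1 ∨ k = 3) → IsLayer n A k → ∃ z ∈ A, deg A z = 1 := by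
    rintro k (rfl | rfl) h
    · obtain ⟨φ, z, hz, hd, rfl⟩ := h
      refine ⟨z, Finset.mem_insert_self _ _, ?_⟩
      rw [← deg_erase_self D, Finset.erase_insert hz, hd]
    · obtain ⟨φ, z, hz, hd, rfl⟩ := h
      refine ⟨z, Finset.mem_insert_self _ _, ?_⟩
      rw [← deg_erase_self D, Finset.erase_insert hz, hd]
  have hfr : ∀ {k : Fin 5}, (k = 2 ∨ k = 4) → IsLayer n A k → ∀ z ∈ A, 2 ≤ deg A z := by
    rintro k (rfl | rfl) h z hz
    · obtain ⟨φ, h⟩ := h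
      exact h.two_le_deg (by omega) (by omega) hz
    · obtain ⟨φ, h⟩ := h
      refine h.two_le_deg ?_ (by omega) hz
      by_contra hcon
      have hn3 : (n : ℤ) = 3 := by omega
      have := h.two_mul_le_card D (by omega) (by omega)
      rw [hn3] at hA' this
      omega
  have h13 : ∀ {k : Fin 5}, (k = 1 ∨ k = 3) → ∀ {l : Fin 5}, (l = 2 ∨ l = 4) → IsLayer n A k →
      IsLayer n A l → False := by
    intro k hk l hl h h'
    obtain ⟨z, hz, hd⟩ := hatt hk h
    have := hfr hl h' z hz
    omega
  have h1 : IsLayer n A 1 → IsLayer n A 3 → False := by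
    rintro ⟨φ, z, hz, hd, h⟩ ⟨ψ, z', hz', hd', h'⟩
    by_cases hzz : z = z'
    · subst hzz
      refine erase_corner_ne_box D hn φ ψ ?_
      rw [← Finset.erase_insert hz, ← h, h', Finset.erase_insert hz']
    · have hzA : z ∈ A := h ▸ Finset.mem_insert_self _ _
      rw [h', Finset.mem_insert] at hzA
      have g1 := Chart.two_le_deg_box (by omega) (by omega) (hzA.resolve_left hzz)
      have g2 : deg (ψ.box (n - 1) (n + 1)) z ≤ deg A z :=
        deg_mono (h' ▸ Finset.subset_insert _ _) z
      have g3 : deg A z = 1 := by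
        rw [h, ← deg_erase_self D, Finset.erase_insert hz, hd]
      omega
  have h2 : IsLayer n A 2 → IsLayer n A 4 → False := by
    rintro ⟨φ, h⟩ ⟨ψ, h'⟩
    have g1 := h.card_ends D (by omega) (by omega) (by omega) (by omega)
    have g2 := h'.card_ends D (by omega) (by omega) (by omega) (by omega)
    omega
  have h0 : ∀ {k : Fin 5}, k ≠ 0 → IsLayer n A 0 → IsLayer n A k → False := by
    intro k hk h h'
    have g1 := h.hper_eq D
    have g2 := h'.hper_eq D
    rw [if_pos rfl] at g1
    rw [if_neg hk] at g2
    omega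
  fin_cases i <;> fin_cases j <;> first
    | rfl
    | exact (h0 (by decide) hi hj).elim
    | exact (h0 (by decide) hj hi).elim
    | exact (h1 hi hj).elim
    | exact (h1 hj hi).elim
    | exact (h2 hi hj).elim
    | exact (h2 hj hi).elim
    | exact (h13 (by decide) (by decide) hi hj).elim
    | exact (h13 (by decide) (by decide) hj hi).elim

/-! ### Descending through the layers -/

/-- For four particles the framed layers are empty. -/
theorem not_isLayer_of_two (D : Dims K L n) (hn : n = 2) {A : Finset (Site K L)}
    (hA : A.card = n ^ 2) : ¬IsLayer n A 2 ∧ ¬IsLayer n A 4 := by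
  subst hn
  constructor
  · rintro ⟨φ, h⟩
    have := h.two_mul_le_card D rfl (by omega)
    rw [hA] at this
    norm_num at this
  · rintro ⟨φ, -, ⟨s, e, h1, h2, h3, -⟩, -⟩
    omega

/-- Every layer is connected to the preceding one; for four particles some are empty. -/
theorem IsLayer.exists_reach (D : Dims K L n) {A : Finset (Site K L)} (hA : A.card = n ^ 2)
    {j : Fin 5} (hj : IsLayer n A j) (hj0 : j ≠ 0) :
    ∃ B i, Reach (Passable n j) A B ∧ IsLayer n B i ∧ i < j ∧ (3 ≤ n → (j : ℕ) = i + 1) := by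
  have hn := D.two_le
  rcases Nat.lt_or_ge n 3 with hn3 | hn3
  · have hno := not_isLayer_of_two D (by omega : n = 2) hA
    fin_cases j
    · exact absurd rfl hj0
    · obtain ⟨B, hB, h⟩ := reach_square D hj
      exact ⟨B, 0, h, hB, by decide, by omega⟩
    · exact absurd hj hno.1
    · obtain ⟨B, hB, -, h⟩ := reach_of_isLayer_three D hj
      exact ⟨B, 1, hB, h (by omega), by decide, by omega⟩
    · exact absurd hj hno.2
  · fin_cases j
    · exact absurd rfl hj0
    · obtain ⟨B, hB, h⟩ := reach_square D hj
      exact ⟨B, 0, h, hB, by decide, fun _ => rfl⟩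
    · obtain ⟨φ, h⟩ := hj
      obtain ⟨B, h, hB⟩ := h.sheds D hn3 (k := 2) (k' := 1) (.inl ⟨rfl, rfl, rfl, rfl⟩) hA
      exact ⟨B, 1, h, hB, by decide, fun _ => rfl⟩
    · obtain ⟨B, hB, h, -⟩ := reach_of_isLayer_three D hj
      exact ⟨B, 2, hB, h hn3, by decide, fun _ => rfl⟩
    · obtain ⟨φ, h⟩ := hj
      obtain ⟨B, h, hB⟩ := h.sheds D hn3 (k := 4) (k' := 3) (.inr ⟨rfl, rfl, rfl, rfl⟩) hA
      exact ⟨B, 3, h, hB, by decide, fun _ => rfl⟩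

/-- Every layer is connected to the squares by paths of height at most `2 * n + 2`. -/
theorem IsLayer.exists_reach_square (D : Dims K L n) {A : Finset (Site K L)} (hA : A.card = n ^ 2)
    {j : Fin 5} (hj : IsLayer n A j) : ∃ B, Reach (IsLow n) A B ∧ IsLayer n B 0 := by
  obtain ⟨m, hm⟩ : ∃ m, (j : ℕ) = m := ⟨_, rfl⟩
  induction m using Nat.strong_induction_on generalizing A j with
  | _ m ih =>
    by_cases hj0 : j = 0
    · subst hj0
      exact ⟨A, Reach.refl A, hj⟩
    obtain ⟨B, i, h, hB, hij, -⟩ := hj.exists_reach D hA hj0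
    obtain ⟨C, h', hC⟩ := ih i (by omega) (h.card_eq.trans hA) hB rfl
    refine ⟨C, (h.mono ?_).trans h', hC⟩
    rintro T (hT | hT)
    · exact hT.le
    · have := hT.hper_eq D
      unfold IsLow
      split_ifs at this <;> omega

end MetaHierarchy

/-! ### Configurations and their sets of occupied sites -/

namespace MetaHierarchy

variable {K L n N : ℕ} [NeZero K] [NeZero L]

/-- The occupied sites of a configuration, as a finite set. -/
def occ (η : Gas K L N) : Finset (Site K L) := {x | η.1 x = 1}

theorem mem_occ {η : Gas K L N} {x : Site K L} : x ∈ occ η ↔ η.1 x = 1 := by simp [occ]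

theorem coe_occ (η : Gas K L N) : (occ η : Set (Site K L)) = occupied η.1 := by
  ext x
  simp [mem_occ, occupied]

theorem card_occ (η : Gas K L N) : (occ η).card = N := by
  rw [← Set.ncard_coe_finset, coe_occ, η.2]

theorem spin_eq_iff {η ξ : Gas K L N} {x y : Site K L} :
    η.1 x = ξ.1 y ↔ (x ∈ occ η ↔ y ∈ occ ξ) := by
  rw [mem_occ, mem_occ]
  rcases Int.units_eq_one_or (η.1 x) with h | h <;>
    rcases Int.units_eq_one_or (ξ.1 y) with h' | h' <;> rw [h, h'] <;> decide

theorem occ_injective : Function.Injective (occ : Gas K L N → Finset (Site K L)) := by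
  intro η ξ h
  apply Subtype.ext
  funext x
  rw [spin_eq_iff, h]

theorem exists_occ_eq {A : Finset (Site K L)} (hA : A.card = N) : ∃ η : Gas K L N, occ η = A := by
  have h : occupied (fun x => if x ∈ A then 1 else -1 : Spins K L) = A := by
    ext x
    by_cases hx : x ∈ A <;> simp [occupied, hx]
  refine ⟨⟨fun x => if x ∈ A then 1 else -1, by rw [h, Set.ncard_coe_finset, hA]⟩, ?_⟩
  rw [← Finset.coe_inj, coe_occ, h]

theorem spin_eq_ind (η : Gas K L N) (x : Site K L) :
    (((η.1 x : ℤˣ) : ℤ) : ℝ) = 2 * (ind (occ η) x : ℝ) - 1 := by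
  rcases Int.units_eq_one_or (η.1 x) with h | h
  · rw [h, ind_of_mem (mem_occ.2 h)]
    norm_num
  · rw [h, ind_of_notMem (by rw [mem_occ, h]; decide)]
    norm_num

/-- The sum over the bonds in one coordinate direction. -/
theorem sum_spin_mul_spin (η : Gas K L N) (d : Site K L) :
    ∑ x, (((η.1 x : ℤˣ) : ℤ) : ℝ) * (((η.1 (x + d) : ℤˣ) : ℤ) : ℝ)
      = K * L - 4 * (ends d (occ η)).card := by
  have h1 : ∑ x, ind (occ η) x = (occ η).card := by
    simp [ind]
  have h2 : ∑ x, ind (occ η) (x + d) = (occ η).card := by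
    rw [← h1]
    exact Equiv.sum_comp (Equiv.addRight d) (ind (occ η))
  have h3 : ∑ x, ind (occ η) x * ind (occ η) (x + d) = ∑ x ∈ occ η, ind (occ η) (x + d) := by
    rw [← Finset.sum_filter_add_sum_filter_not Finset.univ (· ∈ occ η)]
    rw [Finset.sum_eq_zero (s := Finset.univ.filter (· ∉ occ η)), add_zero]
    · rw [Finset.filter_mem_eq_inter, Finset.univ_inter]
      exact Finset.sum_congr rfl fun x hx => by rw [ind_of_mem hx, one_mul]
    · intro x hx
      rw [ind_of_notMem (Finset.mem_filter.1 hx).2, zero_mul]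
  have h4 := card_ends d (occ η)
  have h5 : ∑ x, (2 * ind (occ η) x - 1) * (2 * ind (occ η) (x + d) - 1)
      = (K * L : ℤ) - 4 * (ends d (occ η)).card := by
    have : ∀ x, (2 * ind (occ η) x - 1) * (2 * ind (occ η) (x + d) - 1)
        = 4 * (ind (occ η) x * ind (occ η) (x + d)) - 2 * ind (occ η) x
          - 2 * ind (occ η) (x + d) + 1 := fun x => by ring
    simp only [this]
    rw [Finset.sum_add_distrib, Finset.sum_sub_distrib, Finset.sum_sub_distrib, ← Finset.mul_sum,
      ← Finset.mul_sum, ← Finset.mul_sum, h1, h2, h3, Finset.sum_const, Finset.card_univ,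
      Fintype.card_prod, ZMod.card, ZMod.card, nsmul_one, Nat.cast_mul]
    linarith
  simp only [spin_eq_ind]
  exact_mod_cast h5

open Classical in
/-- Every bond is `{x, x + d}` for exactly one site `x` and one coordinate direction `d`. -/
theorem sum_edgeFinset (D : Dims K L n) (f : Sym2 (Site K L) → ℝ) :
    ∑ e ∈ (lattice K L).edgeFinset, f e
      = ∑ x, f s(x, x + (1, 0)) + ∑ x, f s(x, x + (0, 1)) := by
  have hK := D.one_lt_left
  have hL := D.one_lt_right
  have hn := D.two_le
  have hne : ∀ {i j : ℤ}, |i| ≤ 2 → |j| ≤ 2 → ((i : ZMod K), (j : ZMod L)) = 0 → i = 0 ∧ j = 0 := by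
    intro i j hi hj h
    refine Chart.smul_add_smul_eq_zero (φ := Chart.std 0) D ?_ (by omega) (by omega)
    rw [← h]
    simp [Chart.std]
  have hinj : ∀ d : Site K L, d + d ≠ 0 →
      Function.Injective fun x : Site K L => s(x, x + d) := by
    intro d hd x y h
    rcases Sym2.eq_iff.1 h with ⟨h1, -⟩ | ⟨h1, h2⟩
    · exact h1
    · refine absurd ?_ hd
      rw [h1, add_assoc] at h2
      simpa using h2
  have h11 : ((1, 0) : Site K L) + (1, 0) ≠ 0 := fun h => by
    have := hne (i := 2) (j := 0) (by norm_num) (by norm_num) (by rw [← h]; norm_num)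
    omega
  have h22 : ((0, 1) : Site K L) + (0, 1) ≠ 0 := fun h => by
    have := hne (i := 0) (j := 2) (by norm_num) (by norm_num) (by rw [← h]; norm_num)
    omega
  have h12 : ((1, 0) : Site K L) ≠ (0, 1) := fun h => by
    have := hne (i := 1) (j := -1) (by norm_num) (by norm_num) (by
      rw [← sub_eq_zero] at h
      rw [← h]
      simp)
    omega
  have h21 : ((1, 0) : Site K L) + (0, 1) ≠ 0 := fun h => by
    have := hne (i := 1) (j := 1) (by norm_num) (by norm_num) (by rw [← h]; norm_num)
    omega
  have hE : (lattice K L).edgeFinset = Finset.univ.image (fun x : Site K L => s(x, x + (1, 0))) ∪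
      Finset.univ.image (fun x : Site K L => s(x, x + (0, 1))) := by
    ext e
    induction e using Sym2.ind with
    | _ x y =>
      rw [SimpleGraph.mem_edgeFinset, SimpleGraph.mem_edgeSet, lattice_adj_iff D]
      simp only [Finset.mem_union, Finset.mem_image, Finset.mem_univ, true_and, Sym2.eq_iff]
      constructor
      · rintro (h | h | h | h)
        · exact .inl ⟨x, .inl ⟨rfl, h.symm⟩⟩
        · exact .inl ⟨y, .inr ⟨rfl, by rw [h]; simp⟩⟩
        · exact .inr ⟨x, .inl ⟨rfl, h.symm⟩⟩
        · exact .inr ⟨y, .inr ⟨rfl, by rw [h]; simp⟩⟩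
      · rintro (⟨a, ⟨rfl, rfl⟩ | ⟨rfl, rfl⟩⟩ | ⟨a, ⟨rfl, rfl⟩ | ⟨rfl, rfl⟩⟩) <;> simp [Nbr]
  rw [hE, Finset.sum_union, Finset.sum_image (hinj _ h11).injOn,
    Finset.sum_image (hinj _ h22).injOn]
  rw [Finset.disjoint_left]
  intro e he he'
  simp only [Finset.mem_image, Finset.mem_univ, true_and] at he he'
  obtain ⟨x, rfl⟩ := he
  obtain ⟨y, hy⟩ := he'
  rcases Sym2.eq_iff.1 hy with ⟨rfl, h1⟩ | ⟨rfl, h1⟩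
  · exact h12 (add_left_cancel h1).symm
  · rw [add_assoc] at h1
    exact h21 (by simpa using h1)

theorem energy_eq_hper (D : Dims K L n) (J : ℝ) (η : Gas K L N) :
    energy K L N J η = -(J * (K * L) / 2) + J * hper (occ η) := by
  rw [energy, sum_edgeFinset D]
  simp only [Sym2.lift_mk]
  rw [sum_spin_mul_spin, sum_spin_mul_spin, hper]
  push_cast
  ring

theorem kawasaki_adj_iff (D : Dims K L n) {η ξ : Gas K L N} :
    (kawasaki K L N).Adj η ξ ↔ Step (occ η) (occ ξ) := by
  have key : ∀ {x y : Site K L}, Nbr x y → x ∈ occ η → y ∉ occ η → ξ.1 = η.1 ∘ Equiv.swap x y →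
      Step (occ η) (occ ξ) := by
    intro x y hxy hx hy h
    refine ⟨x, y, hx, hy, hxy, ?_⟩
    ext z
    have h1 : z ∈ occ ξ ↔ Equiv.swap x y z ∈ occ η := by
      rw [mem_occ, mem_occ, h]
      rfl
    rw [h1, Finset.mem_insert, Finset.mem_erase]
    rcases eq_or_ne z x with rfl | hzx
    · rw [Equiv.swap_apply_left]
      simp [hy, hxy.ne D]
    rcases eq_or_ne z y with rfl | hzy
    · rw [Equiv.swap_apply_right]
      simp [hx]
    · rw [Equiv.swap_apply_of_ne_of_ne hzx hzy]
      simp [hzx, hzy]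
  constructor
  · rintro ⟨hne, x, y, hxy, h⟩
    rw [lattice_adj_iff D] at hxy
    by_cases hx : x ∈ occ η <;> by_cases hy : y ∈ occ η
    · refine absurd (Subtype.ext ?_) hne
      rw [h]
      funext z
      have h2 : η.1 x = η.1 y := spin_eq_iff.2 (by simp [hx, hy])
      rw [Function.comp_apply, Equiv.swap_apply_def]
      split_ifs with h3 h4
      · rw [h3, h2]
      · rw [h4, h2]
      · rfl
    · exact key hxy hx hy h
    · exact key hxy.symm hy hx (by rw [h, Equiv.swap_comm])
    · refine absurd (Subtype.ext ?_) hne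
      rw [h]
      funext z
      have h2 : η.1 x = η.1 y := spin_eq_iff.2 (by simp [hx, hy])
      rw [Function.comp_apply, Equiv.swap_apply_def]
      split_ifs with h3 h4
      · rw [h3, h2]
      · rw [h4, h2]
      · rfl
  · rintro ⟨x, y, hx, hy, hxy, h⟩
    refine ⟨fun heq => ?_, x, y, (lattice_adj_iff D).2 hxy, ?_⟩
    · rw [← heq] at h
      exact hy (h ▸ Finset.mem_insert_self _ _)
    · funext z
      rw [Function.comp_apply, spin_eq_iff, h, Finset.mem_insert, Finset.mem_erase]
      rcases eq_or_ne z x with rfl | hzx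
      · rw [Equiv.swap_apply_left]
        simp [hy, hxy.ne D]
      rcases eq_or_ne z y with rfl | hzy
      · rw [Equiv.swap_apply_right]
        simp [hx]
      · rw [Equiv.swap_apply_of_ne_of_ne hzx hzy]
        simp [hzx, hzy]

/-- A path of particle moves, read backwards as a walk of the dynamics. -/
theorem exists_walk_of_reach (D : Dims K L n) {S : Finset (Site K L) → Prop} {η : Gas K L N}
    {B : Finset (Site K L)} (h : Reach S (occ η) B) :
    ∃ ζ : Gas K L N, occ ζ = B ∧
      ∃ w : (kawasaki K L N).Walk ζ η, ∀ ξ ∈ w.support.tail, S (occ ξ) := by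
  induction h with
  | refl => exact ⟨η, rfl, .nil, by simp⟩
  | @tail B C _ h' ih =>
    obtain ⟨ζ, rfl, w, hw⟩ := ih
    obtain ⟨ζ', rfl⟩ := exists_occ_eq (h'.2.card_eq.trans (card_occ ζ))
    refine ⟨ζ', rfl, .cons ((kawasaki_adj_iff D).2 (h'.2.symm D)) w, fun ξ hξ => ?_⟩
    rw [SimpleGraph.Walk.support_cons, List.tail_cons, ← SimpleGraph.Walk.cons_tail_support,
      List.mem_cons] at hξ
    rcases hξ with rfl | hξ
    · exact h'.1
    · exact hw ξ hξ

end MetaHierarchy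

/-! ### The collections of the stable plateaux in charts -/

namespace MetaHierarchy

variable {K L n N : ℕ}

theorem shift_eq_pt (x : Site K L) (i j : ℕ) : shift x i j = (Chart.std x).pt i j := by
  simp only [shift, Chart.pt, Chart.std, add_assoc]
  congr 1
  ext <;> simp

theorem coe_std_box (x : Site K L) (a b : ℕ) :
    ((Chart.std x).box a b : Set (Site K L)) = rect x a b := by
  ext y
  rw [Finset.mem_coe, Chart.mem_box]
  constructor
  · rintro ⟨i, j, h1, h2, h3, h4, rfl⟩
    lift i to ℕ using h1
    lift j to ℕ using h3
    exact ⟨i, by omega, j, by omega, (shift_eq_pt x i j).symm⟩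
  · rintro ⟨i, h1, j, h2, rfl⟩
    exact ⟨i, j, by omega, by omega, by omega, by omega, (shift_eq_pt x i j).symm⟩

theorem deg_pos_of_nbr {A : Finset (Site K L)} {x z : Site K L} (hx : x ∈ A) (h : Nbr z x) :
    0 < deg A z := by
  have h1 := ind_nonneg A (z + (1, 0))
  have h2 := ind_nonneg A (z - (1, 0))
  have h3 := ind_nonneg A (z + (0, 1))
  have h4 := ind_nonneg A (z - (0, 1))
  have h5 := ind_of_mem hx
  unfold deg
  rcases h with rfl | rfl | rfl | rfl <;> omega

theorem isAttached_iff (D : Dims K L n) {A : Finset (Site K L)} {z : Site K L} :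
    IsAttached (A : Set (Site K L)) z ↔ z ∉ A ∧ deg A z = 1 := by
  refine and_congr Iff.rfl ?_
  simp only [Finset.mem_coe, lattice_adj_iff D]
  constructor
  · rintro ⟨y, ⟨hy, hzy⟩, huniq⟩
    have h1 := deg_erase_of_nbr D hzy hy
    have h2 := deg_nonneg (A.erase y) z
    by_contra hcon
    obtain ⟨x, hx, hxz⟩ := Chart.exists_nbr_of_deg_pos (by omega : 0 < deg (A.erase y) z)
    rw [Finset.mem_erase] at hx
    exact hx.1 (huniq x ⟨hx.2, hxz.symm⟩)
  · intro h
    obtain ⟨y, hy, hyz⟩ := Chart.exists_nbr_of_deg_pos (by omega : 0 < deg A z)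
    refine ⟨y, ⟨hy, hyz.symm⟩, fun x hx => ?_⟩
    by_contra hne
    have h1 := deg_erase_of_nbr D hyz.symm hy
    have h2 := deg_pos_of_nbr (Finset.mem_erase.2 ⟨hne, hx.1⟩) hx.2
    omega

theorem isBar_iff {A : Finset (Site K L)} {f : ℕ → Site K L} {g : ℤ → Site K L} {m : ℕ} {m' : ℤ}
    (hfg : ∀ i : ℕ, g i = f i) (hm : m' = m) :
    IsBar (A : Set (Site K L)) f m ↔ HasBar A g m' := by
  subst hm
  constructor
  · rintro ⟨s, e, h1, h2, h3⟩
    refine ⟨s, e, by omega, by omega, by omega, fun i i1 i2 => ?_⟩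
    lift i to ℕ using i1
    rw [hfg, ← Finset.mem_coe, h3 i (by omega)]
    omega
  · rintro ⟨s, e, h0, h1, h2, h3⟩
    lift s to ℕ using h0
    lift e to ℕ using by omega
    refine ⟨s, e, by omega, by omega, fun i hi => ?_⟩
    rw [← hfg, Finset.mem_coe, h3 i (by omega) (by omega)]
    omega

theorem isFramed_iff {A : Finset (Site K L)} {x : Site K L} {a b : ℕ} {a' b' : ℤ} (ha : a' = a)
    (hb : b' = b) (ha1 : 1 ≤ a) (hb1 : 1 ≤ b) :
    IsFramed x a b (A : Set (Site K L)) ↔ Framed (Chart.std x) a' b' A := by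
  subst ha hb
  have h1 : (((a - 1 : ℕ) : ℕ) : ℤ) = a - 1 := by omega
  have h2 : (((b - 1 : ℕ) : ℕ) : ℤ) = b - 1 := by omega
  unfold IsFramed Framed Inside
  rw [and_assoc]
  refine and_congr ?_ (and_congr ?_ (and_congr ?_ (and_congr ?_ (and_congr ?_ ?_))))
  · rw [← coe_std_box, Finset.coe_subset]
  · constructor
    · intro h i j i1 i2 j1 j2
      lift i to ℕ using by omega
      lift j to ℕ using by omega
      rw [← shift_eq_pt]
      exact h i j (by omega) (by omega) (by omega) (by omega)
    · intro h i j i1 i2 j1 j2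
      rw [shift_eq_pt]
      exact h i j (by omega) (by omega) (by omega) (by omega)
  · exact isBar_iff (fun i => (shift_eq_pt x i 0).symm) rfl
  · refine isBar_iff (fun i => ?_) rfl
    rw [shift_eq_pt, h2]
  · exact isBar_iff (fun i => (shift_eq_pt x 0 i).symm) rfl
  · refine isBar_iff (fun i => ?_) rfl
    rw [shift_eq_pt, h1]

theorem exists_framed_iff {A : Finset (Site K L)} {a b : ℕ} {a' b' : ℤ} (ha : a' = a)
    (hb : b' = b) (ha1 : 1 ≤ a) (hb1 : 1 ≤ b) :
    (∃ x, IsFramed x a b (A : Set (Site K L)) ∨ IsFramed x b a (A : Set (Site K L))) ↔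
      ∃ φ, Framed φ a' b' A := by
  constructor
  · rintro ⟨x, h | h⟩
    · exact ⟨_, (isFramed_iff ha hb ha1 hb1).1 h⟩
    · exact ⟨_, ((isFramed_iff hb ha hb1 ha1).1 h).swap⟩
  · rintro ⟨φ, h⟩
    obtain ⟨x, h | h⟩ := Chart.exists_std (P := fun ψ k l => Framed ψ k l A)
      (fun _ _ _ h => h.flip) (fun _ _ _ h => h.swap) h
    · exact ⟨x, .inl ((isFramed_iff ha hb ha1 hb1).2 h)⟩
    · exact ⟨x, .inr ((isFramed_iff hb ha hb1 ha1).2 h)⟩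

/-- The isometries of the torus carry every corner of a square to the corner at the origin. -/
theorem exists_chart_corner (x : Site K L) (hn : 1 ≤ n) {i j : ℕ} (hi : i = 0 ∨ i = n - 1)
    (hj : j = 0 ∨ j = n - 1) :
    ∃ φ : Chart K L, φ.box n n = (Chart.std x).box n n ∧ φ.pt 0 0 = shift x i j := by
  have h1 : ((n - 1 : ℕ) : ℤ) = n - 1 := by omega
  have hflip : ∀ φ : Chart K L, (φ.swap.flip n).swap.box n n = φ.box n n := by
    intro φ
    rw [Chart.swap_box, Chart.flip_box, Chart.swap_box]
  rw [shift_eq_pt]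
  rcases hi with rfl | rfl <;> rcases hj with rfl | rfl
  · exact ⟨_, rfl, rfl⟩
  · refine ⟨((Chart.std x).swap.flip n).swap, hflip _, ?_⟩
    simp [h1]
  · refine ⟨(Chart.std x).flip n, Chart.flip_box _ _, ?_⟩
    simp [h1]
  · refine ⟨(((Chart.std x).flip n).swap.flip n).swap, ?_, ?_⟩
    · rw [hflip, Chart.flip_box]
    · simp [h1]

theorem exists_shift_corner (φ : Chart K L) (hn : 1 ≤ n) :
    ∃ (x : Site K L) (i j : ℕ), (i = 0 ∨ i = n - 1) ∧ (j = 0 ∨ j = n - 1) ∧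
      φ.box n n = (Chart.std x).box n n ∧ φ.pt 0 0 = shift x i j := by
  have key : ∃ x, φ.box n n = (Chart.std x).box n n ∧ ∃ i j : ℤ, (i = 0 ∨ i = n - 1) ∧
      (j = 0 ∨ j = n - 1) ∧ φ.pt 0 0 = (Chart.std x).pt i j := by
    obtain ⟨x, h | h⟩ := Chart.exists_std (φ := φ) (a := n) (b := n)
      (P := fun (ψ : Chart K L) a b => a = n ∧ b = n ∧ φ.box n n = ψ.box n n ∧
        ∃ i j : ℤ, (i = 0 ∨ i = n - 1) ∧ (j = 0 ∨ j = n - 1) ∧ φ.pt 0 0 = ψ.pt i j) (by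
        rintro ψ a b ⟨rfl, rfl, h, i, j, hi, hj, h'⟩
        refine ⟨rfl, rfl, by rw [h, Chart.flip_box], n - 1 - i, j, by omega, hj, ?_⟩
        rw [h', Chart.flip_pt]
        congr 1
        omega) (by
        rintro ψ a b ⟨rfl, rfl, h, i, j, hi, hj, h'⟩
        exact ⟨rfl, rfl, by rw [h, Chart.swap_box], j, i, hj, hi, by rw [h', Chart.swap_pt]⟩)
      ⟨rfl, rfl, rfl, 0, 0, .inl rfl, .inl rfl, rfl⟩
    · exact ⟨x, h.2.2⟩
    · exact ⟨x, h.2.2⟩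
  obtain ⟨x, h, i, j, hi, hj, h'⟩ := key
  lift i to ℕ using by omega
  lift j to ℕ using by omega
  exact ⟨x, i, j, by omega, by omega, h, by rw [h', shift_eq_pt]⟩

variable [NeZero K] [NeZero L]

theorem square_eq_iff {η : Gas K L N} {x : Site K L} :
    η.1 = square K L n x ↔ occ η = (Chart.std x).box n n := by
  rw [← Finset.coe_inj, coe_std_box]
  constructor
  · intro h
    ext y
    rw [Finset.mem_coe, mem_occ, h, square]
    by_cases hy : y ∈ rect x n n
    · simp [hy]
    · simp only [hy, if_false, iff_false]
      decide
  · intro h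
    funext y
    have hy : y ∈ occ η ↔ y ∈ rect x n n := by rw [← h, Finset.mem_coe]
    rw [square]
    split_ifs with h1
    · exact mem_occ.1 (hy.2 h1)
    · exact (Int.units_eq_one_or _).resolve_left fun h2 => h1 (hy.1 (mem_occ.2 h2))

/-- The collections of the statement are the layers of the sets of occupied sites. -/
theorem mem_layer_iff (D : Dims K L n) {η : Gas K L (n ^ 2)} {i : Fin 5} :
    η ∈ layer K L n i ↔ IsLayer n (occ η) i := by
  have hn := D.two_le
  have hn1 : ((n - 1 : ℕ) : ℤ) = n - 1 := by omega
  have hn2 : ((n + 1 : ℕ) : ℤ) = n + 1 := by omega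
  fin_cases i
  · change (∃ x, η.1 = square K L n x) ↔ ∃ φ : Chart K L, occ η = φ.box n n
    simp only [square_eq_iff]
    constructor
    · rintro ⟨x, h⟩
      exact ⟨_, h⟩
    · rintro ⟨φ, h⟩
      obtain ⟨x, hx⟩ := exists_std_box (n := n) φ
      exact ⟨x, h.trans hx⟩
  · have key : ∀ {x : Site K L} {i j : ℕ} {φ : Chart K L}, φ.box n n = (Chart.std x).box n n →
        φ.pt 0 0 = shift x i j → rect x n n \ {shift x i j} =
          ((φ.box n n).erase (φ.pt 0 0) : Finset (Site K L)) := by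
      intro x i j φ h h'
      rw [← coe_std_box, ← h, ← h', Finset.coe_erase]
    constructor
    · rintro ⟨x, i, hi, j, hj, z, -, hz, h⟩
      obtain ⟨φ, hφ, hφ'⟩ := exists_chart_corner (n := n) x (by omega) hi hj
      rw [key hφ hφ'] at hz h
      rw [isAttached_iff D] at hz
      refine ⟨φ, z, hz.1, hz.2, ?_⟩
      rw [← Finset.coe_inj, coe_occ, h, Finset.coe_insert]
    · rintro ⟨φ, z, hz, hd, h⟩
      obtain ⟨x, i, j, hi, hj, hφ, hφ'⟩ := exists_shift_corner (n := n) φ (by omega)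
      refine ⟨x, i, hi, j, hj, z, ?_, ?_, ?_⟩
      · rw [← coe_std_box, Finset.mem_coe, ← hφ]
        intro hmem
        -- the corner has two neighbours in the square
        by_cases hzc : z = φ.pt 0 0
        · have := Chart.deg_corner D (φ := φ)
          rw [hzc, deg_erase_self D] at hd
          omega
        · exact hz (Finset.mem_erase.2 ⟨hzc, hmem⟩)
      · rw [key hφ hφ', isAttached_iff D]
        exact ⟨hz, hd⟩
      · rw [key hφ hφ', ← coe_occ, h, Finset.coe_insert]
  · change (∃ x, IsFramed x n (n + 1) (occupied η.1) ∨ IsFramed x (n + 1) n (occupied η.1)) ↔ _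
    rw [← coe_occ]
    exact exists_framed_iff rfl (by omega) (by omega) (by omega)
  · change (∃ x z,
      (IsAttached (rect x (n - 1) (n + 1)) z ∧
        occupied η.1 = insert z (rect x (n - 1) (n + 1))) ∨
      (IsAttached (rect x (n + 1) (n - 1)) z ∧
        occupied η.1 = insert z (rect x (n + 1) (n - 1)))) ↔ ∃ (φ : Chart K L) (z : Site K L),
          z ∉ φ.box (n - 1) (n + 1) ∧ deg (φ.box (n - 1) (n + 1)) z = 1 ∧
            occ η = insert z (φ.box (n - 1) (n + 1))
    simp only [← coe_std_box, ← coe_occ, ← Finset.coe_insert, Finset.coe_inj, isAttached_iff D, hn1,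
      hn2]
    constructor
    · rintro ⟨x, z, ⟨h1, h2⟩ | ⟨h1, h2⟩⟩
      · exact ⟨_, z, h1.1, h1.2, h2⟩
      · refine ⟨(Chart.std x).swap, z, ?_⟩
        rw [Chart.swap_box]
        exact ⟨h1.1, h1.2, h2⟩
    · rintro ⟨φ, z, h1, h2, h3⟩
      obtain ⟨x, h | h⟩ := Chart.exists_std (P := fun (ψ : Chart K L) a b =>
          φ.box (n - 1) (n + 1) = ψ.box a b)
        (fun ψ a b h => by rw [h, Chart.flip_box]) (fun ψ a b h => by rw [h, Chart.swap_box])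
        (rfl : φ.box (n - 1) (n + 1) = φ.box (n - 1) (n + 1))
      · rw [h] at h1 h2 h3
        exact ⟨x, z, .inl ⟨⟨h1, h2⟩, h3⟩⟩
      · rw [h] at h1 h2 h3
        exact ⟨x, z, .inr ⟨⟨h1, h2⟩, h3⟩⟩
  · change (∃ x, IsFramed x (n - 1) (n + 2) (occupied η.1) ∨
      IsFramed x (n + 2) (n - 1) (occupied η.1)) ↔ _
    rw [← coe_occ]
    exact exists_framed_iff (by omega) (by omega) (by omega) (by omega)

end MetaHierarchy

/-! ### The energy landscape of the lattice gas -/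

namespace MetaHierarchy

variable {K L n : ℕ}

/-- A particle that leaves a square has had at least two neighbours, and afterwards it has at most
one in the square, namely at the site from which it came. -/
theorem two_mul_add_two_le_of_step (D : Dims K L n) {A B : Finset (Site K L)}
    (hA : hper A = 2 * n) (hc : A.card = n ^ 2) (h : Step A B) : 2 * n + 2 ≤ hper B := by
  have hn := D.two_le
  obtain ⟨φ, rfl⟩ := square_of_hper_eq D hA hc
  obtain ⟨x, y, hx, hy, hxy, rfl⟩ := h
  have h1 := Chart.deg_box_le_one (φ := φ) D (a := n) (b := n) (by omega) (by omega) hy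
  have h2 : deg ((φ.box n n).erase x) y = deg (φ.box n n) y - 1 := deg_erase_of_nbr D hxy.symm hx
  have h3 := Chart.two_le_deg_box (φ := φ) (a := n) (b := n) (by omega) (by omega) hx
  rw [hper_insert D (fun h => hy (Finset.mem_of_mem_erase h)), hper_erase D hx, hA]
  omega

variable [NeZero K] [NeZero L]

theorem two_mul_le_hper_occ (D : Dims K L n) (η : Gas K L (n ^ 2)) : 2 * n ≤ hper (occ η) := by
  have hn := D.two_le
  have hA := card_occ η
  exact two_mul_le_hper D (by omega) (by rw [hA]; push_cast; nlinarith)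

/-- The squares are the ground states. -/
theorem mem_layer_zero_iff (D : Dims K L n) {η : Gas K L (n ^ 2)} :
    η ∈ layer K L n 0 ↔ hper (occ η) = 2 * n := by
  rw [mem_layer_iff D]
  exact ⟨fun h => by simpa using h.hper_eq D, fun h => square_of_hper_eq D h (card_occ η)⟩

theorem exists_walk_of_isLow (D : Dims K L n) {η : Gas K L (n ^ 2)} {B : Finset (Site K L)}
    (h : Reach (IsLow n) (occ η) B) (hB : hper B ≤ 2 * n + 2) :
    ∃ ζ : Gas K L (n ^ 2), occ ζ = B ∧ ∃ w : (kawasaki K L (n ^ 2)).Walk ζ η,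
      ∀ ξ ∈ w.support, hper (occ ξ) ≤ 2 * n + 2 := by
  obtain ⟨ζ, rfl, w, hw⟩ := exists_walk_of_reach D h
  refine ⟨ζ, rfl, w, fun ξ hξ => ?_⟩
  rw [← SimpleGraph.Walk.cons_tail_support, List.mem_cons] at hξ
  rcases hξ with rfl | hξ
  · exact hB
  · exact hw ξ hξ

theorem mem_basin_of_isLayer (D : Dims K L n) {η : Gas K L (n ^ 2)} {i : Fin 5}
    (h : IsLayer n (occ η) i) :
    η ∈ TwoStepLandscape.basin (kawasaki K L (n ^ 2)) (fun η => hper (occ η)) (2 * n) := by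
  obtain ⟨B, h1, h2⟩ := h.exists_reach_square D (card_occ η)
  have h3 := h2.hper_eq D
  rw [if_pos rfl] at h3
  obtain ⟨s, rfl, w, hw⟩ := exists_walk_of_isLow D h1 (by omega)
  exact ⟨s, h3, w, hw⟩

/-- The lattice gas is a landscape with two energy gaps, whose integer height is the half
perimeter of the set of occupied sites. -/
theorem twoStepLandscape (D : Dims K L n) {J : ℝ} (hJ : 0 < J) :
    TwoStepLandscape (kawasaki K L (n ^ 2)) (energy K L (n ^ 2) J) (-(J * (K * L) / 2)) J
      (fun η => hper (occ η)) (2 * n) where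
  J_pos := hJ
  energy_eq := energy_eq_hper D J
  neg := by
    have hn := D.two_le
    have hK : (2 * n + 1 : ℝ) ≤ K := by exact_mod_cast D.lt_left
    have hL : (2 * n + 1 : ℝ) ≤ L := by exact_mod_cast D.lt_right
    have hn' : (2 : ℝ) ≤ n := by exact_mod_cast hn
    have h1 : (2 * n + 1 : ℝ) * (2 * n + 1) ≤ K * L := by gcongr
    have h2 : J * (2 * (2 * n + 2)) < J * (K * L) := mul_lt_mul_of_pos_left (by nlinarith) hJ
    push_cast
    linarith
  le_height := two_mul_le_hper_occ D
  two_ground := by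
    have hn := D.two_le
    have hc : ∀ φ : Chart K L, (φ.box n n).card = n ^ 2 := by
      intro φ
      have := Chart.card_box (φ := φ) D (a := n) (b := n) (by omega) (by omega) (by omega)
        (by omega)
      zify
      rw [this]
      ring
    have hp : ∀ φ : Chart K L, hper (φ.box n n) = 2 * n := fun φ => by
      rw [Chart.hper_box D (by omega) (by omega) (by omega) (by omega)]
      ring
    obtain ⟨s, hs⟩ := exists_occ_eq (hc (Chart.std 0))
    obtain ⟨s', hs'⟩ := exists_occ_eq (hc ((Chart.std 0).trans 1 0))
    refine ⟨s, s', ?_, ?_, ?_⟩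
    · rw [hs, hp]
    · rw [hs', hp]
    · rintro rfl
      have h1 : (Chart.std 0).pt 0 0 ∈ occ s := by
        rw [hs]
        exact Chart.pt_mem_box le_rfl (by omega) le_rfl (by omega)
      have h2 : (Chart.std (0 : Site K L)).pt 0 0 = ((Chart.std 0).trans 1 0).pt (-1) 0 := by
        simp
      rw [hs', h2, Chart.pt_mem_box_iff D (by omega) (by omega) (by omega) (by omega)] at h1
      omega
  ground_linked := by
    intro s s' hs hs'
    obtain ⟨φ, hφ⟩ := square_of_hper_eq D hs (card_occ s)
    obtain ⟨ψ, hψ⟩ := square_of_hper_eq D hs' (card_occ s')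
    have h := reach_box D ψ φ
    rw [← hφ, ← hψ] at h
    obtain ⟨ζ, h1, w, hw⟩ := exists_walk_of_isLow D h (by
      change hper (occ s) = _ at hs
      omega)
    obtain rfl := occ_injective h1
    exact ⟨w, hw⟩
  ground_adj := fun s η hs h =>
    two_mul_add_two_le_of_step D hs (card_occ s) ((kawasaki_adj_iff D).1 h)
  exists_middle := by
    have hn := D.two_le
    -- the particle of a corner is attached to an adjacent side
    obtain ⟨φ⟩ : Nonempty (Chart K L) := ⟨Chart.std 0⟩
    have hc : φ.pt 0 0 ∈ φ.box n n := Chart.pt_mem_box le_rfl (by omega) le_rfl (by omega)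
    have hz : φ.pt 1 (-1) ∉ φ.box n n := by
      rw [Chart.pt_mem_box_iff D (by omega) (by omega) (by omega) (by omega)]
      omega
    have hzW : φ.pt 1 (-1) ∉ (φ.box n n).erase (φ.pt 0 0) :=
      fun h => hz (Finset.mem_of_mem_erase h)
    have h10 : φ.pt 1 0 ∈ (φ.box n n).erase (φ.pt 0 0) := by
      refine Finset.mem_erase.2 ⟨fun h => ?_,
        Chart.pt_mem_box (by omega) (by omega) le_rfl (by omega)⟩
      have := Chart.pt_inj D h (by norm_num; omega) (by norm_num)
      omega
    have hd : deg ((φ.box n n).erase (φ.pt 0 0)) (φ.pt 1 (-1)) = 1 := by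
      have h1 := deg_pos_of_nbr h10 (φ.nbr_pt.2 (.inr (.inr (.inl rfl))) : Nbr (φ.pt 1 (-1)) _)
      have h2 := deg_mono (Finset.erase_subset (φ.pt 0 0) (φ.box n n)) (φ.pt 1 (-1))
      have h3 := Chart.deg_box_le_one D (by omega) (by omega) hz
      omega
    have hcard : (insert (φ.pt 1 (-1)) ((φ.box n n).erase (φ.pt 0 0))).card = n ^ 2 := by
      have := Chart.card_box (φ := φ) D (a := n) (b := n) (by omega) (by omega) (by omega)
        (by omega)
      rw [Finset.card_insert_of_notMem hzW, Finset.card_erase_add_one hc]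
      zify
      rw [this]
      ring
    obtain ⟨η, hη⟩ := exists_occ_eq hcard
    have hl : IsLayer n (occ η) 1 := ⟨φ, _, hzW, hd, hη⟩
    exact ⟨η, hl.hper_eq D, mem_basin_of_isLayer D hl⟩

theorem inBasin_of_walk (D : Dims K L n) (hn : 3 ≤ n) {η ξ : Gas K L (n ^ 2)}
    (w : (kawasaki K L (n ^ 2)).Walk η ξ) (hw : ∀ ζ ∈ w.support, hper (occ ζ) ≤ 2 * n + 2)
    (hη : InBasin n (occ η)) : InBasin n (occ ξ) := by
  induction w with
  | nil => exact hη
  | @cons η ζ ξ hadj w ih =>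
    rw [SimpleGraph.Walk.support_cons] at hw
    have h1 := hw η List.mem_cons_self
    have h2 := hw ζ (List.mem_cons_of_mem _ w.start_mem_support)
    refine ih (fun ζ' h => hw ζ' (List.mem_cons_of_mem _ h)) ?_
    obtain ⟨x, y, hx, hy, hxy, h⟩ := (kawasaki_adj_iff D).1 hadj
    rw [h] at h2 ⊢
    exact hη.move D hn (card_occ η) h1 hx hy hxy h2

/-- The configurations that belong to the stable plateaux. -/
theorem low_basin_eq (D : Dims K L n) :
    {η | η ∈ TwoStepLandscape.basin (kawasaki K L (n ^ 2)) (fun η => hper (occ η)) (2 * n) ∧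
      hper (occ η) ≤ 2 * n + 1} = ⋃ i : Fin 5, layer K L n i := by
  have hn := D.two_le
  ext η
  rw [Set.mem_iUnion]
  constructor
  · rintro ⟨⟨s, hs, w, hw⟩, hp⟩
    rcases eq_or_lt_of_le (two_mul_le_hper_occ D η) with h | h
    · exact ⟨0, (mem_layer_zero_iff D).2 h.symm⟩
    have hp' : hper (occ η) = 2 * n + 1 := by omega
    obtain ⟨i, -, hi⟩ : ∃ i : Fin 5, i ≠ 0 ∧ IsLayer n (occ η) i := by
      rcases hn.lt_or_eq with hn3 | rfl
      · exact (inBasin_of_walk D hn3 w hw (.inl hs)).isLayer D hn3 (card_occ η) hp'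
      · exact isLayer_of_two D (card_occ η) hp'
    exact ⟨i, (mem_layer_iff D).2 hi⟩
  · rintro ⟨i, hi⟩
    rw [mem_layer_iff D] at hi
    refine ⟨mem_basin_of_isLayer D hi, ?_⟩
    have := hi.hper_eq D
    split_ifs at this <;> omega

/-- Each layer is obtained from the preceding one by excursions at height `2 * n + 2`. -/
theorem mem_layer_iff_exists_walk (D : Dims K L n) (hn : 3 ≤ n) {i j : Fin 5}
    (hij : (j : ℕ) = i + 1) {η : Gas K L (n ^ 2)} :
    η ∈ layer K L n j ↔ hper (occ η) = 2 * n + 1 ∧ ∃ ζ ∈ layer K L n i,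
      ∃ w : (kawasaki K L (n ^ 2)).Walk ζ η, 0 < w.length ∧
        (∀ ξ ∈ w.support, hper (occ ξ) ≤ 2 * n + 2) ∧
        ∀ ξ ∈ w.support.tail, ∀ k : Fin 5, ξ ∈ layer K L n k → k = j := by
  have hj0 : j ≠ 0 := by
    rintro rfl
    simp at hij
  have hlow : ∀ {A : Finset (Site K L)} {k : Fin 5}, IsLayer n A k → hper A ≤ 2 * n + 2 := by
    intro A k hk
    have := hk.hper_eq D
    split_ifs at this <;> omega
  constructor
  · intro h
    rw [mem_layer_iff D] at h
    have hp := h.hper_eq D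
    rw [if_neg hj0] at hp
    obtain ⟨B, i', h1, h2, -, h3⟩ := h.exists_reach D (card_occ η) hj0
    have hi : i' = i := Fin.ext (by have := h3 hn; omega)
    subst hi
    obtain ⟨ζ, rfl, w, hw⟩ := exists_walk_of_reach D h1
    refine ⟨hp, ζ, (mem_layer_iff D).2 h2, w, ?_, fun ξ hξ => ?_, fun ξ hξ k hk => ?_⟩
    · rw [Nat.pos_iff_ne_zero]
      intro h0
      obtain rfl := SimpleGraph.Walk.eq_of_length_eq_zero h0
      have := h.unique D hn (card_occ ζ) h2
      omega
    · rw [← SimpleGraph.Walk.cons_tail_support, List.mem_cons] at hξ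
      rcases hξ with rfl | hξ
      · exact hlow h2
      · rcases hw ξ hξ with h4 | h4
        · exact h4.le
        · exact hlow h4
    · rw [mem_layer_iff D] at hk
      rcases hw ξ hξ with h4 | h4
      · have := hk.hper_eq D
        split_ifs at this <;> omega
      · exact hk.unique D hn (card_occ ξ) h4
  · rintro ⟨hp, ζ, hζ, w, hlen, hw, hw'⟩
    rw [mem_layer_iff D] at hζ
    have hmem : η ∈ ⋃ k : Fin 5, layer K L n k := by
      rw [← low_basin_eq D]
      obtain ⟨s, hs, u, hu⟩ := mem_basin_of_isLayer D hζ
      refine ⟨⟨s, hs, u.append w, fun ξ hξ => ?_⟩, hp.le⟩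
      rw [SimpleGraph.Walk.mem_support_append_iff] at hξ
      exact hξ.elim (hu ξ) (hw ξ)
    obtain ⟨k, hk⟩ := Set.mem_iUnion.1 hmem
    have htail : η ∈ w.support.tail := by
      cases w with
      | nil => simp at hlen
      | cons h w =>
        rw [SimpleGraph.Walk.support_cons, List.tail_cons]
        exact w.end_mem_support
    rw [← hw' η htail k hk]
    exact hk

end MetaHierarchy
theorem mainTheorem10 (K L n : ℕ) [NeZero K] [NeZero L] (hLK : L ≤ K) (hn : 2 ≤ n)
    (hnL : 2 * n < L) (J : ℝ) (hJ : 0 < J) :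
    -- level one: the configurations in its stable plateaux, and its depth
    (⋃₀ (MetaHierarchy.level (MetaHierarchy.kawasaki K L (n ^ 2))
          (MetaHierarchy.energy K L (n ^ 2) J) 1).plateaux
        = ⋃ i : Fin 5, MetaHierarchy.layer K L n i) ∧
    MetaHierarchy.Level.gamma (MetaHierarchy.kawasaki K L (n ^ 2))
        (MetaHierarchy.energy K L (n ^ 2) J)
        (MetaHierarchy.level (MetaHierarchy.kawasaki K L (n ^ 2))
          (MetaHierarchy.energy K L (n ^ 2) J) 1) = J ∧
    -- level two: its plateaux are the squares; its depth; it is the last level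
    (MetaHierarchy.level (MetaHierarchy.kawasaki K L (n ^ 2))
          (MetaHierarchy.energy K L (n ^ 2) J) 2).plateaux
        = {P | ∃ η ∈ MetaHierarchy.layer K L n 0, P = {η}} ∧
    MetaHierarchy.Level.gamma (MetaHierarchy.kawasaki K L (n ^ 2))
        (MetaHierarchy.energy K L (n ^ 2) J)
        (MetaHierarchy.level (MetaHierarchy.kawasaki K L (n ^ 2))
          (MetaHierarchy.energy K L (n ^ 2) J) 2) = 2 * J ∧
    MetaHierarchy.IsLastLevel (MetaHierarchy.kawasaki K L (n ^ 2))
        (MetaHierarchy.energy K L (n ^ 2) J) 2 ∧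
    -- the collections are successively reached from the squares by excursions of height `2 * J`
    (3 ≤ n → ∀ σ ∈ MetaHierarchy.layer K L n 0, ∀ i j : Fin 5, (j : ℕ) = i + 1 →
      MetaHierarchy.layer K L n j =
        {η | MetaHierarchy.energy K L (n ^ 2) J η = MetaHierarchy.energy K L (n ^ 2) J σ + J ∧
          ∃ ζ ∈ MetaHierarchy.layer K L n i,
            ∃ w : (MetaHierarchy.kawasaki K L (n ^ 2)).Walk ζ η,
              0 < w.length ∧ (∀ ξ ∈ w.support, MetaHierarchy.energy K L (n ^ 2) J ξ
                ≤ MetaHierarchy.energy K L (n ^ 2) J σ + 2 * J) ∧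
              ∀ ξ ∈ w.support.tail, ∀ k : Fin 5, ξ ∈ MetaHierarchy.layer K L n k → k = j}) := by
  have D : MetaHierarchy.Dims K L n := ⟨hn, by omega, hnL⟩
  have h := MetaHierarchy.twoStepLandscape D hJ
  refine ⟨?_, h.gamma_one, ?_, h.gamma_two, h.isLastLevel_two, ?_⟩
  · rw [h.sUnion_plateaux_one, MetaHierarchy.low_basin_eq D]
  · rw [h.level_two]
    simp only [MetaHierarchy.TwoStepLandscape.groundSets, MetaHierarchy.mem_layer_zero_iff D]
  · intro hn3 σ hσ i j hij
    rw [MetaHierarchy.mem_layer_zero_iff D] at hσ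
    have hE := MetaHierarchy.energy_eq_hper D J (N := n ^ 2)
    have h1 : ∀ η, MetaHierarchy.energy K L (n ^ 2) J η
        = MetaHierarchy.energy K L (n ^ 2) J σ + J ↔
          MetaHierarchy.hper (MetaHierarchy.occ η) = 2 * n + 1 := by
      intro η
      rw [hE η, hE σ, add_assoc, add_right_inj, ← mul_add_one, mul_right_inj' hJ.ne', hσ]
      exact_mod_cast Iff.rfl
    have h2 : ∀ ξ, MetaHierarchy.energy K L (n ^ 2) J ξ
        ≤ MetaHierarchy.energy K L (n ^ 2) J σ + 2 * J ↔
          MetaHierarchy.hper (MetaHierarchy.occ ξ) ≤ 2 * n + 2 := by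
      intro ξ
      rw [hE ξ, hE σ, add_assoc, add_le_add_iff_left, mul_comm 2 J, ← mul_add,
        mul_le_mul_iff_right₀ hJ, hσ]
      exact_mod_cast Iff.rfl
    ext η
    simp only [Set.mem_ofPred_eq, h1, h2]
    exact MetaHierarchy.mem_layer_iff_exists_walk D hn3 hij
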